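/- Let $\Lambda^+$ be a Young diagram with $L$ boxes, rows and columns numbered from $1$, let $\lambda_a$ and $\lambda'_s$ be its row and column lengths, and let $\hbar\in\mathbb C\setminus\{0\}$, $\theta=(\theta_1,\dots,\theta_L)\in\mathbb C^L$. Write $f^{[k]}(u)=f(u+\tfrac{k\hbar}{2})$, $f^\pm=f^{[\pm1]}$, $W(f,g)=f^+g^--f^-g^+$, $Q_\theta(u)=\prod_{\ell=1}^L(u-\theta_\ell)$, and let $f\propto g$ mean equality up to a non-zero constant factor. **Q-system.** A solution of the (twist-less) Q-system on $\Lambda^+$ at the point $\theta$ is a family of monic polynomials $\mathbb Q_{a,s}\in\mathbb C[u]$, $a,s\ge 0$, such that $\mathbb Q_{0,0}=Q_\theta$, $\mathbb Q_{a,s}=1$ whenever the box $(a+1,s+1)$ is not in $\Lambda^+$, and $\mathbb Q_{a+1,s}\mathbb Q_{a,s+1}\propto W(\mathbb Q_{a,s},\mathbb Q_{a+1,s+1})$ for each box $(a+1,s+1)\in\Lambda^+$. **Wronskian Bethe equations (WBE).** Call $(m,n)\in\mathbb Z_{\ge0}^2$ a boundary node if $(m+1,n+1)\notin\Lambda^+$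 and ($m=0$ or $n=0$ or $(m,n)\in\Lambda^+$). Put $\hat\lambda_a=\lambda_a-a-n+m$ for $1\le a\le m$ and $\hat\nu_i=\lambda'_i-i-m+n$ for $1\le i\le n$. A solution of the WBE at $\theta$ for the boundary node $(m,n)$ consists of monic polynomials $Q_{a|\emptyset}$ of degree $\hat\lambda_a$ and $Q_{\emptyset|i}$ of degree $\hat\nu_i$, such that the coefficient of $u^{\hat\lambda_b}$ in $Q_{a|\emptyset}$ vanishes for $b>a$ and the coefficient of $u^{\hat\nu_j}$ in $Q_{\emptyset|i}$ vanishes for $j>i$, and of polynomials $Q_{a|i}$ with $Q_{a|i}^+-Q_{a|i}^-=Q_{a|\emptyset}Q_{\emptyset|i}$, subject to $Q_{1\dots m|1\dots n}\propto Q_\theta$. Here for $A\subseteq\{1,\dots,m\}$, $J\subseteq\{1,\dots,n\}$ with $|A|=p\ge q=|J|$, $Q_{A|J}$ is the $p\times p$ determinant with rows labelled by $a\in A$, with the columns $Q_{a|j}^{[p-q]}$, $j\in J$, followed by the columns $Q_{a|\emptyset}^{[p-q-1]},Q_{a|\emptyset}^{[p-q-3]},\dots,Q_{a|\emptyset}^{[-(p-q)+1]}$;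 for $p<q$ the roles of the two kinds of indices are exchanged. (If $\Lambda^+$ fits into the fat hook of $\mathfrak{gl}_{m|n}$, i.e. $(m+1,n+1)\notin\Lambda^+$, the WBE of $\mathfrak{gl}_{m|n}$ are those of the unique boundary node of the form $(m-r,n-r)$, $r\ge0$.) **Leading-order solution.** For a standard Young tableau $\mathcal T$ of shape $\Lambda^+$ let $h^{(\ell)}_{a,s}$ be the hook length of the box $(a,s)$ in the subdiagram of the boxes with entries at most $\ell$, and put $$\mathbb Q^{\mathcal T,\mathrm{lead}}_{a,s}(u)=\prod_{\substack{(\bar a,\bar s)\in\Lambda^+\\ \bar a>a,\ \bar s>s}}\left(u-\theta_{\mathcal T_{\bar a,\bar s}}\prod_{a'=1}^{a}\frac{h^{(\mathcal T_{\bar a,\bar s})}_{a',\bar s}-1}{h^{(\mathcal T_{\bar a,\bar s})}_{a',\bar s}}\prod_{s'=1}^{s}\frac{h^{(\mathcal T_{\bar a,\bar s})}_{\bar a,s'}-1}{h^{(\mathcal T_{\bar a,\bar s})}_{\bar a,s'}}\right).$$ **Statement.** There is an assignment $(\hbar,\theta,\mathcal T)\mapsto(\mathbb Q^{\mathcal T}_{a,s})_{a,s\ge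 0}$ such that for every $\delta>0$ the following holds. 1. There is $K$, depending only on $\Lambda^+$ and $\delta$, such that for all $\hbar\ne0$ and all $\theta\in\mathbb C^L$ with $|\theta_1|\ge\delta|\hbar|$ (if $L\ge 1$) and $|\theta_{\ell+1}/\theta_\ell|\ge K$ for $\ell=1,\dots,L-1$: the map $\mathcal T\mapsto(\mathbb Q^{\mathcal T}_{a,s})$ is a bijection from the standard Young tableaux of shape $\Lambda^+$ onto the solutions of the Q-system on $\Lambda^+$ at $\theta$; and for every boundary node $(m,n)$ there is a bijection from the standard Young tableaux of shape $\Lambda^+$ onto the solutions of the WBE at $\theta$ for $(m,n)$, such that the solution labelled by $\mathcal T$ satisfies $Q_{a+1,\dots,m|s+1,\dots,n}\propto\mathbb Q^{\mathcal T}_{a,s}$ for all $0\le a\le m$, $0\le s\le n$. 2. As the ratios tend to infinity, $\mathbb Q^{\mathcal T}_{a,s}\sim\mathbb Q^{\mathcal T,\mathrm{lead}}_{a,s}$ at leading order, coefficient by coefficient: for every $\varepsilon>0$ there is $K$, depending only on $\Lambda^+$, $\delta$, $\varepsilon$, such that for all $\hbar\ne0$ and $\theta$ with $|\theta_1|\ge\delta|\hbar|$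 (if $L\ge1$) and $|\theta_{\ell+1}/\theta_\ell|\ge K$ for $\ell=1,\dots,L-1$, all $\mathcal T$ and all $a,s,k\ge0$, the coefficients of $u^k$ satisfy $$\left|[u^k]\mathbb Q^{\mathcal T}_{a,s}-[u^k]\mathbb Q^{\mathcal T,\mathrm{lead}}_{a,s}\right|\le\varepsilon\left|[u^k]\mathbb Q^{\mathcal T,\mathrm{lead}}_{a,s}\right|.$$ -/

import Mathlib

open Polynomial

noncomputable section

namespace TwistlessQSystem

/-! ### Shifts, finite-difference Wronskian -/

/-- The shifted polynomial `f^{[k]}(u) = f(u + k ħ / 2)`. -/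
def shift (ħ : ℂ) (k : ℤ) (f : ℂ[X]) : ℂ[X] :=
  f.comp (X + C ((k : ℂ) * ħ / 2))

/-- The finite-difference Wronskian `W(f, g) = f⁺ g⁻ - f⁻ g⁺`, where `f^±(u) = f(u ± ħ / 2)`. -/
def wronskian (ħ : ℂ) (f g : ℂ[X]) : ℂ[X] :=
  shift ħ 1 f * shift ħ (-1) g - shift ħ (-1) f * shift ħ 1 g

/-- `f ∝ g`: equality up to a non-zero constant factor. -/
def Propto (f g : ℂ[X]) : Prop :=
  ∃ c : ℂ, c ≠ 0 ∧ f = C c * g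

/-- `Q_θ(u) = ∏_ℓ (u - θ_ℓ)`. -/
def sourcePoly {L : ℕ} (θ : Fin L → ℂ) : ℂ[X] :=
  ∏ i, (X - C (θ i))

/-! ### The Q-system on a Young diagram

Rows and columns of Young diagrams are numbered from `0`, as in Mathlib: the box called
`(a + 1, s + 1)` in the convention where rows and columns start at `1` is `(a, s)` here, and the
node `(a, s)` of the lattice is the upper left corner of that box. Thus the nodes `(a, s)` with
`(a, s) ∉ μ` are those on the lower right boundary of the diagram and those outside of it. -/

/-- `Q a s` is a solution of the twist-less Q-system on the Young diagram `μ` with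
inhomogeneities `θ`: monic polynomials on the nodes of `μ`, equal to `1` on the
boundary (and, by convention, outside) of the diagram, with `Q 0 0 = Q_θ`, and with
`Q_{a+1,s} Q_{a,s+1} ∝ W(Q_{a,s}, Q_{a+1,s+1})` around each box. -/
structure IsQSystem (μ : YoungDiagram) (ħ : ℂ) (θ : Fin μ.card → ℂ) (Q : ℕ → ℕ → ℂ[X]) :
    Prop where
  monic : ∀ a s, (Q a s).Monic
  eq_one : ∀ a s, (a, s) ∉ μ → Q a s = 1
  source : Q 0 0 = sourcePoly θ
  qq : ∀ a s, (a, s) ∈ μ →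
    Propto (Q (a + 1) s * Q a (s + 1)) (wronskian ħ (Q a s) (Q (a + 1) (s + 1)))

/-! ### The twist-less Wronskian Bethe equations of `gl(m|n)` -/

/-- The node `(m, n)` lies on the lower right boundary of `μ`, the two half-axes outside of
the diagram included. Each diagonal of the lattice contains exactly one such node: if `μ` fits
into the fat hook of `gl(m|n)`, this is the node `(m - r, n - r)` at which the
`gl(m|n)` Wronskian Bethe equations are formulated (`r = 0` for long representations). -/
def IsBoundaryNode (μ : YoungDiagram) (m n : ℕ) : Prop :=
  (m, n) ∉ μ ∧ (m = 0 ∨ n = 0 ∨ (m - 1, n - 1) ∈ μ)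

/-- The shifted weight `λ̂_{a+1} = λ_{a+1} - (a + 1) - n + m`, for `a < m`. At a boundary node
`(m, n)` no subtraction truncates. -/
def bosWeight (μ : YoungDiagram) (m n a : ℕ) : ℕ :=
  (μ.rowLen a - n) + (m - 1 - a)

/-- The shifted weight `ν̂_{i+1} = λ'_{i+1} - (i + 1) - m + n`, for `i < n`, with `λ'` the
transposed partition. -/
def ferWeight (μ : YoungDiagram) (m n i : ℕ) : ℕ :=
  (μ.colLen i - m) + (n - 1 - i)

/-- Q-functions with few indices of a `gl(m|n)` Q-system: `bos a = Q_{a|∅}`, `fer i = Q_{∅|i}`,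
`mix a i = Q_{a|i}`. -/
@[ext]
structure QFunctions (m n : ℕ) where
  bos : Fin m → ℂ[X]
  fer : Fin n → ℂ[X]
  mix : Fin m → Fin n → ℂ[X]

/-- The (supersymmetric) Wronskian determinant which expresses `Q_{A|J}`, `|A| = p`, `|J| = q`,
through `Q_{a|∅}`, `Q_{∅|j}`, `Q_{a|j}` with `a ∈ A`, `j ∈ J` (up to sign). If `q ≤ p` it is the
`p × p` determinant with the `q` columns `Q_{a|j}^{[p-q]}`, followed by the `p - q` columns
`Q_{a|∅}^{[p-q-1]}, Q_{a|∅}^{[p-q-3]}, …, Q_{a|∅}^{[-(p-q)+1]}`; if `p < q` the two kinds of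
indices are exchanged. -/
def superWronskian (ħ : ℂ) {p q : ℕ} (Qb : Fin p → ℂ[X]) (Qf : Fin q → ℂ[X])
    (Qm : Fin p → Fin q → ℂ[X]) : ℂ[X] :=
  if q ≤ p then
    Matrix.det (Matrix.of fun a k : Fin p =>
      if h : (k : ℕ) < q then shift ħ ((p : ℤ) - q) (Qm a ⟨k, h⟩)
      else shift ħ ((p : ℤ) - q - 1 - 2 * ((k : ℤ) - q)) (Qb a))
  else
    Matrix.det (Matrix.of fun i k : Fin q =>
      if h : (k : ℕ) < p then shift ħ ((q : ℤ) - p) (Qm ⟨k, h⟩ i)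
      else shift ħ ((q : ℤ) - p - 1 - 2 * ((k : ℤ) - p)) (Qf i))

/-- `Q_{a+1, …, m | s+1, …, n}`, up to sign. In particular `D.upper ħ 0 0` is the full
Wronskian determinant `Q_{1…m|1…n}`. -/
def QFunctions.upper {m n : ℕ} (D : QFunctions m n) (ħ : ℂ) (a s : ℕ) : ℂ[X] :=
  superWronskian ħ
    (fun i : Fin (m - a) => D.bos ⟨a + i, by omega⟩)
    (fun j : Fin (n - s) => D.fer ⟨s + j, by omega⟩)
    (fun (i : Fin (m - a)) (j : Fin (n - s)) => D.mix ⟨a + i, by omega⟩ ⟨s + j, by omega⟩)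

/-- `D` is a solution of the twist-less Wronskian Bethe equations at the boundary node `(m, n)` of
`μ` with inhomogeneities `θ`. The polynomials `Q_{a|∅}`, `Q_{∅|i}` are monic of degrees `λ̂_a`,
`ν̂_i`, and the symmetries `Q_{a|∅} → Q_{a|∅} + β Q_{b|∅}`, `Q_{∅|i} → Q_{∅|i} + α Q_{∅|j}`
(`b > a`, `j > i`) are fixed by setting the coefficient of `u^{λ̂_b}` in `Q_{a|∅}` and that of
`u^{ν̂_j}` in `Q_{∅|i}` to zero. The `Q_{a|i}` are solutions of
`Q_{a|i}⁺ - Q_{a|i}⁻ = Q_{a|∅} Q_{∅|i}`, which leaves the constant term of each `Q_{a|i}` free.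
The remaining free coefficients, `|μ|` in number, are the unknowns, and the equation is
that the Wronskian determinant, normalised to be monic, equals `Q_θ`. -/
structure IsWBESolution (μ : YoungDiagram) (ħ : ℂ) (θ : Fin μ.card → ℂ) (m n : ℕ)
    (D : QFunctions m n) : Prop where
  bos_monic : ∀ a, (D.bos a).Monic
  bos_degree : ∀ a, (D.bos a).natDegree = bosWeight μ m n a
  bos_gauge : ∀ a b, a < b → (D.bos a).coeff (bosWeight μ m n b) = 0
  fer_monic : ∀ i, (D.fer i).Monic
  fer_degree : ∀ i, (D.fer i).natDegree = ferWeight μ m n i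
  fer_gauge : ∀ i j, i < j → (D.fer i).coeff (ferWeight μ m n j) = 0
  mix_eq : ∀ a i, shift ħ 1 (D.mix a i) - shift ħ (-1) (D.mix a i) = D.bos a * D.fer i
  wronskian_eq : Propto (D.upper ħ 0 0) (sourcePoly θ)

/-! ### Standard Young tableaux and the leading-order solution -/

/-- Standard Young tableaux of shape `μ`. The entries `1, …, L` are represented by
`0, …, L - 1`, i.e. by the indices of the inhomogeneities. -/
structure StandardYoungTableau (μ : YoungDiagram) where
  entry : {c : ℕ × ℕ // c ∈ μ.cells} ≃ Fin μ.card
  row_lt : ∀ c d, c.1.1 = d.1.1 → c.1.2 < d.1.2 → entry c < entry d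
  col_lt : ∀ c d, c.1.2 = d.1.2 → c.1.1 < d.1.1 → entry c < entry d

namespace StandardYoungTableau

variable {μ : YoungDiagram}

/-- The hook length of the box `(a, s)` in the subdiagram formed by the boxes of `T` with
entries at most `ℓ`. -/
def hook (T : StandardYoungTableau μ) (ℓ : Fin μ.card) (a s : ℕ) : ℕ :=
  (Finset.univ.filter fun c : {c : ℕ × ℕ // c ∈ μ.cells} =>
    T.entry c ≤ ℓ ∧ ((c.1.1 = a ∧ s ≤ c.1.2) ∨ (c.1.2 = s ∧ a < c.1.1))).card

/-- The coefficient in front of the inhomogeneity attached to the box `c` in the root of the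
leading-order Q-function at the node `(a, s)`: the product of `(h - 1) / h` over the first `a`
boxes in the column of `c` and the first `s` boxes in the row of `c`, `h` being hook lengths in
the subdiagram of the boxes with entries up to that of `c`. -/
def ratio (T : StandardYoungTableau μ) (c : {c : ℕ × ℕ // c ∈ μ.cells}) (a s : ℕ) : ℂ :=
  (∏ a' ∈ Finset.range a,
      ((T.hook (T.entry c) a' c.1.2 : ℂ) - 1) / (T.hook (T.entry c) a' c.1.2 : ℂ)) *
    ∏ s' ∈ Finset.range s,
      ((T.hook (T.entry c) c.1.1 s' : ℂ) - 1) / (T.hook (T.entry c) c.1.1 s' : ℂ)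

/-- The leading-order Q-function at the node `(a, s)`: one linear factor for each box weakly
below and to the right of the box `(a, s)`. -/
def lead (T : StandardYoungTableau μ) (θ : Fin μ.card → ℂ) (a s : ℕ) : ℂ[X] :=
  ∏ c ∈ Finset.univ.filter
      (fun c : {c : ℕ × ℕ // c ∈ μ.cells} => a ≤ c.1.1 ∧ s ≤ c.1.2),
    (X - C (θ (T.entry c) * T.ratio c a s))

end StandardYoungTableau

/-- The regime of widely separated inhomogeneities: `ħ ≠ 0`, the first inhomogeneity is at
least `δ |ħ|` in modulus, and all ratios `θ_{ℓ+1} / θ_ℓ` are at least `K` in modulus. -/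
def Separated {L : ℕ} (δ K : ℝ) (ħ : ℂ) (θ : Fin L → ℂ) : Prop :=
  ħ ≠ 0 ∧ (∀ i : Fin L, (i : ℕ) = 0 → δ * ‖ħ‖ ≤ ‖θ i‖) ∧
    ∀ i j : Fin L, (j : ℕ) = i + 1 → K ≤ ‖θ j / θ i‖

end TwistlessQSystem

end

namespace TwistlessQSystem

open Finset Matrix YoungDiagram

variable {μ : YoungDiagram} {Q : ℕ → ℕ → ℂ[X]} {P : ℕ → ℂ[X]}

/-! ### Determinant identities -/

section Pluecker

variable {R : Type*} [CommRing R]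

/-- The determinant of the matrix with rows `v`, `w` and `Y`. -/
noncomputable def detTwo {r : ℕ} (Y : Fin r → Fin (r + 2) → R) (v w : Fin (r + 2) → R) : R :=
  det (of (Fin.cons v (Fin.cons w Y) : Fin (r + 2) → Fin (r + 2) → R))

/-- `detTwo` as a linear map in its last argument. -/
noncomputable def detTwoLin {r : ℕ} (Y : Fin r → Fin (r + 2) → R) (v : Fin (r + 2) → R) :
    (Fin (r + 2) → R) →ₗ[R] R :=
  (detRowAlternating (n := Fin (r + 2)) (R := R)).toMultilinearMap.toLinearMap
    (Fin.cons v (Fin.cons 0 Y)) 1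

theorem detTwoLin_apply {r : ℕ} (Y : Fin r → Fin (r + 2) → R) (v w : Fin (r + 2) → R) :
    detTwoLin Y v w = detTwo Y v w := by
  unfold detTwoLin detTwo
  simp only [MultilinearMap.toLinearMap_apply]
  change det _ = det _
  congr 1
  have : (1 : Fin (r + 2)) = Fin.succ 0 := rfl
  rw [this, ← Fin.cons_update, Fin.update_cons_zero]
  rfl

theorem detTwo_row {r : ℕ} (Y : Fin r → Fin (r + 2) → R) (v : Fin (r + 2) → R) (j : Fin r) :
    detTwo Y v (Y j) = 0 := by
  unfold detTwo
  refine det_zero_of_row_eq (i := Fin.succ 0) (j := j.succ.succ) ?_ ?_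
  · intro h
    have := Fin.succ_injective _ h
    exact absurd this.symm (Fin.succ_ne_zero j)
  · ext k
    simp [of_apply, Fin.cons_succ, Fin.cons_zero]

/-- The three-term Plücker relation. -/
theorem detTwo_pluecker [IsDomain R] {r : ℕ} (Y : Fin r → Fin (r + 2) → R)
    (a b c d : Fin (r + 2) → R) :
    detTwo Y a b * detTwo Y c d - detTwo Y a c * detTwo Y b d
      + detTwo Y a d * detTwo Y b c = 0 := by
  classical
  set x : Fin (r + 3) → Fin (r + 2) → R := Fin.cons b (Fin.cons c (Fin.cons d Y)) with hx
  set N : Matrix (Fin (r + 3)) (Fin (r + 3)) R :=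
    of fun i => (Fin.cons (detTwo Y a (x i)) (x i) : Fin (r + 3) → R) with hN
  have hdet : N.det = 0 := by
    rw [← exists_mulVec_eq_zero_iff]
    refine ⟨Fin.cons (-1) fun j => detTwoLin Y a (fun k => if j = k then 1 else 0), ?_, ?_⟩
    · intro h
      have := congrFun h 0
      simp at this
    · funext i
      simp only [mulVec, dotProduct, Fin.sum_univ_succ, hN, of_apply,
        Fin.cons_zero, Fin.cons_succ, Pi.zero_apply]
      have h1 := LinearMap.pi_apply_eq_sum_univ (detTwoLin Y a) (x i)
      rw [detTwoLin_apply] at h1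
      rw [h1]
      simp only [smul_eq_mul, Fin.sum_univ_succ]
      ring
  rw [det_succ_column_zero, Fin.sum_univ_succ, Fin.sum_univ_succ, Fin.sum_univ_succ] at hdet
  have h0 : ∀ i, N i 0 = detTwo Y a (x i) := fun i => rfl
  have hrest : ∀ i : Fin r, N i.succ.succ.succ 0 = 0 := by
    intro i
    rw [h0]
    exact detTwo_row Y a i
  have hsub : ∀ i, (N.submatrix (Fin.succAbove i) Fin.succ) = of (fun k => x (i.succAbove k)) := by
    intro i; ext k l
    simp [hN, submatrix_apply]
  simp only [hrest, mul_zero, zero_mul, sum_const_zero, add_zero, hsub, h0] at hdet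
  have e0 : (of (fun k => x ((0 : Fin (r + 3)).succAbove k))).det = detTwo Y c d := by
    unfold detTwo; congr 1
  have e1 : (of (fun k => x ((Fin.succ 0 : Fin (r + 3)).succAbove k))).det = detTwo Y b d := by
    unfold detTwo; congr 1; congr 1
    funext k
    refine Fin.cases ?_ (fun k => ?_) k
    · simp [hx]
    · refine Fin.cases ?_ (fun k => ?_) k
      · rfl
      · rfl
  have e2 : (of (fun k => x ((Fin.succ (Fin.succ 0) : Fin (r + 3)).succAbove k))).det
      = detTwo Y b c := by
    unfold detTwo; congr 1; congr 1
    funext k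
    refine Fin.cases ?_ (fun k => ?_) k
    · rfl
    · refine Fin.cases ?_ (fun k => ?_) k
      · rfl
      · rfl
  rw [e0, e1, e2] at hdet
  have x0 : x 0 = b := rfl
  have x1 : x (Fin.succ 0) = c := rfl
  have x2 : x (Fin.succ (Fin.succ 0)) = d := rfl
  rw [x0, x1, x2] at hdet
  simp only [Fin.val_succ, Fin.val_zero] at hdet
  linear_combination hdet

theorem det_cons_eq_snoc {r : ℕ} (Y : Fin r → Fin (r + 1) → R) (w : Fin (r + 1) → R) :
    det (of (Fin.cons w Y : Fin (r + 1) → Fin (r + 1) → R)) =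
      (-1) ^ r * det (of (Fin.snoc Y w : Fin (r + 1) → Fin (r + 1) → R)) := by
  have h := det_permute (finRotate (r + 1)) (of (Fin.cons w Y))
  have h2 : (of (Fin.cons w Y : Fin (r + 1) → Fin (r + 1) → R)).submatrix
      (finRotate (r + 1)) id = of (Fin.snoc Y w : Fin (r + 1) → Fin (r + 1) → R) := by
    ext i k
    simp only [submatrix_apply, id, of_apply]
    refine congrFun ?_ k
    refine Fin.lastCases ?_ (fun j => ?_) i
    · rw [finRotate_last]; simp
    · rw [finRotate_of_lt (by simp)]
      simp only [Fin.snoc_castSucc]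
      exact Fin.cons_succ (α := fun _ => Fin (r + 1) → R) w Y j
  rw [h2, sign_finRotate] at h
  rw [h]
  push_cast
  rw [← mul_assoc, ← mul_pow]
  simp

/-- Expansion of `detTwo` when the first row is the first unit vector. -/
theorem detTwo_single_zero {r : ℕ} (Y : Fin r → Fin (r + 2) → R) (w : Fin (r + 2) → R) :
    detTwo Y (Pi.single 0 1) w = det (of (Fin.cons (w ∘ Fin.succ) (fun j => Y j ∘ Fin.succ) :
        Fin (r + 1) → Fin (r + 1) → R)) := by
  unfold detTwo
  rw [det_succ_row_zero, sum_eq_single 0]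
  · simp only [Fin.val_zero, pow_zero, of_apply, Fin.cons_zero, Pi.single_eq_same, one_mul]
    congr 1
    ext i j
    refine Fin.cases ?_ (fun k => ?_) i <;> simp
  · intro b _ hb
    simp [hb]
  · simp

/-- Expansion of `detTwo` when the first row is the second unit vector. -/
theorem detTwo_single_one {r : ℕ} (Y : Fin r → Fin (r + 2) → R) (w : Fin (r + 2) → R) :
    detTwo Y (Pi.single 1 1) w =
      - det (of (Fin.cons (w ∘ Fin.succAbove 1) (fun j => Y j ∘ Fin.succAbove 1) :
        Fin (r + 1) → Fin (r + 1) → R)) := by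
  unfold detTwo
  rw [det_succ_row_zero, sum_eq_single 1]
  · simp only [Fin.val_one, pow_one, of_apply, Fin.cons_zero, Pi.single_eq_same, one_mul,
      neg_mul, mul_one]
    congr 2
    ext i j
    refine Fin.cases ?_ (fun k => ?_) i <;> simp
  · intro b _ hb
    simp [hb]
  · simp

end Pluecker

/-! ### Shifts and proportionality -/

theorem shift_eq_taylor (ħ : ℂ) (k : ℤ) (f : ℂ[X]) : shift ħ k f = taylor ((k : ℂ) * ħ / 2) f := rfl

/-- `shift` as a ring homomorphism. -/
noncomputable def shiftHom (ħ : ℂ) (k : ℤ) : ℂ[X] →+* ℂ[X] :=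
  (taylorAlgHom ((k : ℂ) * ħ / 2)).toRingHom

theorem shiftHom_apply (ħ : ℂ) (k : ℤ) (f : ℂ[X]) : shiftHom ħ k f = shift ħ k f := rfl

@[simp] theorem shift_add (ħ : ℂ) (k : ℤ) (f g : ℂ[X]) :
    shift ħ k (f + g) = shift ħ k f + shift ħ k g := map_add (shiftHom ħ k) f g

@[simp] theorem shift_sub (ħ : ℂ) (k : ℤ) (f g : ℂ[X]) :
    shift ħ k (f - g) = shift ħ k f - shift ħ k g := map_sub (shiftHom ħ k) f g

@[simp] theorem shift_mul (ħ : ℂ) (k : ℤ) (f g : ℂ[X]) :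
    shift ħ k (f * g) = shift ħ k f * shift ħ k g := map_mul (shiftHom ħ k) f g

@[simp] theorem shift_zero_right (ħ : ℂ) (k : ℤ) : shift ħ k 0 = 0 := map_zero (shiftHom ħ k)

@[simp] theorem shift_one (ħ : ℂ) (k : ℤ) : shift ħ k 1 = 1 := map_one (shiftHom ħ k)

@[simp] theorem shift_C (ħ : ℂ) (k : ℤ) (c : ℂ) : shift ħ k (C c) = C c := by simp [shift]

theorem shift_sum {ι : Type*} (ħ : ℂ) (k : ℤ) (s : Finset ι) (f : ι → ℂ[X]) :
    shift ħ k (∑ i ∈ s, f i) = ∑ i ∈ s, shift ħ k (f i) := map_sum (shiftHom ħ k) f s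

theorem shift_shift (ħ : ℂ) (k l : ℤ) (f : ℂ[X]) : shift ħ k (shift ħ l f) = shift ħ (k + l) f := by
  simp only [shift_eq_taylor, taylor_taylor]
  congr 1
  push_cast; ring

@[simp] theorem shift_zero (ħ : ℂ) (f : ℂ[X]) : shift ħ 0 f = f := by
  simp [shift_eq_taylor]

theorem shift_det {n : ℕ} (ħ : ℂ) (k : ℤ) (M : Matrix (Fin n) (Fin n) ℂ[X]) :
    shift ħ k M.det = (of fun i j => shift ħ k (M i j)).det := by
  rw [← shiftHom_apply, RingHom.map_det]
  rfl

@[simp] theorem natDegree_shift (ħ : ℂ) (k : ℤ) (f : ℂ[X]) :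
    (shift ħ k f).natDegree = f.natDegree := natDegree_taylor f _

theorem Propto.refl (f : ℂ[X]) : Propto f f := ⟨1, one_ne_zero, by simp⟩

theorem Propto.symm {f g : ℂ[X]} (h : Propto f g) : Propto g f := by
  obtain ⟨c, hc, rfl⟩ := h
  refine ⟨c⁻¹, inv_ne_zero hc, ?_⟩
  rw [← mul_assoc, ← C_mul, inv_mul_cancel₀ hc]; simp

theorem Propto.trans {f g h : ℂ[X]} (h1 : Propto f g) (h2 : Propto g h) : Propto f h := by
  obtain ⟨c, hc, rfl⟩ := h1
  obtain ⟨d, hd, rfl⟩ := h2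
  exact ⟨c * d, mul_ne_zero hc hd, by rw [C_mul, mul_assoc]⟩

theorem Propto.mul {f f' g g' : ℂ[X]} (h1 : Propto f f') (h2 : Propto g g') :
    Propto (f * g) (f' * g') := by
  obtain ⟨c, hc, rfl⟩ := h1
  obtain ⟨d, hd, rfl⟩ := h2
  exact ⟨c * d, mul_ne_zero hc hd, by rw [C_mul]; ring⟩

theorem Propto.wronskian {f f' g g' : ℂ[X]} (h1 : Propto f f') (h2 : Propto g g') :
    Propto (wronskian ħ f g) (TwistlessQSystem.wronskian ħ f' g') := by
  obtain ⟨c, hc, rfl⟩ := h1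
  obtain ⟨d, hd, rfl⟩ := h2
  refine ⟨c * d, mul_ne_zero hc hd, ?_⟩
  simp only [TwistlessQSystem.wronskian, shift_mul, shift_C, C_mul]; ring

theorem Propto.ne_zero {f g : ℂ[X]} (h : Propto f g) (hf : f ≠ 0) : g ≠ 0 := by
  obtain ⟨c, hc, rfl⟩ := h
  exact right_ne_zero_of_mul hf

theorem Propto.natDegree_eq {f g : ℂ[X]} (h : Propto f g) : f.natDegree = g.natDegree := by
  obtain ⟨c, hc, rfl⟩ := h
  exact natDegree_C_mul hc

theorem Propto.eq_of_monic {f g : ℂ[X]} (h : Propto f g) (hf : f.Monic) (hg : g.Monic) : f = g := by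
  obtain ⟨c, hc, rfl⟩ := h
  have := hf.leadingCoeff
  rw [leadingCoeff_mul, leadingCoeff_C, hg.leadingCoeff, mul_one] at this
  simp [this]

/-- The monic multiple of a polynomial. -/
noncomputable def monicize (f : ℂ[X]) : ℂ[X] := C f.leadingCoeff⁻¹ * f

theorem monicize_monic {f : ℂ[X]} (hf : f ≠ 0) : (monicize f).Monic := by
  rw [Monic, monicize, leadingCoeff_mul, leadingCoeff_C,
    inv_mul_cancel₀ (leadingCoeff_ne_zero.2 hf)]

theorem propto_monicize {f : ℂ[X]} (hf : f ≠ 0) : Propto (monicize f) f :=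
  ⟨_, inv_ne_zero (leadingCoeff_ne_zero.2 hf), rfl⟩

/-! ### Casoratian determinants -/

/-- The Casoratian determinant of a tuple of polynomials. -/
noncomputable def cas (ħ : ℂ) {p : ℕ} (f : Fin p → ℂ[X]) : ℂ[X] :=
  det (of fun i k : Fin p => shift ħ ((p : ℤ) - 1 - 2 * (k : ℤ)) (f i))

theorem cas_cast (ħ : ℂ) {p q : ℕ} (h : p = q) (f : Fin q → ℂ[X]) :
    cas ħ (fun i => f (Fin.cast h i)) = cas ħ f := by
  subst h; rfl

theorem shift_cas (ħ : ℂ) (k : ℤ) {p : ℕ} (f : Fin p → ℂ[X]) : shift ħ k (cas ħ f) =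
    det (of fun i l : Fin p => shift ħ (k + ((p : ℤ) - 1 - 2 * (l : ℤ))) (f i)) := by
  rw [cas, shift_det]
  simp only [of_apply, shift_shift]


theorem shift_congr {k l : ℤ} (h : k = l) (f : ℂ[X]) : shift ħ k f = shift ħ l f := by
  rw [h]

/-- The columns of the matrix of the Casoratian determinant of `r + 2` polynomials. -/
noncomputable def casCol (ħ : ℂ) {r : ℕ} (F : Fin (r + 2) → ℂ[X]) (k : ℕ) : Fin (r + 2) → ℂ[X] :=
  fun i => shift ħ ((r : ℤ) + 1 - 2 * (k : ℤ)) (F i)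

theorem det_casCol_first (ħ : ℂ) {r : ℕ} (F : Fin (r + 2) → ℂ[X]) (σ : Fin (r + 1) → Fin (r + 2)) :
    det (of (Fin.cons (casCol ħ F 0 ∘ σ)
      (fun j : Fin r => casCol ħ F (j + 1) ∘ σ) : Fin (r + 1) → Fin (r + 1) → ℂ[X])) =
      shift ħ 1 (cas ħ (F ∘ σ)) := by
  rw [shift_cas, ← det_transpose]
  refine congrArg _ (ext fun i j => ?_)
  rw [transpose_apply, of_apply, of_apply]
  refine Fin.cases ?_ (fun j => ?_) j
  · rw [Fin.cons_zero]
    exact shift_congr (by push_cast [Fin.val_zero]; ring) _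
  · rw [Fin.cons_succ]
    exact shift_congr (by push_cast [Fin.val_succ]; ring) _

theorem det_casCol_last (ħ : ℂ) {r : ℕ} (F : Fin (r + 2) → ℂ[X]) (σ : Fin (r + 1) → Fin (r + 2)) :
    det (of (Fin.cons (casCol ħ F (r + 1) ∘ σ)
      (fun j : Fin r => casCol ħ F (j + 1) ∘ σ) : Fin (r + 1) → Fin (r + 1) → ℂ[X])) =
      (-1) ^ r * shift ħ (-1) (cas ħ (F ∘ σ)) := by
  rw [det_cons_eq_snoc, shift_cas, ← det_transpose]
  refine congrArg _ (congrArg _ (ext fun i j => ?_))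
  rw [transpose_apply, of_apply, of_apply]
  refine Fin.lastCases ?_ (fun j => ?_) j
  · rw [Fin.snoc_last]
    exact shift_congr (by push_cast [Fin.val_last]; ring) _
  · rw [Fin.snoc_castSucc]
    exact shift_congr (by push_cast [Fin.val_castSucc]; ring) _

theorem detTwo_swap {R : Type*} [CommRing R] {r : ℕ} (Y : Fin r → Fin (r + 2) → R)
    (v w : Fin (r + 2) → R) : detTwo Y v w = - detTwo Y w v := by
  have h := det_permute (Equiv.swap (0 : Fin (r + 2)) 1)
    (of (Fin.cons v (Fin.cons w Y) : Fin (r + 2) → Fin (r + 2) → R))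
  rw [Equiv.Perm.sign_swap (by simp)] at h
  have e2 : (of (Fin.cons v (Fin.cons w Y) : Fin (r + 2) → Fin (r + 2) → R)).submatrix
      (Equiv.swap (0 : Fin (r + 2)) 1) id = of (Fin.cons w (Fin.cons v Y)) := by
    refine ext fun i k => ?_
    rw [submatrix_apply, of_apply, of_apply]
    refine congrFun ?_ k
    refine Fin.cases ?_ (fun i => ?_) i
    · rw [Equiv.swap_apply_left]; rfl
    · refine Fin.cases ?_ (fun i => ?_) i
      · rw [show (Fin.succ 0 : Fin (r + 2)) = 1 from rfl, Equiv.swap_apply_right]; rfl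
      · rw [Equiv.swap_apply_of_ne_of_ne]
        · rfl
        · exact Fin.succ_ne_zero _
        · intro h; exact Fin.succ_ne_zero i (Fin.succ_injective _ h)
  rw [e2] at h
  rw [detTwo, detTwo, h]
  push_cast; ring

theorem detTwo_casCol (ħ : ℂ) {r : ℕ} (F : Fin (r + 2) → ℂ[X]) :
    detTwo (fun j : Fin r => casCol ħ F (j + 1)) (casCol ħ F 0) (casCol ħ F (r + 1)) =
      (-1) ^ r * cas ħ F := by
  rw [detTwo_swap, detTwo, det_cons_eq_snoc, cas, ← det_transpose]
  have : (of (Fin.snoc (Fin.cons (casCol ħ F 0) (fun j : Fin r => casCol ħ F (j + 1)) :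
      Fin (r + 1) → Fin (r + 2) → ℂ[X]) (casCol ħ F (r + 1)) :
      Fin (r + 2) → Fin (r + 2) → ℂ[X])).transpose =
      of fun i k : Fin (r + 2) =>
        shift ħ (((r + 2 : ℕ) : ℤ) - 1 - 2 * (k : ℤ)) (F i) := by
    refine ext fun i j => ?_
    rw [transpose_apply, of_apply, of_apply]
    refine Fin.lastCases ?_ (fun j => ?_) j
    · rw [Fin.snoc_last]
      exact shift_congr (by push_cast [Fin.val_last]; ring) _
    · rw [Fin.snoc_castSucc]
      refine Fin.cases ?_ (fun j => ?_) j
      · rw [Fin.cons_zero]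
        exact shift_congr (by push_cast [Fin.val_castSucc, Fin.val_zero]; ring) _
      · rw [Fin.cons_succ]
        exact shift_congr (by push_cast [Fin.val_castSucc, Fin.val_succ]; ring) _
  rw [this, pow_succ]; ring

theorem detTwo_casCol_single (ħ : ℂ) {r : ℕ} (F : Fin (r + 2) → ℂ[X]) :
    detTwo (fun j : Fin r => casCol ħ F (j + 1)) (Pi.single 0 1) (Pi.single 1 1) =
      cas ħ (fun i => F i.succ.succ) := by
  rw [detTwo_single_zero, det_succ_row_zero, sum_eq_single 0]
  · have e1 : (Pi.single (1 : Fin (r + 2)) (1 : ℂ[X]) : Fin (r + 2) → ℂ[X]) (Fin.succ 0) = 1 :=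
      Pi.single_eq_same _ _
    rw [of_apply, Fin.cons_zero, Function.comp_apply, e1, Fin.val_zero, pow_zero, one_mul,
      one_mul, cas, ← det_transpose]
    refine congrArg _ (ext fun i j => ?_)
    rw [transpose_apply, submatrix_apply, of_apply, of_apply, Fin.cons_succ]
    exact shift_congr (by push_cast; ring) _
  · intro b _ hb
    rw [of_apply, Fin.cons_zero, Function.comp_apply, Pi.single_eq_of_ne]
    · simp
    · intro h; exact hb (Fin.succ_injective _ h)
  · simp

/-- The bilinear relation between Casoratian determinants. -/
theorem wronskian_cas (ħ : ℂ) {r : ℕ} (S : Fin r → ℂ[X]) (x y : ℂ[X]) :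
    wronskian ħ (cas ħ (Fin.cons x S : Fin (r + 1) → ℂ[X]))
      (cas ħ (Fin.cons y S : Fin (r + 1) → ℂ[X])) =
      cas ħ S * cas ħ (Fin.cons x (Fin.cons y S : Fin (r + 1) → ℂ[X]) : Fin (r + 2) → ℂ[X]) := by
  generalize hF : (Fin.cons x (Fin.cons y S : Fin (r + 1) → ℂ[X]) : Fin (r + 2) → ℂ[X]) = F
  have hS0 : (Fin.cons y S : Fin (r + 1) → ℂ[X]) = F ∘ Fin.succ := by
    funext i; rw [← hF]; rfl
  have hS1 : (Fin.cons x S : Fin (r + 1) → ℂ[X]) = F ∘ Fin.succAbove 1 := by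
    funext i
    rw [← hF]
    refine Fin.cases ?_ (fun i => ?_) i
    · rfl
    · rfl
  have hS : S = fun i => F i.succ.succ := by
    funext i; rw [← hF]; rfl
  have key := detTwo_pluecker (fun j : Fin r => casCol ħ F (j + 1)) (Pi.single 0 1)
    (Pi.single 1 1) (casCol ħ F 0) (casCol ħ F (r + 1))
  rw [detTwo_casCol, detTwo_casCol_single, detTwo_single_zero, detTwo_single_one,
    detTwo_single_zero, detTwo_single_one, det_casCol_first, det_casCol_first, det_casCol_last,
    det_casCol_last] at key
  rw [hS0, hS1, hS, wronskian]
  have hs : ((-1 : ℂ[X]) ^ r) * (-1) ^ r = 1 := by rw [← mul_pow]; simp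
  generalize ((-1 : ℂ[X]) ^ r) = s at key hs
  generalize shift ħ 1 (cas ħ (F ∘ Fin.succ)) = A at *
  generalize shift ħ (-1) (cas ħ (F ∘ Fin.succ)) = B at *
  generalize shift ħ 1 (cas ħ (F ∘ Fin.succAbove 1)) = A' at *
  generalize shift ħ (-1) (cas ħ (F ∘ Fin.succAbove 1)) = B' at *
  generalize cas ħ (fun i : Fin r => F i.succ.succ) = U at *
  generalize cas ħ F = V at *
  linear_combination (-s) * key + (U * V - A' * B + B' * A) * hs

/-! ### Degrees of Casoratian determinants -/

theorem coeff_prod_of_coeff_eq_zero {ι : Type*} (s : Finset ι) (f : ι → ℂ[X]) (d : ι → ℕ)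
    (h : ∀ i ∈ s, (f i).natDegree ≤ d i) :
    (∏ i ∈ s, f i).coeff (∑ i ∈ s, d i) = ∏ i ∈ s, (f i).coeff (d i) := by
  classical
  induction s using Finset.induction_on with
  | empty => simp
  | insert a s ha ih =>
    rw [prod_insert ha, sum_insert ha, prod_insert ha,
      coeff_mul_add_eq_of_natDegree_le (h a (mem_insert_self _ _)),
      ih fun i hi => h i (mem_insert_of_mem hi)]
    refine (natDegree_prod_le _ _).trans (sum_le_sum fun i hi => ?_)
    exact h i (mem_insert_of_mem hi)

theorem natDegree_det_le {n : ℕ} (A : Matrix (Fin n) (Fin n) ℂ[X]) (d : Fin n → ℕ)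
    (h : ∀ i j, (A i j).natDegree ≤ d i) : A.det.natDegree ≤ ∑ i, d i := by
  rw [← det_transpose, det_apply]
  refine natDegree_sum_le_of_forall_le _ _ fun σ _ => ?_
  refine (natDegree_smul_le _ _).trans ?_
  exact (natDegree_prod_le _ _).trans (sum_le_sum fun i _ => h i _)

theorem coeff_det_of_natDegree_le {n : ℕ} (A : Matrix (Fin n) (Fin n) ℂ[X]) (d : Fin n → ℕ)
    (h : ∀ i j, (A i j).natDegree ≤ d i) :
    A.det.coeff (∑ i, d i) = det (of fun i j => (A i j).coeff (d i)) := by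
  rw [← det_transpose, ← det_transpose (of _), det_apply, det_apply, finsetSum_coeff]
  refine sum_congr rfl fun σ _ => ?_
  rw [coeff_smul]
  congr 1
  exact coeff_prod_of_coeff_eq_zero _ _ _ fun i _ => h i _

/-- The difference operator `f ↦ f(u + y) - f(u)`. -/
noncomputable def diffOp (y : ℂ) : Module.End ℂ ℂ[X] := taylor y - 1

theorem coeff_taylor_of_bound {y : ℂ} {f : ℂ[X]} {d : ℕ} (hf : f.natDegree ≤ d) (n : ℕ) :
    (taylor y f).coeff n = ∑ i ∈ range (d + 1 - n), ((n + i).choose n : ℂ) *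
      f.coeff (n + i) * y ^ i := by
  by_cases h : n ≤ d
  · rw [taylor_coeff, eval_eq_sum_range' (n := d + 1 - n)]
    · refine sum_congr rfl fun i _ => ?_
      rw [hasseDeriv_coeff, add_comm i n]
    · have := natDegree_hasseDeriv_le f n
      omega
  · rw [coeff_eq_zero_of_natDegree_lt (by rw [natDegree_taylor]; omega),
      show d + 1 - n = 0 by omega, sum_range_zero]

theorem coeff_diffOp {y : ℂ} {f : ℂ[X]} {d : ℕ} (hf : ∀ n, d < n → f.coeff n = 0) (n : ℕ) :
    (d ≤ n → (diffOp y f).coeff n = 0) ∧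
    (n + 1 = d → (diffOp y f).coeff n = y * d * f.coeff d) := by
  have hd : f.natDegree ≤ d := natDegree_le_iff_coeff_eq_zero.2 hf
  have hc : (diffOp y f).coeff n = (taylor y f).coeff n - f.coeff n := by
    simp [diffOp]
  constructor
  · intro hn
    rw [hc]
    rcases hn.eq_or_lt with rfl | hn
    · rw [coeff_taylor_of_bound hd, show d + 1 - d = 1 by omega]; simp
    · rw [hf n hn, coeff_eq_zero_of_natDegree_lt (by rw [natDegree_taylor]; omega)]; simp
  · rintro rfl
    rw [hc, coeff_taylor_of_bound hd, show n + 1 + 1 - n = 2 by omega, sum_range_succ,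
      sum_range_one]
    simp only [add_zero, Nat.choose_self, Nat.choose_succ_self_right, pow_zero, pow_one]
    push_cast; ring

theorem coeff_diffOp_pow {y : ℂ} {f : ℂ[X]} {d : ℕ} (hf : ∀ n, d < n → f.coeff n = 0) (j n : ℕ) :
    (d < n + j → ((diffOp y ^ j) f).coeff n = 0) ∧
    (n + j = d → ((diffOp y ^ j) f).coeff n = y ^ j * d.descFactorial j * f.coeff d) := by
  induction j generalizing n with
  | zero =>
    simp only [add_zero, pow_zero, Module.End.one_apply, Nat.descFactorial_zero]
    exact ⟨hf n, by rintro rfl; simp⟩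
  | succ j ih =>
    rw [pow_succ', Module.End.mul_apply]
    by_cases hj : j ≤ d
    · have hg : ∀ n, d - j < n → ((diffOp y ^ j) f).coeff n = 0 := fun n hn =>
        (ih n).1 (by omega)
      refine ⟨fun h => (coeff_diffOp hg n).1 (by omega), fun h => ?_⟩
      rw [(coeff_diffOp hg n).2 (by omega), (ih _).2 (by omega), Nat.descFactorial_succ]
      push_cast; ring
    · have h0 : (diffOp y ^ j) f = 0 := by
        ext n; rw [(ih n).1 (by omega)]; simp
      rw [h0, map_zero]
      exact ⟨fun _ => by simp, fun h => by omega⟩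

/-- The leading coefficient of the Casoratian determinant of monic polynomials of
degrees `d i`. -/
noncomputable def casLead (ħ : ℂ) {p : ℕ} (d : Fin p → ℕ) : ℂ :=
  (-ħ) ^ (∑ k : Fin p, (k : ℕ)) * ∏ i : Fin p, ∏ j ∈ Finset.Ioi i, ((d j : ℂ) - d i)

theorem casLead_ne_zero (hħ : ħ ≠ 0) {p : ℕ} {d : Fin p → ℕ} (hd : Function.Injective d) :
    casLead ħ d ≠ 0 := by
  refine mul_ne_zero (pow_ne_zero _ (neg_ne_zero.2 hħ)) ?_
  refine prod_ne_zero_iff.2 fun i _ => prod_ne_zero_iff.2 fun j hj => ?_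
  rw [mem_Ioi] at hj
  rw [sub_ne_zero, Nat.cast_injective.ne_iff]
  exact hd.ne hj.ne'

theorem cas_eq_det_diffOp (ħ : ℂ) {p : ℕ} (f : Fin p → ℂ[X]) : cas ħ f = det (of fun i k : Fin p =>
      (diffOp (-ħ) ^ (k : ℕ)) (shift ħ ((p : ℤ) - 1) (f i))) := by
  have h : (of fun i k : Fin p => shift ħ ((p : ℤ) - 1 - 2 * (k : ℤ)) (f i)) =
      (of fun i k : Fin p => (diffOp (-ħ) ^ (k : ℕ)) (shift ħ ((p : ℤ) - 1) (f i))) *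
      (of fun j k : Fin p => (((k : ℕ).choose (j : ℕ) : ℕ) : ℂ[X])) := by
    refine ext fun i k => ?_
    rw [of_apply, mul_apply]
    simp only [of_apply]
    have hT : ∀ (k : ℕ) (g : ℂ[X]), ((1 + diffOp (-ħ)) ^ k) g = shift ħ (-2 * k) g := by
      intro k
      induction k with
      | zero => intro g; simp
      | succ k ih =>
        intro g
        rw [pow_succ', Module.End.mul_apply, ih]
        have : ∀ g, (1 + diffOp (-ħ)) g = shift ħ (-2) g := by
          intro g
          simp only [diffOp, add_sub_cancel, shift_eq_taylor]
          congr 2; push_cast; ring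
        rw [this, shift_shift]
        exact shift_congr (by push_cast; ring) _
    have e1 : shift ħ ((p : ℤ) - 1 - 2 * (k : ℤ)) (f i) =
        ((diffOp (-ħ) + 1) ^ (k : ℕ)) (shift ħ ((p : ℤ) - 1) (f i)) := by
      rw [add_comm, hT, shift_shift]
      exact shift_congr (by ring) _
    rw [e1, (Commute.one_right (diffOp (-ħ))).add_pow, LinearMap.sum_apply, sum_fin_eq_sum_range]
    have hsub : range ((k : ℕ) + 1) ⊆ range p := range_subset_range.2 k.2
    rw [← sum_subset hsub]
    · refine sum_congr rfl fun j hj => ?_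
      rw [mem_range] at hj
      rw [dif_pos (by omega), one_pow, mul_one, ← Nat.cast_comm, ← nsmul_eq_mul,
        LinearMap.smul_apply, nsmul_eq_mul, mul_comm]
    · intro j hj hj'
      rw [mem_range] at hj
      rw [dif_pos hj, Nat.choose_eq_zero_of_lt (by simpa using hj')]
      simp
  rw [cas, h, det_mul]
  have hU : det (of fun j k : Fin p => (((k : ℕ).choose (j : ℕ) : ℕ) : ℂ[X])) = 1 := by
    rw [det_of_isUpperTriangular]
    · simp
    · intro i j hij
      simp only [id] at hij
      rw [of_apply, Nat.choose_eq_zero_of_lt (by exact_mod_cast hij)]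
      simp
  rw [hU, mul_one]

theorem cas_mul_X_pow (ħ : ℂ) {p : ℕ} (f : Fin p → ℂ[X]) :
    cas ħ f * X ^ (∑ k : Fin p, (k : ℕ)) = det (of fun i k : Fin p =>
      X ^ (k : ℕ) * (diffOp (-ħ) ^ (k : ℕ)) (shift ħ ((p : ℤ) - 1) (f i))) := by
  have h := det_mul_row (fun k : Fin p => (X : ℂ[X]) ^ (k : ℕ))
    (of fun i k : Fin p => (diffOp (-ħ) ^ (k : ℕ)) (shift ħ ((p : ℤ) - 1) (f i)))
  rw [← cas_eq_det_diffOp, prod_pow_eq_pow_sum, mul_comm] at h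
  exact h.symm

theorem natDegree_diffOp_entry {y : ℂ} {g : ℂ[X]} {d : ℕ} (hg : g.natDegree ≤ d) (k : ℕ) :
    (X ^ k * (diffOp y ^ k) g).natDegree ≤ d := by
  rw [natDegree_le_iff_coeff_eq_zero] at hg ⊢
  intro n hn
  rw [coeff_X_pow_mul']
  split_ifs with h
  · exact (coeff_diffOp_pow hg k (n - k)).1 (by omega)
  · rfl

theorem coeff_diffOp_entry {y : ℂ} {g : ℂ[X]} {d : ℕ} (hg : g.natDegree ≤ d) (k : ℕ) :
    (X ^ k * (diffOp y ^ k) g).coeff d = y ^ k * d.descFactorial k * g.coeff d := by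
  rw [natDegree_le_iff_coeff_eq_zero] at hg
  rw [coeff_X_pow_mul']
  split_ifs with h
  · exact (coeff_diffOp_pow hg k (d - k)).2 (by omega)
  · rw [Nat.descFactorial_eq_zero_iff_lt.2 (by omega)]; simp

theorem coeff_shift_of_natDegree_le {k : ℤ} {f : ℂ[X]} {d : ℕ} (hf : f.natDegree ≤ d) :
    (shift ħ k f).coeff d = f.coeff d := by
  rw [shift_eq_taylor, coeff_taylor_of_bound hf, show d + 1 - d = 1 by omega]; simp

theorem coeff_cas_mul (ħ : ℂ) {p : ℕ} (f : Fin p → ℂ[X]) (d : Fin p → ℕ)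
    (hf : ∀ i, (f i).natDegree ≤ d i) :
    (cas ħ f * X ^ (∑ k : Fin p, (k : ℕ))).coeff (∑ i, d i) =
      (∏ i, (f i).coeff (d i)) * casLead ħ d := by
  have h1 := coeff_det_of_natDegree_le (of fun i k : Fin p =>
      X ^ (k : ℕ) * (diffOp (-ħ) ^ (k : ℕ)) (shift ħ ((p : ℤ) - 1) (f i))) d
    (fun i j => natDegree_diffOp_entry (by rw [natDegree_shift]; exact hf i) _)
  rw [cas_mul_X_pow, h1]
  have h2 : (of fun i k : Fin p => ((of fun i k : Fin p => X ^ (k : ℕ) *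
      (diffOp (-ħ) ^ (k : ℕ)) (shift ħ ((p : ℤ) - 1) (f i))) i k).coeff (d i)) =
      of fun i k : Fin p => (f i).coeff (d i) * (of fun i k : Fin p =>
        (-ħ) ^ (k : ℕ) * (of fun i k : Fin p =>
          (descPochhammer ℂ k).eval ((d i : ℕ) : ℂ)) i k) i k := by
    refine ext fun i k => ?_
    simp only [of_apply]
    rw [coeff_diffOp_entry (by rw [natDegree_shift]; exact hf i),
      coeff_shift_of_natDegree_le (hf i), descPochhammer_eval_eq_descFactorial]
    ring
  rw [h2, det_mul_column (fun i => (f i).coeff (d i)),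
    det_mul_row (fun k : Fin p => (-ħ) ^ (k : ℕ)),
    ← det_eval_matrixOfPolynomials_eq_det_vandermonde (fun i => ((d i : ℕ) : ℂ))
      (fun k : Fin p => descPochhammer ℂ k) (fun i => descPochhammer_natDegree ℂ i)
      (fun i => monic_descPochhammer ℂ i), det_vandermonde,
    prod_pow_eq_pow_sum, casLead]

theorem coeff_cas (ħ : ℂ) {p : ℕ} (f : Fin p → ℂ[X]) (d : Fin p → ℕ)
    (hf : ∀ i, (f i).natDegree ≤ d i) {n : ℕ} (hn : n + ∑ k : Fin p, (k : ℕ) = ∑ i, d i) :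
    (cas ħ f).coeff n = (∏ i, (f i).coeff (d i)) * casLead ħ d := by
  rw [← coeff_cas_mul ħ f d hf, ← hn, coeff_mul_X_pow]

theorem coeff_cas_eq_zero (ħ : ℂ) {p : ℕ} (f : Fin p → ℂ[X]) (d : Fin p → ℕ)
    (hf : ∀ i, (f i).natDegree ≤ d i) {n : ℕ} (hn : ∑ i, d i < n + ∑ k : Fin p, (k : ℕ)) :
    (cas ħ f).coeff n = 0 := by
  rw [← coeff_mul_X_pow (cas ħ f) (∑ k : Fin p, (k : ℕ)) n, cas_mul_X_pow]
  refine coeff_eq_zero_of_natDegree_lt (lt_of_le_of_lt ?_ hn)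
  exact natDegree_det_le _ d
    (fun i j => natDegree_diffOp_entry (by rw [natDegree_shift]; exact hf i) _)

theorem cas_ne_zero (hħ : ħ ≠ 0) {p : ℕ} {f : Fin p → ℂ[X]} (hf : ∀ i, f i ≠ 0)
    (hd : Function.Injective fun i => (f i).natDegree) : cas ħ f ≠ 0 := by
  intro h0
  have h2 := coeff_cas_mul ħ f _ (fun i => le_rfl)
  rw [h0, zero_mul, coeff_zero] at h2
  refine mul_ne_zero ?_ (casLead_ne_zero hħ hd) h2.symm
  exact prod_ne_zero_iff.2 fun i _ => by
    rw [coeff_natDegree]; exact leadingCoeff_ne_zero.2 (hf i)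

/-! ### Casoratian determinants and linear combinations -/

theorem cas_linear_comb (ħ : ℂ) {p : ℕ} (U : Matrix (Fin p) (Fin p) ℂ) (f : Fin p → ℂ[X]) :
    cas ħ (fun i => ∑ j, C (U i j) * f j) = C U.det * cas ħ f := by
  have h : (of fun i k : Fin p => shift ħ ((p : ℤ) - 1 - 2 * (k : ℤ))
      (∑ j, C (U i j) * f j)) = (U.map C) *
      (of fun i k : Fin p => shift ħ ((p : ℤ) - 1 - 2 * (k : ℤ)) (f i)) := by
    refine ext fun i k => ?_
    rw [mul_apply, of_apply, shift_sum]
    simp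
  rw [cas, h, det_mul, cas, RingHom.map_det]
  rfl

theorem cas_propto_of_mem_span (hħ : ħ ≠ 0) {p q : ℕ} (hpq : p = q) {f : Fin p → ℂ[X]}
    {g : Fin q → ℂ[X]} (hf : ∀ i, f i ≠ 0) (hd : Function.Injective fun i => (f i).natDegree)
    (hs : ∀ i, f i ∈ Submodule.span ℂ (Set.range g)) : Propto (cas ħ f) (cas ħ g) := by
  subst hpq
  have h1 : ∀ i, ∃ c : Fin p → ℂ, ∑ j, c j • g j = f i := fun i =>
    (Submodule.mem_span_range_iff_exists_fun ℂ).1 (hs i)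
  choose U hU using h1
  have h2 : f = fun i => ∑ j, C (of U i j) * g j := by
    funext i
    rw [← hU i]
    simp [smul_eq_C_mul]
  have h3 := cas_linear_comb ħ (of U) g
  rw [← h2] at h3
  refine ⟨_, fun h0 => ?_, h3⟩
  rw [h0, C_0, zero_mul] at h3
  exact cas_ne_zero hħ hf hd h3

theorem mem_span_of_natDegree_lt {t : ℕ} {f : ℂ[X]} (hf : f.natDegree < t) :
    f ∈ Submodule.span ℂ (Set.range fun j : Fin t => (X : ℂ[X]) ^ (t - 1 - (j : ℕ))) := by
  rw [as_sum_range' f t hf]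
  refine Submodule.sum_mem _ fun i hi => ?_
  rw [mem_range] at hi
  rw [← C_mul_X_pow_eq_monomial, ← smul_eq_C_mul]
  refine Submodule.smul_mem _ _ (Submodule.subset_span ⟨⟨t - 1 - i, by omega⟩, ?_⟩)
  simp only
  congr 1
  omega

/-! ### Finite differences -/

/-- The symmetric finite difference `f⁺ - f⁻`. -/
noncomputable def fdiff (ħ : ℂ) (f : ℂ[X]) : ℂ[X] := shift ħ 1 f - shift ħ (-1) f

theorem fdiff_eq (ħ : ℂ) (f : ℂ[X]) : fdiff ħ f = shift ħ (-1) (diffOp ħ f) := by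
  have : diffOp ħ f = shift ħ 2 f - f := by
    simp only [diffOp, shift_eq_taylor, LinearMap.sub_apply, Module.End.one_apply]
    congr 3; push_cast; ring
  rw [this, shift_sub, shift_shift, fdiff]
  norm_num

theorem natDegree_fdiff (hħ : ħ ≠ 0) {f : ℂ[X]} {d : ℕ} (hf : f.natDegree = d + 1) :
    fdiff ħ f ≠ 0 ∧ (fdiff ħ f).natDegree = d := by
  have hb : ∀ n, d + 1 < n → f.coeff n = 0 := fun n hn =>
    coeff_eq_zero_of_natDegree_lt (by omega)
  have h1 : (diffOp ħ f).coeff d ≠ 0 := by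
    rw [(coeff_diffOp hb d).2 rfl]
    refine mul_ne_zero (mul_ne_zero hħ (Nat.cast_ne_zero.2 (by omega))) ?_
    rw [← hf, coeff_natDegree, leadingCoeff_ne_zero]
    rintro rfl; simp at hf
  have h2 : (diffOp ħ f).natDegree = d := by
    refine le_antisymm (natDegree_le_iff_coeff_eq_zero.2 fun n hn => ?_)
      (le_natDegree_of_ne_zero h1)
    exact (coeff_diffOp hb n).1 (by omega)
  rw [fdiff_eq, natDegree_shift, h2]
  refine ⟨fun h0 => ?_, rfl⟩
  have : diffOp ħ f = 0 := by
    rw [← shift_zero ħ (diffOp ħ f), show (0 : ℤ) = 1 + -1 by norm_num, ← shift_shift, h0,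
      shift_zero_right]
  exact h1 (by rw [this, coeff_zero])

theorem natDegree_fdiff_iterate (hħ : ħ ≠ 0) (t : ℕ) {f : ℂ[X]} {d : ℕ} (h0 : f ≠ 0)
    (hf : f.natDegree = d + t) : (fdiff ħ)^[t] f ≠ 0 ∧ ((fdiff ħ)^[t] f).natDegree = d := by
  induction t generalizing f with
  | zero => exact ⟨h0, hf⟩
  | succ t ih =>
    rw [Function.iterate_succ_apply]
    have := natDegree_fdiff hħ (show f.natDegree = (d + t) + 1 by omega)
    exact ih this.1 this.2

theorem cas_snoc_C (ħ : ℂ) {p : ℕ} (f : Fin p → ℂ[X]) (c : ℂ) :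
    cas ħ (Fin.snoc f (C c) : Fin (p + 1) → ℂ[X]) = C c * cas ħ (fun i => fdiff ħ (f i)) := by
  set A : Matrix (Fin (p + 1)) (Fin (p + 1)) ℂ[X] := of fun i k : Fin (p + 1) =>
    shift ħ (((p + 1 : ℕ) : ℤ) - 1 - 2 * (k : ℤ)) ((Fin.snoc f (C c) : Fin (p + 1) → ℂ[X]) i)
    with hA
  set B : Matrix (Fin (p + 1)) (Fin (p + 1)) ℂ[X] := of fun i =>
    (Fin.cons (A i 0) (fun j : Fin p => A i j.succ - A i j.castSucc) : Fin (p + 1) → ℂ[X]) with hB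
  have h1 : A.det = B.det := by
    refine det_eq_of_forall_col_eq_smul_add_pred (fun _ => 1) (fun i => ?_) fun i j => ?_
    · rw [hB, of_apply, Fin.cons_zero]
    · rw [hB, of_apply, Fin.cons_succ]; ring
  have hlast : ∀ k, A (Fin.last p) k = C c := by
    intro k
    rw [hA, of_apply, Fin.snoc_last, shift_C]
  rw [cas, ← hA, h1, det_succ_row B (Fin.last p), sum_eq_single 0]
  · have h2 : B (Fin.last p) 0 = C c := by
      rw [hB, of_apply, Fin.cons_zero, hlast]
    have h3 : (B.submatrix (Fin.last p).succAbove (Fin.succAbove 0)) =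
        -(of fun i k : Fin p => shift ħ ((p : ℤ) - 1 - 2 * (k : ℤ)) (fdiff ħ (f i))) := by
      refine ext fun i k => ?_
      rw [submatrix_apply, neg_apply, of_apply, hB, of_apply,
        Fin.succAbove_zero, Fin.cons_succ, Fin.succAbove_last, hA, of_apply,
        of_apply, Fin.snoc_castSucc, fdiff, shift_sub, shift_shift, shift_shift, neg_sub]
      congr 1 <;> refine shift_congr ?_ _ <;> push_cast [Fin.val_succ, Fin.val_castSucc] <;> ring
    rw [h2, h3, det_neg, cas, Fin.val_last, Fin.val_zero, add_zero, Fintype.card_fin]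
    have hs : ((-1 : ℂ[X]) ^ p) * (-1) ^ p = 1 := by rw [← mul_pow]; simp
    linear_combination (C c * det (of fun i k : Fin p =>
      shift ħ ((p : ℤ) - 1 - 2 * (k : ℤ)) (fdiff ħ (f i)))) * hs
  · intro b _ hb
    obtain ⟨j, rfl⟩ := Fin.exists_succ_eq.2 hb
    have : B (Fin.last p) j.succ = 0 := by
      rw [hB, of_apply, Fin.cons_succ, hlast, hlast, sub_self]
    rw [this]; ring
  · simp

/-- Adding all polynomials of degree less than `t` to a tuple amounts to taking differences. -/
theorem cas_append_propto (hħ : ħ ≠ 0) {p : ℕ} (t : ℕ) (f : Fin p → ℂ[X])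
    (g : Fin t → ℂ[X]) (hg : ∀ j, g j ≠ 0 ∧ (g j).natDegree = t - 1 - j) :
    Propto (cas ħ (Fin.append f g)) (cas ħ (fun i => (fdiff ħ)^[t] (f i))) := by
  induction t generalizing f with
  | zero =>
    rw [Fin.append_right_nil f g rfl]
    exact Propto.refl _
  | succ t ih =>
    have h1 : (Fin.append f g : Fin (p + (t + 1)) → ℂ[X]) =
        Fin.snoc (α := fun _ => ℂ[X]) (Fin.append f (fun j : Fin t => g j.castSucc))
          (g (Fin.last t)) := by
      refine Eq.trans ?_ (Fin.append_snoc f (fun j : Fin t => g j.castSucc) (g (Fin.last t)))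
      refine congrArg _ ?_
      exact (Fin.snoc_init_self g).symm
    have h2 : g (Fin.last t) = C ((g (Fin.last t)).coeff 0) := by
      refine eq_C_of_natDegree_eq_zero ?_
      rw [(hg _).2]; simp
    have h3 : (g (Fin.last t)).coeff 0 ≠ 0 := by
      intro h0
      rw [h0, C_0] at h2
      exact (hg _).1 h2
    have h4 := cas_snoc_C ħ (Fin.append f (fun j => g j.castSucc)) ((g (Fin.last t)).coeff 0)
    rw [← h2, ← h1] at h4
    have h5 : (fun i => fdiff ħ (Fin.append f (fun j => g j.castSucc) i)) =
        Fin.append (fun i => fdiff ħ (f i)) (fun j : Fin t => fdiff ħ (g j.castSucc)) := by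
      funext i
      refine Fin.addCases (fun i => ?_) (fun i => ?_) i
      · rw [Fin.append_left, Fin.append_left]
      · rw [Fin.append_right, Fin.append_right]
    rw [h5] at h4
    have h6 := ih (fun i => fdiff ħ (f i)) (fun j : Fin t => fdiff ħ (g j.castSucc)) (fun j =>
      natDegree_fdiff hħ (by rw [(hg _).2, Fin.val_castSucc]; omega))
    exact Propto.trans ⟨_, h3, h4.trans (by rw [← h2])⟩ h6

theorem eq_zero_of_cas_cons_eq_zero (hħ : ħ ≠ 0) {p : ℕ} {v : ℂ[X]} {f : Fin p → ℂ[X]}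
    (hf : ∀ i, f i ≠ 0) (hd : Function.Injective fun i => (f i).natDegree)
    (hv : ∀ i, v.coeff (f i).natDegree = 0)
    (h : cas ħ (Fin.cons v f : Fin (p + 1) → ℂ[X]) = 0) : v = 0 := by
  by_contra hv0
  have hne : ∀ i, v.natDegree ≠ (f i).natDegree := by
    intro i hi
    have := hv i
    rw [← hi, coeff_natDegree, leadingCoeff_eq_zero] at this
    exact hv0 this
  refine cas_ne_zero hħ ?_ ?_ h
  · intro i
    refine Fin.cases ?_ (fun i => ?_) i
    · exact hv0
    · exact hf i
  · intro i j
    refine Fin.cases ?_ (fun i => ?_) i <;> refine Fin.cases ?_ (fun j => ?_) j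
    · simp
    · intro h; exact absurd h (hne j)
    · intro h; exact absurd h.symm (hne i)
    · intro h; exact congrArg Fin.succ (hd h)

/-- `cas` is additive in the first entry. -/
theorem cas_cons_add (ħ : ℂ) {p : ℕ} (v w : ℂ[X]) (f : Fin p → ℂ[X]) :
    cas ħ (Fin.cons (v + w) f : Fin (p + 1) → ℂ[X]) =
      cas ħ (Fin.cons v f : Fin (p + 1) → ℂ[X]) + cas ħ (Fin.cons w f : Fin (p + 1) → ℂ[X]) := by
  have h : ∀ v : ℂ[X], (of fun i k : Fin (p + 1) => shift ħ (((p + 1 : ℕ) : ℤ) - 1 -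
      2 * (k : ℤ)) ((Fin.cons v f : Fin (p + 1) → ℂ[X]) i)) =
      (of fun i k : Fin (p + 1) => shift ħ (((p + 1 : ℕ) : ℤ) - 1 -
      2 * (k : ℤ)) ((Fin.cons 0 f : Fin (p + 1) → ℂ[X]) i)).updateRow 0
      (fun k => shift ħ (((p + 1 : ℕ) : ℤ) - 1 - 2 * (k : ℤ)) v) := by
    intro v
    refine ext fun i k => ?_
    refine Fin.cases ?_ (fun i => ?_) i
    · rw [updateRow_self, of_apply, Fin.cons_zero]
    · rw [updateRow_ne (Fin.succ_ne_zero i), of_apply, of_apply, Fin.cons_succ, Fin.cons_succ]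
  rw [cas, cas, cas, h (v + w), h v, h w, ← det_updateRow_add]
  congr 2
  funext k
  rw [shift_add]; rfl

theorem cas_cons_C_mul (ħ : ℂ) {p : ℕ} (c : ℂ) (v : ℂ[X]) (f : Fin p → ℂ[X]) :
    cas ħ (Fin.cons (C c * v) f : Fin (p + 1) → ℂ[X]) =
      C c * cas ħ (Fin.cons v f : Fin (p + 1) → ℂ[X]) := by
  have h : ∀ v : ℂ[X], (of fun i k : Fin (p + 1) => shift ħ (((p + 1 : ℕ) : ℤ) - 1 -
      2 * (k : ℤ)) ((Fin.cons v f : Fin (p + 1) → ℂ[X]) i)) =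
      (of fun i k : Fin (p + 1) => shift ħ (((p + 1 : ℕ) : ℤ) - 1 -
      2 * (k : ℤ)) ((Fin.cons 0 f : Fin (p + 1) → ℂ[X]) i)).updateRow 0
      (fun k => shift ħ (((p + 1 : ℕ) : ℤ) - 1 - 2 * (k : ℤ)) v) := by
    intro v
    refine ext fun i k => ?_
    refine Fin.cases ?_ (fun i => ?_) i
    · rw [updateRow_self, of_apply, Fin.cons_zero]
    · rw [updateRow_ne (Fin.succ_ne_zero i), of_apply, of_apply, Fin.cons_succ, Fin.cons_succ]
  rw [cas, cas, h (C c * v), h v, ← det_updateRow_smul]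
  congr 2
  funext k
  rw [shift_mul, shift_C]; rfl

/-! ### Counting boxes -/

/-- The number of boxes of `ν` weakly below and to the right of `(a, s)`. -/
def boxCount (ν : Finset (ℕ × ℕ)) (a s : ℕ) : ℕ := (ν.filter fun c => a ≤ c.1 ∧ s ≤ c.2).card

theorem boxCount_rec (ν : Finset (ℕ × ℕ)) (a s : ℕ) : boxCount ν a s + boxCount ν (a + 1) (s + 1) =
      boxCount ν (a + 1) s + boxCount ν a (s + 1) + if (a, s) ∈ ν then 1 else 0 := by
  have h1 : (ν.filter fun c : ℕ × ℕ => a + 1 ≤ c.1 ∧ s ≤ c.2) ∪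
      (ν.filter fun c : ℕ × ℕ => a ≤ c.1 ∧ s + 1 ≤ c.2) =
      (ν.filter fun c : ℕ × ℕ => a ≤ c.1 ∧ s ≤ c.2).erase (a, s) := by
    ext ⟨x, y⟩
    simp only [mem_union, mem_filter, mem_erase, ne_eq, Prod.mk.injEq]
    constructor
    · rintro (⟨h1, h2, h3⟩ | ⟨h1, h2, h3⟩) <;> refine ⟨by omega, h1, by omega, by omega⟩
    · rintro ⟨h1, h2, h3, h4⟩
      by_cases hx : x = a
      · exact Or.inr ⟨h2, h3, by omega⟩
      · exact Or.inl ⟨h2, by omega, h4⟩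
  have h2 : (ν.filter fun c : ℕ × ℕ => a + 1 ≤ c.1 ∧ s ≤ c.2) ∩
      (ν.filter fun c : ℕ × ℕ => a ≤ c.1 ∧ s + 1 ≤ c.2) =
      (ν.filter fun c : ℕ × ℕ => a + 1 ≤ c.1 ∧ s + 1 ≤ c.2) := by
    ext ⟨x, y⟩
    simp only [mem_inter, mem_filter]
    constructor
    · rintro ⟨⟨h1, h2, h3⟩, h4, h5, h6⟩; exact ⟨h1, h2, h6⟩
    · rintro ⟨h1, h2, h3⟩; exact ⟨⟨h1, h2, by omega⟩, h1, by omega, h3⟩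
  have h3 := card_union_add_card_inter (ν.filter fun c : ℕ × ℕ => a + 1 ≤ c.1 ∧ s ≤ c.2)
    (ν.filter fun c : ℕ × ℕ => a ≤ c.1 ∧ s + 1 ≤ c.2)
  rw [h1, h2] at h3
  unfold boxCount
  split_ifs with h
  · have hm : (a, s) ∈ ν.filter fun c : ℕ × ℕ => a ≤ c.1 ∧ s ≤ c.2 := by simp [h]
    have := card_erase_add_one hm
    omega
  · have hm : (a, s) ∉ ν.filter fun c : ℕ × ℕ => a ≤ c.1 ∧ s ≤ c.2 := by simp [h]
    rw [erase_eq_of_notMem hm] at h3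
    omega

theorem boxCount_zero_zero (ν : Finset (ℕ × ℕ)) : boxCount ν 0 0 = ν.card := by
  simp [boxCount]

theorem boxCount_mono (ν : Finset (ℕ × ℕ)) {a a' s s' : ℕ} (ha : a ≤ a') (hs : s ≤ s') :
    boxCount ν a' s' ≤ boxCount ν a s := by
  refine card_le_card fun c hc => ?_
  rw [mem_filter] at hc ⊢
  exact ⟨hc.1, by omega, by omega⟩

theorem boxCount_lt (ν : Finset (ℕ × ℕ)) {a s a' s' : ℕ} (h : (a, s) ∈ ν) (ha : a ≤ a')
    (hs : s ≤ s') (hne : a < a' ∨ s < s') : boxCount ν a' s' < boxCount ν a s := by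
  refine card_lt_card (ssubset_iff_of_subset ?_ |>.2 ⟨(a, s), ?_, ?_⟩)
  · intro c hc
    rw [mem_filter] at hc ⊢
    exact ⟨hc.1, by omega, by omega⟩
  · simp [h]
  · rw [mem_filter]
    simp only
    omega

theorem boxCount_eq_zero {ν : YoungDiagram} {a s : ℕ} (h : (a, s) ∉ ν) :
    boxCount ν.cells a s = 0 := by
  rw [boxCount, card_eq_zero, filter_eq_empty_iff]
  rintro ⟨x, y⟩ hc hxy
  exact h (ν.up_left_mem hxy.1 hxy.2 hc)

theorem boxCount_pos {ν : Finset (ℕ × ℕ)} {a s : ℕ} (h : (a, s) ∈ ν) : 0 < boxCount ν a s :=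
  card_pos.2 ⟨(a, s), by simp [h]⟩

theorem boxCount_hook_pos {ν : Finset (ℕ × ℕ)} {a s : ℕ} (h : (a, s) ∈ ν) :
    boxCount ν (a + 1) (s + 1) < boxCount ν a s :=
  boxCount_lt ν h (by omega) (by omega) (by omega)

/-- A function on the lattice which vanishes outside of a Young diagram is the sum of its mixed
differences. -/
theorem eq_sum_mixed_difference {A : Type*} [AddCommGroup A] (ν : YoungDiagram) (g : ℕ → ℕ → A)
    (hg : ∀ a s, (a, s) ∉ ν → g a s = 0) (a s : ℕ) :
    g a s = ∑ c ∈ ν.cells.filter (fun c => a ≤ c.1 ∧ s ≤ c.2),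
      (g c.1 c.2 - g (c.1 + 1) c.2 - g c.1 (c.2 + 1) + g (c.1 + 1) (c.2 + 1)) := by
  induction hn : boxCount ν.cells a s using Nat.strong_induction_on generalizing a s with
  | _ n ih =>
    by_cases h : (a, s) ∈ ν
    · have i1 := ih _ (by rw [← hn]; exact boxCount_lt _ h (by omega) le_rfl (by omega))
        (a + 1) s rfl
      have i2 := ih _ (by rw [← hn]; exact boxCount_lt _ h le_rfl (by omega) (by omega))
        a (s + 1) rfl
      have i3 := ih _ (by rw [← hn]; exact boxCount_hook_pos h) (a + 1) (s + 1) rfl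
      have e1 : ν.cells.filter (fun c : ℕ × ℕ => a ≤ c.1 ∧ s ≤ c.2) =
          insert (a, s) ((ν.cells.filter fun c : ℕ × ℕ => a + 1 ≤ c.1 ∧ s ≤ c.2) ∪
            (ν.cells.filter fun c : ℕ × ℕ => a ≤ c.1 ∧ s + 1 ≤ c.2)) := by
        ext ⟨x, y⟩
        simp only [mem_union, mem_filter, mem_insert, Prod.mk.injEq]
        constructor
        · rintro ⟨h1, h2, h3⟩
          by_cases hx : x = a
          · by_cases hy : y = s
            · exact Or.inl ⟨hx, hy⟩
            · exact Or.inr (Or.inr ⟨h1, h2, by omega⟩)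
          · exact Or.inr (Or.inl ⟨h1, by omega, h3⟩)
        · rintro (⟨rfl, rfl⟩ | ⟨h1, h2, h3⟩ | ⟨h1, h2, h3⟩)
          · exact ⟨h, le_rfl, le_rfl⟩
          · exact ⟨h1, by omega, h3⟩
          · exact ⟨h1, h2, by omega⟩
      have e2 : (ν.cells.filter fun c : ℕ × ℕ => a + 1 ≤ c.1 ∧ s ≤ c.2) ∩
          (ν.cells.filter fun c : ℕ × ℕ => a ≤ c.1 ∧ s + 1 ≤ c.2) =
          (ν.cells.filter fun c : ℕ × ℕ => a + 1 ≤ c.1 ∧ s + 1 ≤ c.2) := by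
        ext ⟨x, y⟩
        simp only [mem_inter, mem_filter]
        constructor
        · rintro ⟨⟨h1, h2, h3⟩, h4, h5, h6⟩; exact ⟨h1, h2, h6⟩
        · rintro ⟨h1, h2, h3⟩; exact ⟨⟨h1, h2, by omega⟩, h1, by omega, h3⟩
      rw [e1, sum_insert]
      · have e3 := sum_union_inter (s₁ := ν.cells.filter fun c : ℕ × ℕ =>
          a + 1 ≤ c.1 ∧ s ≤ c.2) (s₂ := ν.cells.filter fun c : ℕ × ℕ => a ≤ c.1 ∧ s + 1 ≤ c.2)
          (f := fun c => g c.1 c.2 - g (c.1 + 1) c.2 - g c.1 (c.2 + 1) + g (c.1 + 1) (c.2 + 1))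
        rw [e2, ← i1, ← i2, ← i3] at e3
        rw [eq_sub_of_add_eq e3]
        abel
      · simp
    · rw [hg a s h, sum_eq_zero]
      rintro ⟨x, y⟩ hc
      rw [mem_filter] at hc
      exact absurd (ν.up_left_mem hc.2.1 hc.2.2 hc.1) h

/-! ### Families of polynomials satisfying the relations of the Q-system -/

/-- The Q-system without a condition on the source term. -/
structure IsQFamily (μ : YoungDiagram) (ħ : ℂ) (Q : ℕ → ℕ → ℂ[X]) : Prop where
  monic : ∀ a s, (Q a s).Monic
  eq_one : ∀ a s, (a, s) ∉ μ → Q a s = 1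
  qq : ∀ a s, (a, s) ∈ μ →
    Propto (Q (a + 1) s * Q a (s + 1)) (wronskian ħ (Q a s) (Q (a + 1) (s + 1)))

theorem wronskian_eq_fdiff (ħ : ℂ) (f g : ℂ[X]) :
    wronskian ħ f g = fdiff ħ f * shift ħ (-1) g - shift ħ (-1) f * fdiff ħ g := by
  simp only [wronskian, fdiff]; ring

theorem coeff_fdiff_of_bound {f : ℂ[X]} {d : ℕ} (hf : f.natDegree ≤ d) (n : ℕ) :
    (d ≤ n → (fdiff ħ f).coeff n = 0) ∧ (n + 1 = d → (fdiff ħ f).coeff n = ħ * d * f.coeff d) := by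
  have hb := natDegree_le_iff_coeff_eq_zero.1 hf
  constructor
  · intro hn
    rw [fdiff_eq]
    have h0 : ∀ m, d ≤ m → (diffOp ħ f).coeff m = 0 := fun m hm => (coeff_diffOp hb m).1 hm
    rcases Nat.eq_zero_or_pos d with rfl | hd
    · have : diffOp ħ f = 0 := by ext m; rw [h0 m (by omega), coeff_zero]
      rw [this, shift_zero_right, coeff_zero]
    · refine coeff_eq_zero_of_natDegree_lt (lt_of_le_of_lt ?_ (show d - 1 < n by omega))
      rw [natDegree_shift, natDegree_le_iff_coeff_eq_zero]
      exact fun m hm => h0 m (by omega)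
  · rintro rfl
    rw [fdiff_eq, coeff_shift_of_natDegree_le]
    · exact (coeff_diffOp hb n).2 rfl
    · rw [natDegree_le_iff_coeff_eq_zero]
      exact fun m hm => (coeff_diffOp hb m).1 (by omega)

theorem coeff_wronskian {f g : ℂ[X]} {d e : ℕ} (hf : f.natDegree ≤ d) (hg : g.natDegree ≤ e) :
    (∀ n, d + e ≤ n → (wronskian ħ f g).coeff n = 0) ∧
    (∀ n, n + 1 = d + e →
      (wronskian ħ f g).coeff n = ħ * ((d : ℂ) - e) * (f.coeff d * g.coeff e)) := by
  have hf' : (shift ħ (-1) f).natDegree ≤ d := by rwa [natDegree_shift]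
  have hg' : (shift ħ (-1) g).natDegree ≤ e := by rwa [natDegree_shift]
  have key : ∀ {f g : ℂ[X]} {d e : ℕ}, f.natDegree ≤ d → g.natDegree ≤ e →
      (∀ n, d + e ≤ n → (fdiff ħ f * g).coeff n = 0) ∧
      (∀ n, n + 1 = d + e → (fdiff ħ f * g).coeff n = ħ * d * f.coeff d * g.coeff e) := by
    intro f g d e hf hg
    rcases Nat.eq_zero_or_pos d with rfl | hd
    · have : fdiff ħ f = 0 := by
        ext m; rw [(coeff_fdiff_of_bound hf m).1 (by omega), coeff_zero]
      rw [this, zero_mul]; simp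
    · have h1 : (fdiff ħ f).natDegree ≤ d - 1 := by
        rw [natDegree_le_iff_coeff_eq_zero]
        exact fun m hm => (coeff_fdiff_of_bound hf m).1 (by omega)
      constructor
      · intro n hn
        refine coeff_eq_zero_of_natDegree_lt (lt_of_le_of_lt natDegree_mul_le ?_)
        omega
      · intro n hn
        rw [show n = (d - 1) + e by omega, coeff_mul_add_eq_of_natDegree_le h1 hg,
          (coeff_fdiff_of_bound hf _).2 (by omega)]
  rw [wronskian_eq_fdiff]
  have k1 := key hf hg'
  have k2 := key hg hf'
  constructor
  · intro n hn
    rw [coeff_sub, mul_comm (shift ħ (-1) f), k1.1 n hn, k2.1 n (by omega), sub_zero]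
  · intro n hn
    rw [coeff_sub, mul_comm (shift ħ (-1) f), k1.2 n hn, k2.2 n (by omega),
      coeff_shift_of_natDegree_le hf, coeff_shift_of_natDegree_le hg]
    ring

theorem IsQFamily.natDegree_eq (hQ : IsQFamily μ ħ Q) (h0 : (Q 0 0).natDegree = μ.card) (a s : ℕ) :
    (Q a s).natDegree = boxCount μ.cells a s := by
  set g : ℕ → ℕ → ℤ := fun a s => ((Q a s).natDegree : ℤ) - boxCount μ.cells a s with hg
  have hout : ∀ a s, (a, s) ∉ μ → g a s = 0 := by
    intro a s h
    simp [hg, hQ.eq_one a s h, boxCount_eq_zero h]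
  have hpos : ∀ c ∈ μ.cells, 0 ≤ g c.1 c.2 - g (c.1 + 1) c.2 - g c.1 (c.2 + 1)
      + g (c.1 + 1) (c.2 + 1) := by
    rintro ⟨a, s⟩ hc
    have hne : Q (a + 1) s * Q a (s + 1) ≠ 0 :=
      mul_ne_zero (hQ.monic _ _).ne_zero (hQ.monic _ _).ne_zero
    have h1 := (hQ.qq a s hc).natDegree_eq
    rw [natDegree_mul (hQ.monic _ _).ne_zero (hQ.monic _ _).ne_zero] at h1
    have h2 : (wronskian ħ (Q a s) (Q (a + 1) (s + 1))).natDegree <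
        (Q a s).natDegree + (Q (a + 1) (s + 1)).natDegree := by
      by_contra hlt
      have h3 := (coeff_wronskian (ħ := ħ) (le_refl (Q a s).natDegree)
        (le_refl (Q (a + 1) (s + 1)).natDegree)).1 _ (not_lt.1 hlt)
      rw [coeff_natDegree, leadingCoeff_eq_zero] at h3
      exact (hQ.qq a s hc).ne_zero hne h3
    have h4 := boxCount_rec μ.cells a s
    rw [if_pos hc] at h4
    simp only [hg]
    omega
  have hsum := eq_sum_mixed_difference μ g hout 0 0
  have h00 : g 0 0 = 0 := by
    simp only [hg, h0, boxCount_zero_zero, sub_eq_zero]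
  rw [h00] at hsum
  have hz := (sum_eq_zero_iff_of_nonneg fun c hc =>
    hpos c (mem_filter.1 hc).1).1 hsum.symm
  have := eq_sum_mixed_difference μ g hout a s
  rw [sum_eq_zero] at this
  · simp only [hg] at this; omega
  · intro c hc
    refine hz c ?_
    rw [mem_filter] at hc ⊢
    exact ⟨hc.1, by omega, by omega⟩

/-- The Q-system with the normalisation made explicit. -/
theorem IsQFamily.wronskian_eq (hQ : IsQFamily μ ħ Q) (h0 : (Q 0 0).natDegree = μ.card) {a s : ℕ}
    (h : (a, s) ∈ μ) :
    wronskian ħ (Q a s) (Q (a + 1) (s + 1)) =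
      C (ħ * ((boxCount μ.cells a s : ℂ) - boxCount μ.cells (a + 1) (s + 1))) *
        (Q (a + 1) s * Q a (s + 1)) := by
  obtain ⟨c, hc, h1⟩ := (hQ.qq a s h).symm
  rw [h1]
  congr 2
  have hd := hQ.natDegree_eq h0
  have h4 := boxCount_rec μ.cells a s
  rw [if_pos (show (a, s) ∈ μ.cells from h)] at h4
  have h2 := (coeff_wronskian (ħ := ħ) (hd a s).le (hd (a + 1) (s + 1)).le).2
    (boxCount μ.cells (a + 1) s + boxCount μ.cells a (s + 1)) (by omega)
  have hm : ∀ a s, (Q a s).coeff (boxCount μ.cells a s) = 1 := fun a s => by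
    rw [← hd]; exact hQ.monic a s
  rw [h1, coeff_C_mul, coeff_mul_add_eq_of_natDegree_le (hd _ _).le (hd _ _).le, hm, hm, hm,
    hm] at h2
  linear_combination h2

/-! ### Solutions of the Q-system from Casoratian determinants -/

/-- The Casoratian determinant of the members with index `a, …, M - 1` of a sequence. -/
noncomputable def casTail (ħ : ℂ) (M : ℕ) (P : ℕ → ℂ[X]) (a : ℕ) : ℂ[X] :=
  cas ħ fun i : Fin (M - a) => P (a + i)

/-- The degree of the `a`-th polynomial in the description of a Q-system by `M` polynomials. -/
def rowDeg (μ : YoungDiagram) (M a : ℕ) : ℕ := μ.rowLen a + (M - 1 - a)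

/-- The exponents complementary to those given by `rowDeg`. -/
def gapDeg (μ : YoungDiagram) (M j : ℕ) : ℕ := M + j - μ.colLen j

theorem colLen_le {M : ℕ} (hM : (M, 0) ∉ μ) (j : ℕ) : μ.colLen j ≤ M := by
  by_contra h
  have : (M, j) ∈ μ := mem_iff_lt_colLen.2 (not_le.1 h)
  exact hM (μ.up_left_mem le_rfl (Nat.zero_le _) this)

theorem rowDeg_strictAnti {M a b : ℕ} (h : a < b) (hb : b < M) : rowDeg μ M b < rowDeg μ M a := by
  have := μ.rowLen_anti a b h.le
  unfold rowDeg; omega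

theorem gapDeg_strictMono {M : ℕ} (hM : (M, 0) ∉ μ) {i j : ℕ} (h : i < j) :
    gapDeg μ M i < gapDeg μ M j := by
  have := μ.colLen_anti i j h.le
  have := colLen_le hM i
  unfold gapDeg; omega

theorem rowDeg_ne_gapDeg {M : ℕ} (hM : (M, 0) ∉ μ) {b j : ℕ} (hb : b < M) :
    rowDeg μ M b ≠ gapDeg μ M j := by
  have := colLen_le hM j
  unfold rowDeg gapDeg
  by_cases h : (b, j) ∈ μ
  · have h1 := mem_iff_lt_rowLen.1 h
    have h2 := mem_iff_lt_colLen.1 h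
    omega
  · have h1 := mt mem_iff_lt_rowLen.2 h
    have h2 := mt mem_iff_lt_colLen.2 h
    omega

/-- The tuple of polynomials of the Casoratian determinant at the node `(a, s)`. -/
noncomputable def nodeTuple (μ : YoungDiagram) (M : ℕ) (P : ℕ → ℂ[X]) (a s : ℕ) :
    Fin ((M - a) + s) → ℂ[X] :=
  Fin.append (fun i : Fin (M - a) => P (a + i)) (fun j : Fin s => X ^ gapDeg μ M j)

theorem range_nodeTuple_subset (μ : YoungDiagram) (M : ℕ) (P : ℕ → ℂ[X]) (a s : ℕ)
    {S : Set ℂ[X]} (h1 : ∀ b, a ≤ b → b < M → P b ∈ S) (h2 : ∀ j < s, X ^ gapDeg μ M j ∈ S)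
    (i : Fin ((M - a) + s)) : nodeTuple μ M P a s i ∈ S := by
  unfold nodeTuple
  refine Fin.addCases (fun i => ?_) (fun i => ?_) i
  · rw [Fin.append_left]
    exact h1 _ (by omega) (by omega)
  · rw [Fin.append_right]
    exact h2 _ i.2

theorem mem_range_nodeTuple_left (μ : YoungDiagram) (M : ℕ) (P : ℕ → ℂ[X]) (a s : ℕ) {b : ℕ}
    (h1 : a ≤ b) (h2 : b < M) : P b ∈ Set.range (nodeTuple μ M P a s) := by
  refine ⟨Fin.castAdd s ⟨b - a, by omega⟩, ?_⟩
  rw [nodeTuple, Fin.append_left]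
  simp only
  congr 1; omega

theorem mem_range_nodeTuple_right (μ : YoungDiagram) (M : ℕ) (P : ℕ → ℂ[X]) (a s : ℕ) {j : ℕ}
    (h : j < s) : X ^ gapDeg μ M j ∈ Set.range (nodeTuple μ M P a s) := by
  refine ⟨Fin.natAdd _ ⟨j, h⟩, ?_⟩
  rw [nodeTuple, Fin.append_right]

/-- The sequence `P` consists of non-zero polynomials of the degrees prescribed by `μ`. -/
def HasRowDegrees (μ : YoungDiagram) (M : ℕ) (P : ℕ → ℂ[X]) : Prop :=
  ∀ a < M, P a ≠ 0 ∧ (P a).natDegree = rowDeg μ M a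

theorem nodeTuple_ne_zero {M : ℕ} (hP : HasRowDegrees μ M P)
    (a s : ℕ) (i) : nodeTuple μ M P a s i ≠ 0 :=
  range_nodeTuple_subset μ M P a s (S := {f | f ≠ 0}) (fun b _ hb => (hP b hb).1)
    (fun _ _ => pow_ne_zero _ X_ne_zero) i

theorem nodeTuple_natDegree_injective {M : ℕ} (hM : (M, 0) ∉ μ)
    {P : ℕ → ℂ[X]} (hP : HasRowDegrees μ M P) (a s : ℕ) :
    Function.Injective fun i => (nodeTuple μ M P a s i).natDegree := by
  have e1 : ∀ i : Fin (M - a), (nodeTuple μ M P a s (Fin.castAdd s i)).natDegree =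
      rowDeg μ M (a + i) := fun i => by
    rw [nodeTuple, Fin.append_left, (hP _ (by omega)).2]
  have e2 : ∀ i : Fin s, (nodeTuple μ M P a s (Fin.natAdd _ i)).natDegree =
      gapDeg μ M i := fun i => by
    rw [nodeTuple, Fin.append_right, natDegree_X_pow]
  intro i j
  refine Fin.addCases (fun i => ?_) (fun i => ?_) i <;>
    refine Fin.addCases (fun j => ?_) (fun j => ?_) j
  · simp only [e1]
    intro h
    rcases lt_trichotomy (i : ℕ) j with hij | hij | hij
    · have := rowDeg_strictAnti (μ := μ) (M := M) (a := a + i) (b := a + j) (by omega) (by omega)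
      omega
    · rw [Fin.ext hij]
    · have := rowDeg_strictAnti (μ := μ) (M := M) (a := a + j) (b := a + i) (by omega) (by omega)
      omega
  · simp only [e1, e2]
    intro h
    exact absurd h (rowDeg_ne_gapDeg hM (by omega))
  · simp only [e1, e2]
    intro h
    exact absurd h.symm (rowDeg_ne_gapDeg hM (by omega))
  · simp only [e2]
    intro h
    rcases lt_trichotomy (i : ℕ) j with hij | hij | hij
    · have := gapDeg_strictMono hM hij
      omega
    · rw [Fin.ext hij]
    · have := gapDeg_strictMono hM hij
      omega

theorem cas_nodeTuple_ne_zero (hħ : ħ ≠ 0) {M : ℕ} (hM : (M, 0) ∉ μ)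
    {P : ℕ → ℂ[X]} (hP : HasRowDegrees μ M P) (a s : ℕ) : cas ħ (nodeTuple μ M P a s) ≠ 0 :=
  cas_ne_zero hħ (nodeTuple_ne_zero hP a s) (nodeTuple_natDegree_injective hM hP a s)

theorem cas_nodeTuple_propto (hħ : ħ ≠ 0) {M : ℕ} (hM : (M, 0) ∉ μ)
    {P : ℕ → ℂ[X]} (hP : HasRowDegrees μ M P) {a s q : ℕ} (hq : (M - a) + s = q)
    {g : Fin q → ℂ[X]} (h1 : ∀ b, a ≤ b → b < M → P b ∈ Submodule.span ℂ (Set.range g))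
    (h2 : ∀ j < s, X ^ gapDeg μ M j ∈ Submodule.span ℂ (Set.range g)) :
    Propto (cas ħ (nodeTuple μ M P a s)) (cas ħ g) :=
  cas_propto_of_mem_span hħ hq (nodeTuple_ne_zero hP a s) (nodeTuple_natDegree_injective hM hP a s)
    (range_nodeTuple_subset μ M P a s h1 h2)

theorem cas_nodeTuple_zero (μ : YoungDiagram) (ħ : ℂ) (M : ℕ) (P : ℕ → ℂ[X]) (a : ℕ) :
    cas ħ (nodeTuple μ M P a 0) = casTail ħ M P a := by
  have : nodeTuple μ M P a 0 = (fun i : Fin (M - a) => P (a + i)) ∘ Fin.cast (add_zero _) := by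
    rw [nodeTuple, Fin.append_right_nil _ _ rfl]
  rw [this]
  exact cas_cast ħ (add_zero _) _

/-- A node at which the Casoratian determinant of `nodeTuple` is the right one. -/
def IsAdmissibleNode (μ : YoungDiagram) (a s : ℕ) : Prop := s = 0 ∨ a ≤ μ.colLen (s - 1)

theorem natDegree_cas_X_pow (ħ : ℂ) (q : ℕ) :
    (cas ħ fun j : Fin q => X ^ (q - 1 - (j : ℕ))).natDegree = 0 := by
  rw [← Nat.le_zero, natDegree_le_iff_coeff_eq_zero]
  intro n hn
  refine coeff_cas_eq_zero ħ _ (fun j => q - 1 - (j : ℕ)) (fun i => natDegree_X_pow_le _) ?_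
  have : ∑ i : Fin q, (q - 1 - (i : ℕ)) = ∑ i : Fin q, (i : ℕ) := by
    rw [← Equiv.sum_comp Fin.revPerm]
    refine sum_congr rfl fun i _ => ?_
    simp only [Fin.revPerm_apply, Fin.val_rev]
    omega
  rw [this]
  omega

theorem cas_nodeTuple_propto_one (hħ : ħ ≠ 0) {M : ℕ}
    (hM : (M, 0) ∉ μ) {P : ℕ → ℂ[X]} (hP : HasRowDegrees μ M P) {a s : ℕ} (ha : a ≤ M)
    (has : IsAdmissibleNode μ a s) (h : (a, s) ∉ μ) : Propto (cas ħ (nodeTuple μ M P a s)) 1 := by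
  have h1 := cas_nodeTuple_propto hħ hM hP (a := a) (s := s) rfl
    (g := fun j : Fin ((M - a) + s) => X ^ ((M - a) + s - 1 - (j : ℕ))) (fun b hab hb => ?_)
    (fun j hj => ?_)
  · have h2 := natDegree_cas_X_pow ħ ((M - a) + s)
    rw [← h1.natDegree_eq] at h2
    rw [eq_C_of_natDegree_eq_zero h2]
    refine ⟨_, fun h0 => ?_, by rw [mul_one]⟩
    refine cas_nodeTuple_ne_zero hħ hM hP a s ?_
    rw [eq_C_of_natDegree_eq_zero h2, h0, C_0]
  · refine mem_span_of_natDegree_lt ?_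
    rw [(hP b hb).2, rowDeg]
    have h2 : μ.rowLen b ≤ s := by
      by_contra hlt
      exact h (μ.up_left_mem hab le_rfl (mem_iff_lt_rowLen.2 (not_le.1 hlt)))
    omega
  · refine mem_span_of_natDegree_lt ?_
    rw [natDegree_X_pow, gapDeg]
    have h2 := colLen_le hM j
    have h3 : a ≤ μ.colLen j := by
      rcases has with rfl | h3
      · omega
      · exact h3.trans (μ.colLen_anti _ _ (by omega))
    omega

theorem exists_isQFamily (hħ : ħ ≠ 0) {M : ℕ} (hM : (M, 0) ∉ μ)
    {P : ℕ → ℂ[X]} (hP : HasRowDegrees μ M P) :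
    ∃ Q, IsQFamily μ ħ Q ∧ ∀ a ≤ M, ∀ s, IsAdmissibleNode μ a s →
      Propto (Q a s) (cas ħ (nodeTuple μ M P a s)) := by
  classical
  set Q : ℕ → ℕ → ℂ[X] := fun a s =>
    if (a, s) ∈ μ then monicize (cas ħ (nodeTuple μ M P a s)) else 1 with hQ
  have hne := cas_nodeTuple_ne_zero hħ hM hP
  have hprop : ∀ a ≤ M, ∀ s, IsAdmissibleNode μ a s →
      Propto (Q a s) (cas ħ (nodeTuple μ M P a s)) := by
    intro a ha s has
    by_cases h : (a, s) ∈ μ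
    · simp only [hQ, if_pos h]
      exact propto_monicize (hne a s)
    · simp only [hQ, if_neg h]
      exact (cas_nodeTuple_propto_one hħ hM hP ha has h).symm
  refine ⟨Q, ⟨fun a s => ?_, fun a s h => ?_, fun a s h => ?_⟩, hprop⟩
  · by_cases h : (a, s) ∈ μ
    · simp only [hQ, if_pos h]
      exact monicize_monic (hne a s)
    · simp only [hQ, if_neg h]
      exact monic_one
  · simp only [hQ, if_neg h]
  · have hs : a < μ.colLen s := mem_iff_lt_colLen.1 h
    have haM : a < M := lt_of_lt_of_le hs (colLen_le hM s)
    have hs' : s = 0 ∨ a + 1 ≤ μ.colLen (s - 1) :=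
      Or.inr (le_trans hs (μ.colLen_anti _ _ (by omega)))
    have p00 := hprop a haM.le s (by unfold IsAdmissibleNode; omega)
    have p10 := hprop (a + 1) haM s hs'
    have p01 := hprop a haM.le (s + 1) (Or.inr (by simpa using hs.le))
    have p11 := hprop (a + 1) haM (s + 1) (Or.inr (by simpa using hs))
    set S := nodeTuple μ M P (a + 1) s with hS
    have hl : ∀ {x : ℂ[X]} {n : ℕ} (T : Fin n → ℂ[X]),
        x ∈ Submodule.span ℂ (Set.range (Fin.cons x T : Fin (n + 1) → ℂ[X])) := fun T =>
      Submodule.subset_span ⟨0, rfl⟩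
    have hr : ∀ {x y : ℂ[X]} {n : ℕ} (T : Fin n → ℂ[X]), x ∈ Set.range T →
        x ∈ Submodule.span ℂ (Set.range (Fin.cons y T : Fin (n + 1) → ℂ[X])) := by
      rintro x y n T ⟨i, rfl⟩
      exact Submodule.subset_span ⟨i.succ, rfl⟩
    have q00 := cas_nodeTuple_propto hħ hM hP (a := a) (s := s)
      (show (M - a) + s = (M - (a + 1) + s) + 1 by omega)
      (g := Fin.cons (P a) S) (fun b hab hb => by
        rcases hab.eq_or_lt with rfl | hab
        · exact hl _
        · exact hr _ (mem_range_nodeTuple_left μ M P (a + 1) s hab hb))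
      (fun j hj => hr _ (mem_range_nodeTuple_right μ M P (a + 1) s hj))
    have q11 := cas_nodeTuple_propto hħ hM hP (a := a + 1) (s := s + 1)
      (show (M - (a + 1)) + (s + 1) = (M - (a + 1) + s) + 1 by omega)
      (g := Fin.cons (X ^ gapDeg μ M s) S) (fun b hab hb =>
        hr _ (mem_range_nodeTuple_left μ M P (a + 1) s hab hb))
      (fun j hj => by
        rcases (Nat.lt_succ_iff.1 hj).eq_or_lt with rfl | hj
        · exact hl _
        · exact hr _ (mem_range_nodeTuple_right μ M P (a + 1) s hj))
    have q01 := cas_nodeTuple_propto hħ hM hP (a := a) (s := s + 1)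
      (show (M - a) + (s + 1) = (M - (a + 1) + s) + 2 by omega)
      (g := Fin.cons (P a) (Fin.cons (X ^ gapDeg μ M s) S : Fin ((M - (a + 1) + s) + 1) → ℂ[X]))
      (fun b hab hb => by
        rcases hab.eq_or_lt with rfl | hab
        · exact hl _
        · exact hr _ (by
            obtain ⟨i, hi⟩ := mem_range_nodeTuple_left μ M P (a + 1) s hab hb
            exact ⟨i.succ, hi⟩))
      (fun j hj => by
        rcases (Nat.lt_succ_iff.1 hj).eq_or_lt with rfl | hj
        · exact hr _ ⟨0, rfl⟩
        · exact hr _ (by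
            obtain ⟨i, hi⟩ := mem_range_nodeTuple_right μ M P (a + 1) s hj
            exact ⟨i.succ, hi⟩))
    have e1 := (p00.trans q00).wronskian (ħ := ħ) (p11.trans q11)
    rw [wronskian_cas] at e1
    exact (p10.mul (p01.trans q01)).trans e1.symm

/-- The column of a boundary node in terms of differences. -/
theorem cas_nodeTuple_propto_fdiff (hħ : ħ ≠ 0) {M m n : ℕ}
    (hM : (M, 0) ∉ μ) {P : ℕ → ℂ[X]} (hP : HasRowDegrees μ M P) (hmn : IsBoundaryNode μ m n)
    (hmM : m ≤ M) {a : ℕ} (ha : a ≤ m) :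
    Propto (cas ħ (nodeTuple μ M P a n))
      (casTail ħ m (fun b => (fdiff ħ)^[M - m + n] (P b)) a) := by
  set t := M - m + n with ht
  set f : Fin (m - a) → ℂ[X] := fun i => P (a + i) with hf
  set g : Fin t → ℂ[X] := fun j => X ^ (t - 1 - (j : ℕ)) with hg
  have hcol : ∀ j < n, m ≤ μ.colLen j := by
    intro j hj
    rcases hmn.2 with h | h | h
    · omega
    · omega
    · have := mem_iff_lt_colLen.1 h
      have := μ.colLen_anti j (n - 1) (by omega)
      omega
  have hrow : ∀ b, m ≤ b → μ.rowLen b ≤ n := by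
    intro b hb
    by_contra hlt
    exact hmn.1 (μ.up_left_mem hb le_rfl (mem_iff_lt_rowLen.2 (not_le.1 hlt)))
  have hsub : ∀ {x : ℂ[X]}, x.natDegree < t →
      x ∈ Submodule.span ℂ (Set.range (Fin.append f g)) := by
    intro x hx
    refine Submodule.span_mono ?_ (mem_span_of_natDegree_lt hx)
    rintro _ ⟨j, rfl⟩
    exact ⟨Fin.natAdd _ j, by rw [Fin.append_right]⟩
  have h1 := cas_nodeTuple_propto hħ hM hP (a := a) (s := n)
    (show (M - a) + n = (m - a) + t by omega) (g := Fin.append f g) (fun b hab hb => by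
      by_cases hbm : b < m
      · refine Submodule.subset_span ⟨Fin.castAdd _ ⟨b - a, by omega⟩, ?_⟩
        rw [Fin.append_left, hf]
        simp only
        congr 1; omega
      · refine hsub ?_
        rw [(hP b hb).2, rowDeg]
        have := hrow b (not_lt.1 hbm)
        omega)
    (fun j hj => by
      refine hsub ?_
      rw [natDegree_X_pow, gapDeg]
      have := hcol j hj
      omega)
  refine h1.trans ?_
  exact cas_append_propto hħ t f g fun j => ⟨pow_ne_zero _ X_ne_zero, natDegree_X_pow _⟩

/-! ### Solutions of the differential Q-system with one root away from the origin -/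

/-- A function on a Young diagram which is supported weakly above and to the left of a box `c₀`
and whose mixed differences vanish at all other boxes is constant on its support. -/
theorem eq_of_mixed_difference_eq_zero {A : Type*} [AddCommGroup A] {ν : YoungDiagram}
    {g : ℕ → ℕ → A} {c₀ : ℕ × ℕ} (hc₀ : c₀ ∈ ν)
    (hg : ∀ a s, ¬ (a ≤ c₀.1 ∧ s ≤ c₀.2) → g a s = 0)
    (hmix : ∀ c ∈ ν, c ≠ c₀ →
      g c.1 c.2 - g (c.1 + 1) c.2 - g c.1 (c.2 + 1) + g (c.1 + 1) (c.2 + 1) = 0)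
    {a s : ℕ} (ha : a ≤ c₀.1) (hs : s ≤ c₀.2) : g a s = g 0 0 := by
  have hout : ∀ a s, (a, s) ∉ ν → g a s = 0 := fun a s h =>
    hg a s fun h' => h (ν.up_left_mem h'.1 h'.2 hc₀)
  have key : ∀ a s, a ≤ c₀.1 → s ≤ c₀.2 → g a s =
      g c₀.1 c₀.2 - g (c₀.1 + 1) c₀.2 - g c₀.1 (c₀.2 + 1) + g (c₀.1 + 1) (c₀.2 + 1) := by
    intro a s ha hs
    rw [eq_sum_mixed_difference ν g hout a s]
    refine sum_eq_single_of_mem c₀ (mem_filter.2 ⟨hc₀, ha, hs⟩) ?_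
    exact fun c hc hne => hmix c (mem_filter.1 hc).1 hne
  rw [key a s ha hs, key 0 0 (Nat.zero_le _) (Nat.zero_le _)]

theorem eq_of_mul_eq_mul_on_boxes {ν : YoungDiagram} {g : ℕ → ℕ → ℂ} {c₀ : ℕ × ℕ} (hc₀ : c₀ ∈ ν)
    (hne : ∀ a s, g a s ≠ 0) (hg : ∀ a s, ¬ (a ≤ c₀.1 ∧ s ≤ c₀.2) → g a s = 1)
    (hmix : ∀ c ∈ ν, c ≠ c₀ → g c.1 c.2 * g (c.1 + 1) (c.2 + 1) = g (c.1 + 1) c.2 * g c.1 (c.2 + 1))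
    {a s : ℕ} (ha : a ≤ c₀.1) (hs : s ≤ c₀.2) : g a s = g 0 0 := by
  have h := eq_of_mixed_difference_eq_zero (A := Additive ℂˣ)
    (g := fun a s => Additive.ofMul (Units.mk0 (g a s) (hne a s))) hc₀
    (fun a s h => by simp [hg a s h]) (fun c hc hcne => ?_) ha hs
  · have := congrArg (fun x => ((Additive.toMul x : ℂˣ) : ℂ)) h
    simpa using this
  · have h1 : Units.mk0 (g c.1 c.2) (hne _ _) * Units.mk0 (g (c.1 + 1) (c.2 + 1)) (hne _ _) =
        Units.mk0 (g (c.1 + 1) c.2) (hne _ _) * Units.mk0 (g c.1 (c.2 + 1)) (hne _ _) :=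
      Units.ext (by simpa using hmix c hc hcne)
    have h2 := congrArg Additive.ofMul h1
    simp only [ofMul_mul] at h2
    rw [sub_sub, sub_add_eq_add_sub, h2, sub_self]

/-- The hook length of a box, as the number of boxes which are weakly below and to the right of
it, but not strictly below and to the right. -/
noncomputable def hookC (ν : Finset (ℕ × ℕ)) (a s : ℕ) : ℂ :=
  (boxCount ν a s : ℂ) - boxCount ν (a + 1) (s + 1)

theorem hookC_ne_zero {ν : Finset (ℕ × ℕ)} {a s : ℕ} (h : (a, s) ∈ ν) : hookC ν a s ≠ 0 := by
  have := boxCount_hook_pos h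
  rw [hookC, sub_ne_zero]
  exact_mod_cast this.ne'

theorem hookC_ne_one {ν : Finset (ℕ × ℕ)} {a s : ℕ} (h : (a, s) ∈ ν)
    (h' : (a + 1, s) ∈ ν ∨ (a, s + 1) ∈ ν) : hookC ν a s - 1 ≠ 0 := by
  have h1 := boxCount_rec ν a s
  rw [if_pos h] at h1
  have h2 : boxCount ν (a + 1) (s + 1) ≤ boxCount ν (a + 1) s := boxCount_mono ν le_rfl (by omega)
  have h3 : boxCount ν (a + 1) (s + 1) ≤ boxCount ν a (s + 1) := boxCount_mono ν (by omega) le_rfl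
  have h4 : boxCount ν a s ≠ boxCount ν (a + 1) (s + 1) + 1 := by
    rcases h' with h' | h'
    · have := boxCount_lt ν h' (le_refl (a + 1)) (show s ≤ s + 1 by omega) (by omega)
      omega
    · have := boxCount_lt ν h' (show a ≤ a + 1 by omega) (le_refl (s + 1)) (by omega)
      omega
  rw [hookC, sub_sub, sub_ne_zero]
  exact_mod_cast h4

/-- The root of the leading-order Q-function at `(a, s)` attached to the box `c` of `ν`,
relative to the root at the origin of the lattice. -/
noncomputable def cornerRatio (ν : Finset (ℕ × ℕ)) (c : ℕ × ℕ) (a s : ℕ) : ℂ :=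
  (∏ a' ∈ range a, (hookC ν a' c.2 - 1) / hookC ν a' c.2) *
    ∏ s' ∈ range s, (hookC ν c.1 s' - 1) / hookC ν c.1 s'

theorem cornerRatio_zero (ν : Finset (ℕ × ℕ)) (c : ℕ × ℕ) : cornerRatio ν c 0 0 = 1 := by
  simp [cornerRatio]

theorem cornerRatio_ne_zero {ν : Finset (ℕ × ℕ)} {c : ℕ × ℕ}
    (hν : ∀ a s, a ≤ c.1 → s ≤ c.2 → (a, s) ∈ ν) {a s : ℕ} (ha : a ≤ c.1) (hs : s ≤ c.2) :
    cornerRatio ν c a s ≠ 0 := by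
  refine mul_ne_zero (prod_ne_zero_iff.2 fun i hi => ?_)
    (prod_ne_zero_iff.2 fun i hi => ?_) <;> rw [mem_range] at hi
  · exact div_ne_zero (hookC_ne_one (hν _ _ (by omega) le_rfl)
      (Or.inl (hν _ _ (by omega) le_rfl))) (hookC_ne_zero (hν _ _ (by omega) le_rfl))
  · exact div_ne_zero (hookC_ne_one (hν _ _ le_rfl (by omega))
      (Or.inr (hν _ _ le_rfl (by omega)))) (hookC_ne_zero (hν _ _ le_rfl (by omega)))

/-- The differential Q-system, for polynomials of the degrees of a Q-system. -/
structure IsDifferentialQFamily (ν : YoungDiagram) (q : ℕ → ℕ → ℂ[X]) : Prop where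
  monic : ∀ a s, (q a s).Monic
  natDegree_eq : ∀ a s, (q a s).natDegree = boxCount ν.cells a s
  qq : ∀ a s, (a, s) ∈ ν →
    derivative (q a s) * q (a + 1) (s + 1) - q a s * derivative (q (a + 1) (s + 1)) =
      C (hookC ν.cells a s) * (q (a + 1) s * q a (s + 1))

theorem coeff_X_pow_mul_self (p : ℂ[X]) (k : ℕ) : (X ^ k * p).coeff k = p.coeff 0 := by
  simpa using coeff_X_pow_mul p k 0

theorem coeff_diffW_of_dvd {f g : ℂ[X]} {m n : ℕ} (hf : X ^ m ∣ f) (hg : X ^ n ∣ g) :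
    (∀ k < m + n, (X * (derivative f * g - f * derivative g)).coeff k = 0) ∧
      (X * (derivative f * g - f * derivative g)).coeff (m + n) =
        ((m : ℂ) - n) * (f.coeff m * g.coeff n) := by
  obtain ⟨f, rfl⟩ := hf
  obtain ⟨g, rfl⟩ := hg
  have hX : ∀ n : ℕ, X * derivative (X ^ n : ℂ[X]) = C (n : ℂ) * X ^ n := by
    intro n
    rcases n with _ | n
    · simp
    · rw [derivative_X_pow, pow_succ]; simp only [Nat.add_sub_cancel]; ring
  have h : X * (derivative (X ^ m * f) * (X ^ n * g) - X ^ m * f * derivative (X ^ n * g)) =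
      X ^ (m + n) * (C ((m : ℂ) - n) * (f * g) + X * (derivative f * g - f * derivative g)) := by
    simp only [derivative_mul, C_sub]
    linear_combination (X ^ n * f * g) * hX m - (X ^ m * f * g) * hX n
  rw [h]
  constructor
  · intro k hk
    rw [coeff_X_pow_mul', if_neg (by omega)]
  · rw [coeff_X_pow_mul_self, coeff_X_pow_mul_self, coeff_X_pow_mul_self]
    simp [mul_coeff_zero]

section

variable {ν : YoungDiagram} {q : ℕ → ℕ → ℂ[X]}

theorem IsDifferentialQFamily.trailing (hq : IsDifferentialQFamily ν q) {a s : ℕ} (h : (a, s) ∈ ν) :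
    (q a s).natTrailingDegree + (q (a + 1) (s + 1)).natTrailingDegree ≤
        (q (a + 1) s).natTrailingDegree + (q a (s + 1)).natTrailingDegree + 1 ∧
      ((q a s).natTrailingDegree + (q (a + 1) (s + 1)).natTrailingDegree =
        (q (a + 1) s).natTrailingDegree + (q a (s + 1)).natTrailingDegree + 1 →
      ((q a s).natTrailingDegree - (q (a + 1) (s + 1)).natTrailingDegree : ℂ) *
          ((q a s).trailingCoeff * (q (a + 1) (s + 1)).trailingCoeff) =
        hookC ν.cells a s * ((q (a + 1) s).trailingCoeff * (q a (s + 1)).trailingCoeff)) := by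
  have hd : ∀ a s, X ^ (q a s).natTrailingDegree ∣ q a s := fun a s =>
    X_pow_dvd_iff.2 fun d hd => coeff_eq_zero_of_lt_natTrailingDegree hd
  have ht : ∀ a s, (q a s).trailingCoeff ≠ 0 := fun a s =>
    trailingCoeff_nonzero_iff_nonzero.2 (hq.monic a s).ne_zero
  obtain ⟨h1, h2⟩ := coeff_diffW_of_dvd (hd a s) (hd (a + 1) (s + 1))
  have h3 := coeff_mul_natTrailingDegree_add_natTrailingDegree (p := q (a + 1) s) (q := q a (s + 1))
  rw [hq.qq a s h] at h1 h2
  have h4 : (X * (C (hookC ν.cells a s) * (q (a + 1) s * q a (s + 1)))).coeff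
      ((q (a + 1) s).natTrailingDegree + (q a (s + 1)).natTrailingDegree + 1) =
        hookC ν.cells a s * ((q (a + 1) s).trailingCoeff * (q a (s + 1)).trailingCoeff) := by
    rw [coeff_X_mul, coeff_C_mul, h3]
  have h5 : hookC ν.cells a s ≠ 0 := hookC_ne_zero h
  constructor
  · by_contra hlt
    rw [h1 _ (by omega)] at h4
    exact mul_ne_zero h5 (mul_ne_zero (ht _ _) (ht _ _)) h4.symm
  · intro he
    rw [he, h4] at h2
    exact h2.symm

/-- The mixed differences of the number of non-zero roots are non-negative. -/
theorem IsDifferentialQFamily.mixed_nonneg (hq : IsDifferentialQFamily ν q) {g : ℕ → ℕ → ℤ}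
    (hg : ∀ a s, g a s = boxCount ν.cells a s - (q a s).natTrailingDegree) {c : ℕ × ℕ}
    (h : c ∈ ν) :
    0 ≤ g c.1 c.2 - g (c.1 + 1) c.2 - g c.1 (c.2 + 1) + g (c.1 + 1) (c.2 + 1) ∧
    (g c.1 c.2 - g (c.1 + 1) c.2 - g c.1 (c.2 + 1) + g (c.1 + 1) (c.2 + 1) = 0 →
      (q c.1 c.2).natTrailingDegree + (q (c.1 + 1) (c.2 + 1)).natTrailingDegree =
        (q (c.1 + 1) c.2).natTrailingDegree + (q c.1 (c.2 + 1)).natTrailingDegree + 1) := by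
  have h1 := boxCount_rec ν.cells c.1 c.2
  rw [if_pos (show (c.1, c.2) ∈ ν.cells from h)] at h1
  have h2 := (hq.trailing (a := c.1) (s := c.2) h).1
  simp only [hg]
  omega

theorem IsDifferentialQFamily.eq_one (hq : IsDifferentialQFamily ν q) {a s : ℕ}
    (h : (a, s) ∉ ν) : q a s = 1 :=
  (hq.monic a s).natDegree_eq_zero.1 (by rw [hq.natDegree_eq, boxCount_eq_zero h])

theorem IsDifferentialQFamily.eq_X_pow (hq : IsDifferentialQFamily ν q) {a s : ℕ}
    (h : boxCount ν.cells a s ≤ (q a s).natTrailingDegree) :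
    q a s = X ^ boxCount ν.cells a s := by
  have := hq.natDegree_eq a s
  have h1 := ((hq.monic a s).eq_X_pow_iff_natDegree_le_natTrailingDegree).2 (by omega)
  rw [← this]; exact h1

theorem IsDifferentialQFamily.eq_X_pow_of_source (hq : IsDifferentialQFamily ν q)
    (h0 : q 0 0 = X ^ ν.card) (a s : ℕ) : q a s = X ^ boxCount ν.cells a s := by
  set g : ℕ → ℕ → ℤ := fun a s => (boxCount ν.cells a s : ℤ) - (q a s).natTrailingDegree with hg
  have hout : ∀ a s, (a, s) ∉ ν → g a s = 0 := fun a s h => by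
    simp [hg, boxCount_eq_zero h, hq.eq_one h]
  have hsum := eq_sum_mixed_difference ν g hout 0 0
  have h00 : g 0 0 = 0 := by
    simp only [hg, h0, natTrailingDegree_X_pow, boxCount_zero_zero]
    exact sub_self _
  rw [h00] at hsum
  have hz := (sum_eq_zero_iff_of_nonneg fun c hc =>
    (hq.mixed_nonneg (fun _ _ => rfl) (mem_filter.1 hc).1).1).1 hsum.symm
  refine hq.eq_X_pow ?_
  have h1 := eq_sum_mixed_difference ν g hout a s
  rw [sum_eq_zero] at h1
  · simp only [hg] at h1; omega
  · intro c hc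
    refine hz c ?_
    rw [mem_filter] at hc ⊢
    exact ⟨hc.1, by omega, by omega⟩

theorem IsDifferentialQFamily.exists_corner (hq : IsDifferentialQFamily ν q) {t : ℂ} (ht : t ≠ 0)
    (h0 : q 0 0 = X ^ (ν.card - 1) * (X - C t)) :
    ∃ c₀ ∈ ν, (c₀.1 + 1, c₀.2) ∉ ν ∧ (c₀.1, c₀.2 + 1) ∉ ν ∧
      ∀ a s, q a s = if a ≤ c₀.1 ∧ s ≤ c₀.2 then
        X ^ (boxCount ν.cells a s - 1) * (X - C (t * cornerRatio ν.cells c₀ a s))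
        else X ^ boxCount ν.cells a s := by
  have hXt : (X - C t : ℂ[X]).natTrailingDegree = 0 :=
    natTrailingDegree_eq_zero_of_constantCoeff_ne_zero (by simpa using ht)
  have ho00 : (q 0 0).natTrailingDegree = ν.card - 1 := by
    rw [h0, natTrailingDegree_mul (by simp) (X_sub_C_ne_zero t), natTrailingDegree_X_pow, hXt]
    rfl
  have hcard : 0 < ν.card := by
    have h1 := hq.natDegree_eq 0 0
    rw [h0, natDegree_mul (by simp) (X_sub_C_ne_zero t), natDegree_X_sub_C,
      boxCount_zero_zero] at h1
    exact lt_of_lt_of_le (Nat.succ_pos _) h1.le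
  have ht00 : (q 0 0).trailingCoeff = -t := by
    rw [trailingCoeff, ho00, h0, coeff_X_pow_mul_self]
    simp
  set g : ℕ → ℕ → ℤ := fun a s => (boxCount ν.cells a s : ℤ) - (q a s).natTrailingDegree with hg
  have hout : ∀ a s, (a, s) ∉ ν → g a s = 0 := fun a s h => by
    simp [hg, boxCount_eq_zero h, hq.eq_one h]
  set mx : ℕ × ℕ → ℤ := fun c =>
    g c.1 c.2 - g (c.1 + 1) c.2 - g c.1 (c.2 + 1) + g (c.1 + 1) (c.2 + 1) with hmx
  have hsum : ∀ a s, g a s = ∑ c ∈ ν.cells.filter (fun c => a ≤ c.1 ∧ s ≤ c.2), mx c :=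
    eq_sum_mixed_difference ν g hout
  have hnn : ∀ c ∈ ν, 0 ≤ mx c := fun c hc => (hq.mixed_nonneg (fun _ _ => rfl) hc).1
  have h00 : ∑ c ∈ ν.cells, mx c = 1 := by
    have h1 := hsum 0 0
    simp only [hg, ho00, boxCount_zero_zero, Nat.zero_le, and_self, filter_true] at h1
    have h2 : ν.cells.card = ν.card := rfl
    omega
  obtain ⟨c₀, hc₀, hne⟩ : ∃ c ∈ ν.cells, mx c ≠ 0 := by
    by_contra! h
    rw [sum_eq_zero h] at h00
    omega
  have hrest : ∀ c ∈ ν.cells, c ≠ c₀ → mx c = 0 := by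
    have h1 := add_sum_erase ν.cells mx hc₀
    have h2 : 0 ≤ ∑ c ∈ ν.cells.erase c₀, mx c := sum_nonneg fun c hc => hnn c (mem_of_mem_erase hc)
    have h3 := hnn c₀ hc₀
    intro c hc hcne
    exact (sum_eq_zero_iff_of_nonneg fun c hc => hnn c (mem_of_mem_erase hc)).1
      (show ∑ c ∈ ν.cells.erase c₀, mx c = 0 by omega) c (mem_erase.2 ⟨hcne, hc⟩)
  have hmx0 : mx c₀ = 1 := by
    rw [sum_eq_single_of_mem c₀ hc₀ hrest] at h00; exact h00
  have hgval : ∀ a s, g a s = if a ≤ c₀.1 ∧ s ≤ c₀.2 then 1 else 0 := by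
    intro a s
    rw [hsum]
    split_ifs with h
    · rw [sum_eq_single_of_mem c₀ (mem_filter.2 ⟨hc₀, h⟩), hmx0]
      exact fun c hc hcne => hrest c (mem_filter.1 hc).1 hcne
    · refine sum_eq_zero fun c hc => hrest c (mem_filter.1 hc).1 ?_
      rintro rfl
      exact h (mem_filter.1 hc).2
  have hν : ∀ a s, a ≤ c₀.1 → s ≤ c₀.2 → (a, s) ∈ ν := fun a s ha hs => ν.up_left_mem ha hs hc₀
  have hoff : ∀ a s, ¬ (a ≤ c₀.1 ∧ s ≤ c₀.2) → q a s = X ^ boxCount ν.cells a s := by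
    intro a s h
    have := hgval a s
    rw [if_neg h] at this
    exact hq.eq_X_pow (by simp only [hg] at this; omega)
  have hpos : ∀ a s, a ≤ c₀.1 → s ≤ c₀.2 → 0 < boxCount ν.cells a s := fun a s ha hs =>
    boxCount_pos (hν a s ha hs)
  have hon : ∀ a s, a ≤ c₀.1 → s ≤ c₀.2 →
      q a s = X ^ (boxCount ν.cells a s - 1) * (X + C (q a s).trailingCoeff) := by
    intro a s ha hs
    have h1 := hgval a s
    rw [if_pos ⟨ha, hs⟩] at h1
    have h2 := hpos a s ha hs
    have h3 : (q a s).natTrailingDegree = boxCount ν.cells a s - 1 := by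
      simp only [hg] at h1; omega
    obtain ⟨f, hf⟩ : X ^ (boxCount ν.cells a s - 1) ∣ q a s :=
      X_pow_dvd_iff.2 fun d hd => coeff_eq_zero_of_lt_natTrailingDegree (by omega)
    have hfm : f.Monic := Monic.of_mul_monic_left (monic_X_pow (boxCount ν.cells a s - 1))
      (by rw [← hf]; exact hq.monic a s)
    have hfd : f.natDegree = 1 := by
      have h4 := hq.natDegree_eq a s
      rw [hf, natDegree_mul (by simp) hfm.ne_zero, natDegree_X_pow] at h4
      omega
    have hf0 : (q a s).trailingCoeff = f.coeff 0 := by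
      rw [trailingCoeff, h3, hf, coeff_X_pow_mul_self]
    rw [hf0]
    refine hf.trans ?_
    congr 1
    exact hfm.eq_X_add_C hfd
  have htne : ∀ a s, (q a s).trailingCoeff ≠ 0 := fun a s =>
    trailingCoeff_nonzero_iff_nonzero.2 (hq.monic a s).ne_zero
  have hone : ∀ a s, ¬ (a ≤ c₀.1 ∧ s ≤ c₀.2) → (q a s).trailingCoeff = 1 := by
    intro a s h
    have h1 := hgval a s
    rw [if_neg h] at h1
    rw [trailingCoeff, show (q a s).natTrailingDegree = (q a s).natDegree by
      rw [hq.natDegree_eq]; simp only [hg] at h1; omega]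
    exact hq.monic a s
  obtain ⟨a₀, s₀⟩ := c₀
  simp only at *
  have hrec := boxCount_rec ν.cells a₀ s₀
  rw [if_pos hc₀] at hrec
  -- the box is a corner
  have hhook : boxCount ν.cells a₀ s₀ = boxCount ν.cells (a₀ + 1) (s₀ + 1) + 1 := by
    have h1 := hq.qq a₀ s₀ hc₀
    have h2 := hpos a₀ s₀ le_rfl le_rfl
    rw [hoff (a₀ + 1) (s₀ + 1) (by omega), hoff (a₀ + 1) s₀ (by omega),
      hoff a₀ (s₀ + 1) (by omega), ← pow_add] at h1
    have h3 := coeff_diffW_of_dvd (f := q a₀ s₀)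
      (show X ^ (boxCount ν.cells a₀ s₀ - 1) ∣ q a₀ s₀ from
        ⟨_, hon a₀ s₀ le_rfl le_rfl⟩) (dvd_refl (X ^ boxCount ν.cells (a₀ + 1) (s₀ + 1)))
    have h4 := h3.2
    rw [h1, mul_left_comm, ← pow_succ', coeff_C_mul, coeff_X_pow, if_neg (by omega), mul_zero] at h4
    have h5 : (q a₀ s₀).coeff (boxCount ν.cells a₀ s₀ - 1) = (q a₀ s₀).trailingCoeff := by
      conv_lhs => rw [hon a₀ s₀ le_rfl le_rfl]
      rw [coeff_X_pow_mul_self]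
      simp
    rw [h5, coeff_X_pow_self, mul_one] at h4
    have h6 := (mul_eq_zero.1 h4.symm).resolve_right (htne _ _)
    rw [sub_eq_zero] at h6
    have h7 : boxCount ν.cells a₀ s₀ - 1 = boxCount ν.cells (a₀ + 1) (s₀ + 1) := by
      exact_mod_cast h6
    omega
  have hm1 : boxCount ν.cells (a₀ + 1) (s₀ + 1) ≤ boxCount ν.cells (a₀ + 1) s₀ :=
    boxCount_mono _ le_rfl (by omega)
  have hm2 : boxCount ν.cells (a₀ + 1) (s₀ + 1) ≤ boxCount ν.cells a₀ (s₀ + 1) :=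
    boxCount_mono _ (by omega) le_rfl
  have hcor1 : (a₀ + 1, s₀) ∉ ν := fun h => by
    have := boxCount_lt ν.cells h (le_refl (a₀ + 1)) (show s₀ ≤ s₀ + 1 by omega) (by omega)
    omega
  have hcor2 : (a₀, s₀ + 1) ∉ ν := fun h => by
    have := boxCount_lt ν.cells h (show a₀ ≤ a₀ + 1 by omega) (le_refl (s₀ + 1)) (by omega)
    omega
  refine ⟨(a₀, s₀), hc₀, hcor1, hcor2, ?_⟩
  -- the relative coefficients
  set R : ℕ → ℕ → ℂ := fun a s =>
    if a ≤ a₀ ∧ s ≤ s₀ then cornerRatio ν.cells (a₀, s₀) a s else 1 with hR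
  have hRon : ∀ a s, a ≤ a₀ → s ≤ s₀ → R a s = cornerRatio ν.cells (a₀, s₀) a s :=
    fun a s ha hs => if_pos ⟨ha, hs⟩
  have hRoff : ∀ a s, ¬ (a ≤ a₀ ∧ s ≤ s₀) → R a s = 1 := fun a s h => if_neg h
  have hRne : ∀ a s, R a s ≠ 0 := by
    intro a s
    by_cases h : a ≤ a₀ ∧ s ≤ s₀
    · rw [hRon a s h.1 h.2]; exact cornerRatio_ne_zero hν h.1 h.2
    · rw [hRoff a s h]; exact one_ne_zero
  have hRrel : ∀ c ∈ ν, c ≠ (a₀, s₀) →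
      ((q c.1 c.2).natTrailingDegree - (q (c.1 + 1) (c.2 + 1)).natTrailingDegree : ℂ) *
        (R c.1 c.2 * R (c.1 + 1) (c.2 + 1)) =
      hookC ν.cells c.1 c.2 * (R (c.1 + 1) c.2 * R c.1 (c.2 + 1)) := by
    rintro ⟨a, s⟩ hc hcne
    have hk := hookC_ne_zero (show (a, s) ∈ ν.cells from hc)
    have e1 := hgval a s
    have e2 := hgval (a + 1) (s + 1)
    have ho : ((q a s).natTrailingDegree - (q (a + 1) (s + 1)).natTrailingDegree : ℂ) =
        hookC ν.cells a s - (if a ≤ a₀ ∧ s ≤ s₀ then 1 else 0) +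
          (if a + 1 ≤ a₀ ∧ s + 1 ≤ s₀ then 1 else 0) := by
      have hcast : ∀ (x y : ℕ) (b : Prop) [Decidable b], ((x : ℤ) - y = if b then 1 else 0) →
          (x : ℂ) - y = if b then 1 else 0 := by
        intro x y b _ h
        have := congrArg (fun z : ℤ => (z : ℂ)) h
        push_cast at this
        exact this
      have e1' := hcast _ _ _ e1
      have e2' := hcast _ _ _ e2
      rw [hookC]
      linear_combination e2' - e1'
    simp only
    rw [ho]
    by_cases h1 : a ≤ a₀
    · by_cases h2 : s ≤ s₀
      · rcases h1.lt_or_eq with h3 | rfl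
        · rcases h2.lt_or_eq with h4 | rfl
          · rw [if_pos ⟨h1, h2⟩, if_pos (by omega), hRon a s h1 h2, hRon _ _ h3 h4,
              hRon _ _ h3 h2, hRon _ _ h1 h4]
            simp only [cornerRatio, prod_range_succ]
            ring
          · rw [if_pos ⟨h1, h2⟩, if_neg (by omega), hRon a s h1 h2, hRoff _ _ (by omega),
              hRon _ _ h3 h2, hRoff _ _ (by omega)]
            simp only [cornerRatio, prod_range_succ]
            field_simp
            ring
        · rcases h2.lt_or_eq with h4 | rfl
          · rw [if_pos ⟨h1, h2⟩, if_neg (by omega), hRon a s h1 h2, hRoff _ _ (by omega),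
              hRoff _ _ (by omega), hRon _ _ h1 h4]
            simp only [cornerRatio, prod_range_succ]
            field_simp
            ring
          · exact absurd rfl hcne
      · rw [if_neg (by omega), if_neg (by omega), hRoff _ _ (by omega), hRoff _ _ (by omega),
          hRoff _ _ (by omega), hRoff _ _ (by omega)]
        ring
    · rw [if_neg (by omega), if_neg (by omega), hRoff _ _ (by omega), hRoff _ _ (by omega),
        hRoff _ _ (by omega), hRoff _ _ (by omega)]
      ring
  have hconst : ∀ a s, a ≤ a₀ → s ≤ s₀ →
      (q a s).trailingCoeff / R a s = (q 0 0).trailingCoeff / R 0 0 := by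
    intro a s ha hs
    refine eq_of_mul_eq_mul_on_boxes (g := fun a s => (q a s).trailingCoeff / R a s)
      (show (a₀, s₀) ∈ ν from hc₀) (fun a s => div_ne_zero (htne a s) (hRne a s))
      (fun a s h => ?_) (fun c hc hcne => ?_) ha hs
    · simp only [hone a s h, hRoff a s h, div_one]
    · have h1 := (hq.trailing (a := c.1) (s := c.2) hc).2
        ((hq.mixed_nonneg (fun _ _ => rfl) hc).2 (hrest c hc hcne))
      have h2 := hRrel c hc hcne
      have hk := hookC_ne_zero (show (c.1, c.2) ∈ ν.cells from hc)
      have r1 := hRne c.1 c.2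
      have r2 := hRne (c.1 + 1) (c.2 + 1)
      have r3 := hRne (c.1 + 1) c.2
      have r4 := hRne c.1 (c.2 + 1)
      have hx : ((q c.1 c.2).natTrailingDegree -
          (q (c.1 + 1) (c.2 + 1)).natTrailingDegree : ℂ) ≠ 0 := by
        intro h0
        rw [h0, zero_mul] at h2
        exact mul_ne_zero hk (mul_ne_zero r3 r4) h2.symm
      rw [div_mul_div_comm, div_mul_div_comm, div_eq_div_iff (mul_ne_zero r1 r2)
        (mul_ne_zero r3 r4)]
      refine mul_left_cancel₀ (mul_ne_zero hx hk) ?_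
      linear_combination (hookC ν.cells c.1 c.2 * (R (c.1 + 1) c.2 * R c.1 (c.2 + 1))) * h1 -
        (hookC ν.cells c.1 c.2 * ((q (c.1 + 1) c.2).trailingCoeff *
          (q c.1 (c.2 + 1)).trailingCoeff)) * h2
  intro a s
  split_ifs with h
  · rw [hon a s h.1 h.2]
    have h1 := hconst a s h.1 h.2
    rw [hRon 0 0 (Nat.zero_le _) (Nat.zero_le _), cornerRatio_zero, div_one, ht00,
      div_eq_iff (hRne a s), hRon a s h.1 h.2] at h1
    rw [h1, neg_mul, C_neg, ← sub_eq_add_neg]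
  · exact hoff a s h

end

/-! ### Coefficientwise limits of polynomials -/

section

open Filter Topology

variable {ι : Type*} {l : Filter ι}

/-- Convergence of every coefficient. -/
def CoeffTendsto (f : ι → ℂ[X]) (l : Filter ι) (g : ℂ[X]) : Prop :=
  ∀ k, Tendsto (fun i => (f i).coeff k) l (𝓝 (g.coeff k))

namespace CoeffTendsto

variable {f f' : ι → ℂ[X]} {g g' : ℂ[X]}

theorem const (g : ℂ[X]) : CoeffTendsto (fun _ : ι => g) l g := fun _ => tendsto_const_nhds

theorem C {c : ι → ℂ} {x : ℂ} (h : Tendsto c l (𝓝 x)) :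
    CoeffTendsto (fun i => Polynomial.C (c i)) l (Polynomial.C x) := by
  intro k
  rcases Nat.eq_zero_or_pos k with rfl | hk
  · simpa using h
  · simp [coeff_C_of_ne_zero hk.ne', tendsto_const_nhds]

theorem add (h : CoeffTendsto f l g) (h' : CoeffTendsto f' l g') :
    CoeffTendsto (fun i => f i + f' i) l (g + g') := fun k => by
  simpa only [coeff_add] using (h k).add (h' k)

theorem sub (h : CoeffTendsto f l g) (h' : CoeffTendsto f' l g') :
    CoeffTendsto (fun i => f i - f' i) l (g - g') := fun k => by
  simpa only [coeff_sub] using (h k).sub (h' k)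

theorem mul (h : CoeffTendsto f l g) (h' : CoeffTendsto f' l g') :
    CoeffTendsto (fun i => f i * f' i) l (g * g') := fun k => by
  simp only [coeff_mul]
  exact tendsto_finsetSum _ fun x _ => (h x.1).mul (h' x.2)

theorem pow (h : CoeffTendsto f l g) (n : ℕ) : CoeffTendsto (fun i => f i ^ n) l (g ^ n) := by
  induction n with
  | zero => simpa using const 1
  | succ n ih => simpa only [pow_succ] using ih.mul h

theorem sum {α : Type*} (s : Finset α) {f : α → ι → ℂ[X]} {g : α → ℂ[X]}
    (h : ∀ x ∈ s, CoeffTendsto (f x) l (g x)) :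
    CoeffTendsto (fun i => ∑ x ∈ s, f x i) l (∑ x ∈ s, g x) := fun k => by
  simp only [finsetSum_coeff]
  exact tendsto_finsetSum _ fun x hx => h x hx k

theorem unique [l.NeBot] (h : CoeffTendsto f l g) (h' : CoeffTendsto f l g') : g = g' :=
  Polynomial.ext fun k => tendsto_nhds_unique (h k) (h' k)

theorem congr' (h : CoeffTendsto f l g) (he : ∀ᶠ i in l, f i = f' i) : CoeffTendsto f' l g :=
  fun k => (h k).congr' (he.mono fun i hi => by rw [hi])

theorem natDegree_le [l.NeBot] {D : ℕ} (h : CoeffTendsto f l g) (hf : ∀ i, (f i).natDegree ≤ D) :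
    g.natDegree ≤ D := by
  rw [natDegree_le_iff_coeff_eq_zero]
  intro k hk
  refine tendsto_nhds_unique (h k) ?_
  simp only [coeff_eq_zero_of_natDegree_lt ((hf _).trans_lt hk)]
  exact tendsto_const_nhds

end CoeffTendsto

theorem eq_sum_C_mul_X_pow {f : ℂ[X]} {D : ℕ} (hf : f.natDegree ≤ D) :
    f = ∑ j ∈ range (D + 1), C (f.coeff j) * X ^ j := by
  simpa only [C_mul_X_pow_eq_monomial] using f.as_sum_range' (D + 1) (by omega)

theorem shift_eq_sum (κ : ℂ) (k : ℤ) {f : ℂ[X]} {D : ℕ} (hf : f.natDegree ≤ D) :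
    shift κ k f = ∑ j ∈ range (D + 1), C (f.coeff j) * (X + C (k * κ / 2)) ^ j := by
  conv_lhs => rw [eq_sum_C_mul_X_pow hf]
  rw [shift_sum]
  refine sum_congr rfl fun j _ => ?_
  rw [shift_mul, shift_C, shift, X_pow_comp]

theorem CoeffTendsto.shift {κ : ι → ℂ} (hκ : Tendsto κ l (𝓝 0)) (k : ℤ) {f : ι → ℂ[X]} {g : ℂ[X]}
    {D : ℕ} (h : CoeffTendsto f l g) (hf : ∀ i, (f i).natDegree ≤ D) (hg : g.natDegree ≤ D) :
    CoeffTendsto (fun i => TwistlessQSystem.shift (κ i) k (f i)) l g := by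
  rw [eq_sum_C_mul_X_pow hg]
  simp only [shift_eq_sum _ _ (hf _)]
  refine CoeffTendsto.sum _ fun j _ => (CoeffTendsto.C (h j)).mul (CoeffTendsto.pow ?_ j)
  simpa using (CoeffTendsto.const (X : ℂ[X])).add (CoeffTendsto.C (x := 0)
    (by simpa using (hκ.const_mul (k : ℂ)).div_const 2))

theorem CoeffTendsto.fdiff {κ : ι → ℂ} (hκ : Tendsto κ l (𝓝 0)) (hκ0 : ∀ i, κ i ≠ 0)
    {f : ι → ℂ[X]} {g : ℂ[X]}
    {D : ℕ} (h : CoeffTendsto f l g) (hf : ∀ i, (f i).natDegree ≤ D) (hg : g.natDegree ≤ D) :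
    CoeffTendsto (fun i => Polynomial.C (κ i)⁻¹ * TwistlessQSystem.fdiff (κ i) (f i)) l
      (derivative g) := by
  have hX : ∀ k : ℤ, CoeffTendsto (fun i => (X + Polynomial.C (k * κ i / 2) : ℂ[X])) l X :=
    fun k => by
    simpa using (CoeffTendsto.const (X : ℂ[X])).add (CoeffTendsto.C (x := 0)
      (by simpa using (hκ.const_mul (k : ℂ)).div_const 2))
  have h1 : ∀ i, Polynomial.C (κ i)⁻¹ * TwistlessQSystem.fdiff (κ i) (f i) =
      ∑ j ∈ range (D + 1), Polynomial.C ((f i).coeff j) *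
        ∑ m ∈ range j, (X + Polynomial.C (((1 : ℤ) : ℂ) * κ i / 2)) ^ m *
          (X + Polynomial.C (((-1 : ℤ) : ℂ) * κ i / 2)) ^ (j - 1 - m) := by
    intro i
    rw [TwistlessQSystem.fdiff, shift_eq_sum _ _ (hf i), shift_eq_sum _ _ (hf i),
      ← sum_sub_distrib, mul_sum]
    refine sum_congr rfl fun j _ => ?_
    rw [← mul_sub, ← geom_sum₂_mul, show (X + Polynomial.C (((1 : ℤ) : ℂ) * κ i / 2) -
      (X + Polynomial.C (((-1 : ℤ) : ℂ) * κ i / 2)) : ℂ[X]) = Polynomial.C (κ i) by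
        rw [add_sub_add_left_eq_sub, ← C_sub]; congr 1; push_cast; ring]
    have h2 : Polynomial.C (κ i)⁻¹ * Polynomial.C (κ i) = 1 := by
      rw [← C_mul, inv_mul_cancel₀ (hκ0 i), C_1]
    linear_combination (Polynomial.C ((f i).coeff j) * ∑ m ∈ range j,
      (X + Polynomial.C (((1 : ℤ) : ℂ) * κ i / 2)) ^ m *
        (X + Polynomial.C (((-1 : ℤ) : ℂ) * κ i / 2)) ^ (j - 1 - m)) * h2
  have h2 : derivative g = ∑ j ∈ range (D + 1), Polynomial.C (g.coeff j) *
      ∑ m ∈ range j, (X : ℂ[X]) ^ m * X ^ (j - 1 - m) := by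
    conv_lhs => rw [eq_sum_C_mul_X_pow hg]
    rw [derivative_sum]
    refine sum_congr rfl fun j _ => ?_
    rw [derivative_C_mul, derivative_X_pow]
    congr 1
    rw [sum_congr rfl (g := fun _ => X ^ (j - 1)) fun m hm => by
      rw [← pow_add]; congr 1; rw [mem_range] at hm; omega]
    simp
  simp only [h1, h2]
  exact CoeffTendsto.sum _ fun j _ => (CoeffTendsto.C (h j)).mul
    (CoeffTendsto.sum _ fun m _ => ((hX _).pow m).mul ((hX _).pow _))

theorem CoeffTendsto.wronskian {κ : ι → ℂ} (hκ : Tendsto κ l (𝓝 0)) (hκ0 : ∀ i, κ i ≠ 0)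
    {f f' : ι → ℂ[X]} {g g' : ℂ[X]} {D : ℕ} (h : CoeffTendsto f l g) (h' : CoeffTendsto f' l g')
    (hf : ∀ i, (f i).natDegree ≤ D) (hf' : ∀ i, (f' i).natDegree ≤ D)
    (hg : g.natDegree ≤ D) (hg' : g'.natDegree ≤ D) :
    CoeffTendsto (fun i => Polynomial.C (κ i)⁻¹ * TwistlessQSystem.wronskian (κ i) (f i) (f' i)) l
      (derivative g * g' - g * derivative g') := by
  have h1 := ((h.fdiff hκ hκ0 hf hg).mul (h'.shift hκ (-1) hf' hg')).sub
    ((h.shift hκ (-1) hf hg).mul (h'.fdiff hκ hκ0 hf' hg'))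
  refine h1.congr' (Eventually.of_forall fun i => ?_)
  rw [wronskian_eq_fdiff]
  ring

/-! ### Rescaling -/

/-- The polynomial `f (σ u) / (N σ ^ d)`. -/
noncomputable def normScale (σ N : ℂ) (d : ℕ) (f : ℂ[X]) : ℂ[X] :=
  C (N * σ ^ d)⁻¹ * f.comp (C σ * X)

theorem coeff_normScale (σ N : ℂ) (d : ℕ) (f : ℂ[X]) (k : ℕ) :
    (normScale σ N d f).coeff k = f.coeff k * σ ^ k / (N * σ ^ d) := by
  rw [normScale, coeff_C_mul, comp_C_mul_X_coeff]
  ring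

theorem normScale_mul (σ N N' : ℂ) (d d' : ℕ) (f f' : ℂ[X]) :
    normScale σ (N * N') (d + d') (f * f') = normScale σ N d f * normScale σ N' d' f' := by
  simp only [normScale, mul_comp, pow_add, mul_inv, C_mul]
  ring

theorem natDegree_normScale_le (σ N : ℂ) (d : ℕ) (f : ℂ[X]) :
    (normScale σ N d f).natDegree ≤ f.natDegree := by
  rw [natDegree_le_iff_coeff_eq_zero]
  intro k hk
  rw [coeff_normScale, coeff_eq_zero_of_natDegree_lt hk, zero_mul, zero_div]

theorem normScale_normScale {σ ρ : ℂ} (hρ : ρ ≠ 0) (N : ℂ) (d : ℕ) (f : ℂ[X]) :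
    normScale (σ / ρ) 1 d (normScale ρ N d f) = normScale σ N d f := by
  ext k
  simp only [coeff_normScale]
  rcases eq_or_ne σ 0 with rfl | hσ
  · rcases Nat.eq_zero_or_pos d with rfl | hd
    · rcases Nat.eq_zero_or_pos k with rfl | hk
      · simp
      · simp [hk.ne']
    · simp [hd.ne']
  · simp only [div_pow]
    field_simp

theorem CoeffTendsto.normScale {σ : ι → ℂ} {t : ℂ} (hσ : Tendsto σ l (𝓝 t)) (ht : t ≠ 0) (d : ℕ)
    {f : ι → ℂ[X]} {g : ℂ[X]} (h : CoeffTendsto f l g) :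
    CoeffTendsto (fun i => TwistlessQSystem.normScale (σ i) 1 d (f i)) l
      (TwistlessQSystem.normScale t 1 d g) := fun k => by
  simp only [coeff_normScale, one_mul]
  exact ((h k).mul (hσ.pow k)).div (hσ.pow d) (pow_ne_zero d ht)

theorem shift_comp_C_mul_X {σ : ℂ} (hσ : σ ≠ 0) (ħ : ℂ) (k : ℤ) (f : ℂ[X]) :
    (shift ħ k f).comp (C σ * X) = shift (ħ / σ) k (f.comp (C σ * X)) := by
  simp only [shift, comp_assoc]
  congr 1
  simp only [add_comp, X_comp, C_comp, mul_comp, mul_add, ← C_mul]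
  congr 2
  field_simp

theorem wronskian_comp_C_mul_X {σ : ℂ} (hσ : σ ≠ 0) (ħ : ℂ) (f g : ℂ[X]) :
    (wronskian ħ f g).comp (C σ * X) = wronskian (ħ / σ) (f.comp (C σ * X)) (g.comp (C σ * X)) := by
  simp only [wronskian, sub_comp, mul_comp, shift_comp_C_mul_X hσ]

theorem wronskian_C_mul (ħ c c' : ℂ) (f g : ℂ[X]) :
    wronskian ħ (C c * f) (C c' * g) = C (c * c') * wronskian ħ f g := by
  simp only [wronskian, shift_mul, shift_C, C_mul]
  ring

theorem coeff_diffW_of_monic {f g : ℂ[X]} {d e : ℕ} (hf : f.Monic) (hg : g.Monic)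
    (hd : f.natDegree = d) (he : g.natDegree = e) :
    (X * (derivative f * g - f * derivative g)).coeff (d + e) = (d : ℂ) - e := by
  have h : ∀ f : ℂ[X], ∀ k, (X * derivative f).coeff k = k * f.coeff k := by
    intro f k
    rcases k with _ | k
    · simp
    · rw [coeff_X_mul, coeff_derivative]; push_cast; ring
  have h1 : ∀ {f : ℂ[X]} {d : ℕ}, f.natDegree = d → (X * derivative f).natDegree ≤ d := by
    intro f d hd
    rw [natDegree_le_iff_coeff_eq_zero]
    intro k hk
    rw [h, coeff_eq_zero_of_natDegree_lt (by omega), mul_zero]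
  have e1 : X * (derivative f * g - f * derivative g) =
      X * derivative f * g - f * (X * derivative g) := by ring
  rw [e1, coeff_sub, coeff_mul_add_eq_of_natDegree_le (h1 hd) he.le,
    coeff_mul_add_eq_of_natDegree_le hd.le (h1 he), h, h,
    show f.coeff d = 1 by rw [← hd]; exact hf, show g.coeff e = 1 by rw [← he]; exact hg]
  ring

/-- The constant in the relations of a rescaled Q-system. -/
noncomputable def scaleConst (μ : YoungDiagram) (ħ σ : ℂ) (N : ℕ → ℕ → ℂ) (d : ℕ → ℕ → ℕ)
    (a s : ℕ) : ℂ :=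
  (ħ / σ)⁻¹ * ((N a s * σ ^ d a s)⁻¹ * (N (a + 1) (s + 1) * σ ^ d (a + 1) (s + 1))⁻¹) *
    (ħ * hookC μ.cells a s) * (N (a + 1) s * σ ^ d (a + 1) s * (N a (s + 1) * σ ^ d a (s + 1)))

theorem IsQFamily.wronskian_normScale {ħ σ : ℂ} (hQ : IsQFamily μ ħ Q)
    (hdeg : (Q 0 0).natDegree = μ.card) (hσ : σ ≠ 0) {N : ℕ → ℕ → ℂ}
    (hN : ∀ a s, N a s ≠ 0) (d : ℕ → ℕ → ℕ) {a s : ℕ} (h : (a, s) ∈ μ) :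
    C (ħ / σ)⁻¹ * wronskian (ħ / σ) (normScale σ (N a s) (d a s) (Q a s))
        (normScale σ (N (a + 1) (s + 1)) (d (a + 1) (s + 1)) (Q (a + 1) (s + 1))) =
      C (scaleConst μ ħ σ N d a s) * (normScale σ (N (a + 1) s) (d (a + 1) s) (Q (a + 1) s) *
        normScale σ (N a (s + 1)) (d a (s + 1)) (Q a (s + 1))) := by
  have hw0 : ∀ a s, N a s * σ ^ d a s ≠ 0 := fun a s => mul_ne_zero (hN a s) (pow_ne_zero _ hσ)
  have h1 := congrArg (fun f => f.comp (C σ * X)) (hQ.wronskian_eq hdeg h)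
  simp only [wronskian_comp_C_mul_X hσ, mul_comp, C_comp] at h1
  have e1 : ∀ a s, C (N a s * σ ^ d a s) * normScale σ (N a s) (d a s) (Q a s) =
      (Q a s).comp (C σ * X) := by
    intro a s
    simp only [normScale, ← mul_assoc, ← C_mul]
    rw [mul_inv_cancel₀ (hw0 a s)]; simp
  rw [← e1 (a + 1) s, ← e1 a (s + 1)] at h1
  simp only [normScale] at h1 ⊢
  rw [wronskian_C_mul, h1]
  simp only [scaleConst, hookC, C_mul]
  ring

section

variable [l.NeBot] {μ ν : YoungDiagram} {ħ σ : ι → ℂ}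
  {Q : ι → ℕ → ℕ → ℂ[X]} {N : ι → ℕ → ℕ → ℂ} {q : ℕ → ℕ → ℂ[X]}

theorem tendsto_scaleConst (hνμ : ν ≤ μ)
    (hQ : ∀ i, IsQFamily μ (ħ i) (Q i)) (hdeg : ∀ i, (Q i 0 0).natDegree = μ.card)
    (hħ : ∀ i, ħ i ≠ 0) (hσ : ∀ i, σ i ≠ 0) (hħσ : Tendsto (fun i => ħ i / σ i) l (𝓝 0))
    (hN : ∀ i a s, N i a s ≠ 0) (hm : ∀ a s, (q a s).Monic)
    (hd : ∀ a s, (q a s).natDegree = boxCount ν.cells a s)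
    (hlim : ∀ a s, CoeffTendsto
      (fun i => normScale (σ i) (N i a s) (boxCount ν.cells a s) (Q i a s)) l (q a s))
    {a s : ℕ} (h : (a, s) ∈ ν) :
    Tendsto (fun i => scaleConst μ (ħ i) (σ i) (N i) (boxCount ν.cells) a s) l
      (𝓝 (hookC ν.cells a s)) ∧
    derivative (q a s) * q (a + 1) (s + 1) - q a s * derivative (q (a + 1) (s + 1)) =
      C (hookC ν.cells a s) * (q (a + 1) s * q a (s + 1)) := by
  set F : ι → ℕ → ℕ → ℂ[X] :=
    fun i a s => normScale (σ i) (N i a s) (boxCount ν.cells a s) (Q i a s) with hF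
  have hD : ∀ i a s, (F i a s).natDegree ≤ μ.card := fun i a s =>
    (natDegree_normScale_le _ _ _ _).trans (by
      rw [(hQ i).natDegree_eq (hdeg i), ← show boxCount μ.cells 0 0 = μ.card from
        boxCount_zero_zero _]
      exact boxCount_mono _ (Nat.zero_le _) (Nat.zero_le _))
  have hDq : ∀ a s, (q a s).natDegree ≤ μ.card := fun a s => (hlim a s).natDegree_le (hD · a s)
  have hW := (hlim a s).wronskian hħσ (fun i => div_ne_zero (hħ i) (hσ i))
    (hlim (a + 1) (s + 1)) (hD · a s) (hD · _ _) (hDq a s) (hDq _ _)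
  have hP := (hlim (a + 1) s).mul (hlim a (s + 1))
  have hrel := fun i => (hQ i).wronskian_normScale (hdeg i) (hσ i) (hN i) (boxCount ν.cells) (hνμ h)
  have hbox := boxCount_rec ν.cells a s
  rw [if_pos (show (a, s) ∈ ν.cells from h)] at hbox
  set m := boxCount ν.cells (a + 1) s + boxCount ν.cells a (s + 1) with hmdef
  have h1 := hW m
  have h2 := hP m
  have hone : (q (a + 1) s * q a (s + 1)).coeff m = 1 := by
    rw [coeff_mul_add_eq_of_natDegree_le (hd _ _).le (hd _ _).le, ← hd, ← hd]
    simp [(hm (a + 1) s).coeff_natDegree, (hm a (s + 1)).coeff_natDegree]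
  have htop : (derivative (q a s) * q (a + 1) (s + 1) -
      q a s * derivative (q (a + 1) (s + 1))).coeff m = hookC ν.cells a s := by
    rw [← coeff_X_mul, ← hbox]
    exact coeff_diffW_of_monic (hm _ _) (hm _ _) (hd _ _) (hd _ _)
  rw [htop] at h1
  rw [hone] at h2
  have hclim : Tendsto (fun i => scaleConst μ (ħ i) (σ i) (N i) (boxCount ν.cells) a s) l
      (𝓝 (hookC ν.cells a s)) := by
    have h3 := h1.div h2 one_ne_zero
    rw [div_one] at h3
    refine h3.congr' ?_
    filter_upwards [h2.eventually_ne one_ne_zero] with i hi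
    rw [Pi.div_apply, hrel, coeff_C_mul, mul_div_assoc, div_self hi, mul_one]
  exact ⟨hclim, hW.unique (((CoeffTendsto.C hclim).mul hP).congr'
    (Eventually.of_forall fun i => (hrel i).symm))⟩

/-- Limits of rescaled solutions of the Q-system solve the differential Q-system. -/
theorem isDifferentialQFamily_of_tendsto (hνμ : ν ≤ μ)
    (hQ : ∀ i, IsQFamily μ (ħ i) (Q i)) (hdeg : ∀ i, (Q i 0 0).natDegree = μ.card)
    (hħ : ∀ i, ħ i ≠ 0) (hσ : ∀ i, σ i ≠ 0) (hħσ : Tendsto (fun i => ħ i / σ i) l (𝓝 0))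
    (hN : ∀ i a s, N i a s ≠ 0) (hm : ∀ a s, (q a s).Monic)
    (hd : ∀ a s, (q a s).natDegree = boxCount ν.cells a s)
    (hlim : ∀ a s, CoeffTendsto
      (fun i => normScale (σ i) (N i a s) (boxCount ν.cells a s) (Q i a s)) l (q a s)) :
    IsDifferentialQFamily ν q :=
  ⟨hm, hd, fun _ _ h => (tendsto_scaleConst hνμ hQ hdeg hħ hσ hħσ hN hm hd hlim h).2⟩

end

/-- The limit of a rescaled product of linear factors. -/
theorem coeffTendsto_prod_X_sub_C {α : Type*} [DecidableEq α] (t : Finset α) (p : α → Prop)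
    [DecidablePred p] {σ : ι → ℂ} (hσ : ∀ i, σ i ≠ 0) {r : ι → α → ℂ} {x : α → ℂ}
    (hp : ∀ c ∈ t, p c → Tendsto (fun i => r i c / σ i) l (𝓝 (x c)))
    (hn : ∀ c ∈ t, ¬ p c → Tendsto (fun i => σ i / r i c) l (𝓝 0))
    (hr : ∀ c ∈ t, ∀ i, r i c ≠ 0) :
    CoeffTendsto (fun i => normScale (σ i) (∏ c ∈ t.filter (fun c => ¬ p c), -r i c)
      (t.filter p).card (∏ c ∈ t, (X - C (r i c)))) l (∏ c ∈ t.filter p, (X - C (x c))) := by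
  induction t using Finset.induction_on with
  | empty => simpa [normScale] using CoeffTendsto.const (1 : ℂ[X])
  | insert b t hb ih =>
    have ih' := ih (fun c hc => hp c (mem_insert_of_mem hc))
      (fun c hc => hn c (mem_insert_of_mem hc))
      (fun c hc => hr c (mem_insert_of_mem hc))
    simp only [prod_insert hb]
    by_cases hpb : p b
    · simp only [filter_insert, hpb, not_true_eq_false, if_true, if_false]
      rw [prod_insert (by simp [hb]), card_insert_of_notMem (by simp [hb]), add_comm]
      have h1 := hp b (mem_insert_self _ _) hpb
      have h2 : CoeffTendsto (fun i => normScale (σ i) 1 1 (X - C (r i b))) l (X - C (x b)) := by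
        refine ((CoeffTendsto.const X).sub (CoeffTendsto.C h1)).congr'
          (Eventually.of_forall fun i => ?_)
        simp only [normScale, sub_comp, X_comp, C_comp, one_mul, pow_one, mul_sub, ← mul_assoc,
          ← C_mul]
        rw [inv_mul_cancel₀ (hσ i), div_eq_inv_mul]
        simp
      refine (h2.mul ih').congr' (Eventually.of_forall fun i => ?_)
      rw [← normScale_mul, one_mul]
    · simp only [filter_insert, hpb, not_false_eq_true, if_true, if_false]
      rw [← zero_add (t.filter p).card]
      simp only [prod_insert (show b ∉ t.filter (fun c => ¬ p c) by simp [hb])]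
      have h1 := hn b (mem_insert_self _ _) hpb
      have h2 : CoeffTendsto (fun i => normScale (σ i) (-r i b) 0 (X - C (r i b))) l 1 := by
        have h3 : CoeffTendsto (fun i => 1 - C (σ i / r i b) * X) l (1 - C 0 * X) :=
          (CoeffTendsto.const 1).sub ((CoeffTendsto.C h1).mul (CoeffTendsto.const X))
        rw [C_0, zero_mul, sub_zero] at h3
        refine h3.congr' (Eventually.of_forall fun i => ?_)
        have hb0 := hr b (mem_insert_self _ _) i
        simp only [normScale, sub_comp, X_comp, C_comp, pow_zero, mul_one, mul_sub, ← mul_assoc,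
          ← C_mul]
        rw [show (-r i b)⁻¹ * r i b = -1 by field_simp,
          show (-r i b)⁻¹ * σ i = -(σ i / r i b) by field_simp]
        simp only [C_neg, C_1]
        ring
      rw [← one_mul (∏ c ∈ t.filter p, _)]
      refine (h2.mul ih').congr' (Eventually.of_forall fun i => ?_)
      rw [← normScale_mul]

end

/-! ### Tableaux as entry functions -/

/-- `e` numbers the boxes of `ν` from `0` on, increasingly along rows and columns. -/
structure IsTab (ν : Finset (ℕ × ℕ)) (e : ℕ × ℕ → ℕ) : Prop where
  lt : ∀ c ∈ ν, e c < ν.card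
  inj : ∀ c ∈ ν, ∀ d ∈ ν, e c = e d → c = d
  mono : ∀ c ∈ ν, ∀ d ∈ ν, c.1 ≤ d.1 → c.2 ≤ d.2 → c ≠ d → e c < e d

/-- The ratio between the roots at `(a, s)` and at the origin which belong to the box `c`. -/
noncomputable def tabRatio (ν : Finset (ℕ × ℕ)) (e : ℕ × ℕ → ℕ) (c : ℕ × ℕ) (a s : ℕ) : ℂ :=
  cornerRatio (ν.filter fun d => e d ≤ e c) c a s

/-- The product of the roots at `(a, s)` which belong to boxes with entries at least `j`, up
to sign. -/
noncomputable def tabTop (ν : Finset (ℕ × ℕ)) (e : ℕ × ℕ → ℕ) (θ : ℕ → ℂ) (j a s : ℕ) : ℂ :=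
  ∏ c ∈ ν.filter (fun c => a ≤ c.1 ∧ s ≤ c.2 ∧ j ≤ e c), -(θ (e c) * tabRatio ν e c a s)

/-- The number of boxes weakly below and to the right of `(a, s)` with entries less than `j`. -/
def tabCount (ν : Finset (ℕ × ℕ)) (e : ℕ × ℕ → ℕ) (j a s : ℕ) : ℕ :=
  boxCount (ν.filter fun c => e c < j) a s

theorem boxCount_erase {ν : Finset (ℕ × ℕ)} {c : ℕ × ℕ} (hc : c ∈ ν) (a s : ℕ) :
    boxCount ν a s = boxCount (ν.erase c) a s + if a ≤ c.1 ∧ s ≤ c.2 then 1 else 0 := by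
  unfold boxCount
  rw [filter_erase]
  split_ifs with h
  · rw [card_erase_add_one (mem_filter.2 ⟨hc, h⟩)]
  · rw [erase_eq_of_notMem, add_zero]
    exact fun h' => h (mem_filter.1 h').2

theorem exists_erase_corner {ν : YoungDiagram} {c : ℕ × ℕ} (h1 : (c.1 + 1, c.2) ∉ ν)
    (h2 : (c.1, c.2 + 1) ∉ ν) : ∃ ν' : YoungDiagram, ν'.cells = ν.cells.erase c := by
  refine ⟨⟨ν.cells.erase c, fun x y hyx hx => ?_⟩, rfl⟩
  rw [mem_coe, mem_erase] at hx ⊢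
  obtain ⟨hx1, hx2⟩ := hx
  refine ⟨?_, ν.isLowerSet hyx hx2⟩
  rintro rfl
  have hle := Prod.le_def.1 hyx
  rcases hle.1.lt_or_eq with h | h
  · exact h1 (ν.up_left_mem (show y.1 + 1 ≤ x.1 from h) hle.2 hx2)
  · rcases hle.2.lt_or_eq with h' | h'
    · exact h2 (ν.up_left_mem hle.1 (show y.2 + 1 ≤ x.2 from h') hx2)
    · exact hx1 (Prod.ext h h').symm

/-- Adding a box with the largest entry. -/
theorem IsTab.insert {ν : Finset (ℕ × ℕ)} {c : ℕ × ℕ} (hc : c ∈ ν)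
    (hcor : ∀ d ∈ ν, c.1 ≤ d.1 → c.2 ≤ d.2 → d = c) {e : ℕ × ℕ → ℕ} (he : IsTab (ν.erase c) e) :
    IsTab ν (Function.update e c (ν.card - 1)) := by
  have hcard := card_erase_add_one hc
  have hlt : ∀ d ∈ ν, d ≠ c → e d < ν.card - 1 := fun d hd hne => by
    have := he.lt d (mem_erase.2 ⟨hne, hd⟩); omega
  refine ⟨fun d hd => ?_, fun d hd d' hd' h => ?_, fun d hd d' hd' h1 h2 hne => ?_⟩
  · by_cases h : d = c
    · subst h; rw [Function.update_self]; omega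
    · rw [Function.update_of_ne h]; have := hlt d hd h; omega
  · by_cases h1 : d = c
    · by_cases h2 : d' = c
      · rw [h1, h2]
      · rw [h1, Function.update_self, Function.update_of_ne h2] at h
        have := hlt d' hd' h2; omega
    · by_cases h2 : d' = c
      · rw [h2, Function.update_self, Function.update_of_ne h1] at h
        have := hlt d hd h1; omega
      · rw [Function.update_of_ne h1, Function.update_of_ne h2] at h
        exact he.inj d (mem_erase.2 ⟨h1, hd⟩) d' (mem_erase.2 ⟨h2, hd'⟩) h
  · have h3 : d ≠ c := fun h => hne (by rw [h]; exact (hcor d' hd' (h ▸ h1) (h ▸ h2)).symm)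
    rw [Function.update_of_ne h3]
    by_cases h4 : d' = c
    · rw [h4, Function.update_self]; exact hlt d hd h3
    · rw [Function.update_of_ne h4]
      exact he.mono d (mem_erase.2 ⟨h3, hd⟩) d' (mem_erase.2 ⟨h4, hd'⟩) h1 h2 hne

section

variable {ν : Finset (ℕ × ℕ)} {c₀ : ℕ × ℕ} {e : ℕ × ℕ → ℕ}

theorem tabRatio_erase (htop : ∀ c ∈ ν, c ≠ c₀ → e c < e c₀) {c : ℕ × ℕ} (h : c ∈ ν)
    (hne : c ≠ c₀) (a s : ℕ) : tabRatio (ν.erase c₀) e c a s = tabRatio ν e c a s := by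
  unfold tabRatio
  rw [filter_erase, erase_eq_of_notMem]
  intro h'
  exact absurd (mem_filter.1 h').2 (not_le.2 (htop c h hne))

theorem tabRatio_top (htop : ∀ c ∈ ν, c ≠ c₀ → e c < e c₀) (a s : ℕ) :
    tabRatio ν e c₀ a s = cornerRatio ν c₀ a s := by
  unfold tabRatio
  rw [filter_true_of_mem]
  intro c hc
  by_cases h : c = c₀
  · rw [h]
  · exact (htop c hc h).le

theorem tabCount_erase {j : ℕ} (hj : j ≤ e c₀) (a s : ℕ) :
    tabCount (ν.erase c₀) e j a s = tabCount ν e j a s := by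
  unfold tabCount
  rw [filter_erase, erase_eq_of_notMem]
  intro h'
  exact absurd (mem_filter.1 h').2 (not_lt.2 hj)

theorem tabTop_erase (hc : c₀ ∈ ν) (htop : ∀ c ∈ ν, c ≠ c₀ → e c < e c₀) (θ : ℕ → ℂ) {j : ℕ}
    (hj : j ≤ e c₀) (a s : ℕ) :
    tabTop ν e θ j a s = tabTop (ν.erase c₀) e θ j a s *
      if a ≤ c₀.1 ∧ s ≤ c₀.2 then -(θ (e c₀) * cornerRatio ν c₀ a s) else 1 := by
  unfold tabTop
  rw [filter_erase]
  have h1 : ∀ c ∈ (ν.filter (fun c : ℕ × ℕ => a ≤ c.1 ∧ s ≤ c.2 ∧ j ≤ e c)).erase c₀,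
      -(θ (e c) * tabRatio (ν.erase c₀) e c a s) = -(θ (e c) * tabRatio ν e c a s) := by
    intro c hc'
    rw [mem_erase, mem_filter] at hc'
    rw [tabRatio_erase htop hc'.2.1 hc'.1]
  rw [prod_congr rfl h1]
  split_ifs with h
  · rw [prod_erase_mul _ _ (mem_filter.2 ⟨hc, h.1, h.2, hj⟩) |>.symm, tabRatio_top htop]
  · rw [erase_eq_of_notMem, mul_one]
    intro h'
    exact h ⟨(mem_filter.1 h').2.1, (mem_filter.1 h').2.2.1⟩

end

theorem tabTop_congr {ν : Finset (ℕ × ℕ)} {e e' : ℕ × ℕ → ℕ} (h : ∀ c ∈ ν, e c = e' c)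
    (θ : ℕ → ℂ) (j a s : ℕ) : tabTop ν e θ j a s = tabTop ν e' θ j a s := by
  unfold tabTop
  have h1 : ν.filter (fun c : ℕ × ℕ => a ≤ c.1 ∧ s ≤ c.2 ∧ j ≤ e c) =
      ν.filter (fun c : ℕ × ℕ => a ≤ c.1 ∧ s ≤ c.2 ∧ j ≤ e' c) :=
    filter_congr fun c hc => by rw [h c hc]
  rw [h1]
  refine prod_congr rfl fun c hc => ?_
  have hc' := (mem_filter.1 hc).1
  have h2 : ν.filter (fun d => e d ≤ e c) = ν.filter (fun d => e' d ≤ e' c) :=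
    filter_congr fun d hd => by rw [h d hd, h c hc']
  rw [tabRatio, tabRatio, h2, h c hc']

theorem tabCount_congr {ν : Finset (ℕ × ℕ)} {e e' : ℕ × ℕ → ℕ} (h : ∀ c ∈ ν, e c = e' c)
    (j a s : ℕ) : tabCount ν e j a s = tabCount ν e' j a s := by
  unfold tabCount
  rw [filter_congr fun c hc => by rw [h c hc]]

/-! ### Separated sequences of inhomogeneities -/

section

open Filter Topology

variable {ι : Type*}

/-- Sequences of inhomogeneities whose ratios tend to infinity. -/
structure SeparatedSeq (L : ℕ) (l : Filter ι) (ħ : ι → ℂ) (θ : ι → ℕ → ℂ) : Prop where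
  ħ_ne : ∀ i, ħ i ≠ 0
  θ_ne : ∀ i j, θ i j ≠ 0
  sep : ∀ j k, j < k → k < L → Tendsto (fun i => θ i j / θ i k) l (𝓝 0)
  ħ_le : 0 < L → ∃ B : ℝ, ∀ i, ‖ħ i / θ i 0‖ ≤ B

theorem tendsto_zero_of_norm_le {l : Filter ι} {u v : ι → ℂ} {B : ℝ} (hu : ∀ i, ‖u i‖ ≤ B)
    (hv : Tendsto v l (𝓝 0)) : Tendsto (fun i => u i * v i) l (𝓝 0) := by
  rw [tendsto_zero_iff_norm_tendsto_zero] at hv ⊢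
  have h := hv.const_mul B
  rw [mul_zero] at h
  refine squeeze_zero (fun i => norm_nonneg _) (fun i => ?_) h
  rw [norm_mul]
  exact mul_le_mul_of_nonneg_right (hu i) (norm_nonneg _)

theorem SeparatedSeq.ħ_sep {L : ℕ} {l : Filter ι} {ħ : ι → ℂ} {θ : ι → ℕ → ℂ}
    (h : SeparatedSeq L l ħ θ) (j : ℕ) (hj : 0 < j) (hjL : j < L) :
    Tendsto (fun i => ħ i / θ i j) l (𝓝 0) := by
  obtain ⟨B, hB⟩ := h.ħ_le (by omega)
  refine (tendsto_zero_of_norm_le hB (h.sep 0 j hj hjL)).congr fun i => ?_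
  rw [div_mul_div_cancel₀ (h.θ_ne i 0)]

theorem exists_tendsto_of_eventually_norm_le (l : Ultrafilter ι) {u : ι → ℂ} {B : ℝ}
    (h : ∀ᶠ i in (l : Filter ι), ‖u i‖ ≤ B) : ∃ x, Tendsto u l (𝓝 x) := by
  have hK := (isCompact_closedBall (0 : ℂ) B).ultrafilter_le_nhds (l.map u) (by
    rw [le_principal_iff, Ultrafilter.mem_coe, Ultrafilter.mem_map]
    filter_upwards [h] with i hi
    simpa using hi)
  obtain ⟨x, _, hx⟩ := hK
  exact ⟨x, hx⟩

theorem exists_eventually_of_finset (l : Ultrafilter ι) {α : Type*} (J : Finset α)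
    {p : α → ι → Prop} (h : ∀ᶠ i in (l : Filter ι), ∃ x ∈ J, p x i) :
    ∃ x ∈ J, ∀ᶠ i in (l : Filter ι), p x i := by
  by_contra! hc
  have : ∀ᶠ i in (l : Filter ι), ∀ x ∈ J, ¬ p x i := by
    rw [Filter.eventually_all_finset]
    exact hc
  obtain ⟨i, ⟨x, hx, h1⟩, h2⟩ := (h.and this).exists
  exact h2 x hx h1

theorem exists_radius {α : Type*} (J : Finset α) {x : α → ℝ} {n : α → ℕ}
    (hn : ∀ j ∈ J, 0 < n j) {σ : ℝ} (hσ : 0 < σ) :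
    ∃ ρ, σ ≤ ρ ∧ (∀ j ∈ J, x j ≤ ρ ^ n j) ∧ (ρ = σ ∨ ∃ j ∈ J, x j = ρ ^ n j) := by
  classical
  induction J using Finset.induction_on with
  | empty => exact ⟨σ, le_rfl, by simp, Or.inl rfl⟩
  | insert b J hb ih =>
    obtain ⟨ρ, h1, h2, h3⟩ := ih fun j hj => hn j (mem_insert_of_mem hj)
    by_cases h : x b ≤ ρ ^ n b
    · refine ⟨ρ, h1, fun j hj => ?_, ?_⟩
      · rcases mem_insert.1 hj with rfl | hj
        · exact h
        · exact h2 j hj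
      · rcases h3 with h3 | ⟨j, hj, h3⟩
        · exact Or.inl h3
        · exact Or.inr ⟨j, mem_insert_of_mem hj, h3⟩
    · have hρ : 0 < ρ := hσ.trans_le h1
      have hb0 := hn b (mem_insert_self _ _)
      have hx : 0 ≤ x b := (pow_pos hρ _).le.trans (not_le.1 h).le
      have hr : (x b ^ ((n b : ℝ)⁻¹)) ^ n b = x b := Real.rpow_inv_natCast_pow hx hb0.ne'
      have hlt : ρ ≤ x b ^ ((n b : ℝ)⁻¹) := by
        by_contra! hlt
        exact h (hr ▸ pow_le_pow_left₀ (Real.rpow_nonneg hx _) hlt.le _)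
      refine ⟨x b ^ ((n b : ℝ)⁻¹), h1.trans hlt, fun j hj => ?_,
        Or.inr ⟨b, mem_insert_self _ _, hr.symm⟩⟩
      rcases mem_insert.1 hj with rfl | hj
      · exact hr.ge
      · exact (h2 j hj).trans (pow_le_pow_left₀ hρ.le hlt _)

/-- Passing to a smaller scale kills the higher coefficients. -/
theorem tendsto_coeff_normScale {l : Filter ι} {σ τ : ι → ℂ} (hσ : ∀ i, σ i ≠ 0) (hτ : ∀ i, τ i ≠ 0)
    (h : Tendsto (fun i => σ i / τ i) l (𝓝 0)) {N : ι → ℂ} {d : ℕ} {f : ι → ℂ[X]} {g : ℂ[X]}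
    (hf : CoeffTendsto (fun i => normScale (τ i) (N i) d (f i)) l g) {k : ℕ} (hk : d ≤ k) :
    Tendsto (fun i => (normScale (σ i) (N i) d (f i)).coeff k) l
      (𝓝 (if k = d then g.coeff d else 0)) := by
  have h1 := (hf k).mul (h.pow (k - d))
  have h2 : g.coeff k * 0 ^ (k - d) = if k = d then g.coeff d else 0 := by
    split_ifs with hkd
    · subst hkd; simp
    · rw [zero_pow (by omega), mul_zero]
  rw [h2] at h1
  refine h1.congr fun i => ?_
  have e1 := pow_ne_zero d (hσ i)
  have e2 := pow_ne_zero d (hτ i)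
  have e3 := pow_ne_zero (k - d) (hτ i)
  simp only [coeff_normScale, div_pow]
  obtain ⟨m, rfl⟩ := Nat.exists_eq_add_of_le hk
  rw [Nat.add_sub_cancel_left] at e3 ⊢
  rw [pow_add, pow_add]
  by_cases hN : N i = 0
  · simp [hN]
  · field_simp

theorem tendsto_div_of_norm_le {l : Filter ι} {u v w : ι → ℂ}
    (h : Tendsto (fun i => u i / v i) l (𝓝 0)) (hw : ∀ᶠ i in l, ‖v i‖ ≤ ‖w i‖)
    (hv : ∀ i, v i ≠ 0) : Tendsto (fun i => u i / w i) l (𝓝 0) := by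
  rw [tendsto_zero_iff_norm_tendsto_zero] at h ⊢
  refine squeeze_zero' (Eventually.of_forall fun i => norm_nonneg _) ?_ h
  filter_upwards [hw] with i hi
  rw [norm_div, norm_div]
  exact div_le_div_of_nonneg_left (norm_nonneg _) (norm_pos_iff.2 (hv i)) hi

end

section

open Filter Topology

variable {ι : Type*}

theorem rectangle_of_card_eq_one {ν : YoungDiagram} (h : ν.card = 1) (a s : ℕ) :
    (a, s) ∈ ν ↔ a = 0 ∧ s = 0 := by
  obtain ⟨c, hc⟩ := card_eq_one.1 (show ν.cells.card = 1 from h)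
  have h1 : ∀ d, d ∈ ν ↔ d = c := fun d => by
    rw [← mem_cells, hc, mem_singleton]
  have h0 : (0, 0) ∈ ν := ν.up_left_mem (Nat.zero_le c.1) (Nat.zero_le c.2) ((h1 c).2 rfl)
  rw [h1, ← (h1 _).1 h0, Prod.mk.injEq]

/-- At the scale of the source term of the family. -/
theorem tendsto_normScale_source {L : ℕ} {l : Filter ι} [l.NeBot] {θ : ι → ℕ → ℂ}
    (hθ : ∀ i j, θ i j ≠ 0) {f : ι → ℂ[X]} (hfd : ∀ i, (f i).natDegree ≤ L)
    (hsrc : ∀ k ≤ L, Tendsto (fun i => (f i).coeff k /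
      (∏ j ∈ range L, (X - C (θ i j))).coeff k) l (𝓝 1))
    {n : ℕ} (hn : n < L) {σ : ι → ℂ} (hσ : ∀ i, σ i ≠ 0) {t : ℂ}
    (h1 : ∀ j < n, Tendsto (fun i => θ i j / σ i) l (𝓝 0))
    (h2 : Tendsto (fun i => θ i n / σ i) l (𝓝 t))
    (h3 : ∀ j, n < j → j < L → Tendsto (fun i => σ i / θ i j) l (𝓝 0)) :
    CoeffTendsto (fun i => normScale (σ i) (∏ j ∈ Finset.Ico (n + 1) L, -θ i j) (n + 1) (f i)) l
      (X ^ n * (X - C t)) := by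
  have h := coeffTendsto_prod_X_sub_C (range L) (fun j => j ≤ n) hσ (r := θ)
    (x := fun j => if j = n then t else 0) (l := l)
    (fun j _ hj => by
      rcases hj.lt_or_eq with hj | rfl
      · simpa [hj.ne] using h1 j hj
      · simpa using h2)
    (fun j hj hjn => h3 j (not_le.1 hjn) (mem_range.1 hj)) (fun j _ i => hθ i j)
  have e1 : (range L).filter (fun j => ¬ j ≤ n) = Finset.Ico (n + 1) L := by
    ext j; simp only [mem_filter, mem_range, mem_Ico]; omega
  have e2 : (range L).filter (fun j => j ≤ n) = range (n + 1) := by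
    ext j; simp only [mem_filter, mem_range]; omega
  rw [e1, e2, card_range, prod_range_succ, prod_congr rfl (g := fun _ => (X : ℂ[X])) fun j hj => by
      rw [if_neg (mem_range.1 hj).ne, C_0, sub_zero]] at h
  simp only [if_true, prod_const, card_range] at h
  intro k
  by_cases hk : k ≤ L
  · have h4 := (h k).mul (hsrc k hk)
    rw [mul_one] at h4
    refine h4.congr' ?_
    filter_upwards [(hsrc k hk).eventually_ne one_ne_zero] with i hi
    have hne : (∏ j ∈ range L, (X - C (θ i j))).coeff k ≠ 0 := fun h0 => hi (by
      rw [h0, div_zero])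
    simp only [coeff_normScale]
    field_simp
  · have h5 : (X ^ n * (X - C t)).coeff k = 0 := by
      refine coeff_eq_zero_of_natDegree_lt (natDegree_mul_le.trans_lt ?_)
      rw [natDegree_X_pow, natDegree_X_sub_C]; omega
    rw [h5]
    simp only [coeff_normScale, coeff_eq_zero_of_natDegree_lt ((hfd _).trans_lt (not_le.1 hk)),
      zero_mul, zero_div]
    exact tendsto_const_nhds

theorem normScale_X_pow_mul_X_sub_C {t : ℂ} (ht : t ≠ 0) (d : ℕ) (r : ℂ) :
    normScale t 1 (d + 1) (X ^ d * (X - C (t * r))) = X ^ d * (X - C r) := by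
  have e1 : C t⁻¹ * C t = 1 := by rw [← C_mul, inv_mul_cancel₀ ht, C_1]
  rw [← one_mul (1 : ℂ), normScale_mul]
  congr 1
  · simp only [normScale, X_pow_comp, mul_pow, one_mul, ← C_pow, ← mul_assoc, ← C_mul]
    rw [inv_mul_cancel₀ (pow_ne_zero d ht)]; simp
  · simp only [normScale, sub_comp, mul_comp, X_comp, C_comp, one_mul, pow_one, C_mul]
    linear_combination (X - C r) * e1

theorem normScale_X_pow {t : ℂ} (ht : t ≠ 0) (d : ℕ) : normScale t 1 d (X ^ d) = X ^ d := by
  simp only [normScale, X_pow_comp, mul_pow, one_mul, ← C_pow, ← mul_assoc, ← C_mul]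
  rw [inv_mul_cancel₀ (pow_ne_zero d ht)]; simp

/-- At the scale of the largest inhomogeneity which has not been split off yet, a corner is
singled out. -/
theorem exists_corner_of_scale {l : Ultrafilter ι} {μ ν : YoungDiagram} (hνμ : ν ≤ μ) {n : ℕ}
    (hn : ν.card = n + 1) {ħ : ι → ℂ} {θ : ι → ℕ → ℂ} (hsep : SeparatedSeq μ.card l ħ θ)
    {Q : ι → ℕ → ℕ → ℂ[X]} (hQ : ∀ i, IsQFamily μ (ħ i) (Q i))
    (hdeg : ∀ i, (Q i 0 0).natDegree = μ.card)
    (hsrc : ∀ k ≤ μ.card, Tendsto (fun i => (Q i 0 0).coeff k /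
      (∏ j ∈ range μ.card, (X - C (θ i j))).coeff k) l (𝓝 1))
    {N : ι → ℕ → ℕ → ℂ} (hN : ∀ i a s, N i a s ≠ 0)
    (hN0 : ∀ i, N i 0 0 = ∏ j ∈ Finset.Ico (n + 1) μ.card, -θ i j)
    {τ : ι → ℂ} (hτ : ∀ i, τ i ≠ 0) (hθτ : Tendsto (fun i => θ i n / τ i) l (𝓝 0))
    (hτθ : ∀ j, n < j → j < μ.card → ∃ x, Tendsto (fun i => τ i / θ i j) l (𝓝 x))
    (hlim : ∀ a s, ∃ g : ℂ[X], CoeffTendsto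
      (fun i => normScale (τ i) (N i a s) (boxCount ν.cells a s) (Q i a s)) l g ∧
      (∀ k < boxCount ν.cells a s, g.coeff k = 0) ∧ g.coeff (boxCount ν.cells a s) = 1) :
    ∃ c₀ ∈ ν, (c₀.1 + 1, c₀.2) ∉ ν ∧ (c₀.1, c₀.2 + 1) ∉ ν ∧ ∀ a s, CoeffTendsto
      (fun i => normScale (θ i n) (N i a s) (boxCount ν.cells a s) (Q i a s)) l
      (if a ≤ c₀.1 ∧ s ≤ c₀.2 then
        X ^ (boxCount ν.cells a s - 1) * (X - C (cornerRatio ν.cells c₀ a s))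
        else X ^ boxCount ν.cells a s) := by
  have hcardle : ν.card ≤ μ.card := card_le_card (cells_subset_iff.2 hνμ)
  have hnL : n < μ.card := by omega
  have hθ0 : ∀ i, θ i n ≠ 0 := fun i => hsep.θ_ne i n
  have hdegle : ∀ i, (Q i 0 0).natDegree ≤ μ.card := fun i => (hdeg i).le
  have hup : ∀ {σ : ι → ℂ}, (∀ i, σ i ≠ 0) → Tendsto (fun i => σ i / τ i) l (𝓝 0) →
      ∀ a s k, boxCount ν.cells a s ≤ k → Tendsto
        (fun i => (normScale (σ i) (N i a s) (boxCount ν.cells a s) (Q i a s)).coeff k) l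
        (𝓝 (if k = boxCount ν.cells a s then 1 else 0)) := by
    intro σ hσ hστ a s k hk
    obtain ⟨g, hg, _, hg1⟩ := hlim a s
    rw [← hg1]
    exact tendsto_coeff_normScale hσ hτ hστ hg hk
  have hsource : ∀ {σ : ι → ℂ} {t : ℂ}, (∀ i, σ i ≠ 0) → Tendsto (fun i => θ i n / σ i) l (𝓝 t) →
      (∀ j < n, Tendsto (fun i => θ i j / σ i) l (𝓝 0)) →
      (∀ j, n < j → j < μ.card → Tendsto (fun i => σ i / θ i j) l (𝓝 0)) →
      CoeffTendsto (fun i => normScale (σ i) (N i 0 0) (boxCount ν.cells 0 0) (Q i 0 0)) l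
        (X ^ n * (X - C t)) := by
    intro σ t hσ h2 h1 h3
    have := tendsto_normScale_source hsep.θ_ne hdegle hsrc hnL hσ h1 h2 h3
    simp only [hN0, boxCount_zero_zero]
    rw [show ν.cells.card = n + 1 from hn]
    exact this
  rcases Nat.eq_zero_or_pos n with rfl | hnpos
  · -- a single box
    have hmem := rectangle_of_card_eq_one hn
    refine ⟨(0, 0), (hmem 0 0).2 ⟨rfl, rfl⟩, fun h => by simp at *; have := (hmem 1 0).1 h; omega,
      fun h => by simp at *; have := (hmem 0 1).1 h; omega, fun a s => ?_⟩
    by_cases has : a = 0 ∧ s = 0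
    · obtain ⟨rfl, rfl⟩ := has
      rw [if_pos ⟨le_rfl, le_rfl⟩, cornerRatio_zero]
      have h1 := hsource (t := 1) hθ0 (by simp only [div_self (hθ0 _)]; exact tendsto_const_nhds)
        (fun j hj => absurd hj (Nat.not_lt_zero j)) (fun j h1 h2 => hsep.sep _ _ h1 h2)
      convert h1 using 3
      rw [boxCount_zero_zero, show ν.cells.card = 1 from hn]
    · rw [if_neg (by simpa using has)]
      have h0 : boxCount ν.cells a s = 0 := boxCount_eq_zero fun h => has ((hmem a s).1 h)
      intro k
      have h1 := hup hθ0 hθτ a s k (by omega)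
      rwa [← coeff_X_pow] at h1
  · set J : Finset ((ℕ × ℕ) × ℕ) := (ν.cells ×ˢ range (n + 1)).filter
      (fun j => j.2 < boxCount ν.cells j.1.1 j.1.2) with hJ
    set x : ι → (ℕ × ℕ) × ℕ → ℝ :=
      fun i j => ‖(Q i j.1.1 j.1.2).coeff j.2 / N i j.1.1 j.1.2‖ with hx
    set m : (ℕ × ℕ) × ℕ → ℕ := fun j => boxCount ν.cells j.1.1 j.1.2 - j.2 with hm
    have hmpos : ∀ j ∈ J, 0 < m j := fun j hj => by
      have := (mem_filter.1 hj).2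
      simp only [hm]; omega
    choose ρ hρ1 hρ2 hρ3 using fun i =>
      exists_radius J (x := x i) hmpos (norm_pos_iff.2 (hθ0 i))
    have hρ : ∀ i, 0 < ρ i := fun i => (norm_pos_iff.2 (hθ0 i)).trans_le (hρ1 i)
    set σ : ι → ℂ := fun i => (ρ i : ℂ) with hσdef
    have hσ : ∀ i, σ i ≠ 0 := fun i => Complex.ofReal_ne_zero.2 (hρ i).ne'
    have hσn : ∀ i, ‖σ i‖ = ρ i := fun i => by
      rw [hσdef]; simp [abs_of_pos (hρ i)]
    have hcoef : ∀ (ω : ι → ℂ), (∀ i, ω i ≠ 0) → ∀ j ∈ J, ∀ i,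
        ‖(normScale (ω i) (N i j.1.1 j.1.2) (boxCount ν.cells j.1.1 j.1.2)
          (Q i j.1.1 j.1.2)).coeff j.2‖ = x i j / ‖ω i‖ ^ m j := by
      intro ω hω j hj i
      have h1 := (mem_filter.1 hj).2
      have h2 := norm_ne_zero_iff.2 (hω i)
      have h3 := norm_ne_zero_iff.2 (hN i j.1.1 j.1.2)
      obtain ⟨p, hp⟩ := Nat.exists_eq_add_of_lt h1
      simp only [coeff_normScale, hx, hm, norm_div, norm_mul, norm_pow]
      rw [hp, show j.2 + p + 1 - j.2 = p + 1 by omega, show j.2 + p + 1 = j.2 + (p + 1) by omega,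
        pow_add]
      field_simp
    have hcases : (∀ᶠ i in (l : Filter ι), ρ i = ‖θ i n‖) ∨
        ∃ j ∈ J, ∀ᶠ i in (l : Filter ι), x i j = ρ i ^ m j := by
      rcases Ultrafilter.eventually_or.1 (Eventually.of_forall (f := (l : Filter ι)) hρ3) with h | h
      · exact Or.inl h
      · exact Or.inr (exists_eventually_of_finset l J h)
    have hστ : Tendsto (fun i => σ i / τ i) l (𝓝 0) := by
      rw [tendsto_zero_iff_norm_tendsto_zero]
      rcases hcases with h | ⟨j, hj, h⟩
      · rw [tendsto_zero_iff_norm_tendsto_zero] at hθτ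
        refine hθτ.congr' ?_
        filter_upwards [h] with i hi
        rw [norm_div, norm_div, hσn, hi]
      · obtain ⟨g, hg, hg0, _⟩ := hlim j.1.1 j.1.2
        have h1 := (hg j.2).norm
        rw [hg0 _ (mem_filter.1 hj).2, norm_zero] at h1
        simp only [hcoef τ hτ j hj] at h1
        have h2 := h1.rpow_const (p := ((m j : ℝ)⁻¹)) (Or.inr (by positivity))
        rw [Real.zero_rpow (inv_ne_zero (Nat.cast_ne_zero.2 (hmpos j hj).ne'))] at h2
        refine h2.congr' ?_
        filter_upwards [h] with i hi
        rw [hi, ← div_pow, Real.pow_rpow_inv_natCast (div_nonneg (hρ i).le (norm_nonneg _))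
          (hmpos j hj).ne', norm_div, hσn]
    have hnσ : ∀ᶠ i in (l : Filter ι), ‖θ i n‖ ≤ ‖σ i‖ := Eventually.of_forall fun i => by
      rw [hσn]; exact hρ1 i
    obtain ⟨t, ht⟩ := exists_tendsto_of_eventually_norm_le l (u := fun i => θ i n / σ i) (B := 1) (by
      filter_upwards [hnσ] with i hi
      rw [norm_div]
      exact div_le_one_of_le₀ hi (norm_nonneg _))
    have hex : ∀ a s k, ∃ y : ℂ, Tendsto
        (fun i => (normScale (σ i) (N i a s) (boxCount ν.cells a s) (Q i a s)).coeff k) l (𝓝 y) ∧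
        (boxCount ν.cells a s ≤ k → y = if k = boxCount ν.cells a s then 1 else 0) := by
      intro a s k
      by_cases hk : boxCount ν.cells a s ≤ k
      · exact ⟨_, hup hσ hστ a s k hk, fun _ => rfl⟩
      · have has : (a, s) ∈ ν := by
          by_contra h; rw [boxCount_eq_zero h] at hk; omega
        have hle : boxCount ν.cells a s ≤ n + 1 := by
          rw [← hn]
          exact card_filter_le _ _
        have hj : ((a, s), k) ∈ J := mem_filter.2 ⟨mem_product.2
          ⟨has, mem_range.2 (by omega)⟩, not_le.1 hk⟩
        obtain ⟨y, hy⟩ := exists_tendsto_of_eventually_norm_le l (B := 1)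
          (u := fun i => (normScale (σ i) (N i a s) (boxCount ν.cells a s) (Q i a s)).coeff k)
          (Eventually.of_forall fun i => by
            have h1 := hcoef σ hσ _ hj i
            simp only at h1
            rw [h1, hσn]
            exact div_le_one_of_le₀ (hρ2 i _ hj) (pow_nonneg (hρ i).le _))
        exact ⟨y, hy, fun h => absurd h hk⟩
    choose y hy hytop using hex
    set q : ℕ → ℕ → ℂ[X] := fun a s =>
      ∑ k ∈ range (boxCount ν.cells a s + 1), C (y a s k) * X ^ k with hq
    have hqc : ∀ a s k, (q a s).coeff k = y a s k := by
      intro a s k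
      simp only [hq, finsetSum_coeff, coeff_C_mul_X_pow, sum_ite_eq, mem_range]
      split_ifs with h
      · rfl
      · rw [hytop a s k (by omega), if_neg (by omega)]
    have hqlim : ∀ a s, CoeffTendsto
        (fun i => normScale (σ i) (N i a s) (boxCount ν.cells a s) (Q i a s)) l (q a s) :=
      fun a s k => by rw [hqc]; exact hy a s k
    have hqd : ∀ a s, (q a s).natDegree ≤ boxCount ν.cells a s := fun a s => by
      rw [natDegree_le_iff_coeff_eq_zero]
      intro k hk
      rw [hqc, hytop a s k hk.le, if_neg hk.ne']
    have hq1 : ∀ a s, (q a s).coeff (boxCount ν.cells a s) = 1 := fun a s => by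
      rw [hqc, hytop a s _ le_rfl, if_pos rfl]
    have hqm : ∀ a s, (q a s).Monic := fun a s => monic_of_natDegree_le_of_coeff_eq_one _
      (hqd a s) (hq1 a s)
    have hqd' : ∀ a s, (q a s).natDegree = boxCount ν.cells a s := fun a s =>
      le_antisymm (hqd a s) (le_natDegree_of_ne_zero (by rw [hq1]; exact one_ne_zero))
    have hfam := isDifferentialQFamily_of_tendsto hνμ hQ hdeg hsep.ħ_ne hσ
      (tendsto_div_of_norm_le (hsep.ħ_sep n hnpos hnL) hnσ hθ0) hN hqm hqd' hqlim
    have hq00 : q 0 0 = X ^ n * (X - C t) := by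
      refine (hqlim 0 0).unique (hsource hσ ht
        (fun j hj => tendsto_div_of_norm_le (hsep.sep j n hj hnL) hnσ hθ0) fun j h1 h2 => ?_)
      obtain ⟨z, hz⟩ := hτθ j h1 h2
      have h3 := hστ.mul hz
      rw [zero_mul] at h3
      refine h3.congr fun i => ?_
      rw [div_mul_div_cancel₀ (hτ i)]
    have ht0 : t ≠ 0 := by
      rintro rfl
      have hX := hfam.eq_X_pow_of_source (by rw [hq00, C_0, sub_zero, ← pow_succ, hn])
      rcases hcases with h | ⟨j, hj, h⟩
      · have h1 := ht.norm
        rw [norm_zero] at h1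
        refine zero_ne_one (tendsto_nhds_unique h1 (tendsto_const_nhds.congr' ?_))
        filter_upwards [h] with i hi
        rw [norm_div, hσn, hi, div_self (norm_ne_zero_iff.2 (hθ0 i))]
      · have h1 := (hqlim j.1.1 j.1.2 j.2).norm
        rw [hX, coeff_X_pow, if_neg (mem_filter.1 hj).2.ne, norm_zero] at h1
        refine zero_ne_one (tendsto_nhds_unique h1 (tendsto_const_nhds.congr' ?_))
        filter_upwards [h] with i hi
        rw [hcoef σ hσ j hj, hσn, hi, div_self (pow_ne_zero _ (hρ i).ne')]
    obtain ⟨c₀, hc₀, h1, h2, h3⟩ := hfam.exists_corner ht0 (by rw [hq00, hn, Nat.add_sub_cancel])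
    refine ⟨c₀, hc₀, h1, h2, fun a s => ?_⟩
    have h4 := (hqlim a s).normScale ht ht0 (boxCount ν.cells a s)
    simp only [normScale_normScale (hσ _)] at h4
    convert h4 using 1
    rw [h3]
    split_ifs with h
    · obtain ⟨d, hd⟩ := Nat.exists_eq_add_of_lt (boxCount_pos (ν.up_left_mem h.1 h.2 hc₀))
      rw [zero_add] at hd
      rw [hd, Nat.add_sub_cancel, normScale_X_pow_mul_X_sub_C ht0]
    · rw [normScale_X_pow ht0]

end

section

open Filter Topology

variable {ι : Type*}

theorem tabCount_card {ν : Finset (ℕ × ℕ)} {e : ℕ × ℕ → ℕ} (he : IsTab ν e) (a s : ℕ) :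
    tabCount ν e ν.card a s = boxCount ν a s := by
  rw [tabCount, filter_true_of_mem he.lt]

theorem tabTop_card {ν : Finset (ℕ × ℕ)} {e : ℕ × ℕ → ℕ} (he : IsTab ν e) (θ : ℕ → ℂ) (a s : ℕ) :
    tabTop ν e θ ν.card a s = 1 := by
  rw [tabTop, filter_false_of_mem, prod_empty]
  rintro c hc ⟨-, -, h⟩
  exact absurd (he.lt c hc) (not_lt.2 h)

theorem exists_tab_of_scale {l : Ultrafilter ι} {ħ : ι → ℂ} {θ : ι → ℕ → ℂ}
    (hsep : SeparatedSeq μ.card l ħ θ)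
    {Q : ι → ℕ → ℕ → ℂ[X]} (hQ : ∀ i, IsQFamily μ (ħ i) (Q i))
    (hdeg : ∀ i, (Q i 0 0).natDegree = μ.card)
    (hsrc : ∀ k ≤ μ.card, Tendsto (fun i => (Q i 0 0).coeff k /
      (∏ j ∈ range μ.card, (X - C (θ i j))).coeff k) l (𝓝 1)) (n : ℕ) :
    ∀ {ν : YoungDiagram}, ν ≤ μ → ν.card = n →
    ∀ {N : ι → ℕ → ℕ → ℂ}, (∀ i a s, N i a s ≠ 0) →
    (∀ i, N i 0 0 = ∏ j ∈ Finset.Ico n μ.card, -θ i j) →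
    ∀ {τ : ι → ℂ}, (∀ i, τ i ≠ 0) → (∀ j < n, Tendsto (fun i => θ i j / τ i) l (𝓝 0)) →
    (∀ j, n ≤ j → j < μ.card → ∃ x, Tendsto (fun i => τ i / θ i j) l (𝓝 x)) →
    (∀ a s, ∃ g : ℂ[X], CoeffTendsto
      (fun i => normScale (τ i) (N i a s) (boxCount ν.cells a s) (Q i a s)) l g ∧
      (∀ k < boxCount ν.cells a s, g.coeff k = 0) ∧ g.coeff (boxCount ν.cells a s) = 1) →
    ∃ e, IsTab ν.cells e ∧ ∀ a s, ∀ j ≤ n, Tendsto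
      (fun i => (Q i a s).coeff (tabCount ν.cells e j a s) /
        (N i a s * tabTop ν.cells e (θ i) j a s)) l (𝓝 1) := by
  have htop : ∀ {ν : YoungDiagram} {N : ι → ℕ → ℕ → ℂ} {τ : ι → ℂ}, (∀ i, τ i ≠ 0) →
      (∀ a s, ∃ g : ℂ[X], CoeffTendsto
      (fun i => normScale (τ i) (N i a s) (boxCount ν.cells a s) (Q i a s)) l g ∧
      (∀ k < boxCount ν.cells a s, g.coeff k = 0) ∧ g.coeff (boxCount ν.cells a s) = 1) →
      ∀ {e}, IsTab ν.cells e → ∀ a s, Tendsto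
        (fun i => (Q i a s).coeff (tabCount ν.cells e ν.card a s) /
          (N i a s * tabTop ν.cells e (θ i) ν.card a s)) l (𝓝 1) := by
    intro ν N τ hτ hlim e he a s
    obtain ⟨g, hg, _, hg1⟩ := hlim a s
    have h1 := hg (boxCount ν.cells a s)
    rw [hg1] at h1
    refine h1.congr fun i => ?_
    have h2 := tabTop_card he (θ i) a s
    have h3 := tabCount_card he a s
    rw [show ν.cells.card = ν.card from rfl] at h2 h3
    rw [h2, h3, coeff_normScale, mul_one, mul_div_mul_right _ _ (pow_ne_zero _ (hτ i))]
  induction n with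
  | zero =>
    intro ν hνμ hn N hN hN0 τ hτ hθτ hτθ hlim
    have hempty : ν.cells = ∅ := card_eq_zero.1 hn
    have he : IsTab ν.cells (fun _ => 0) := by
      rw [hempty]; exact ⟨by simp, by simp, by simp⟩
    refine ⟨fun _ => 0, he, fun a s j hj => ?_⟩
    have := htop hτ hlim he a s
    rw [hn] at this
    rwa [Nat.le_zero.1 hj]
  | succ n ih =>
    intro ν hνμ hn N hN hN0 τ hτ hθτ hτθ hlim
    have hcardle : ν.card ≤ μ.card := card_le_card (cells_subset_iff.2 hνμ)
    have hnL : n < μ.card := by omega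
    obtain ⟨c₀, hc₀, hc1, hc2, hc3⟩ := exists_corner_of_scale hνμ hn hsep hQ hdeg hsrc hN hN0 hτ
      (hθτ n (Nat.lt_succ_self n)) (fun j h1 h2 => hτθ j h1 h2) hlim
    obtain ⟨ν', hν'⟩ := exists_erase_corner hc1 hc2
    have hcor : ∀ d ∈ ν.cells, c₀.1 ≤ d.1 → c₀.2 ≤ d.2 → d = c₀ := by
      intro d hd h1 h2
      rcases h1.lt_or_eq with h | h
      · exact absurd (ν.up_left_mem (show c₀.1 + 1 ≤ d.1 from h) h2 hd) hc1
      · rcases h2.lt_or_eq with h' | h'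
        · exact absurd (ν.up_left_mem h1 (show c₀.2 + 1 ≤ d.2 from h') hd) hc2
        · exact Prod.ext h.symm h'.symm
    have hcard' : ν'.card = n := by
      have : ν'.cells.card = n := by
        rw [hν', card_erase_of_mem hc₀, show ν.cells.card = ν.card from rfl, hn]; rfl
      exact this
    have hν'μ : ν' ≤ μ := by
      rw [← cells_subset_iff, hν']
      exact (erase_subset _ _).trans (cells_subset_iff.2 hνμ)
    have hR : ∀ a s, a ≤ c₀.1 → s ≤ c₀.2 → cornerRatio ν.cells c₀ a s ≠ 0 := fun a s =>
      cornerRatio_ne_zero fun a s ha hs => ν.up_left_mem ha hs hc₀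
    set r : ι → ℕ → ℕ → ℂ := fun i a s =>
      if a ≤ c₀.1 ∧ s ≤ c₀.2 then -(θ i n * cornerRatio ν.cells c₀ a s) else 1 with hr
    have hr0 : ∀ i a s, r i a s ≠ 0 := by
      intro i a s
      simp only [hr]
      split_ifs with h
      · exact neg_ne_zero.2 (mul_ne_zero (hsep.θ_ne i n) (hR a s h.1 h.2))
      · exact one_ne_zero
    obtain ⟨e, he, hlim'⟩ := ih hν'μ hcard' (N := fun i a s => N i a s * r i a s)
      (fun i a s => mul_ne_zero (hN i a s) (hr0 i a s))
      (fun i => by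
        simp only [hr, hN0, Nat.zero_le, and_self, if_true, cornerRatio_zero, mul_one]
        rw [mul_comm]
        exact (prod_eq_prod_Ico_succ_bot hnL fun j => -θ i j).symm)
      (fun i => hsep.θ_ne i n) (fun j hj => hsep.sep j n hj hnL)
      (fun j h1 h2 => by
        rcases h1.lt_or_eq with h | rfl
        · exact ⟨0, hsep.sep n j h h2⟩
        · exact ⟨1, by simp only [div_self (hsep.θ_ne _ n)]; exact tendsto_const_nhds⟩)
      (fun a s => by
        have h1 := boxCount_erase (show c₀ ∈ ν.cells from hc₀) a s
        rw [← hν'] at h1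
        have h2 := hc3 a s
        by_cases h : a ≤ c₀.1 ∧ s ≤ c₀.2
        · rw [if_pos h] at h1 h2
          rw [h1, Nat.add_sub_cancel] at h2
          have h3 := (CoeffTendsto.const (l := (l : Filter ι))
            (C (-(cornerRatio ν.cells c₀ a s)⁻¹))).mul h2
          refine ⟨_, h3.congr' (Eventually.of_forall fun i => ?_), fun k hk => ?_, ?_⟩
          · have h4 := hsep.θ_ne i n
            have h5 := hR a s h.1 h.2
            have h6 := hN i a s
            ext k
            simp only [coeff_C_mul, coeff_normScale, hr, if_pos h, pow_succ]
            field_simp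
          · rw [coeff_C_mul, coeff_X_pow_mul', if_neg (by omega), mul_zero]
          · rw [coeff_C_mul, coeff_X_pow_mul_self]
            have h5 := hR a s h.1 h.2
            simp only [coeff_sub, coeff_X_zero, coeff_C_zero]
            field_simp
            ring
        · rw [if_neg h, add_zero] at h1
          rw [if_neg h, h1] at h2
          refine ⟨_, h2.congr' (Eventually.of_forall fun i => ?_), fun k hk => ?_, ?_⟩
          · simp only [hr, if_neg h, mul_one]
          · rw [coeff_X_pow, if_neg hk.ne]
          · rw [coeff_X_pow_self])
    rw [hν'] at he hlim'
    have hcardν : ν.cells.card - 1 = n := by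
      rw [show ν.cells.card = ν.card from rfl, hn]; rfl
    have hetab := he.insert (show c₀ ∈ ν.cells from hc₀) hcor
    rw [hcardν] at hetab
    set e' := Function.update e c₀ n with he'
    have hself : e' c₀ = n := Function.update_self _ _ _
    have hee : ∀ c ∈ ν.cells.erase c₀, e' c = e c := fun c hc =>
      Function.update_of_ne (ne_of_mem_erase hc) _ _
    have hlast : ∀ c ∈ ν.cells, c ≠ c₀ → e' c < e' c₀ := by
      intro c hc hne
      rw [hself, he', Function.update_of_ne hne]
      have h1 := he.lt c (mem_erase.2 ⟨hne, hc⟩)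
      rw [card_erase_of_mem hc₀, hcardν] at h1
      exact h1
    refine ⟨e', hetab, fun a s j hj => ?_⟩
    rcases hj.lt_or_eq with hj | rfl
    · have hj' : j ≤ e' c₀ := by rw [hself]; omega
      refine (hlim' a s j (by omega)).congr fun i => ?_
      rw [← tabCount_erase hj', tabTop_erase (show c₀ ∈ ν.cells from hc₀) hlast _ hj',
        tabCount_congr hee, tabTop_congr hee, hself, mul_assoc, mul_comm (r i a s)]
    · rw [← hn]
      exact htop hτ hlim hetab a s

end

/-- The leading-order Q-function of a tableau. -/
noncomputable def tabLead (ν : Finset (ℕ × ℕ)) (e : ℕ × ℕ → ℕ) (θ : ℕ → ℂ) (a s : ℕ) : ℂ[X] :=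
  ∏ c ∈ ν.filter (fun c => a ≤ c.1 ∧ s ≤ c.2), (X - C (θ (e c) * tabRatio ν e c a s))

theorem tabLead_monic (ν : Finset (ℕ × ℕ)) (e : ℕ × ℕ → ℕ) (θ : ℕ → ℂ) (a s : ℕ) :
    (tabLead ν e θ a s).Monic := monic_prod_of_monic _ _ fun _ _ => monic_X_sub_C _

theorem natDegree_tabLead (ν : Finset (ℕ × ℕ)) (e : ℕ × ℕ → ℕ) (θ : ℕ → ℂ) (a s : ℕ) :
    (tabLead ν e θ a s).natDegree = boxCount ν a s := by
  rw [tabLead, natDegree_prod_of_monic _ _ fun _ _ => monic_X_sub_C _]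
  simp only [natDegree_X_sub_C, sum_const, smul_eq_mul, mul_one]
  rfl

theorem tabCount_zero (ν : Finset (ℕ × ℕ)) (e : ℕ × ℕ → ℕ) (a s : ℕ) : tabCount ν e 0 a s = 0 := by
  simp [tabCount, boxCount]

section

variable {ν : Finset (ℕ × ℕ)} {e : ℕ × ℕ → ℕ}

theorem IsTab.image_eq (he : IsTab ν e) : ν.image e = range ν.card := by
  refine eq_of_subset_of_card_le (fun x hx => ?_) ?_
  · obtain ⟨c, hc, rfl⟩ := mem_image.1 hx
    exact mem_range.2 (he.lt c hc)
  · rw [card_range, card_image_of_injOn fun c hc d hd h => he.inj c hc d hd h]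

theorem IsTab.exists_box (he : IsTab ν e) {j : ℕ} (hj : j < ν.card) : ∃ c ∈ ν, e c = j := by
  have h : j ∈ ν.image e := by rw [he.image_eq]; exact mem_range.2 hj
  exact mem_image.1 h

theorem IsTab.filter_succ (he : IsTab ν e) {c : ℕ × ℕ} (hc : c ∈ ν) :
    (ν.filter fun d => e d < e c + 1).erase c = ν.filter fun d => e d < e c := by
  ext d
  simp only [mem_erase, mem_filter]
  constructor
  · rintro ⟨h1, h2, h3⟩
    refine ⟨h2, lt_of_le_of_ne (Nat.lt_succ_iff.1 h3) fun h => h1 (he.inj d h2 c hc h)⟩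
  · rintro ⟨h1, h2⟩
    exact ⟨fun h => by rw [h] at h2; exact lt_irrefl _ h2, h1, by omega⟩

theorem IsTab.tabCount_succ (he : IsTab ν e) {c : ℕ × ℕ} (hc : c ∈ ν) (a s : ℕ) :
    tabCount ν e (e c + 1) a s = tabCount ν e (e c) a s + if a ≤ c.1 ∧ s ≤ c.2 then 1 else 0 := by
  rw [tabCount, boxCount_erase (c := c) (by simp [hc]), he.filter_succ hc, tabCount]

theorem IsTab.exists_tabCount_eq (he : IsTab ν e) {a s k : ℕ} (hk : k ≤ boxCount ν a s) :
    ∃ j ≤ ν.card, tabCount ν e j a s = k := by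
  have h : ∀ n ≤ ν.card, k ≤ tabCount ν e n a s → ∃ j ≤ n, tabCount ν e j a s = k := by
    intro n
    induction n with
    | zero =>
      intro _ h
      rw [tabCount_zero] at h
      exact ⟨0, le_rfl, by rw [tabCount_zero]; omega⟩
    | succ n ih =>
      intro hn h
      by_cases h' : k ≤ tabCount ν e n a s
      · obtain ⟨j, hj, h2⟩ := ih (by omega) h'
        exact ⟨j, by omega, h2⟩
      · obtain ⟨c, hc, rfl⟩ := he.exists_box (show n < ν.card by omega)
        refine ⟨e c + 1, le_rfl, ?_⟩
        have := he.tabCount_succ hc a s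
        split_ifs at this <;> omega
  exact h ν.card le_rfl (by rwa [tabCount_card he])

theorem IsTab.exists_diagram (he : IsTab μ.cells e) (j : ℕ) :
    ∃ ν : YoungDiagram, ν ≤ μ ∧ ν.cells = μ.cells.filter fun c => e c < j := by
  refine ⟨⟨μ.cells.filter fun c => e c < j, fun x y hyx hx => ?_⟩, ?_, rfl⟩
  · rw [mem_coe, mem_filter] at hx ⊢
    have hy : y ∈ μ.cells := μ.isLowerSet hyx hx.1
    refine ⟨hy, ?_⟩
    by_cases h : y = x
    · rw [h]; exact hx.2
    · have hle := Prod.le_def.1 hyx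
      exact (he.mono y hy x hx.1 hle.1 hle.2 h).trans hx.2
  · rw [← cells_subset_iff]
    exact filter_subset _ _

theorem IsTab.tabRatio_ne_zero (he : IsTab μ.cells e) {c : ℕ × ℕ}
    (hc : c ∈ μ.cells) {a s : ℕ} (ha : a ≤ c.1) (hs : s ≤ c.2) : tabRatio μ.cells e c a s ≠ 0 := by
  refine cornerRatio_ne_zero (fun a s ha hs => ?_) ha hs
  have h : (a, s) ∈ μ.cells := μ.up_left_mem ha hs hc
  refine mem_filter.2 ⟨h, ?_⟩
  by_cases hac : (a, s) = c
  · rw [hac]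
  · exact (he.mono _ h c hc ha hs hac).le

theorem IsTab.tabTop_ne_zero (he : IsTab μ.cells e) {θ : ℕ → ℂ}
    (hθ : ∀ j, θ j ≠ 0) (j a s : ℕ) : tabTop μ.cells e θ j a s ≠ 0 := by
  refine prod_ne_zero_iff.2 fun c hc => neg_ne_zero.2 (mul_ne_zero (hθ _) ?_)
  rw [mem_filter] at hc
  exact he.tabRatio_ne_zero hc.1 hc.2.1 hc.2.2.1

end

section

open Filter Topology

variable {ι : Type*} {l : Filter ι} {L : ℕ} {ħ : ι → ℂ} {θ : ι → ℕ → ℂ}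

/-- Scales between consecutive inhomogeneities. -/
theorem SeparatedSeq.exists_scale (h : SeparatedSeq L l ħ θ) {η : ι → ℂ} (hη : ∀ i, η i ≠ 0)
    (hη0 : Tendsto η l (𝓝 0)) {j : ℕ} (hj : j ≤ L) :
    ∃ σ : ι → ℂ, (∀ i, σ i ≠ 0) ∧ (∀ k < j, Tendsto (fun i => θ i k / σ i) l (𝓝 0)) ∧
      (∀ k, j ≤ k → k < L → Tendsto (fun i => σ i / θ i k) l (𝓝 0)) ∧
      (0 < j → Tendsto (fun i => ħ i / σ i) l (𝓝 0)) := by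
  have hle : ∀ m k, m ≤ k → k < L → ∃ x, Tendsto (fun i => θ i m / θ i k) l (𝓝 x) := by
    intro m k hmk hk
    rcases hmk.lt_or_eq with h1 | rfl
    · exact ⟨0, h.sep m k h1 hk⟩
    · exact ⟨1, by simp only [div_self (h.θ_ne _ _)]; exact tendsto_const_nhds⟩
  have hlow : ∀ {σ : ι → ℂ} {m : ℕ}, m < L → (∀ i, σ i ≠ 0) →
      Tendsto (fun i => θ i m / σ i) l (𝓝 0) →
      ∀ k ≤ m, Tendsto (fun i => θ i k / σ i) l (𝓝 0) := by
    intro σ m hm hσ h1 k hk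
    obtain ⟨x, hx⟩ := hle k m hk hm
    have h2 := hx.mul h1
    rw [mul_zero] at h2
    exact h2.congr fun i => div_mul_div_cancel₀ (h.θ_ne i m)
  have hhigh : ∀ {σ : ι → ℂ} {m : ℕ}, (∀ i, σ i ≠ 0) → Tendsto (fun i => σ i / θ i m) l (𝓝 0) →
      ∀ k, m ≤ k → k < L → Tendsto (fun i => σ i / θ i k) l (𝓝 0) := by
    intro σ m hσ h1 k hk hkL
    obtain ⟨x, hx⟩ := hle m k hk hkL
    have h2 := h1.mul hx
    rw [zero_mul] at h2
    exact h2.congr fun i => div_mul_div_cancel₀ (h.θ_ne i m)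
  have hħ : ∀ {σ : ι → ℂ}, 0 < L → (∀ i, σ i ≠ 0) → Tendsto (fun i => θ i 0 / σ i) l (𝓝 0) →
      Tendsto (fun i => ħ i / σ i) l (𝓝 0) := by
    intro σ hL hσ h1
    obtain ⟨B, hB⟩ := h.ħ_le hL
    exact (tendsto_zero_of_norm_le hB h1).congr fun i => div_mul_div_cancel₀ (h.θ_ne i 0)
  rcases Nat.eq_zero_or_pos j with rfl | hj0
  · refine ⟨fun i => η i * θ i 0, fun i => mul_ne_zero (hη i) (h.θ_ne i 0),
      fun k hk => absurd hk (Nat.not_lt_zero k), ?_, fun h => absurd h (lt_irrefl 0)⟩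
    intro k hk hkL
    refine hhigh (fun i => mul_ne_zero (hη i) (h.θ_ne i 0)) (m := 0) ?_ k hk hkL
    refine hη0.congr fun i => ?_
    rw [mul_div_assoc, div_self (h.θ_ne i 0), mul_one]
  · rcases hj.lt_or_eq with hjL | rfl
    · set u : ι → ℂ := fun i => ((Real.sqrt ‖θ i (j - 1) / θ i j‖ : ℝ) : ℂ) with hu
      have hn0 : ∀ i, 0 < ‖θ i (j - 1) / θ i j‖ := fun i =>
        norm_pos_iff.2 (div_ne_zero (h.θ_ne i _) (h.θ_ne i _))
      have hu0 : ∀ i, u i ≠ 0 := fun i =>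
        Complex.ofReal_ne_zero.2 (Real.sqrt_ne_zero'.2 (hn0 i))
      have hs := (Real.continuous_sqrt.tendsto 0).comp
        (tendsto_zero_iff_norm_tendsto_zero.1 (h.sep (j - 1) j (by omega) hjL))
      rw [Real.sqrt_zero] at hs
      have hσ : ∀ i, u i * θ i j ≠ 0 := fun i => mul_ne_zero (hu0 i) (h.θ_ne i j)
      have h1 : Tendsto (fun i => u i * θ i j / θ i j) l (𝓝 0) := by
        have := (Complex.continuous_ofReal.tendsto 0).comp hs
        rw [Complex.ofReal_zero] at this
        refine this.congr fun i => ?_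
        rw [mul_div_assoc, div_self (h.θ_ne i j), mul_one]
        rfl
      have h2 : Tendsto (fun i => θ i (j - 1) / (u i * θ i j)) l (𝓝 0) := by
        rw [tendsto_zero_iff_norm_tendsto_zero]
        refine hs.congr fun i => ?_
        have e1 : ‖u i‖ = Real.sqrt ‖θ i (j - 1) / θ i j‖ := by
          rw [hu]; simp [abs_of_nonneg (Real.sqrt_nonneg _)]
        rw [Function.comp_apply, mul_comm (u i), ← div_div, norm_div (θ i (j - 1) / θ i j) (u i),
          e1, Real.div_sqrt]
      have h3 := hlow (by omega) hσ h2
      exact ⟨_, hσ, fun k hk => h3 k (by omega), hhigh hσ h1,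
        fun _ => hħ (by omega) hσ (h3 0 (Nat.zero_le _))⟩
    · have hσ : ∀ i, θ i (j - 1) / η i ≠ 0 := fun i => div_ne_zero (h.θ_ne i _) (hη i)
      have h3 := hlow (σ := fun i => θ i (j - 1) / η i) (m := j - 1) (by omega) hσ (by
        refine hη0.congr fun i => ?_
        rw [div_div_cancel₀ (h.θ_ne i _)])
      exact ⟨_, hσ, fun k hk => h3 k (by omega), fun k h1 h2 => absurd h2 (not_lt.2 h1),
        fun _ => hħ hj0 hσ (h3 0 (Nat.zero_le _))⟩

variable {μ : YoungDiagram} {e : ℕ × ℕ → ℕ}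

theorem IsTab.tendsto_normScale_tabLead (he : IsTab μ.cells e) (hθ : ∀ i j, θ i j ≠ 0) {j : ℕ}
    {σ : ι → ℂ} (hσ : ∀ i, σ i ≠ 0) (h1 : ∀ k < j, Tendsto (fun i => θ i k / σ i) l (𝓝 0))
    (h2 : ∀ k, j ≤ k → k < μ.card → Tendsto (fun i => σ i / θ i k) l (𝓝 0)) (a s : ℕ) :
    CoeffTendsto (fun i => normScale (σ i) (tabTop μ.cells e (θ i) j a s)
      (tabCount μ.cells e j a s) (tabLead μ.cells e (θ i) a s)) l
      (X ^ tabCount μ.cells e j a s) := by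
  have hr0 : ∀ c ∈ μ.cells.filter (fun c => a ≤ c.1 ∧ s ≤ c.2), tabRatio μ.cells e c a s ≠ 0 :=
    fun c hc => he.tabRatio_ne_zero (mem_filter.1 hc).1 (mem_filter.1 hc).2.1 (mem_filter.1 hc).2.2
  have h := coeffTendsto_prod_X_sub_C (l := l) (μ.cells.filter fun c => a ≤ c.1 ∧ s ≤ c.2)
    (fun c => e c < j) hσ (r := fun i c => θ i (e c) * tabRatio μ.cells e c a s)
    (x := fun _ => 0)
    (fun c hc hcj => by
      have := (h1 _ hcj).mul_const (tabRatio μ.cells e c a s)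
      rw [zero_mul] at this
      exact this.congr fun i => by ring)
    (fun c hc hcj => by
      have := (h2 _ (not_lt.1 hcj) (he.lt c (mem_filter.1 hc).1)).div_const
        (tabRatio μ.cells e c a s)
      rw [zero_div] at this
      exact this.congr fun i => by rw [div_div])
    (fun c hc i => mul_ne_zero (hθ i _) (hr0 c hc))
  have e1 : (μ.cells.filter fun c => a ≤ c.1 ∧ s ≤ c.2).filter (fun c => ¬ e c < j) =
      μ.cells.filter (fun c => a ≤ c.1 ∧ s ≤ c.2 ∧ j ≤ e c) := by
    rw [filter_filter]
    exact filter_congr fun c _ => by rw [not_lt, and_assoc]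
  have e2 : ((μ.cells.filter fun c => a ≤ c.1 ∧ s ≤ c.2).filter fun c => e c < j).card =
      tabCount μ.cells e j a s := by
    rw [filter_comm]; rfl
  rw [e1, e2, prod_const, e2, C_0, sub_zero] at h
  exact h

theorem coeff_normScale_self {σ : ℂ} (hσ : σ ≠ 0) (N : ℂ) (d : ℕ) (f : ℂ[X]) :
    (normScale σ N d f).coeff d = f.coeff d / N := by
  rw [coeff_normScale, mul_div_mul_right _ _ (pow_ne_zero d hσ)]

theorem IsTab.tendsto_tabLead_div (he : IsTab μ.cells e) (h : SeparatedSeq μ.card l ħ θ)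
    {η : ι → ℂ} (hη : ∀ i, η i ≠ 0)
    (hη0 : Tendsto η l (𝓝 0)) {j : ℕ} (hj : j ≤ μ.card) (a s : ℕ) :
    Tendsto (fun i => (tabLead μ.cells e (θ i) a s).coeff (tabCount μ.cells e j a s) /
      tabTop μ.cells e (θ i) j a s) l (𝓝 1) := by
  obtain ⟨σ, hσ, h1, h2, _⟩ := h.exists_scale hη hη0 hj
  have h3 := he.tendsto_normScale_tabLead h.θ_ne hσ h1 h2 a s (tabCount μ.cells e j a s)
  rw [coeff_X_pow_self] at h3
  exact h3.congr fun i => coeff_normScale_self (hσ i) _ _ _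

theorem IsTab.eventually_coeff_tabLead_ne_zero (he : IsTab μ.cells e)
    (h : SeparatedSeq μ.card l ħ θ) {η : ι → ℂ} (hη : ∀ i, η i ≠ 0)
    (hη0 : Tendsto η l (𝓝 0)) {a s k : ℕ} (hk : k ≤ boxCount μ.cells a s) :
    ∀ᶠ i in l, (tabLead μ.cells e (θ i) a s).coeff k ≠ 0 := by
  obtain ⟨j, hj, rfl⟩ := he.exists_tabCount_eq hk
  filter_upwards [(he.tendsto_tabLead_div h hη hη0 hj a s).eventually_ne one_ne_zero] with i hi h0
  exact hi (by rw [h0, zero_div])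

/-- Solutions of the Q-system with a separated source are asymptotic to the leading-order solution
of a tableau. -/
theorem exists_tab_tendsto {l : Ultrafilter ι} (h : SeparatedSeq μ.card l ħ θ)
    {η : ι → ℂ} (hη : ∀ i, η i ≠ 0) (hη0 : Tendsto η l (𝓝 0))
    {Q : ι → ℕ → ℕ → ℂ[X]} (hQ : ∀ i, IsQFamily μ (ħ i) (Q i))
    (hdeg : ∀ i, (Q i 0 0).natDegree = μ.card)
    (hsrc : ∀ k ≤ μ.card, Tendsto (fun i => (Q i 0 0).coeff k /
      (∏ j ∈ range μ.card, (X - C (θ i j))).coeff k) l (𝓝 1)) :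
    ∃ e, IsTab μ.cells e ∧ ∀ a s k, k ≤ boxCount μ.cells a s →
      Tendsto (fun i => (Q i a s).coeff k / (tabLead μ.cells e (θ i) a s).coeff k) l (𝓝 1) := by
  set S : ι → ℝ := fun i => ∑ c ∈ μ.cells, ∑ k ∈ range μ.card, ‖(Q i c.1 c.2).coeff k‖ with hS
  set S' : ι → ℝ := fun i => ∑ j ∈ range μ.card, ‖θ i j‖ with hS'
  have hS0 : ∀ i, 0 ≤ S i := fun i =>
    sum_nonneg fun _ _ => sum_nonneg fun _ _ => norm_nonneg _
  have hS'0 : ∀ i, 0 ≤ S' i := fun i => sum_nonneg fun _ _ => norm_nonneg _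
  set τ : ι → ℂ := fun i => ((1 + S i + S' i : ℝ) : ℂ) / η i with hτdef
  have hpos : ∀ i, 0 < 1 + S i + S' i := fun i => by linarith [hS0 i, hS'0 i]
  have hτ : ∀ i, τ i ≠ 0 := fun i =>
    div_ne_zero (Complex.ofReal_ne_zero.2 (hpos i).ne') (hη i)
  have hnτ : ∀ i, ‖τ i‖ = (1 + S i + S' i) / ‖η i‖ := fun i => by
    rw [hτdef, norm_div, Complex.norm_real, Real.norm_of_nonneg (hpos i).le]
  have hsmall : ∀ (u : ι → ℂ), (∀ i, ‖u i‖ ≤ 1 + S i + S' i) →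
      Tendsto (fun i => u i / τ i) l (𝓝 0) := by
    intro u hu
    refine squeeze_zero_norm (fun i => ?_) (tendsto_zero_iff_norm_tendsto_zero.1 hη0)
    have := norm_pos_iff.2 (hη i)
    rw [norm_div, hnτ, div_le_iff₀ (div_pos (hpos i) this), mul_div_cancel₀ _ this.ne']
    exact hu i
  have hcoefs : ∀ a s, CoeffTendsto (fun i => normScale (τ i) 1 (boxCount μ.cells a s) (Q i a s)) l
      (X ^ boxCount μ.cells a s) := by
    intro a s k
    rw [coeff_X_pow]
    rcases lt_trichotomy k (boxCount μ.cells a s) with hk | hk | hk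
    · rw [if_neg hk.ne]
      have hmem : (a, s) ∈ μ.cells := by
        by_contra hn
        rw [boxCount_eq_zero hn] at hk
        omega
      obtain ⟨m, hm⟩ := Nat.exists_eq_add_of_lt hk
      have hk' : k ∈ range μ.card := mem_range.2 (hk.trans_le (card_filter_le _ _))
      have h1 := hsmall (fun i => (Q i a s).coeff k) (fun i => by
        have e1 : ‖(Q i a s).coeff k‖ ≤ ∑ k ∈ range μ.card, ‖(Q i a s).coeff k‖ :=
          single_le_sum (f := fun k => ‖(Q i a s).coeff k‖) (fun _ _ => norm_nonneg _) hk'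
        have e2 : ∑ k ∈ range μ.card, ‖(Q i a s).coeff k‖ ≤ S i := single_le_sum
            (f := fun c : ℕ × ℕ => ∑ k ∈ range μ.card, ‖(Q i c.1 c.2).coeff k‖)
            (fun _ _ => sum_nonneg fun _ _ => norm_nonneg _) hmem
        linarith [hS'0 i])
      have h2 := hsmall (fun _ => 1) (fun i => by rw [norm_one]; linarith [hS0 i, hS'0 i])
      have h3 := h1.mul (h2.pow m)
      rw [zero_mul] at h3
      refine h3.congr fun i => ?_
      rw [coeff_normScale, hm, one_mul]
      have := hτ i
      simp only [div_pow, one_pow, pow_add, pow_one]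
      field_simp
    · rw [if_pos hk, hk]
      simp only [coeff_normScale_self (hτ _), div_one]
      have : ∀ i, (Q i a s).coeff (boxCount μ.cells a s) = 1 := fun i => by
        rw [← (hQ i).natDegree_eq (hdeg i)]; exact (hQ i).monic a s
      simp only [this]
      exact tendsto_const_nhds
    · rw [if_neg hk.ne']
      have : ∀ i, (Q i a s).coeff k = 0 := fun i => coeff_eq_zero_of_natDegree_lt (by
        rwa [(hQ i).natDegree_eq (hdeg i)])
      simp only [coeff_normScale, this, zero_mul, zero_div]
      exact tendsto_const_nhds
  obtain ⟨e, he, hlim⟩ := exists_tab_of_scale h hQ hdeg hsrc μ.card le_rfl rfl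
    (N := fun _ _ _ => 1) (fun _ _ _ => one_ne_zero) (fun i => by simp) hτ
    (fun j hj => hsmall (fun i => θ i j) fun i => by
      have e1 : ‖θ i j‖ ≤ S' i := single_le_sum (f := fun k => ‖θ i k‖)
        (fun _ _ => norm_nonneg _) (mem_range.2 hj)
      linarith [hS0 i])
    (fun j h1 h2 => absurd h2 (not_lt.2 h1))
    (fun a s => ⟨_, hcoefs a s, fun k hk => by rw [coeff_X_pow, if_neg hk.ne],
      by rw [coeff_X_pow_self]⟩)
  refine ⟨e, he, fun a s k hk => ?_⟩
  obtain ⟨j, hj, rfl⟩ := he.exists_tabCount_eq hk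
  have h1 := (hlim a s j hj).div (he.tendsto_tabLead_div h hη hη0 hj a s) one_ne_zero
  rw [div_one] at h1
  refine h1.congr fun i => ?_
  have h2 := he.tabTop_ne_zero (h.θ_ne i) j a s
  simp only [Pi.div_apply, one_mul]
  rw [div_div_div_cancel_right₀ h2]

end

section

open Filter Topology

variable {ι : Type*} {ħ : ι → ℂ} {θ : ι → ℕ → ℂ} {μ : YoungDiagram} {e : ℕ × ℕ → ℕ}

theorem IsQFamily.coeff_boxCount {ħ : ℂ} (hQ : IsQFamily μ ħ Q)
    (hdeg : (Q 0 0).natDegree = μ.card) (a s : ℕ) :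
    (Q a s).coeff (boxCount μ.cells a s) = 1 := by
  rw [← hQ.natDegree_eq hdeg]; exact hQ.monic a s

theorem IsQFamily.coeff_eq_zero {ħ : ℂ} (hQ : IsQFamily μ ħ Q)
    (hdeg : (Q 0 0).natDegree = μ.card) {a s k : ℕ} (hk : boxCount μ.cells a s < k) :
    (Q a s).coeff k = 0 :=
  coeff_eq_zero_of_natDegree_lt (by rwa [hQ.natDegree_eq hdeg])

/-- The linearised relations of the Q-system around a leading-order solution. -/
theorem linearised_relation {l : Filter ι} [l.NeBot] (h : SeparatedSeq μ.card l ħ θ)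
    {η : ι → ℂ} (hη : ∀ i, η i ≠ 0) (hη0 : Tendsto η l (𝓝 0)) (he : IsTab μ.cells e)
    {Q Q' : ι → ℕ → ℕ → ℂ[X]} (hQ : ∀ i, IsQFamily μ (ħ i) (Q i))
    (hdeg : ∀ i, (Q i 0 0).natDegree = μ.card) (hQ' : ∀ i, IsQFamily μ (ħ i) (Q' i))
    (hdeg' : ∀ i, (Q' i 0 0).natDegree = μ.card)
    (hnear : ∀ a s k, k ≤ boxCount μ.cells a s →
      Tendsto (fun i => (Q i a s).coeff k / (tabLead μ.cells e (θ i) a s).coeff k) l (𝓝 1))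
    (hnear' : ∀ a s k, k ≤ boxCount μ.cells a s →
      Tendsto (fun i => (Q' i a s).coeff k / (tabLead μ.cells e (θ i) a s).coeff k) l (𝓝 1))
    {M : ι → ℂ} (hM : ∀ i, M i ≠ 0) {z : ℕ → ℕ → ℕ → ℂ}
    (hz : ∀ a s k, Tendsto (fun i => ((Q i a s).coeff k - (Q' i a s).coeff k) /
      (M i * (tabLead μ.cells e (θ i) a s).coeff k)) l (𝓝 (z a s k)))
    {j : ℕ} (hj : j ≤ μ.card) {a s : ℕ} (hc : (a, s) ∈ μ.cells) (hcj : e (a, s) < j) :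
    z a s (tabCount μ.cells e j a s) + z (a + 1) (s + 1) (tabCount μ.cells e j (a + 1) (s + 1)) =
      z (a + 1) s (tabCount μ.cells e j (a + 1) s) +
        z a (s + 1) (tabCount μ.cells e j a (s + 1)) := by
  obtain ⟨σ, hσ, h1, h2, h3⟩ := h.exists_scale hη hη0 hj
  have hħσ := h3 (by omega)
  obtain ⟨ν, hνμ, hν⟩ := he.exists_diagram j
  have hcν : (a, s) ∈ ν.cells := by rw [hν]; exact mem_filter.2 ⟨hc, hcj⟩
  set n : ℕ → ℕ → ℕ := boxCount ν.cells with hn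
  have hnt : ∀ a s, tabCount μ.cells e j a s = n a s := fun a s => by rw [hn, hν]; rfl
  have hL := he.tendsto_normScale_tabLead h.θ_ne hσ h1 h2
  simp only [hnt] at hL ⊢
  set N : ι → ℕ → ℕ → ℂ := fun i a s => tabTop μ.cells e (θ i) j a s with hN
  have hN0 : ∀ i a s, N i a s ≠ 0 := fun i a s => he.tabTop_ne_zero (h.θ_ne i) j a s
  have hlead : ∀ a s k, k ≤ boxCount μ.cells a s →
      ∀ᶠ i in l, (tabLead μ.cells e (θ i) a s).coeff k ≠ 0 := fun a s k hk =>
    he.eventually_coeff_tabLead_ne_zero h hη hη0 hk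
  have hXzero : ∀ a s k, boxCount μ.cells a s < k → (X ^ n a s : ℂ[X]).coeff k = 0 := by
    intro a s k hk
    rw [coeff_X_pow, if_neg]
    have : n a s ≤ boxCount μ.cells a s := by
      refine card_le_card (filter_subset_filter _ ?_)
      exact cells_subset_iff.2 hνμ
    omega
  have hF : ∀ {Q : ι → ℕ → ℕ → ℂ[X]}, (∀ i, IsQFamily μ (ħ i) (Q i)) →
      (∀ i, (Q i 0 0).natDegree = μ.card) → (∀ a s k, k ≤ boxCount μ.cells a s →
      Tendsto (fun i => (Q i a s).coeff k / (tabLead μ.cells e (θ i) a s).coeff k) l (𝓝 1)) →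
      ∀ a s, CoeffTendsto (fun i => normScale (σ i) (N i a s) (n a s) (Q i a s)) l (X ^ n a s) := by
    intro Q hQ hdeg hnear a s k
    by_cases hk : k ≤ boxCount μ.cells a s
    · have h4 := (hnear a s k hk).mul (hL a s k)
      rw [one_mul] at h4
      refine h4.congr' ?_
      filter_upwards [hlead a s k hk] with i hi
      simp only [coeff_normScale]
      rw [← mul_div_assoc, ← mul_assoc, div_mul_cancel₀ _ hi]
    · rw [hXzero a s k (not_le.1 hk)]
      simp only [coeff_normScale, (hQ _).coeff_eq_zero (hdeg _) (not_le.1 hk), zero_mul, zero_div]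
      exact tendsto_const_nhds
  have hFQ := hF hQ hdeg hnear
  have hFQ' := hF hQ' hdeg' hnear'
  set F : ι → ℕ → ℕ → ℂ[X] := fun i a s => normScale (σ i) (N i a s) (n a s) (Q i a s) with hFdef
  set F' : ι → ℕ → ℕ → ℂ[X] := fun i a s => normScale (σ i) (N i a s) (n a s) (Q' i a s) with hF'def
  have hD : ∀ a s, CoeffTendsto (fun i => C (M i)⁻¹ * (F i a s - F' i a s)) l
      (C (z a s (n a s)) * X ^ n a s) := by
    intro a s k
    have h4 := (hz a s k).mul (hL a s k)
    have e1 : (C (z a s (n a s)) * X ^ n a s : ℂ[X]).coeff k = z a s k * (X ^ n a s).coeff k := by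
      rw [coeff_C_mul, coeff_X_pow]
      split_ifs with hk
      · rw [hk]
      · simp
    rw [e1]
    by_cases hk : k ≤ boxCount μ.cells a s
    · refine h4.congr' ?_
      filter_upwards [hlead a s k hk] with i hi
      have := hM i
      simp only [hFdef, hF'def, hN, coeff_C_mul, coeff_sub, coeff_normScale]
      field_simp
    · rw [hXzero a s k (not_le.1 hk), mul_zero]
      simp only [hFdef, hF'def, coeff_C_mul, coeff_sub, coeff_normScale,
        (hQ _).coeff_eq_zero (hdeg _) (not_le.1 hk), (hQ' _).coeff_eq_zero (hdeg' _) (not_le.1 hk),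
        zero_mul, zero_div, sub_zero, mul_zero]
      exact tendsto_const_nhds
  have hble : ∀ a s, boxCount μ.cells a s ≤ μ.card := fun a s => card_filter_le _ _
  have hFd : ∀ i a s, (F i a s).natDegree ≤ μ.card := fun i a s =>
    (natDegree_normScale_le _ _ _ _).trans (by rw [(hQ i).natDegree_eq (hdeg i)]; exact hble a s)
  have hFd' : ∀ i a s, (F' i a s).natDegree ≤ μ.card := fun i a s =>
    (natDegree_normScale_le _ _ _ _).trans (by rw [(hQ' i).natDegree_eq (hdeg' i)]; exact hble a s)
  have hDd : ∀ i a s, (C (M i)⁻¹ * (F i a s - F' i a s)).natDegree ≤ μ.card := fun i a s =>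
    (natDegree_C_mul_le _ _).trans ((natDegree_sub_le _ _).trans (max_le (hFd i a s) (hFd' i a s)))
  have hκ0 : ∀ i, ħ i / σ i ≠ 0 := fun i => div_ne_zero (h.ħ_ne i) (hσ i)
  have hconst := (tendsto_scaleConst hνμ hQ hdeg h.ħ_ne hσ hħσ hN0 (fun a s => monic_X_pow _)
    (fun a s => natDegree_X_pow _) hFQ hcν).1
  have hlhs := ((hD a s).wronskian hħσ hκ0 (hFQ (a + 1) (s + 1)) (hDd · a s) (hFd · _ _)
      ((hD a s).natDegree_le (hDd · a s)) ((hFQ _ _).natDegree_le (hFd · _ _))).add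
    ((hFQ' a s).wronskian hħσ hκ0 (hD (a + 1) (s + 1)) (hFd' · a s) (hDd · _ _)
      ((hFQ' a s).natDegree_le (hFd' · a s)) ((hD _ _).natDegree_le (hDd · _ _)))
  have hrhs := (CoeffTendsto.C hconst).mul (((hD (a + 1) s).mul (hFQ a (s + 1))).add
    ((hFQ' (a + 1) s).mul (hD a (s + 1))))
  have heq := hlhs.unique (hrhs.congr' (Eventually.of_forall fun i => by
    have r1 := (hQ i).wronskian_normScale (hdeg i) (hσ i) (hN0 i) n (hνμ hcν)
    have r2 := (hQ' i).wronskian_normScale (hdeg' i) (hσ i) (hN0 i) n (hνμ hcν)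
    simp only [hFdef, hF'def] at r1 r2 ⊢
    rw [wronskian] at r1 r2
    simp only [wronskian, shift_mul, shift_C, shift_sub]
    linear_combination C (M i)⁻¹ * r2 - C (M i)⁻¹ * r1))
  have hbox := boxCount_rec ν.cells a s
  rw [if_pos hcν] at hbox
  have hcoef := congrArg (fun f => (X * f).coeff (n a s + n (a + 1) (s + 1))) heq
  simp only [mul_add, coeff_add] at hcoef
  have hdv : ∀ (y : ℂ) (m : ℕ), (X ^ m : ℂ[X]) ∣ C y * X ^ m := fun y m => Dvd.intro_left _ rfl
  rw [(coeff_diffW_of_dvd (hdv _ _) (dvd_refl _)).2,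
    (coeff_diffW_of_dvd (dvd_refl _) (hdv _ _)).2] at hcoef
  have e2 : ∀ (w w' y : ℂ) (m m' : ℕ),
      (X * (C w * (C y * X ^ m * X ^ m'))).coeff (m + m' + 1) = w * y := by
    intro w w' y m m'
    rw [coeff_X_mul, mul_assoc, ← pow_add, coeff_C_mul, coeff_C_mul, coeff_X_pow_self, mul_one]
  have e3 : ∀ (w y : ℂ) (m m' : ℕ),
      (X * (C w * (X ^ m * (C y * X ^ m')))).coeff (m + m' + 1) = w * y := by
    intro w y m m'
    rw [coeff_X_mul, mul_left_comm (X ^ m), ← pow_add, coeff_C_mul, coeff_C_mul, coeff_X_pow_self,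
      mul_one]
  rw [hbox, e2 _ 0, e3, coeff_C_mul, coeff_C_mul, coeff_X_pow_self, coeff_X_pow_self] at hcoef
  refine mul_left_cancel₀ (hookC_ne_zero hcν) ?_
  have hk : hookC ν.cells a s = n a s - n (a + 1) (s + 1) := rfl
  rw [← hk] at hcoef
  linear_combination hcoef

/-- Two solutions which are asymptotic to the same leading-order solution: if the relative
difference of the sources is negligible, so are all relative differences. -/
theorem tendsto_relative_difference {l : Ultrafilter ι} (h : SeparatedSeq μ.card l ħ θ)
    {η : ι → ℂ} (hη : ∀ i, η i ≠ 0) (hη0 : Tendsto η l (𝓝 0)) (he : IsTab μ.cells e)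
    {Q Q' : ι → ℕ → ℕ → ℂ[X]} (hQ : ∀ i, IsQFamily μ (ħ i) (Q i))
    (hdeg : ∀ i, (Q i 0 0).natDegree = μ.card) (hQ' : ∀ i, IsQFamily μ (ħ i) (Q' i))
    (hdeg' : ∀ i, (Q' i 0 0).natDegree = μ.card)
    (hnear : ∀ a s k, k ≤ boxCount μ.cells a s →
      Tendsto (fun i => (Q i a s).coeff k / (tabLead μ.cells e (θ i) a s).coeff k) l (𝓝 1))
    (hnear' : ∀ a s k, k ≤ boxCount μ.cells a s →
      Tendsto (fun i => (Q' i a s).coeff k / (tabLead μ.cells e (θ i) a s).coeff k) l (𝓝 1))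
    {M : ι → ℂ} (hM : ∀ i, M i ≠ 0)
    (hle : ∀ i a s k, ‖(Q i a s).coeff k - (Q' i a s).coeff k‖ ≤
      ‖M i‖ * ‖(tabLead μ.cells e (θ i) a s).coeff k‖)
    (h0 : ∀ k, Tendsto (fun i => ((Q i 0 0).coeff k - (Q' i 0 0).coeff k) /
      (M i * (tabLead μ.cells e (θ i) 0 0).coeff k)) l (𝓝 0)) (a s k : ℕ) :
    Tendsto (fun i => ((Q i a s).coeff k - (Q' i a s).coeff k) /
      (M i * (tabLead μ.cells e (θ i) a s).coeff k)) l (𝓝 0) := by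
  have hex : ∀ a s k, ∃ z, Tendsto (fun i => ((Q i a s).coeff k - (Q' i a s).coeff k) /
      (M i * (tabLead μ.cells e (θ i) a s).coeff k)) l (𝓝 z) := fun a s k =>
    exists_tendsto_of_eventually_norm_le l (B := 1) (Eventually.of_forall fun i => by
      rw [norm_div, norm_mul]
      exact div_le_one_of_le₀ (hle i a s k) (by positivity))
  choose z hz using hex
  have key : ∀ m j, j + m = μ.card → ∀ a s, z a s (tabCount μ.cells e j a s) = 0 := by
    intro m
    induction m with
    | zero =>
      rintro j rfl a s
      refine tendsto_nhds_unique (hz a s _) ?_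
      have := tabCount_card he a s
      rw [show μ.cells.card = μ.card from rfl] at this
      simp only [this, (hQ _).coeff_boxCount (hdeg _), (hQ' _).coeff_boxCount (hdeg' _), sub_self,
        zero_div]
      exact tendsto_const_nhds
    | succ m ih =>
      intro j hj a s
      obtain ⟨c₀, hc₀, rfl⟩ := he.exists_box (show j < μ.cells.card from (show j < μ.card by omega))
      have hsucc := he.tabCount_succ hc₀
      have hoff : ∀ a s, ¬ (a ≤ c₀.1 ∧ s ≤ c₀.2) → z a s (tabCount μ.cells e (e c₀) a s) = 0 := by
        intro a s hn
        have h1 := hsucc a s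
        rw [if_neg hn, add_zero] at h1
        rw [← h1]
        exact ih _ (by omega) a s
      by_cases hon : a ≤ c₀.1 ∧ s ≤ c₀.2
      · obtain ⟨ν, hνμ, hν⟩ := he.exists_diagram (e c₀ + 1)
        have hc₀ν : c₀ ∈ ν := by
          rw [← mem_cells, hν]; simp [hc₀]
        rw [eq_of_mixed_difference_eq_zero (g := fun a s => z a s (tabCount μ.cells e (e c₀) a s))
          hc₀ν hoff (fun c hc hne => ?_) hon.1 hon.2]
        · exact tendsto_nhds_unique (hz 0 0 _) (h0 _)
        · rw [← mem_cells, hν, mem_filter] at hc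
          have hlt : e c < e c₀ := lt_of_le_of_ne (Nat.lt_succ_iff.1 hc.2) fun h' =>
            hne (he.inj c hc.1 c₀ hc₀ h')
          have := linearised_relation h hη hη0 he hQ hdeg hQ' hdeg' hnear hnear' hM hz
            (j := e c₀) (by omega) (a := c.1) (s := c.2) hc.1 hlt
          linear_combination this
      · exact hoff a s hon
  by_cases hk : k ≤ boxCount μ.cells a s
  · obtain ⟨j, hj, rfl⟩ := he.exists_tabCount_eq hk
    obtain ⟨m, hm⟩ := Nat.exists_eq_add_of_le hj
    rw [← key m j hm.symm a s]
    exact hz a s _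
  · simp only [(hQ _).coeff_eq_zero (hdeg _) (not_le.1 hk),
      (hQ' _).coeff_eq_zero (hdeg' _) (not_le.1 hk), sub_self, zero_div]
    exact tendsto_const_nhds

/-! ### Leading-order solutions of different tableaux -/

theorem IsTab.tabTop_succ (he : IsTab μ.cells e) {c : ℕ × ℕ} (hc : c ∈ μ.cells) (θ : ℕ → ℂ)
    (a s : ℕ) : tabTop μ.cells e θ (e c) a s = tabTop μ.cells e θ (e c + 1) a s *
      if a ≤ c.1 ∧ s ≤ c.2 then -(θ (e c) * tabRatio μ.cells e c a s) else 1 := by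
  unfold tabTop
  have h1 : μ.cells.filter (fun d : ℕ × ℕ => a ≤ d.1 ∧ s ≤ d.2 ∧ e c + 1 ≤ e d) =
      (μ.cells.filter (fun d : ℕ × ℕ => a ≤ d.1 ∧ s ≤ d.2 ∧ e c ≤ e d)).erase c := by
    ext d
    simp only [mem_erase, mem_filter]
    constructor
    · rintro ⟨h1, h2, h3, h4⟩
      exact ⟨fun h => by rw [h] at h4; omega, h1, h2, h3, by omega⟩
    · rintro ⟨h0, h1, h2, h3, h4⟩
      exact ⟨h1, h2, h3, lt_of_le_of_ne h4 fun h => h0 (he.inj c hc d h1 h).symm⟩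
  rw [h1]
  split_ifs with h
  · rw [prod_erase_mul _ _ (mem_filter.2 ⟨hc, h.1, h.2, le_rfl⟩)]
  · rw [erase_eq_of_notMem, mul_one]
    exact fun h' => h ⟨(mem_filter.1 h').2.1, (mem_filter.1 h').2.2.1⟩

theorem not_eventually_comparable {l : Filter ι} [l.NeBot] (h : SeparatedSeq μ.card l ħ θ)
    {η : ι → ℂ} (hη : ∀ i, η i ≠ 0) (hη0 : Tendsto η l (𝓝 0)) {e e' : ℕ × ℕ → ℕ}
    (he : IsTab μ.cells e) (he' : IsTab μ.cells e') {j : ℕ}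
    (hagree : ∀ c ∈ μ.cells, (j + 1 ≤ e c ∨ j + 1 ≤ e' c) → e c = e' c)
    {c c' : ℕ × ℕ} (hc : c ∈ μ.cells) (hc' : c' ∈ μ.cells) (hcj : e c = j) (hcj' : e' c' = j)
    (hlt : c'.1 < c.1) {B : ℝ}
    (hcmp : ∀ a k, ∀ᶠ i in l, ‖(tabLead μ.cells e (θ i) a 0).coeff k‖ ≤
      B * ‖(tabLead μ.cells e' (θ i) a 0).coeff k‖) : False := by
  set a := c.1 with ha
  have hjL : j < μ.card := hcj ▸ he.lt c hc
  have hiff : ∀ v, j + 1 ≤ v → ∀ d ∈ μ.cells, (e d ≤ v ↔ e' d ≤ v) := by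
    intro v hv d hd
    have := hagree d hd
    constructor <;> intro h1 <;> by_contra h2
    · have := this (Or.inr (by omega)); omega
    · have := this (Or.inl (by omega)); omega
  have hiff' : ∀ d ∈ μ.cells, (j + 1 ≤ e d ↔ j + 1 ≤ e' d) := by
    intro d hd
    have := hagree d hd
    constructor <;> intro h1
    · rw [← this (Or.inl h1)]; exact h1
    · rw [this (Or.inr h1)]; exact h1
  have hcount : tabCount μ.cells e (j + 1) a 0 = tabCount μ.cells e' (j + 1) a 0 := by
    unfold tabCount
    rw [filter_congr fun d hd => by
      rw [← not_le, hiff' d hd, not_le]]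
  have htop : ∀ θ : ℕ → ℂ, tabTop μ.cells e θ (j + 1) a 0 = tabTop μ.cells e' θ (j + 1) a 0 := by
    intro θ
    unfold tabTop
    rw [filter_congr fun d hd => by rw [hiff' d hd]]
    refine prod_congr rfl fun d hd => ?_
    rw [mem_filter] at hd
    have hd1 := hagree d hd.1 (Or.inr hd.2.2.2)
    rw [hd1, tabRatio, tabRatio, hd1, filter_congr fun x hx =>
      hiff (e' d) hd.2.2.2 x hx]
  have hc1 := he.tabCount_succ hc a 0
  have hc2 := he'.tabCount_succ hc' a 0
  rw [hcj, if_pos ⟨le_rfl, Nat.zero_le _⟩] at hc1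
  rw [hcj', if_neg (by omega), add_zero] at hc2
  have ht1 := fun i => he.tabTop_succ hc (θ i) a 0
  have ht2 := fun i => he'.tabTop_succ hc' (θ i) a 0
  simp only [hcj, if_pos (show a ≤ c.1 ∧ 0 ≤ c.2 from ⟨le_rfl, Nat.zero_le _⟩)] at ht1
  simp only [hcj', if_neg (show ¬ (a ≤ c'.1 ∧ 0 ≤ c'.2) by omega), mul_one] at ht2
  set k := tabCount μ.cells e j a 0 with hk
  have hR := he.tabRatio_ne_zero hc (a := a) (s := 0) le_rfl (Nat.zero_le _)
  obtain ⟨σ, hσ, h1, h2, _⟩ := h.exists_scale hη hη0 hjL.le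
  have hl1 := he.tendsto_tabLead_div h hη hη0 hjL.le a 0
  have hl2 := he'.tendsto_normScale_tabLead h.θ_ne hσ h1 h2 a 0 k
  rw [← hc2, ← hcount, hc1, coeff_X_pow, if_neg (by omega)] at hl2
  have h3 := (hl2.mul (h2 j le_rfl hjL)).mul_const (-(tabRatio μ.cells e c a 0)⁻¹)
  have h4 := h3.div hl1 one_ne_zero
  simp only [zero_mul, zero_div] at h4
  have h5 := (h4.norm).const_mul B
  rw [norm_zero, mul_zero] at h5
  have h6 : ∀ᶠ i in l, (1 : ℝ) ≤ B * ‖(normScale (σ i) (tabTop μ.cells e' (θ i) j a 0) (k + 1)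
        (tabLead μ.cells e' (θ i) a 0)).coeff k * (σ i / θ i j) * -(tabRatio μ.cells e c a 0)⁻¹ /
        ((tabLead μ.cells e (θ i) a 0).coeff (tabCount μ.cells e j a 0) /
          tabTop μ.cells e (θ i) j a 0)‖ := by
    filter_upwards [hcmp a k, hl1.eventually_ne one_ne_zero] with i hi hi'
    have hne : (tabLead μ.cells e (θ i) a 0).coeff k ≠ 0 := fun h0 => hi' (by
      rw [← hk, h0, zero_div])
    have hT := he'.tabTop_ne_zero (h.θ_ne i) (j + 1) a 0
    have e1 : (normScale (σ i) (tabTop μ.cells e' (θ i) j a 0) (k + 1)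
        (tabLead μ.cells e' (θ i) a 0)).coeff k * (σ i / θ i j) * -(tabRatio μ.cells e c a 0)⁻¹ /
        ((tabLead μ.cells e (θ i) a 0).coeff (tabCount μ.cells e j a 0) /
          tabTop μ.cells e (θ i) j a 0) =
        (tabLead μ.cells e' (θ i) a 0).coeff k / (tabLead μ.cells e (θ i) a 0).coeff k := by
      rw [← hk, ht1, ht2, htop, coeff_normScale, pow_succ]
      have := hσ i
      have := h.θ_ne i j
      field_simp
    rw [e1, norm_div, ← mul_div_assoc, le_div_iff₀ (norm_pos_iff.2 hne), one_mul]
    exact hi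
  obtain ⟨i, hi1, hi2⟩ := (h6.and (h5.eventually_lt_const one_pos)).exists
  exact absurd hi1 (not_le.2 hi2)

theorem eq_of_eventually_comparable {l : Filter ι} [l.NeBot] (h : SeparatedSeq μ.card l ħ θ)
    {η : ι → ℂ} (hη : ∀ i, η i ≠ 0) (hη0 : Tendsto η l (𝓝 0)) {e e' : ℕ × ℕ → ℕ}
    (he : IsTab μ.cells e) (he' : IsTab μ.cells e') {B : ℝ}
    (hcmp : ∀ a k, ∀ᶠ i in l, ‖(tabLead μ.cells e (θ i) a 0).coeff k‖ ≤
      B * ‖(tabLead μ.cells e' (θ i) a 0).coeff k‖)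
    (hcmp' : ∀ a k, ∀ᶠ i in l, ‖(tabLead μ.cells e' (θ i) a 0).coeff k‖ ≤
      B * ‖(tabLead μ.cells e (θ i) a 0).coeff k‖) : ∀ c ∈ μ.cells, e c = e' c := by
  have key : ∀ m j, j + m = μ.card → ∀ c ∈ μ.cells, (j ≤ e c ∨ j ≤ e' c) → e c = e' c := by
    intro m
    induction m with
    | zero =>
      rintro j rfl c hc h1
      have h2 : e c < μ.card := he.lt c hc
      have h3 : e' c < μ.card := he'.lt c hc
      omega
    | succ m ih =>
      intro j hj
      have hP := ih (j + 1) (by omega)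
      have hjL : j < μ.cells.card := (show j < μ.card by omega)
      obtain ⟨c₁, hc₁, h1⟩ := he.exists_box hjL
      obtain ⟨c₂, hc₂, h2⟩ := he'.exists_box hjL
      have hcc : c₁ = c₂ := by
        by_contra hne
        rcases lt_trichotomy c₁.1 c₂.1 with h3 | h3 | h3
        · exact not_eventually_comparable h hη hη0 he' he
            (fun c hc h4 => (hP c hc h4.symm).symm) hc₂ hc₁ h2 h1 h3 hcmp'
        · rcases lt_trichotomy c₁.2 c₂.2 with h4 | h4 | h4
          · have h5 := he.mono c₁ hc₁ c₂ hc₂ h3.le h4.le hne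
            have := hP c₂ hc₂ (Or.inl (by omega))
            omega
          · exact hne (Prod.ext h3 h4)
          · have h5 := he'.mono c₂ hc₂ c₁ hc₁ h3.ge h4.le (Ne.symm hne)
            have := hP c₁ hc₁ (Or.inr (by omega))
            omega
        · exact not_eventually_comparable h hη hη0 he he' hP hc₁ hc₂ h1 h2 h3 hcmp
      subst hcc
      intro c hc h3
      by_cases h4 : j + 1 ≤ e c ∨ j + 1 ≤ e' c
      · exact hP c hc h4
      · push Not at h4
        rcases h3 with h3 | h3
        · have : c = c₁ := he.inj c hc c₁ hc₁ (by omega)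
          rw [this, h1, h2]
        · have : c = c₁ := he'.inj c hc c₁ hc₁ (by omega)
          rw [this, h1, h2]
  exact fun c hc => key μ.card 0 (zero_add _) c hc (Or.inl (Nat.zero_le _))

end

/-! ### Uniform statements for well separated inhomogeneities -/

/-- `f` agrees with the leading-order solution up to a relative error `ε` in each coefficient. -/
def IsNear (ν : Finset (ℕ × ℕ)) (e : ℕ × ℕ → ℕ) (θ : ℕ → ℂ) (ε : ℝ) (Q : ℕ → ℕ → ℂ[X]) : Prop :=
  ∀ a s k, ‖(Q a s).coeff k - (tabLead ν e θ a s).coeff k‖ ≤ ε * ‖(tabLead ν e θ a s).coeff k‖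

/-- The regime of widely separated inhomogeneities. -/
structure WellSeparated (L : ℕ) (δ K : ℝ) (ħ : ℂ) (θ : ℕ → ℂ) : Prop where
  ħ_ne : ħ ≠ 0
  θ_ne : ∀ j, θ j ≠ 0
  first : 0 < L → δ * ‖ħ‖ ≤ ‖θ 0‖
  ratio : ∀ j, j + 1 < L → K * ‖θ j‖ ≤ ‖θ (j + 1)‖

theorem WellSeparated.mono {L : ℕ} {δ K K' : ℝ} {θ : ℕ → ℂ}
    (h : WellSeparated L δ K ħ θ) (hK : K' ≤ K) : WellSeparated L δ K' ħ θ :=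
  ⟨h.ħ_ne, h.θ_ne, h.first, fun j hj =>
    (mul_le_mul_of_nonneg_right hK (norm_nonneg _)).trans (h.ratio j hj)⟩

theorem exists_bound_of_finite {α : Type*} (S : Finset α) {P : α → ℝ → Prop}
    (hP : ∀ x ∈ S, ∃ K, ∀ K', K ≤ K' → P x K') : ∃ K, ∀ x ∈ S, ∀ K', K ≤ K' → P x K' := by
  classical
  induction S using Finset.induction_on with
  | empty => exact ⟨0, by simp⟩
  | insert b S hb ih =>
    obtain ⟨K, hK⟩ := ih fun x hx => hP x (mem_insert_of_mem hx)
    obtain ⟨K', hK'⟩ := hP b (mem_insert_self _ _)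
    refine ⟨max K K', fun x hx K'' h => ?_⟩
    rcases mem_insert.1 hx with rfl | hx
    · exact hK' K'' ((le_max_right _ _).trans h)
    · exact hK x hx K'' ((le_max_left _ _).trans h)

theorem tabLead_congr {ν : Finset (ℕ × ℕ)} {e e' : ℕ × ℕ → ℕ} (h : ∀ c ∈ ν, e c = e' c)
    (θ : ℕ → ℂ) (a s : ℕ) : tabLead ν e θ a s = tabLead ν e' θ a s := by
  refine prod_congr rfl fun c hc => ?_
  have hc' := (mem_filter.1 hc).1
  have h2 : ν.filter (fun d => e d ≤ e c) = ν.filter (fun d => e' d ≤ e' c) :=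
    filter_congr fun d hd => by rw [h d hd, h c hc']
  rw [tabRatio, tabRatio, h2, h c hc']

theorem IsTab.congr {ν : Finset (ℕ × ℕ)} {e e' : ℕ × ℕ → ℕ} (he : IsTab ν e)
    (h : ∀ c ∈ ν, e c = e' c) : IsTab ν e' :=
  ⟨fun c hc => h c hc ▸ he.lt c hc,
    fun c hc d hd h' => he.inj c hc d hd (by rw [h c hc, h d hd, h']),
    fun c hc d hd h1 h2 h3 => by rw [← h c hc, ← h d hd]; exact he.mono c hc d hd h1 h2 h3⟩

theorem exists_finset_tabs (ν : Finset (ℕ × ℕ)) : ∃ S : Finset (ℕ × ℕ → ℕ),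
    (∀ e ∈ S, IsTab ν e) ∧ ∀ e, IsTab ν e → ∃ e' ∈ S, ∀ c ∈ ν, e c = e' c := by
  classical
  set ext : (∀ c ∈ ν, ℕ) → ℕ × ℕ → ℕ := fun f c => if h : c ∈ ν then f c h else 0 with hext
  refine ⟨((ν.pi fun _ => range ν.card).image ext).filter (IsTab ν), ?_, ?_⟩
  · exact fun e he => (mem_filter.1 he).2
  · intro e he
    have h : ∀ c ∈ ν, e c = ext (fun c _ => e c) c := fun c hc => by
      simp only [hext, dif_pos hc]
    refine ⟨ext fun c _ => e c, mem_filter.2 ⟨mem_image.2 ⟨_, ?_, rfl⟩, he.congr h⟩, h⟩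
    rw [mem_pi]
    exact fun c hc => mem_range.2 (he.lt c hc)

theorem tabLead_zero_zero {ν : Finset (ℕ × ℕ)} {e : ℕ × ℕ → ℕ} (he : IsTab ν e) (θ : ℕ → ℂ) :
    tabLead ν e θ 0 0 = ∏ j ∈ range ν.card, (X - C (θ j)) := by
  rw [← he.image_eq, prod_image fun c hc d hd h => he.inj c hc d hd h, tabLead]
  simp [tabRatio, cornerRatio_zero]

section

open Filter Topology

theorem tendsto_inv_succ : Tendsto (fun i : ℕ => 1 / ((i : ℂ) + 1)) (hyperfilter ℕ) (𝓝 0) :=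
  (tendsto_one_div_add_atTop_nhds_zero_nat (𝕜 := ℂ)).mono_left Nat.hyperfilter_le_atTop

theorem tendsto_inv_succ_real : Tendsto (fun i : ℕ => 1 / ((i : ℝ) + 1)) (hyperfilter ℕ) (𝓝 0) :=
  (tendsto_one_div_add_atTop_nhds_zero_nat (𝕜 := ℝ)).mono_left Nat.hyperfilter_le_atTop

theorem inv_succ_ne_zero (i : ℕ) : 1 / ((i : ℂ) + 1) ≠ 0 :=
  one_div_ne_zero (Nat.cast_add_one_ne_zero i)

theorem separatedSeq_of_wellSeparated {L : ℕ} {δ : ℝ} (hδ : 0 < δ) {ħ : ℕ → ℂ} {θ : ℕ → ℕ → ℂ}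
    (h : ∀ i : ℕ, WellSeparated L δ (i + 1) (ħ i) (θ i)) :
    SeparatedSeq L (hyperfilter ℕ : Filter ℕ) ħ θ := by
  refine ⟨fun i => (h i).ħ_ne, fun i => (h i).θ_ne, fun j k hjk hk => ?_, fun hL =>
    ⟨1 / δ, fun i => ?_⟩⟩
  · refine squeeze_zero_norm (fun i => ?_) tendsto_inv_succ_real
    have key : ∀ k, j + 1 ≤ k → k < L → ((i : ℝ) + 1) * ‖θ i j‖ ≤ ‖θ i k‖ := by
      intro k hk
      induction k, hk using Nat.le_induction with
      | base => exact fun hL => (h i).ratio j hL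
      | succ k _ ih =>
        intro hL
        have h1 := ih (by omega)
        have h2 := (h i).ratio k hL
        have h3 : (0 : ℝ) ≤ i := Nat.cast_nonneg i
        have h4 := norm_nonneg (θ i k)
        nlinarith
    have h1 := key k hjk hk
    rw [norm_div, div_le_div_iff₀ (norm_pos_iff.2 ((h i).θ_ne k)) (by positivity)]
    linarith
  · rw [norm_div, div_le_div_iff₀ (norm_pos_iff.2 ((h i).θ_ne 0)) hδ]
    have := (h i).first hL
    linarith

variable {μ : YoungDiagram}

theorem eventually_coeff_source_ne_zero {L : ℕ} {ι : Type*} {l : Filter ι} {ħ : ι → ℂ}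
    {θ : ι → ℕ → ℂ} (h : SeparatedSeq L l ħ θ)
    {η : ι → ℂ} (hη : ∀ i, η i ≠ 0) (hη0 : Tendsto η l (𝓝 0)) {k : ℕ} (hk : k ≤ L) :
    ∀ᶠ i in l, (∏ j ∈ range L, (X - C (θ i j))).coeff k ≠ 0 := by
  obtain ⟨σ, hσ, h1, h2, _⟩ := h.exists_scale hη hη0 hk
  have h3 := coeffTendsto_prod_X_sub_C (l := l) (range L) (fun j => j < k) hσ (r := θ)
    (x := fun _ => 0) (fun j _ hj => h1 j hj)
    (fun j hj hjk => h2 j (not_lt.1 hjk) (mem_range.1 hj)) (fun j _ i => h.θ_ne i j)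
  have e : (range L).filter (fun j => j < k) = range k := by
    ext j; simp only [mem_filter, mem_range]; omega
  rw [e, prod_const, card_range, C_0, sub_zero] at h3
  have h4 := h3 k
  rw [coeff_X_pow_self] at h4
  filter_upwards [h4.eventually_ne one_ne_zero] with i hi h0
  exact hi (by rw [coeff_normScale, h0, zero_mul, zero_div])

theorem tendsto_div_one_of_norm_sub_le {ι : Type*} {l : Filter ι} {u v : ι → ℂ} {ε : ι → ℝ}
    (hε : Tendsto ε l (𝓝 0)) (h : ∀ i, ‖u i - v i‖ ≤ ε i * ‖v i‖) (hv : ∀ᶠ i in l, v i ≠ 0) :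
    Tendsto (fun i => u i / v i) l (𝓝 1) := by
  rw [tendsto_iff_norm_sub_tendsto_zero]
  refine squeeze_zero' (Eventually.of_forall fun i => norm_nonneg _) ?_ hε
  filter_upwards [hv] with i hi
  rw [div_sub_one hi, norm_div, div_le_iff₀ (norm_pos_iff.2 hi)]
  exact h i

theorem IsQFamily.coeff_eq_tabLead (hQ : IsQFamily μ ħ Q)
    (hdeg : (Q 0 0).natDegree = μ.card) (e : ℕ × ℕ → ℕ) (θ : ℕ → ℂ) {a s k : ℕ}
    (hk : boxCount μ.cells a s ≤ k) :
    (Q a s).coeff k = (tabLead μ.cells e θ a s).coeff k := by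
  rcases hk.lt_or_eq with h | rfl
  · rw [hQ.coeff_eq_zero hdeg h, coeff_eq_zero_of_natDegree_lt (by rwa [natDegree_tabLead])]
  · rw [hQ.coeff_boxCount hdeg]
    have := (tabLead_monic μ.cells e θ a s).coeff_natDegree
    rw [natDegree_tabLead] at this
    exact this.symm

theorem lt_boxCount_mem {a s k : ℕ} (hk : k < boxCount μ.cells a s) :
    (a, s) ∈ μ.cells ∧ k ∈ range μ.card := by
  constructor
  · by_contra h
    rw [boxCount_eq_zero h] at hk
    omega
  · exact mem_range.2 (hk.trans_le (card_filter_le _ _))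

theorem exists_isNear (μ : YoungDiagram) {δ : ℝ} (hδ : 0 < δ) {ε : ℝ} (hε : 0 < ε) :
    ∃ K η : ℝ, 0 < η ∧ ∀ ħ θ, WellSeparated μ.card δ K ħ θ → ∀ Q, IsQFamily μ ħ Q →
      (Q 0 0).natDegree = μ.card →
      (∀ k, ‖(Q 0 0).coeff k - (∏ j ∈ range μ.card, (X - C (θ j))).coeff k‖ ≤
        η * ‖(∏ j ∈ range μ.card, (X - C (θ j))).coeff k‖) →
      ∃ e, IsTab μ.cells e ∧ IsNear μ.cells e θ ε Q := by
  by_contra! hcon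
  have hpos : ∀ i : ℕ, (0 : ℝ) < 1 / ((i : ℝ) + 1) := fun i => by positivity
  choose ħ θ hsep Q hQ hdeg hsrc hno using fun i : ℕ => hcon (i + 1) (1 / ((i : ℝ) + 1)) (hpos i)
  have hS := separatedSeq_of_wellSeparated hδ hsep
  obtain ⟨e, he, hlim⟩ := exists_tab_tendsto (l := hyperfilter ℕ) hS inv_succ_ne_zero
    tendsto_inv_succ hQ hdeg (fun k hk => tendsto_div_one_of_norm_sub_le tendsto_inv_succ_real
      (fun i => hsrc i k)
      (eventually_coeff_source_ne_zero hS inv_succ_ne_zero tendsto_inv_succ hk))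
  have hev : ∀ᶠ i in (hyperfilter ℕ : Filter ℕ), ∀ c ∈ μ.cells, ∀ k ∈ range μ.card,
      ‖(Q i c.1 c.2).coeff k - (tabLead μ.cells e (θ i) c.1 c.2).coeff k‖ ≤
        ε * ‖(tabLead μ.cells e (θ i) c.1 c.2).coeff k‖ := by
    rw [Filter.eventually_all_finset]
    intro c hc
    rw [Filter.eventually_all_finset]
    intro k _
    by_cases hk : k ≤ boxCount μ.cells c.1 c.2
    · have h1 := tendsto_iff_norm_sub_tendsto_zero.1 (hlim c.1 c.2 k hk)
      filter_upwards [h1.eventually_le_const hε,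
        he.eventually_coeff_tabLead_ne_zero hS inv_succ_ne_zero tendsto_inv_succ hk] with i h2 h3
      rwa [div_sub_one h3, norm_div, div_le_iff₀ (norm_pos_iff.2 h3)] at h2
    · refine Eventually.of_forall fun i => ?_
      rw [(hQ i).coeff_eq_tabLead (hdeg i) e (θ i) (not_le.1 hk).le, sub_self, norm_zero]
      positivity
  obtain ⟨i, hi⟩ := hev.exists
  refine hno i e he fun a s k => ?_
  by_cases hk : k < boxCount μ.cells a s
  · obtain ⟨h1, h2⟩ := lt_boxCount_mem hk
    exact hi (a, s) h1 k h2
  · rw [(hQ i).coeff_eq_tabLead (hdeg i) e (θ i) (not_lt.1 hk), sub_self, norm_zero]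
    positivity

theorem le_sum_sum {α β : Type*} {s : Finset α} {t : Finset β} {f : α → β → ℝ}
    (hf : ∀ x y, 0 ≤ f x y) {x : α} {y : β} (hx : x ∈ s) (hy : y ∈ t) :
    f x y ≤ ∑ x ∈ s, ∑ y ∈ t, f x y :=
  (single_le_sum (f := f x) (fun y _ => hf x y) hy).trans
    (single_le_sum (f := fun x => ∑ y ∈ t, f x y) (fun x _ => sum_nonneg fun y _ => hf x y) hx)

theorem exists_lipschitz {δ : ℝ} (hδ : 0 < δ) {e : ℕ × ℕ → ℕ} (he : IsTab μ.cells e) :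
    ∃ K η C : ℝ, 0 < η ∧ ∀ ħ θ, WellSeparated μ.card δ K ħ θ → ∀ Q Q', IsQFamily μ ħ Q →
      (Q 0 0).natDegree = μ.card → IsQFamily μ ħ Q' → (Q' 0 0).natDegree = μ.card →
      IsNear μ.cells e θ η Q → IsNear μ.cells e θ η Q' → ∀ B : ℝ,
      (∀ k, ‖(Q 0 0).coeff k - (Q' 0 0).coeff k‖ ≤ B * ‖(tabLead μ.cells e θ 0 0).coeff k‖) →
      ∀ a s k, ‖(Q a s).coeff k - (Q' a s).coeff k‖ ≤
        C * B * ‖(tabLead μ.cells e θ a s).coeff k‖ := by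
  by_contra! hcon
  have hpos : ∀ i : ℕ, (0 : ℝ) < 1 / ((i : ℝ) + 1) := fun i => by positivity
  choose ħ θ hsep Q Q' hQ hdeg hQ' hdeg' hn hn' B hB a s k hno using
    fun i : ℕ => hcon (i + 1) (1 / ((i : ℝ) + 1)) (i + 1) (hpos i)
  have hS := separatedSeq_of_wellSeparated hδ hsep
  set T : ℕ → ℕ → ℕ → ℂ[X] := fun i => tabLead μ.cells e (θ i) with hT
  have hnear : ∀ {Q : ℕ → ℕ → ℕ → ℂ[X]},
      (∀ i : ℕ, IsNear μ.cells e (θ i) (1 / ((i : ℝ) + 1)) (Q i)) →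
      ∀ a s k, k ≤ boxCount μ.cells a s →
      Tendsto (fun i => (Q i a s).coeff k / (T i a s).coeff k) (hyperfilter ℕ) (𝓝 1) :=
    fun hn a s k hk => tendsto_div_one_of_norm_sub_le tendsto_inv_succ_real (fun i => hn i a s k)
      (he.eventually_coeff_tabLead_ne_zero hS inv_succ_ne_zero tendsto_inv_succ hk)
  have hzero : ∀ i a s k, (T i a s).coeff k = 0 → (Q i a s).coeff k - (Q' i a s).coeff k = 0 := by
    intro i a s k h0
    have h1 := hn i a s k
    have h2 := hn' i a s k
    simp only [hT] at h0
    rw [h0, norm_zero, mul_zero, sub_zero, norm_le_zero_iff] at h1 h2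
    rw [h1, h2, sub_zero]
  set M : ℕ → ℝ := fun i => ∑ c ∈ μ.cells, ∑ k ∈ range μ.card,
    ‖(Q i c.1 c.2).coeff k - (Q' i c.1 c.2).coeff k‖ / ‖(T i c.1 c.2).coeff k‖ with hM
  have hMle : ∀ i a s k, ‖(Q i a s).coeff k - (Q' i a s).coeff k‖ ≤ M i * ‖(T i a s).coeff k‖ := by
    intro i a s k
    by_cases hk : k < boxCount μ.cells a s
    · obtain ⟨h1, h2⟩ := lt_boxCount_mem hk
      by_cases h0 : (T i a s).coeff k = 0
      · rw [hzero i a s k h0, h0, norm_zero, mul_zero]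
      · rw [← div_le_iff₀ (norm_pos_iff.2 h0)]
        exact le_sum_sum (f := fun (c : ℕ × ℕ) k =>
          ‖(Q i c.1 c.2).coeff k - (Q' i c.1 c.2).coeff k‖ / ‖(T i c.1 c.2).coeff k‖)
          (fun _ _ => div_nonneg (norm_nonneg _) (norm_nonneg _)) h1 h2
    · rw [(hQ i).coeff_eq_tabLead (hdeg i) e (θ i) (not_lt.1 hk),
        (hQ' i).coeff_eq_tabLead (hdeg' i) e (θ i) (not_lt.1 hk), sub_self, norm_zero]
      exact mul_nonneg (sum_nonneg fun _ _ => sum_nonneg fun _ _ => by positivity) (norm_nonneg _)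
  have hB0 : ∀ i, 0 ≤ B i := by
    intro i
    have h1 := hB i μ.card
    have h2 : (tabLead μ.cells e (θ i) 0 0).coeff μ.card = 1 := by
      have := (tabLead_monic μ.cells e (θ i) 0 0).coeff_natDegree
      rwa [natDegree_tabLead, boxCount_zero_zero] at this
    rw [h2, norm_one, mul_one] at h1
    exact (norm_nonneg _).trans h1
  have hMB : ∀ i : ℕ, ((i : ℝ) + 1) * B i < M i := by
    intro i
    by_contra! hle
    exact absurd ((hMle i (a i) (s i) (k i)).trans
      (mul_le_mul_of_nonneg_right hle (norm_nonneg _))) (not_le.2 (hno i))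
  have hM0 : ∀ i, 0 < M i := fun i =>
    lt_of_le_of_lt (mul_nonneg (by positivity) (hB0 i)) (hMB i)
  have hMn : ∀ i, ‖((M i : ℝ) : ℂ)‖ = M i := fun i => by
    rw [Complex.norm_real, Real.norm_of_nonneg (hM0 i).le]
  have hlim := tendsto_relative_difference (l := hyperfilter ℕ) hS inv_succ_ne_zero
    tendsto_inv_succ he hQ hdeg hQ' hdeg' (hnear hn) (hnear hn') (M := fun i => ((M i : ℝ) : ℂ))
    (fun i => Complex.ofReal_ne_zero.2 (hM0 i).ne') (fun i a s k => by
      rw [hMn]; exact hMle i a s k)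
    (fun k => by
      refine squeeze_zero_norm (fun i => ?_) tendsto_inv_succ_real
      rw [norm_div, norm_mul, hMn]
      by_cases h0 : (T i 0 0).coeff k = 0
      · simp only [hT] at h0
        rw [h0, norm_zero, mul_zero, div_zero]
        exact (hpos i).le
      · have h1 := norm_pos_iff.2 h0
        rw [div_le_div_iff₀ (mul_pos (hM0 i) h1) (by positivity)]
        have h2 := hB i k
        have h3 := hMB i
        simp only [hT] at h1
        have h4 : (0 : ℝ) ≤ (i : ℝ) + 1 := by positivity
        calc _ ≤ B i * ‖(tabLead μ.cells e (θ i) 0 0).coeff k‖ * ((i : ℝ) + 1) :=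
              mul_le_mul_of_nonneg_right h2 h4
          _ = (((i : ℝ) + 1) * B i) * ‖(tabLead μ.cells e (θ i) 0 0).coeff k‖ := by ring
          _ ≤ _ := by rw [one_mul]; exact mul_le_mul_of_nonneg_right h3.le h1.le)
  have hsum := tendsto_finsetSum μ.cells fun c _ => tendsto_finsetSum (range μ.card)
    fun k _ => (hlim c.1 c.2 k).norm
  simp only [norm_zero, sum_const_zero] at hsum
  refine zero_ne_one (tendsto_nhds_unique hsum (tendsto_const_nhds.congr fun i => ?_))
  have h1 : M i / M i = 1 := div_self (hM0 i).ne'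
  rw [← h1]
  conv_lhs => rw [hM]
  simp only [sum_div]
  refine sum_congr rfl fun c _ => sum_congr rfl fun k _ => ?_
  rw [norm_div, norm_mul, hMn, div_div, mul_comm]

theorem exists_eq_of_comparable {δ : ℝ} (hδ : 0 < δ) {e e' : ℕ × ℕ → ℕ} (he : IsTab μ.cells e)
    (he' : IsTab μ.cells e') (B : ℝ) : ∃ K : ℝ, ∀ ħ θ, WellSeparated μ.card δ K ħ θ →
      (∀ a k, ‖(tabLead μ.cells e θ a 0).coeff k‖ ≤ B * ‖(tabLead μ.cells e' θ a 0).coeff k‖) →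
      (∀ a k, ‖(tabLead μ.cells e' θ a 0).coeff k‖ ≤ B * ‖(tabLead μ.cells e θ a 0).coeff k‖) →
      ∀ c ∈ μ.cells, e c = e' c := by
  by_contra! hcon
  choose ħ θ hsep h1 h2 hno using fun i : ℕ => hcon (i + 1)
  have hS := separatedSeq_of_wellSeparated hδ hsep
  obtain ⟨c, hc, hne⟩ := hno 0
  exact hne (eq_of_eventually_comparable hS inv_succ_ne_zero tendsto_inv_succ he he'
    (fun a k => Eventually.of_forall fun i => h1 i a k)
    (fun a k => Eventually.of_forall fun i => h2 i a k) c hc)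

/-- Tableaux are determined by approximate solutions, already by the first column. -/
theorem exists_eq_of_isNear (μ : YoungDiagram) {δ : ℝ} (hδ : 0 < δ) :
    ∃ K : ℝ, ∀ ħ θ, WellSeparated μ.card δ K ħ θ → ∀ e e', IsTab μ.cells e → IsTab μ.cells e' →
      ∀ f : ℕ → ℂ[X],
      (∀ a k, ‖(f a).coeff k - (tabLead μ.cells e θ a 0).coeff k‖ ≤
        1 / 2 * ‖(tabLead μ.cells e θ a 0).coeff k‖) →
      (∀ a k, ‖(f a).coeff k - (tabLead μ.cells e' θ a 0).coeff k‖ ≤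
        1 / 2 * ‖(tabLead μ.cells e' θ a 0).coeff k‖) → ∀ c ∈ μ.cells, e c = e' c := by
  obtain ⟨S, hS, hS'⟩ := exists_finset_tabs μ.cells
  obtain ⟨K, hK⟩ := exists_bound_of_finite (S ×ˢ S) (P := fun p K => ∀ ħ θ,
      WellSeparated μ.card δ K ħ θ →
      (∀ a k, ‖(tabLead μ.cells p.1 θ a 0).coeff k‖ ≤ 3 * ‖(tabLead μ.cells p.2 θ a 0).coeff k‖) →
      (∀ a k, ‖(tabLead μ.cells p.2 θ a 0).coeff k‖ ≤ 3 * ‖(tabLead μ.cells p.1 θ a 0).coeff k‖) →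
      ∀ c ∈ μ.cells, p.1 c = p.2 c) (by
    rintro ⟨e, e'⟩ h
    rw [mem_product] at h
    obtain ⟨K, hK⟩ := exists_eq_of_comparable hδ (hS e h.1) (hS e' h.2) 3
    exact ⟨K, fun K' h ħ θ hs => hK ħ θ (hs.mono h)⟩)
  refine ⟨K, fun ħ θ hs e e' he he' f h1 h2 => ?_⟩
  obtain ⟨x, hx, hex⟩ := hS' e he
  obtain ⟨x', hx', hex'⟩ := hS' e' he'
  have hcmp : ∀ {u v w : ℂ}, ‖u - v‖ ≤ 1 / 2 * ‖v‖ → ‖u - w‖ ≤ 1 / 2 * ‖w‖ → ‖v‖ ≤ 3 * ‖w‖ := by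
    intro u v w h1 h2
    have h3 := norm_sub_norm_le v u
    have h4 := norm_sub_norm_le u w
    rw [norm_sub_rev v u] at h3
    linarith
  simp only [tabLead_congr hex, tabLead_congr hex'] at h1 h2
  intro c hc
  rw [hex c hc, hex' c hc]
  exact hK (x, x') (mem_product.2 ⟨hx, hx'⟩) K le_rfl ħ θ hs
    (fun a k => hcmp (h1 a k) (h2 a k)) (fun a k => hcmp (h2 a k) (h1 a k)) c hc

end

/-! ### Tuples of polynomials in the gauge of the Wronskian Bethe equations -/

/-- The exponents, below the leading ones, which are left free by the gauge conditions. -/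
def gaugeIndex (M : ℕ) (d : ℕ → ℕ) : Finset (ℕ × ℕ) := (range M ×ˢ range (d 0)).filter fun p =>
    p.2 < d p.1 ∧ ∀ b ∈ range M, p.1 < b → p.2 ≠ d b

/-- The tuple of monic polynomials with given free coefficients. -/
noncomputable def gaugeTuple (M : ℕ) (d : ℕ → ℕ) (c : gaugeIndex M d → ℂ) (a : ℕ) : ℂ[X] :=
  X ^ d a + ∑ p, if p.1.1 = a then C (c p) * X ^ p.1.2 else 0

/-- The polynomials are monic of the given degrees and satisfy the gauge conditions. -/
def IsGaugeFixed (M : ℕ) (d : ℕ → ℕ) (g : ℕ → ℂ[X]) : Prop :=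
  ∀ a < M, (g a).Monic ∧ (g a).natDegree = d a ∧ ∀ b, a < b → b < M → (g a).coeff (d b) = 0

section

variable {M : ℕ} {d : ℕ → ℕ}

theorem mem_gaugeIndex (hd : ∀ a b, a < b → b < M → d b < d a) {a k : ℕ} :
    (a, k) ∈ gaugeIndex M d ↔ a < M ∧ k < d a ∧ ∀ b, a < b → b < M → k ≠ d b := by
  simp only [gaugeIndex, mem_filter, mem_product, mem_range]
  constructor
  · rintro ⟨⟨h1, _⟩, h2, h3⟩
    exact ⟨h1, h2, fun b hb hbM => h3 b hbM hb⟩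
  · rintro ⟨h1, h2, h3⟩
    refine ⟨⟨h1, ?_⟩, h2, fun b hbM hb => h3 b hb hbM⟩
    rcases Nat.eq_zero_or_pos a with rfl | h
    · exact h2
    · exact h2.trans (hd 0 a h h1)

theorem coeff_gaugeTuple (c : gaugeIndex M d → ℂ) (a k : ℕ) : (gaugeTuple M d c a).coeff k =
      (if k = d a then 1 else 0) + if h : (a, k) ∈ gaugeIndex M d then c ⟨(a, k), h⟩ else 0 := by
  rw [gaugeTuple, coeff_add, coeff_X_pow, finsetSum_coeff]
  congr 1
  split_ifs with h
  · rw [sum_eq_single ⟨(a, k), h⟩]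
    · simp
    · rintro ⟨⟨a', k'⟩, hp⟩ _ hne
      split_ifs with h1
      · rw [coeff_C_mul_X_pow, if_neg]
        rintro rfl
        simp only at h1
        subst h1
        exact hne rfl
      · simp
    · simp
  · refine sum_eq_zero fun p _ => ?_
    split_ifs with h1
    · rw [coeff_C_mul_X_pow, if_neg]
      rintro rfl
      subst h1
      exact h p.2
    · simp

theorem isGaugeFixed_gaugeTuple (hd : ∀ a b, a < b → b < M → d b < d a)
    (c : gaugeIndex M d → ℂ) : IsGaugeFixed M d (gaugeTuple M d c) := by
  intro a ha
  have h1 : (gaugeTuple M d c a).natDegree ≤ d a := by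
    rw [natDegree_le_iff_coeff_eq_zero]
    intro k hk
    rw [coeff_gaugeTuple, if_neg hk.ne', dif_neg, add_zero]
    rw [mem_gaugeIndex hd]
    omega
  have h2 : (gaugeTuple M d c a).coeff (d a) = 1 := by
    rw [coeff_gaugeTuple, if_pos rfl, dif_neg, add_zero]
    rw [mem_gaugeIndex hd]
    omega
  refine ⟨monic_of_natDegree_le_of_coeff_eq_one _ h1 h2,
    le_antisymm h1 (le_natDegree_of_ne_zero (by rw [h2]; exact one_ne_zero)), fun b hb hbM => ?_⟩
  rw [coeff_gaugeTuple, if_neg (hd a b hb hbM).ne, dif_neg, add_zero]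
  rw [mem_gaugeIndex hd]
  exact fun h => h.2.2 b hb hbM rfl

theorem IsGaugeFixed.exists_gaugeTuple (hd : ∀ a b, a < b → b < M → d b < d a) {g : ℕ → ℂ[X]}
    (hg : IsGaugeFixed M d g) : ∃ c, ∀ a < M, gaugeTuple M d c a = g a := by
  refine ⟨fun p => (g p.1.1).coeff p.1.2, fun a ha => ?_⟩
  obtain ⟨h1, h2, h3⟩ := hg a ha
  ext k
  rw [coeff_gaugeTuple]
  rcases lt_trichotomy k (d a) with hk | rfl | hk
  · rw [if_neg hk.ne, zero_add]
    split_ifs with h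
    · rfl
    · rw [mem_gaugeIndex hd] at h
      push Not at h
      obtain ⟨b, hb, hbM, rfl⟩ := h ha hk
      exact (h3 b hb hbM).symm
  · rw [if_pos rfl, dif_neg (by rw [mem_gaugeIndex hd]; omega), add_zero, ← h2]
    exact h1.symm
  · rw [if_neg hk.ne', dif_neg (by rw [mem_gaugeIndex hd]; omega), add_zero,
      coeff_eq_zero_of_natDegree_lt (by omega)]

theorem card_gaugeIndex (hd : ∀ a b, a < b → b < M → d b < d a) :
    (gaugeIndex M d).card = ∑ a ∈ range M, (d a - (M - 1 - a)) := by
  rw [card_eq_sum_card_fiberwise (f := Prod.fst) (t := range M)]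
  · refine sum_congr rfl fun a ha => ?_
    rw [mem_range] at ha
    have hinj : Set.InjOn d (Finset.Ioo a M : Set ℕ) := by
      intro b hb b' hb' h
      rw [coe_Ioo, Set.mem_Ioo] at hb hb'
      rcases lt_trichotomy b b' with h1 | h1 | h1
      · exact absurd h (hd b b' h1 hb'.2).ne'
      · exact h1
      · exact absurd h (hd b' b h1 hb.2).ne
    have h1 : ((range (d a)) \ (Finset.Ioo a M).image d).card = d a - (M - 1 - a) := by
      rw [card_sdiff_of_subset, card_image_of_injOn hinj, card_range, Nat.card_Ioo]
      · congr 1; omega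
      · intro x hx
        obtain ⟨b, hb, rfl⟩ := mem_image.1 hx
        rw [mem_Ioo] at hb
        exact mem_range.2 (hd a b hb.1 hb.2)
    rw [← h1]
    refine card_bij' (fun p _ => p.2) (fun k _ => (a, k)) ?_ ?_ ?_ ?_
    · rintro ⟨x, k⟩ hp
      rw [mem_filter] at hp
      obtain ⟨hp, rfl⟩ := hp
      rw [mem_gaugeIndex hd] at hp
      rw [mem_sdiff, mem_range, mem_image]
      refine ⟨hp.2.1, ?_⟩
      rintro ⟨b, hb, h⟩
      rw [mem_Ioo] at hb
      exact hp.2.2 b hb.1 hb.2 h.symm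
    · intro k hk
      rw [mem_sdiff, mem_range, mem_image] at hk
      rw [mem_filter, mem_gaugeIndex hd]
      exact ⟨⟨ha, hk.1, fun b hb hbM h => hk.2 ⟨b, mem_Ioo.2 ⟨hb, hbM⟩, h.symm⟩⟩, rfl⟩
    · rintro ⟨x, k⟩ hp
      rw [mem_filter] at hp
      rw [← hp.2]
    · intro k _; rfl
  · intro p hp
    exact mem_coe.2 (mem_range.2 ((mem_gaugeIndex hd).1 hp).1)

/-- The symmetries of the Wronskian Bethe equations can be used to fix the gauge. -/
theorem exists_isGaugeFixed (hd : ∀ a b, a < b → b < M → d b < d a) {f : ℕ → ℂ[X]}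
    (hf : ∀ a < M, f a ≠ 0 ∧ (f a).natDegree = d a) :
    ∃ g, IsGaugeFixed M d g ∧ ∀ a < M, g a ∈ Submodule.span ℂ (f '' Set.Ico a M) := by
  have key : ∀ a < M, ∀ m, a + 1 ≤ m → m ≤ M → ∃ p ∈ Submodule.span ℂ (f '' Set.Ico a M),
      p.Monic ∧ p.natDegree = d a ∧ ∀ b, a < b → b < m → p.coeff (d b) = 0 := by
    intro a ha m hm
    have hlc : ∀ b < M, (f b).coeff (d b) ≠ 0 := fun b hb => by
      rw [← (hf b hb).2]; exact leadingCoeff_ne_zero.2 (hf b hb).1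
    have hmem : ∀ b, a ≤ b → b < M → ∀ x : ℂ, C x * f b ∈ Submodule.span ℂ (f '' Set.Ico a M) :=
      fun b h1 h2 x => by
        rw [← smul_eq_C_mul]
        exact Submodule.smul_mem _ _ (Submodule.subset_span ⟨b, ⟨h1, h2⟩, rfl⟩)
    induction m, hm using Nat.le_induction with
    | base =>
      intro _
      have h0 : (C ((f a).coeff (d a))⁻¹ * f a).natDegree = d a := by
        rw [natDegree_C_mul (inv_ne_zero (hlc a ha)), (hf a ha).2]
      refine ⟨_, hmem a le_rfl ha _, ?_, h0, fun b h1 h2 => by omega⟩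
      rw [Monic, leadingCoeff, h0, coeff_C_mul, inv_mul_cancel₀ (hlc a ha)]
    | succ m hm ih =>
      intro hmM
      obtain ⟨p, hp1, hp2, hp3, hp4⟩ := ih (by omega)
      have hlt : d m < d a := hd a m hm (by omega)
      have hdeg : (C (p.coeff (d m) / (f m).coeff (d m)) * f m).natDegree < p.natDegree := by
        refine (natDegree_C_mul_le _ _).trans_lt ?_
        rw [(hf m (by omega)).2, hp3]; exact hlt
      refine ⟨p - C (p.coeff (d m) / (f m).coeff (d m)) * f m,
        Submodule.sub_mem _ hp1 (hmem m (by omega) (by omega) _), hp2.sub_of_left ?_, ?_, ?_⟩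
      · exact degree_lt_degree hdeg
      · rw [natDegree_sub_eq_left_of_natDegree_lt hdeg, hp3]
      · intro b h1 h2
        rw [coeff_sub, coeff_C_mul]
        rcases (Nat.lt_succ_iff.1 h2).lt_or_eq with h3 | rfl
        · have h4 : (f m).coeff (d b) = 0 := coeff_eq_zero_of_natDegree_lt (by
            rw [(hf m (by omega)).2]; exact hd b m h3 (by omega))
          rw [hp4 b h1 h3, h4, mul_zero, sub_zero]
        · rw [div_mul_cancel₀ _ (hlc b (by omega)), sub_self]
  choose! p hp using fun a (ha : a < M) => key a ha M ha le_rfl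
  exact ⟨p, fun a ha => (hp a ha).2, fun a ha => (hp a ha).1⟩

theorem casTail_congr (ħ : ℂ) {P P' : ℕ → ℂ[X]} (h : ∀ a < M, P a = P' a) (a : ℕ) :
    casTail ħ M P a = casTail ħ M P' a := by
  unfold casTail
  congr 1
  funext i
  exact h _ (by omega)

theorem casTail_propto_of_mem_span (hħ : ħ ≠ 0)
    (hd : ∀ a b, a < b → b < M → d b < d a) {f g : ℕ → ℂ[X]}
    (hg : ∀ a < M, g a ≠ 0 ∧ (g a).natDegree = d a)
    (hs : ∀ a < M, g a ∈ Submodule.span ℂ (f '' Set.Ico a M)) (a : ℕ) :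
    Propto (casTail ħ M g a) (casTail ħ M f a) := by
  refine cas_propto_of_mem_span hħ rfl (fun i => (hg _ (by omega)).1) (fun i j hij => ?_)
    (fun i => ?_)
  · simp only [(hg (a + i) (by omega)).2, (hg (a + j) (by omega)).2] at hij
    rcases lt_trichotomy (i : ℕ) j with h | h | h
    · exact absurd hij (hd _ _ (by omega) (by omega)).ne'
    · exact Fin.ext h
    · exact absurd hij (hd _ _ (by omega) (by omega)).ne
  · refine Submodule.span_mono ?_ (hs (a + i) (by omega))
    rintro _ ⟨b, hb, rfl⟩
    obtain ⟨h1, h2⟩ := Set.mem_Ico.1 hb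
    exact ⟨⟨b - a, by omega⟩, by simp only; congr 1; omega⟩

theorem casTail_eq_cons (ħ : ℂ) (P : ℕ → ℂ[X]) {a : ℕ} (ha : a < M) :
    casTail ħ M P a = cas ħ (Fin.cons (P a) (fun i : Fin (M - (a + 1)) => P (a + 1 + i)) :
      Fin (M - (a + 1) + 1) → ℂ[X]) := by
  have h : M - (a + 1) + 1 = M - a := by omega
  rw [casTail, ← cas_cast ħ h]
  congr 1
  funext i
  refine Fin.cases ?_ (fun j => ?_) i
  · simp
  · simp only [Fin.cons_succ]
    congr 1
    simp; omega

end

/-! ### The first column -/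

section

variable {μ : YoungDiagram} {M : ℕ}

theorem rowLen_eq_zero_of_le (hM : (M, 0) ∉ μ) {a : ℕ} (ha : M ≤ a) : μ.rowLen a = 0 := by
  by_contra h
  exact hM (μ.up_left_mem ha le_rfl (mem_iff_lt_rowLen.2 (Nat.pos_of_ne_zero h)))

theorem boxCount_succ_left (a s : ℕ) :
    boxCount μ.cells a s = boxCount μ.cells (a + 1) s + (μ.rowLen a - s) := by
  have h : μ.cells.filter (fun c : ℕ × ℕ => a ≤ c.1 ∧ s ≤ c.2) =
      (μ.cells.filter fun c : ℕ × ℕ => a + 1 ≤ c.1 ∧ s ≤ c.2) ∪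
        (Finset.Ico s (μ.rowLen a)).image fun k => (a, k) := by
    ext ⟨x, y⟩
    simp only [mem_union, mem_filter, mem_image, mem_Ico, Prod.mk.injEq, mem_cells]
    constructor
    · rintro ⟨h1, h2, h3⟩
      rcases h2.lt_or_eq with h | rfl
      · exact Or.inl ⟨h1, h, h3⟩
      · exact Or.inr ⟨y, ⟨h3, mem_iff_lt_rowLen.1 h1⟩, rfl, rfl⟩
    · rintro (⟨h1, h2, h3⟩ | ⟨k, ⟨h1, h2⟩, rfl, rfl⟩)
      · exact ⟨h1, by omega, h3⟩
      · exact ⟨mem_iff_lt_rowLen.2 h2, le_rfl, h1⟩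
  rw [boxCount, h, card_union_of_disjoint, card_image_of_injective, Nat.card_Ico]
  · rfl
  · intro k k' h; exact (Prod.mk.inj h).2
  · rw [disjoint_left]
    rintro ⟨x, y⟩ h1 h2
    simp only [mem_filter, mem_image, Prod.mk.injEq] at h1 h2
    obtain ⟨k, _, h3, _⟩ := h2
    omega

theorem boxCount_eq_sum_rowLen (hM : (M, 0) ∉ μ) (a : ℕ) :
    boxCount μ.cells a 0 = ∑ i : Fin (M - a), μ.rowLen (a + i) := by
  rw [Fin.sum_univ_eq_sum_range (fun i => μ.rowLen (a + i))]
  induction hm : M - a generalizing a with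
  | zero =>
    rw [sum_range_zero, boxCount_eq_zero]
    exact fun h => hM (μ.up_left_mem (by omega) le_rfl h)
  | succ m ih =>
    rw [boxCount_succ_left, ih (a + 1) (by omega), sum_range_succ']
    simp only [Nat.sub_zero, add_zero]
    congr 1
    exact sum_congr rfl fun i _ => by rw [add_right_comm, add_assoc]

theorem boxCount_add_sum (hM : (M, 0) ∉ μ) (a : ℕ) :
    boxCount μ.cells a 0 + ∑ k : Fin (M - a), (k : ℕ) = ∑ i : Fin (M - a), rowDeg μ M (a + i) := by
  rw [boxCount_eq_sum_rowLen hM, ← Equiv.sum_comp Fin.revPerm, ← sum_add_distrib,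
    ← Equiv.sum_comp Fin.revPerm]
  refine sum_congr rfl fun i _ => ?_
  simp only [rowDeg, Fin.revPerm_apply, Fin.rev_rev, Fin.val_rev]
  omega

/-- The leading coefficient of the Wronskian of monic polynomials of degrees `rowDeg μ M b`,
`a ≤ b < M`. -/
noncomputable def tailLead (μ : YoungDiagram) (ħ : ℂ) (M a : ℕ) : ℂ :=
  casLead ħ fun i : Fin (M - a) => rowDeg μ M (a + i)

theorem tailLead_ne_zero (hħ : ħ ≠ 0) (a : ℕ) : tailLead μ ħ M a ≠ 0 := by
  refine casLead_ne_zero hħ fun i j hij => ?_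
  rcases lt_trichotomy (i : ℕ) j with h | h | h
  · exact absurd hij (rowDeg_strictAnti (by omega) (by omega)).ne'
  · exact Fin.ext h
  · exact absurd hij (rowDeg_strictAnti (by omega) (by omega)).ne

theorem natDegree_casTail_le (hM : (M, 0) ∉ μ) (ħ : ℂ)
    (hP : ∀ b < M, (P b).natDegree ≤ rowDeg μ M b) (a : ℕ) :
    (casTail ħ M P a).natDegree ≤ boxCount μ.cells a 0 := by
  rw [natDegree_le_iff_coeff_eq_zero]
  intro k hk
  refine coeff_cas_eq_zero ħ _ (fun i => rowDeg μ M (a + i)) (fun i => hP _ (by omega)) ?_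
  rw [← boxCount_add_sum hM]
  omega

theorem coeff_casTail (hM : (M, 0) ∉ μ) (ħ : ℂ) (hP : ∀ b < M, (P b).natDegree ≤ rowDeg μ M b)
    (a : ℕ) :
    (casTail ħ M P a).coeff (boxCount μ.cells a 0) =
      (∏ i : Fin (M - a), (P (a + i)).coeff (rowDeg μ M (a + i))) * tailLead μ ħ M a :=
  coeff_cas ħ _ _ (fun i => hP _ (by omega)) (boxCount_add_sum hM a)

theorem casTail_of_le (ħ : ℂ) {M : ℕ} (P : ℕ → ℂ[X]) {a : ℕ} (ha : M ≤ a) :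
    casTail ħ M P a = 1 := by
  have : IsEmpty (Fin (M - a)) := by rw [Nat.sub_eq_zero_of_le ha]; infer_instance
  rw [casTail, cas, det_isEmpty]

theorem exists_isQFamily_column (hħ : ħ ≠ 0) (hM : (M, 0) ∉ μ) (hP : HasRowDegrees μ M P) :
    ∃ Q, IsQFamily μ ħ Q ∧ (Q 0 0).natDegree = μ.card ∧
      ∀ a, Propto (Q a 0) (casTail ħ M P a) := by
  obtain ⟨Q, hQ, h⟩ := exists_isQFamily hħ hM hP
  have hcol : ∀ a, Propto (Q a 0) (casTail ħ M P a) := by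
    intro a
    rcases le_or_gt a M with ha | ha
    · rw [← cas_nodeTuple_zero μ]
      exact h a ha 0 (Or.inl rfl)
    · rw [hQ.eq_one a 0 fun h => hM (μ.up_left_mem ha.le le_rfl h), casTail_of_le ħ P ha.le]
      exact Propto.refl 1
  refine ⟨Q, hQ, ?_, hcol⟩
  have hle : ∀ b < M, (P b).natDegree ≤ rowDeg μ M b := fun b hb => (hP b hb).2.le
  rw [(hcol 0).natDegree_eq, ← show boxCount μ.cells 0 0 = μ.card from boxCount_zero_zero _]
  refine le_antisymm (natDegree_casTail_le hM ħ hle 0) (le_natDegree_of_ne_zero ?_)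
  rw [coeff_casTail hM ħ hle]
  refine mul_ne_zero (prod_ne_zero_iff.2 fun i _ => ?_) (tailLead_ne_zero hħ 0)
  have h1 := hP (0 + i) (by omega)
  rw [← h1.2]
  exact leadingCoeff_ne_zero.2 h1.1

/-- The normalised Wronskians of the tuple with given free coefficients. -/
noncomputable def tailPoly (μ : YoungDiagram) (ħ : ℂ) (M : ℕ)
    (c : gaugeIndex M (rowDeg μ M) → ℂ) (a : ℕ) : ℂ[X] :=
  C (tailLead μ ħ M a)⁻¹ * casTail ħ M (gaugeTuple M (rowDeg μ M) c) a

theorem hasRowDegrees_gaugeTuple (c : gaugeIndex M (rowDeg μ M) → ℂ) :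
    HasRowDegrees μ M (gaugeTuple M (rowDeg μ M) c) := fun a ha =>
  have h := isGaugeFixed_gaugeTuple (fun _ _ h h' => rowDeg_strictAnti h h') c a ha
  ⟨h.1.ne_zero, h.2.1⟩

theorem coeff_tailPoly (hħ : ħ ≠ 0) (hM : (M, 0) ∉ μ) (c : gaugeIndex M (rowDeg μ M) → ℂ) (a : ℕ) :
    (tailPoly μ ħ M c a).coeff (boxCount μ.cells a 0) = 1 := by
  rw [tailPoly, coeff_C_mul, coeff_casTail hM ħ fun b hb => (hasRowDegrees_gaugeTuple c b hb).2.le,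
    prod_eq_one, one_mul, inv_mul_cancel₀ (tailLead_ne_zero hħ a)]
  intro i _
  have h := isGaugeFixed_gaugeTuple (d := rowDeg μ M) (fun _ _ h h' => rowDeg_strictAnti h h') c
    (a + i) (by omega)
  conv_lhs => rw [← h.2.1]
  exact h.1

theorem natDegree_tailPoly_le (hM : (M, 0) ∉ μ) (ħ : ℂ)
    (c : gaugeIndex M (rowDeg μ M) → ℂ) (a : ℕ) :
    (tailPoly μ ħ M c a).natDegree ≤ boxCount μ.cells a 0 :=
  (natDegree_C_mul_le _ _).trans
    (natDegree_casTail_le hM ħ (fun b hb => (hasRowDegrees_gaugeTuple c b hb).2.le) a)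

theorem exists_isQFamily_tailPoly (hħ : ħ ≠ 0) (hM : (M, 0) ∉ μ)
    (c : gaugeIndex M (rowDeg μ M) → ℂ) : ∃ Q, IsQFamily μ ħ Q ∧ (Q 0 0).natDegree = μ.card ∧
      ∀ a, Q a 0 = tailPoly μ ħ M c a := by
  obtain ⟨Q, hQ, h0, h⟩ := exists_isQFamily_column hħ hM (hasRowDegrees_gaugeTuple c)
  refine ⟨Q, hQ, h0, fun a => ?_⟩
  refine Propto.eq_of_monic ((h a).trans ?_) (hQ.monic a 0)
    (monic_of_natDegree_le_of_coeff_eq_one _ (natDegree_tailPoly_le hM ħ c a)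
      (coeff_tailPoly hħ hM c a))
  exact Propto.symm ⟨_, inv_ne_zero (tailLead_ne_zero hħ a), rfl⟩

/-- Any tuple with the right degrees can be gauge-fixed. -/
theorem exists_tailPoly_eq (hħ : ħ ≠ 0) (hP : HasRowDegrees μ M P) : ∃ c, ∀ a, Propto
    (tailPoly μ ħ M c a) (casTail ħ M P a) := by
  have hd : ∀ a b, a < b → b < M → rowDeg μ M b < rowDeg μ M a := fun _ _ h h' =>
    rowDeg_strictAnti h h'
  obtain ⟨g, hg, hs⟩ := exists_isGaugeFixed hd hP
  obtain ⟨c, hc⟩ := hg.exists_gaugeTuple hd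
  refine ⟨c, fun a => Propto.trans ⟨_, inv_ne_zero (tailLead_ne_zero hħ a), rfl⟩ ?_⟩
  rw [casTail_congr ħ hc]
  exact casTail_propto_of_mem_span hħ hd (fun a ha => ⟨(hg a ha).1.ne_zero, (hg a ha).2.1⟩) hs a

theorem card_gaugeIndex_rowDeg (hM : (M, 0) ∉ μ) : (gaugeIndex M (rowDeg μ M)).card = μ.card := by
  rw [card_gaugeIndex fun _ _ h h' => rowDeg_strictAnti h h',
    ← show boxCount μ.cells 0 0 = μ.card from boxCount_zero_zero _, boxCount_eq_sum_rowLen hM,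
    Fin.sum_univ_eq_sum_range (fun i => μ.rowLen (0 + i)), Nat.sub_zero]
  exact sum_congr rfl fun a _ => by rw [rowDeg, zero_add]; omega

end

/-! ### Polynomials which depend smoothly on parameters -/

section

open Filter Topology

theorem exists_lift {ι κ : Type*} [Fintype ι] [Fintype κ] (hcard : Fintype.card ι = Fintype.card κ)
    {F : (ι → ℂ) → κ → ℂ} {z₀ : ι → ℂ} (hF : ContDiffAt ℂ 1 F z₀)
    (hinj : ∀ v : ι → ℂ, HasDerivAt (fun t : ℂ => F (z₀ + t • v)) 0 0 → v = 0) :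
    ∃ G : (κ → ℂ) → ι → ℂ, Tendsto G (𝓝 (F z₀)) (𝓝 z₀) ∧ ∀ᶠ y in 𝓝 (F z₀), F (G y) = y := by
  have h := hF.hasStrictFDerivAt one_ne_zero
  have hker : Function.Injective (fderiv ℂ F z₀ : (ι → ℂ) →ₗ[ℂ] κ → ℂ) := by
    rw [← LinearMap.ker_eq_bot, LinearMap.ker_eq_bot']
    intro v hv
    refine hinj v ?_
    have h1 : HasDerivAt (fun t : ℂ => z₀ + t • v) v 0 := by
      have := ((hasDerivAt_id (0 : ℂ)).smul_const v).const_add z₀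
      simpa using this
    have h2 : HasFDerivAt F (fderiv ℂ F z₀) (z₀ + (0 : ℂ) • v) := by
      rw [zero_smul, add_zero]; exact h.hasFDerivAt
    have h3 := h2.comp_hasDerivAt (0 : ℂ) h1
    have h4 : fderiv ℂ F z₀ v = 0 := hv
    rwa [h4] at h3
  have hrank : Module.finrank ℂ (ι → ℂ) = Module.finrank ℂ (κ → ℂ) := by
    rw [Module.finrank_fintype_fun_eq_card, Module.finrank_fintype_fun_eq_card, hcard]
  set e := (LinearEquiv.ofInjectiveOfFinrankEq _ hker hrank).toContinuousLinearEquiv with he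
  have h' : HasStrictFDerivAt F (e : (ι → ℂ) →L[ℂ] κ → ℂ) z₀ := by
    have h2 : (e : (ι → ℂ) →L[ℂ] κ → ℂ) = fderiv ℂ F z₀ := by
      ext1 v
      exact LinearMap.congr_fun (LinearEquiv.coe_ofInjectiveOfFinrankEq _ hker hrank) v
    rwa [h2]
  exact ⟨_, h'.localInverse_tendsto, h'.eventually_right_inverse⟩

variable {E : Type*} [NormedAddCommGroup E] [NormedSpace ℂ E]

/-- All coefficients depend smoothly on the parameters. -/
def CoeffSmooth (f : E → ℂ[X]) : Prop := ∀ k, ContDiff ℂ 1 fun z => (f z).coeff k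

theorem CoeffSmooth.const (g : ℂ[X]) : CoeffSmooth fun _ : E => g := fun _ => contDiff_const

theorem CoeffSmooth.C {f : E → ℂ} (hf : ContDiff ℂ 1 f) : CoeffSmooth fun z => C (f z) := by
  intro k
  simp only [coeff_C]
  split_ifs
  · exact hf
  · exact contDiff_const

theorem CoeffSmooth.add {f g : E → ℂ[X]} (hf : CoeffSmooth f) (hg : CoeffSmooth g) :
    CoeffSmooth fun z => f z + g z := by
  intro k
  simp only [coeff_add]
  exact (hf k).add (hg k)

theorem CoeffSmooth.mul {f g : E → ℂ[X]} (hf : CoeffSmooth f) (hg : CoeffSmooth g) :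
    CoeffSmooth fun z => f z * g z := by
  intro k
  simp only [coeff_mul]
  exact ContDiff.sum fun p _ => (hf p.1).mul (hg p.2)

theorem CoeffSmooth.sum {α : Type*} {s : Finset α} {f : α → E → ℂ[X]}
    (hf : ∀ x ∈ s, CoeffSmooth (f x)) : CoeffSmooth fun z => ∑ x ∈ s, f x z := by
  intro k
  simp only [finsetSum_coeff]
  exact ContDiff.sum fun x hx => hf x hx k

theorem CoeffSmooth.prod {α : Type*} {s : Finset α} {f : α → E → ℂ[X]}
    (hf : ∀ x ∈ s, CoeffSmooth (f x)) : CoeffSmooth fun z => ∏ x ∈ s, f x z := by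
  classical
  induction s using Finset.induction_on with
  | empty => simpa using CoeffSmooth.const 1
  | insert b s hb ih =>
    simp only [prod_insert hb]
    exact (hf b (mem_insert_self _ _)).mul (ih fun x hx => hf x (mem_insert_of_mem hx))

theorem CoeffSmooth.shift (ħ : ℂ) (k : ℤ) {f : E → ℂ[X]} (hf : CoeffSmooth f) {D : ℕ}
    (hD : ∀ z, (f z).natDegree ≤ D) : CoeffSmooth fun z => shift ħ k (f z) := by
  simp only [fun z => shift_eq_sum ħ k (hD z)]
  exact CoeffSmooth.sum fun j _ => (CoeffSmooth.C (hf j)).mul (CoeffSmooth.const _)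

theorem CoeffSmooth.cas (ħ : ℂ) {p : ℕ} {f : E → Fin p → ℂ[X]}
    (hf : ∀ i, CoeffSmooth fun z => f z i)
    {D : ℕ} (hD : ∀ z i, (f z i).natDegree ≤ D) : CoeffSmooth fun z => cas ħ (f z) := by
  simp only [TwistlessQSystem.cas, det_apply']
  refine CoeffSmooth.sum fun σ _ => (CoeffSmooth.const _).mul (CoeffSmooth.prod fun i _ => ?_)
  exact (hf _).shift ħ _ fun z => hD z _

theorem CoeffSmooth.tendsto {f : E → ℂ[X]} (hf : CoeffSmooth f) {ι : Type*} {l : Filter ι}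
    {z : ι → E} {z₀ : E} (hz : Tendsto z l (𝓝 z₀)) : CoeffTendsto (fun i => f (z i)) l (f z₀) :=
  fun k => ((hf k).continuous.tendsto z₀).comp hz

theorem CoeffTendsto.cas (ħ : ℂ) {ι : Type*} {l : Filter ι} {p : ℕ} {f : ι → Fin p → ℂ[X]}
    {g : Fin p → ℂ[X]} (h : ∀ j, CoeffTendsto (fun i => f i j) l (g j)) {D : ℕ}
    (hf : ∀ i j, (f i j).natDegree ≤ D) (hg : ∀ j, (g j).natDegree ≤ D) :
    CoeffTendsto (fun i => cas ħ (f i)) l (cas ħ g) := by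
  have hS : CoeffSmooth fun z : Fin p → Fin (D + 1) → ℂ =>
      TwistlessQSystem.cas ħ fun j => ∑ k : Fin (D + 1), Polynomial.C (z j k) * X ^ (k : ℕ) := by
    refine CoeffSmooth.cas (D := D) ħ (fun j => CoeffSmooth.sum fun k _ =>
      (CoeffSmooth.C ?_).mul (CoeffSmooth.const _)) fun z j => ?_
    · exact contDiff_apply_apply ℂ ℂ j k
    · exact natDegree_sum_le_of_forall_le _ _ fun k _ =>
        (natDegree_C_mul_X_pow_le _ _).trans (by omega)
  have e : ∀ F : Fin p → ℂ[X], (∀ j, (F j).natDegree ≤ D) →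
      (fun j => ∑ k : Fin (D + 1), Polynomial.C ((F j).coeff k) * X ^ (k : ℕ)) = F := by
    intro F hF
    funext j
    rw [Fin.sum_univ_eq_sum_range (fun k => Polynomial.C ((F j).coeff k) * X ^ k), ← eq_sum_C_mul_X_pow (hF j)]
  have h1 := hS.tendsto (l := l) (z := fun i j k => (f i j).coeff (k : ℕ))
    (z₀ := fun j k => (g j).coeff (k : ℕ))
    (tendsto_pi_nhds.2 fun j => tendsto_pi_nhds.2 fun k => h j k)
  rw [e g hg] at h1
  exact h1.congr' (Eventually.of_forall fun i => by rw [e (f i) (hf i)])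

theorem coeffSmooth_gaugeTuple (M : ℕ) (d : ℕ → ℕ) (a : ℕ) :
    CoeffSmooth fun c : gaugeIndex M d → ℂ => gaugeTuple M d c a := by
  refine (CoeffSmooth.const _).add (CoeffSmooth.sum fun p _ => ?_)
  split_ifs
  · exact (CoeffSmooth.C (contDiff_apply ℂ ℂ p)).mul (CoeffSmooth.const _)
  · exact CoeffSmooth.const _

end

section

open Filter Topology

variable {μ : YoungDiagram} {M : ℕ}

theorem rowDeg_le (μ : YoungDiagram) (M : ℕ) {a b : ℕ} (hab : a ≤ b) (hb : b < M) :
    rowDeg μ M b ≤ rowDeg μ M a := by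
  rcases hab.lt_or_eq with h | rfl
  · exact (rowDeg_strictAnti h hb).le
  · exact le_rfl

theorem natDegree_gaugeTuple_le (c : gaugeIndex M (rowDeg μ M) → ℂ) {a : ℕ} (ha : a < M) :
    (gaugeTuple M (rowDeg μ M) c a).natDegree ≤ rowDeg μ M 0 :=
  (hasRowDegrees_gaugeTuple c a ha).2.le.trans (rowDeg_le μ M (Nat.zero_le a) ha)

theorem coeffSmooth_tailPoly (μ : YoungDiagram) (ħ : ℂ) (M a : ℕ) :
    CoeffSmooth fun c => tailPoly μ ħ M c a := by
  refine (CoeffSmooth.const _).mul (CoeffSmooth.cas (D := rowDeg μ M 0) ħ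
    (fun i => coeffSmooth_gaugeTuple M _ _) fun z i => natDegree_gaugeTuple_le z (by omega))

/-- The variation of the `a`-th polynomial of a tuple. -/
noncomputable def gaugeVar (M : ℕ) (d : ℕ → ℕ) (c : gaugeIndex M d → ℂ) (a : ℕ) : ℂ[X] :=
  ∑ p, if p.1.1 = a then C (c p) * X ^ p.1.2 else 0

theorem gaugeTuple_eq (d : ℕ → ℕ) (c : gaugeIndex M d → ℂ) (a : ℕ) :
    gaugeTuple M d c a = X ^ d a + gaugeVar M d c a := rfl

theorem gaugeVar_linear (d : ℕ → ℕ) (c v : gaugeIndex M d → ℂ) (t : ℂ) (a : ℕ) :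
    gaugeVar M d (c + t • v) a = gaugeVar M d c a + C t * gaugeVar M d v a := by
  rw [gaugeVar, gaugeVar, gaugeVar, mul_sum, ← sum_add_distrib]
  refine sum_congr rfl fun p _ => ?_
  split_ifs
  · simp only [Pi.add_apply, Pi.smul_apply, smul_eq_mul, C_add, C_mul]; ring
  · ring

theorem coeff_gaugeVar {d : ℕ → ℕ} (c : gaugeIndex M d → ℂ) (a k : ℕ) :
    (gaugeVar M d c a).coeff k = if h : (a, k) ∈ gaugeIndex M d then c ⟨(a, k), h⟩ else 0 := by
  have h := coeff_gaugeTuple c a k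
  rw [gaugeTuple_eq, coeff_add, coeff_X_pow] at h
  exact add_left_cancel h

theorem gaugeVar_eq_zero_of_cas (hħ : ħ ≠ 0) (c v : gaugeIndex M (rowDeg μ M) → ℂ) {a : ℕ}
    (h : cas ħ (Fin.cons (gaugeVar M _ v a) (fun i : Fin (M - (a + 1)) =>
      gaugeTuple M _ c (a + 1 + i)) : Fin (M - (a + 1) + 1) → ℂ[X]) = 0) :
    gaugeVar M _ v a = 0 := by
  have hP := hasRowDegrees_gaugeTuple c
  have hd : ∀ a b, a < b → b < M → rowDeg μ M b < rowDeg μ M a := fun _ _ h h' =>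
    rowDeg_strictAnti h h'
  refine eq_zero_of_cas_cons_eq_zero hħ (fun i => (hP _ (by omega)).1) (fun i j hij => ?_)
    (fun i => ?_) h
  · simp only [(hP (a + 1 + i) (by omega)).2, (hP (a + 1 + j) (by omega)).2] at hij
    rcases lt_trichotomy (i : ℕ) j with h | h | h
    · exact absurd hij (rowDeg_strictAnti (by omega) (by omega)).ne'
    · exact Fin.ext h
    · exact absurd hij (rowDeg_strictAnti (by omega) (by omega)).ne
  · rw [(hP _ (by omega)).2, coeff_gaugeVar, dif_neg]
    rw [mem_gaugeIndex hd]
    exact fun h => h.2.2 (a + 1 + i) (by omega) (by omega) rfl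

theorem casTail_add_smul (ħ : ℂ) {d : ℕ → ℕ} (c v : gaugeIndex M d → ℂ) (t : ℂ) {a : ℕ} (ha : a < M)
    (hv : ∀ b, a < b → gaugeVar M d v b = 0) :
    casTail ħ M (gaugeTuple M d (c + t • v)) a = casTail ħ M (gaugeTuple M d c) a +
      C t * cas ħ (Fin.cons (gaugeVar M d v a) (fun i : Fin (M - (a + 1)) =>
        gaugeTuple M d c (a + 1 + i)) : Fin (M - (a + 1) + 1) → ℂ[X]) := by
  have h1 : ∀ b, gaugeTuple M d (c + t • v) b = gaugeTuple M d c b + C t * gaugeVar M d v b := by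
    intro b; rw [gaugeTuple_eq, gaugeTuple_eq, gaugeVar_linear, add_assoc]
  rw [casTail_eq_cons ħ _ ha, casTail_eq_cons ħ _ ha, h1 a, cas_cons_add, cas_cons_C_mul]
  have h2 : (fun i : Fin (M - (a + 1)) => gaugeTuple M d (c + t • v) (a + 1 + i)) =
      fun i : Fin (M - (a + 1)) => gaugeTuple M d c (a + 1 + i) := by
    funext i; rw [h1, hv _ (by omega), mul_zero, add_zero]
  rw [h2]

/-- A direction along which all normalised Wronskians are stationary vanishes. -/
theorem eq_zero_of_tailPoly_stationary (hħ : ħ ≠ 0) {c v : gaugeIndex M (rowDeg μ M) → ℂ}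
    (h : ∀ a k, Tendsto (fun t : ℂ => ((tailPoly μ ħ M (c + t • v) a).coeff k -
      (tailPoly μ ħ M c a).coeff k) / t) (𝓝[≠] 0) (𝓝 0)) : v = 0 := by
  have key : ∀ n a, M ≤ a + n → gaugeVar M (rowDeg μ M) v a = 0 := by
    intro n
    induction n with
    | zero =>
      intro a ha
      refine sum_eq_zero fun p _ => if_neg ?_
      have : p.1.1 < M := ((mem_gaugeIndex (fun _ _ h h' => rowDeg_strictAnti h h')).1 p.2).1
      exact fun h => by omega
    | succ n ih =>
      intro a ha
      rcases Nat.lt_or_ge a M with haM | haM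
      · have hv : ∀ b, a < b → gaugeVar M (rowDeg μ M) v b = 0 := fun b hb => ih b (by omega)
        refine gaugeVar_eq_zero_of_cas hħ c v ?_
        ext k
        have h1 := h a k
        have h2 : Tendsto (fun t : ℂ => ((tailPoly μ ħ M (c + t • v) a).coeff k -
            (tailPoly μ ħ M c a).coeff k) / t) (𝓝[≠] 0) (𝓝 ((tailLead μ ħ M a)⁻¹ *
            (cas ħ (Fin.cons (gaugeVar M _ v a) (fun i : Fin (M - (a + 1)) =>
              gaugeTuple M _ c (a + 1 + i)) : Fin (M - (a + 1) + 1) → ℂ[X])).coeff k)) := by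
          refine tendsto_const_nhds.congr' ?_
          filter_upwards [self_mem_nhdsWithin] with t ht
          have ht' : t ≠ 0 := ht
          rw [tailPoly, tailPoly, casTail_add_smul ħ c v t haM hv, mul_add, coeff_add,
            add_sub_cancel_left, coeff_C_mul, coeff_C_mul]
          field_simp
        have h3 := tendsto_nhds_unique h2 h1
        rw [coeff_zero]
        exact (mul_eq_zero.1 h3).resolve_left (inv_ne_zero (tailLead_ne_zero hħ a))
      · exact ih a (by omega)
  funext p
  have h1 := coeff_gaugeVar v p.1.1 p.1.2
  rw [key M p.1.1 (by omega), coeff_zero, dif_pos p.2] at h1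
  exact h1.symm

/-- Free coefficients converge when the normalised Wronskians do. -/
theorem exists_tendsto_of_tailPoly (hħ : ħ ≠ 0) {ι : Type*} (l : Ultrafilter ι)
    {c : ι → gaugeIndex M (rowDeg μ M) → ℂ} {V : ℕ → ℂ[X]}
    (h : ∀ a, CoeffTendsto (fun i => tailPoly μ ħ M (c i) a) l (V a)) :
    ∃ c₀, Tendsto c l (𝓝 c₀) := by
  have hd : ∀ a b, a < b → b < M → rowDeg μ M b < rowDeg μ M a := fun _ _ h h' =>
    rowDeg_strictAnti h h'
  have key : ∀ n, ∀ p : gaugeIndex M (rowDeg μ M), M ≤ p.1.1 + n →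
      ∃ x, Tendsto (fun i => c i p) l (𝓝 x) := by
    intro n
    induction n with
    | zero => intro p hp; have : p.1.1 < M := ((mem_gaugeIndex hd).1 p.2).1; omega
    | succ n ih =>
      intro p hp
      set a := p.1.1 with ha
      have haM : a < M := ((mem_gaugeIndex hd).1 p.2).1
      classical
      have ih' : ∀ p : gaugeIndex M (rowDeg μ M), ∃ x : ℂ, a < p.1.1 →
          Tendsto (fun i => c i p) l (𝓝 x) := fun p => by
        by_cases h : a < p.1.1
        · obtain ⟨x, hx⟩ := ih p (by omega)
          exact ⟨x, fun _ => hx⟩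
        · exact ⟨0, fun h' => absurd h' h⟩
      choose y hy using ih'
      set w : ι → gaugeIndex M (rowDeg μ M) → ℂ := fun i q => if q.1.1 = a then c i q else 0 with hw
      set N : ι → ℝ := fun i => 1 + ∑ q, ‖w i q‖ with hN
      have hw0 : ∀ i, 0 ≤ ∑ q, ‖w i q‖ := fun i => sum_nonneg fun q _ => norm_nonneg _
      have hN1 : ∀ i, 1 ≤ N i := fun i => le_add_of_nonneg_right (hw0 i)
      have hNn : ∀ i, ‖((N i : ℝ) : ℂ)‖ = N i := fun i => by
        rw [Complex.norm_real, Real.norm_of_nonneg (zero_le_one.trans (hN1 i))]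
      have hN0 : ∀ i, ((N i : ℝ) : ℂ) ≠ 0 := fun i =>
        Complex.ofReal_ne_zero.2 (zero_lt_one.trans_le (hN1 i)).ne'
      obtain ⟨u₀, hu⟩ := exists_tendsto_of_eventually_norm_le l (u := fun i => ((N i : ℝ) : ℂ)⁻¹)
        (B := 1) (Eventually.of_forall fun i => by
          rw [norm_inv, hNn]; exact inv_le_one_of_one_le₀ (hN1 i))
      have hv : ∀ q, ∃ x, Tendsto (fun i => ((N i : ℝ) : ℂ)⁻¹ * w i q) l (𝓝 x) := fun q =>
        exists_tendsto_of_eventually_norm_le l (B := 1) (Eventually.of_forall fun i => by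
          rw [norm_mul, norm_inv, hNn, inv_mul_le_iff₀ (zero_lt_one.trans_le (hN1 i)), mul_one]
          exact (single_le_sum (f := fun q => ‖w i q‖) (fun q _ => norm_nonneg _)
            (mem_univ q)).trans (le_add_of_nonneg_left zero_le_one))
      choose v hv using hv
      have hgw : ∀ i, gaugeVar M (rowDeg μ M) (w i) a = gaugeVar M (rowDeg μ M) (c i) a := by
        intro i
        refine sum_congr rfl fun q _ => ?_
        by_cases hq : q.1.1 = a
        · simp only [hw, if_pos hq]
        · rw [if_neg hq, if_neg hq]
      have hlim : CoeffTendsto (fun i => cas ħ (Fin.cons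
          (C ((N i : ℝ) : ℂ)⁻¹ * gaugeTuple M (rowDeg μ M) (c i) a)
          (fun j : Fin (M - (a + 1)) => gaugeTuple M (rowDeg μ M) (c i) (a + 1 + j)) :
            Fin (M - (a + 1) + 1) → ℂ[X])) l
          (cas ħ (Fin.cons (C u₀ * X ^ rowDeg μ M a + gaugeVar M (rowDeg μ M) v a)
          (fun j : Fin (M - (a + 1)) => gaugeTuple M (rowDeg μ M) y (a + 1 + j)) :
            Fin (M - (a + 1) + 1) → ℂ[X])) := by
        have hle : ∀ v, (gaugeVar M (rowDeg μ M) v a).natDegree ≤ rowDeg μ M 0 := by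
          intro v
          rw [natDegree_le_iff_coeff_eq_zero]
          intro k hk
          rw [coeff_gaugeVar, dif_neg]
          rw [mem_gaugeIndex hd]
          have := rowDeg_le μ M (Nat.zero_le a) haM
          exact fun h => by omega
        refine CoeffTendsto.cas (D := rowDeg μ M 0) ħ (fun j => ?_) (fun i j => ?_) fun j => ?_
        · refine Fin.cases ?_ (fun j => ?_) j
          · simp only [Fin.cons_zero]
            intro k
            simp only [gaugeTuple_eq, ← hgw, coeff_C_mul, coeff_add, mul_add]
            refine (hu.mul_const _).add ?_
            simp only [coeff_gaugeVar]
            split_ifs with hk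
            · exact hv _
            · simp
          · simp only [Fin.cons_succ]
            intro k
            simp only [coeff_gaugeTuple]
            refine tendsto_const_nhds.add ?_
            split_ifs with hk
            · exact hy _ (by simp only; omega)
            · exact tendsto_const_nhds
        · refine Fin.cases ?_ (fun j => ?_) j
          · exact (natDegree_C_mul_le _ _).trans (natDegree_gaugeTuple_le _ haM)
          · exact natDegree_gaugeTuple_le _ (by omega)
        · refine Fin.cases ?_ (fun j => ?_) j
          · refine natDegree_add_le_of_degree_le ((natDegree_C_mul_X_pow_le _ _).trans
              (rowDeg_le μ M (Nat.zero_le a) haM)) (hle v)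
          · exact natDegree_gaugeTuple_le _ (by omega)
      have hu0 : u₀ ≠ 0 := by
        rintro rfl
        have h1 : gaugeVar M (rowDeg μ M) v a = 0 := by
          refine gaugeVar_eq_zero_of_cas hħ y v ?_
          ext k
          have h2 := hlim k
          rw [C_0, zero_mul, zero_add] at h2
          refine tendsto_nhds_unique h2 ?_
          have h3 := hu.mul ((h a k).const_mul (tailLead μ ħ M a))
          rw [zero_mul] at h3
          refine h3.congr fun i => ?_
          simp only []
          rw [cas_cons_C_mul, ← casTail_eq_cons ħ _ haM, coeff_C_mul, tailPoly, coeff_C_mul,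
            mul_inv_cancel_left₀ (tailLead_ne_zero hħ a)]
        have h2 : ∀ q, v q = 0 := by
          intro q
          by_cases hq : q.1.1 = a
          · have h3 := coeff_gaugeVar v q.1.1 q.1.2
            rw [hq, h1, coeff_zero, ← hq, dif_pos q.2] at h3
            exact h3.symm
          · refine tendsto_nhds_unique (hv q) ?_
            simp only [hw, if_neg hq, mul_zero]
            exact tendsto_const_nhds
        have h3 := hu.norm.add (tendsto_finsetSum univ fun q _ => (hv q).norm)
        simp only [h2, norm_zero, sum_const_zero, add_zero] at h3
        refine zero_ne_one (tendsto_nhds_unique h3 (tendsto_const_nhds.congr fun i => ?_))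
        simp only [norm_mul, norm_inv, hNn]
        rw [← mul_sum, ← mul_one_add, inv_mul_cancel₀ (zero_lt_one.trans_le (hN1 i)).ne']
      refine ⟨v p / u₀, ((hv p).div hu hu0).congr fun i => ?_⟩
      rw [Pi.div_apply, mul_div_cancel_left₀ _ (inv_ne_zero (hN0 i))]
      simp only [hw, if_pos ha.symm]
  choose x hx using fun p => key M p (by omega)
  exact ⟨x, tendsto_pi_nhds.2 hx⟩

end

/-! ### Continuation in the largest inhomogeneity -/

/-- The free coefficients `c` describe a solution of the Q-system whose first column agrees with
the leading-order solution up to a relative error `ε`. -/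
structure IsLabelled (μ : YoungDiagram) (M : ℕ) (ħ : ℂ) (θ : ℕ → ℂ) (e : ℕ × ℕ → ℕ) (ε : ℝ)
    (c : gaugeIndex M (rowDeg μ M) → ℂ) : Prop where
  source : tailPoly μ ħ M c 0 = ∏ j ∈ range μ.card, (X - C (θ j))
  near : ∀ a k, ‖(tailPoly μ ħ M c a).coeff k - (tabLead μ.cells e θ a 0).coeff k‖ ≤
    ε * ‖(tabLead μ.cells e θ a 0).coeff k‖

section

open Filter Topology

variable {μ : YoungDiagram} {M : ℕ} {e : ℕ × ℕ → ℕ}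

theorem exists_isNear_of_column (μ : YoungDiagram) {δ : ℝ} (hδ : 0 < δ) {ε : ℝ} (hε : 0 < ε) :
    ∃ K η : ℝ, 0 < η ∧ ∀ ħ θ, WellSeparated μ.card δ K ħ θ → ∀ Q, IsQFamily μ ħ Q →
      (Q 0 0).natDegree = μ.card →
      (∀ k, ‖(Q 0 0).coeff k - (∏ j ∈ range μ.card, (X - C (θ j))).coeff k‖ ≤
        η * ‖(∏ j ∈ range μ.card, (X - C (θ j))).coeff k‖) →
      ∀ e, IsTab μ.cells e →
      (∀ a k, ‖(Q a 0).coeff k - (tabLead μ.cells e θ a 0).coeff k‖ ≤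
        1 / 2 * ‖(tabLead μ.cells e θ a 0).coeff k‖) → IsNear μ.cells e θ ε Q := by
  obtain ⟨K, η, hη, h⟩ := exists_isNear μ hδ (lt_min hε one_half_pos)
  obtain ⟨K', h'⟩ := exists_eq_of_isNear μ hδ
  refine ⟨max K K', η, hη, fun ħ θ hs Q hQ hdeg hsrc e he hcol => ?_⟩
  obtain ⟨e', he', hn⟩ := h ħ θ (hs.mono (le_max_left _ _)) Q hQ hdeg hsrc
  have heq := h' ħ θ (hs.mono (le_max_right _ _)) e e' he he' (fun a => Q a 0) hcol
    (fun a k => (hn a 0 k).trans (mul_le_mul_of_nonneg_right (min_le_right _ _) (norm_nonneg _)))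
  intro a s k
  rw [tabLead_congr heq]
  exact (hn a s k).trans (mul_le_mul_of_nonneg_right (min_le_left _ _) (norm_nonneg _))

theorem exists_coeff_ne_zero {δ : ℝ} (hδ : 0 < δ) (he : IsTab μ.cells e) :
    ∃ K : ℝ, ∀ ħ θ, WellSeparated μ.card δ K ħ θ → ∀ a s k, k ≤ boxCount μ.cells a s →
      (tabLead μ.cells e θ a s).coeff k ≠ 0 := by
  have hfin : ∃ K : ℝ, ∀ x ∈ μ.cells ×ˢ range μ.card, ∀ K', K ≤ K' → ∀ ħ θ,
      WellSeparated μ.card δ K' ħ θ → x.2 ≤ boxCount μ.cells x.1.1 x.1.2 →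
      (tabLead μ.cells e θ x.1.1 x.1.2).coeff x.2 ≠ 0 := by
    refine exists_bound_of_finite _ (P := fun (x : (ℕ × ℕ) × ℕ) K' => ∀ ħ θ,
      WellSeparated μ.card δ K' ħ θ → x.2 ≤ boxCount μ.cells x.1.1 x.1.2 →
      (tabLead μ.cells e θ x.1.1 x.1.2).coeff x.2 ≠ 0) fun x _ => ?_
    by_contra! hcon
    choose K hK ħ θ hsep hk h0 using fun i : ℕ => hcon (i + 1)
    have hS := separatedSeq_of_wellSeparated hδ fun i => (hsep i).mono (hK i)
    obtain ⟨i, hi⟩ := (he.eventually_coeff_tabLead_ne_zero hS inv_succ_ne_zero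
      tendsto_inv_succ (hk 0)).exists
    exact hi (h0 i)
  obtain ⟨K, hK⟩ := hfin
  refine ⟨K, fun ħ θ hs a s k hk => ?_⟩
  rcases hk.lt_or_eq with hlt | rfl
  · obtain ⟨h1, h2⟩ := lt_boxCount_mem hlt
    exact hK ((a, s), k) (mem_product.2 ⟨h1, h2⟩) K le_rfl ħ θ hs hk
  · rw [← natDegree_tabLead μ.cells e θ, (tabLead_monic μ.cells e θ a s).coeff_natDegree]
    exact one_ne_zero

theorem eventually_norm_sub_le {ι : Type*} {l : Filter ι} {u v : ι → ℂ} {x y : ℂ}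
    (hu : Tendsto u l (𝓝 x)) (hv : Tendsto v l (𝓝 y)) (hy : y ≠ 0)
    (h : ‖x - y‖ ≤ 1 / 4 * ‖y‖) : ∀ᶠ i in l, ‖u i - v i‖ ≤ 1 / 2 * ‖v i‖ := by
  have h1 := (hu.sub hv).norm
  have h2 := hv.norm.const_mul (1 / 2)
  have h3 := norm_pos_iff.2 hy
  filter_upwards [h1.eventually_lt h2 (by linarith)] with i hi using hi.le

theorem coeff_tailPoly_eq_tabLead (hħ : ħ ≠ 0) (hM : (M, 0) ∉ μ)
    (c : gaugeIndex M (rowDeg μ M) → ℂ) (e : ℕ × ℕ → ℕ) (θ : ℕ → ℂ) {a k : ℕ}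
    (hk : boxCount μ.cells a 0 ≤ k) :
    (tailPoly μ ħ M c a).coeff k = (tabLead μ.cells e θ a 0).coeff k := by
  obtain ⟨Q, hQ, hdeg, h⟩ := exists_isQFamily_tailPoly hħ hM c
  rw [← h, hQ.coeff_eq_tabLead hdeg e θ hk]

theorem eventually_near (hħ : ħ ≠ 0) (hM : (M, 0) ∉ μ) {ι : Type*} {l : Filter ι}
    {z : ι → gaugeIndex M (rowDeg μ M) → ℂ} {θ : ι → ℕ → ℂ}
    (h : ∀ a k, k < boxCount μ.cells a 0 → ∀ᶠ i in l,
      ‖(tailPoly μ ħ M (z i) a).coeff k - (tabLead μ.cells e (θ i) a 0).coeff k‖ ≤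
        1 / 2 * ‖(tabLead μ.cells e (θ i) a 0).coeff k‖) :
    ∀ᶠ i in l, ∀ a k, ‖(tailPoly μ ħ M (z i) a).coeff k - (tabLead μ.cells e (θ i) a 0).coeff k‖ ≤
        1 / 2 * ‖(tabLead μ.cells e (θ i) a 0).coeff k‖ := by
  have h1 : ∀ᶠ i in l, ∀ c ∈ μ.cells, ∀ k ∈ range μ.card, k < boxCount μ.cells c.1 0 →
      ‖(tailPoly μ ħ M (z i) c.1).coeff k - (tabLead μ.cells e (θ i) c.1 0).coeff k‖ ≤
        1 / 2 * ‖(tabLead μ.cells e (θ i) c.1 0).coeff k‖ := by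
    rw [eventually_all_finset]
    intro c _
    rw [eventually_all_finset]
    intro k _
    by_cases hk : k < boxCount μ.cells c.1 0
    · filter_upwards [h c.1 k hk] with i hi _ using hi
    · exact Eventually.of_forall fun i h' => absurd h' hk
  filter_upwards [h1] with i hi a k
  by_cases hk : k < boxCount μ.cells a 0
  · obtain ⟨h2, h3⟩ := lt_boxCount_mem hk
    exact hi (a, 0) h2 k h3 hk
  · rw [coeff_tailPoly_eq_tabLead hħ hM (z i) e (θ i) (not_lt.1 hk), sub_self, norm_zero]
    positivity

theorem CoeffTendsto.prod {ι α : Type*} {l : Filter ι} {s : Finset α} {f : α → ι → ℂ[X]}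
    {g : α → ℂ[X]} (h : ∀ x ∈ s, CoeffTendsto (f x) l (g x)) :
    CoeffTendsto (fun i => ∏ x ∈ s, f x i) l (∏ x ∈ s, g x) := by
  classical
  induction s using Finset.induction_on with
  | empty => simpa using CoeffTendsto.const 1
  | insert b s hb ih =>
    simp only [prod_insert hb]
    exact (h b (mem_insert_self _ _)).mul (ih fun x hx => h x (mem_insert_of_mem hx))

theorem coeffTendsto_tabLead {ι : Type*} {l : Filter ι} {θ : ι → ℕ → ℂ} {θ₀ : ℕ → ℂ}
    (h : ∀ j, Tendsto (fun i => θ i j) l (𝓝 (θ₀ j))) (ν : Finset (ℕ × ℕ)) (e : ℕ × ℕ → ℕ)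
    (a s : ℕ) : CoeffTendsto (fun i => tabLead ν e (θ i) a s) l (tabLead ν e θ₀ a s) :=
  CoeffTendsto.prod fun c _ => (CoeffTendsto.const X).sub (CoeffTendsto.C ((h (e c)).mul_const _))

/-- The equations determining the free coefficients. -/
noncomputable def tailCoeffs (μ : YoungDiagram) (ħ : ℂ) (M : ℕ)
    (c : gaugeIndex M (rowDeg μ M) → ℂ) (k : Fin μ.card) : ℂ :=
  (tailPoly μ ħ M c 0).coeff k

theorem contDiff_tailCoeffs (μ : YoungDiagram) (ħ : ℂ) (M : ℕ) : ContDiff ℂ 1 (tailCoeffs μ ħ M) :=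
  contDiff_pi.2 fun k => coeffSmooth_tailPoly μ ħ M 0 k

theorem IsLabelled.exists_improve {δ : ℝ} (hδ : 0 < δ) (he : IsTab μ.cells e) (hM : (M, 0) ∉ μ)
    {ε : ℝ} (hε : 0 < ε) : ∃ K : ℝ, ∀ ħ θ, WellSeparated μ.card δ K ħ θ → ∀ c,
      IsLabelled μ M ħ θ e (1 / 2) c → IsLabelled μ M ħ θ e ε c := by
  obtain ⟨K, η, hη, h⟩ := exists_isNear_of_column μ hδ hε
  refine ⟨K, fun ħ θ hs c hc => ⟨hc.source, fun a k => ?_⟩⟩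
  obtain ⟨Q, hQ, hdeg, hQc⟩ := exists_isQFamily_tailPoly hs.ħ_ne hM c
  rw [← hQc]
  refine h ħ θ hs Q hQ hdeg (fun k => ?_) e he (fun a k => ?_) a 0 k
  · rw [hQc, hc.source, sub_self, norm_zero]; positivity
  · rw [hQc]; exact hc.near a k

theorem IsLabelled.exists_injective {δ : ℝ} (hδ : 0 < δ) (he : IsTab μ.cells e)
    (hM : (M, 0) ∉ μ) : ∃ K : ℝ, ∀ ħ θ, WellSeparated μ.card δ K ħ θ → ∀ c,
      IsLabelled μ M ħ θ e (1 / 2) c → ∀ v,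
      HasDerivAt (fun t : ℂ => tailCoeffs μ ħ M (c + t • v)) 0 0 → v = 0 := by
  obtain ⟨K₁, η₁, B, hη₁, hlip⟩ := exists_lipschitz hδ he
  obtain ⟨K₂, η₂, hη₂, hnear⟩ := exists_isNear_of_column μ hδ hη₁
  obtain ⟨K₃, himp⟩ := IsLabelled.exists_improve hδ he hM (show (0 : ℝ) < 1 / 4 by norm_num)
  obtain ⟨K₄, hne⟩ := exists_coeff_ne_zero hδ he
  refine ⟨max (max K₁ K₂) (max K₃ K₄), fun ħ θ hs c hc v hv => ?_⟩
  have hs1 := hs.mono ((le_max_left K₁ K₂).trans (le_max_left _ (max K₃ K₄)))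
  have hs2 := hs.mono ((le_max_right K₁ K₂).trans (le_max_left _ (max K₃ K₄)))
  have hs3 := hs.mono ((le_max_left K₃ K₄).trans (le_max_right (max K₁ K₂) _))
  have hs4 := hs.mono ((le_max_right K₃ K₄).trans (le_max_right (max K₁ K₂) _))
  have hc4 := himp ħ θ hs3 c hc
  have hħ := hs.ħ_ne
  have hsrc0 := tabLead_zero_zero he θ
  have hz : Tendsto (fun t : ℂ => c + t • v) (𝓝[≠] 0) (𝓝 c) := by
    have h1 : Tendsto (fun t : ℂ => c + t • v) (𝓝 0) (𝓝 (c + (0 : ℂ) • v)) :=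
      (tendsto_id.smul_const v).const_add c
    rw [zero_smul, add_zero] at h1
    exact h1.mono_left nhdsWithin_le_nhds
  have hcol := eventually_near (l := 𝓝[≠] (0 : ℂ)) (e := e) (θ := fun _ => θ) hħ hM
    (z := fun t : ℂ => c + t • v) fun a k hk => eventually_norm_sub_le
      ((coeffSmooth_tailPoly μ ħ M a).tendsto hz k) tendsto_const_nhds
      (hne ħ θ hs4 a 0 k hk.le) (hc4.near a k)
  have hsrc : ∀ᶠ t in 𝓝[≠] (0 : ℂ), ∀ k ∈ range μ.card,
      ‖(tailPoly μ ħ M (c + t • v) 0).coeff k - (tabLead μ.cells e θ 0 0).coeff k‖ ≤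
        η₂ * ‖(tabLead μ.cells e θ 0 0).coeff k‖ := by
    rw [eventually_all_finset]
    intro k hk
    have h1 := (((coeffSmooth_tailPoly μ ħ M 0).tendsto hz k).sub_const
      ((tabLead μ.cells e θ 0 0).coeff k)).norm
    rw [hc.source, hsrc0, sub_self, norm_zero] at h1
    have h2 : 0 < η₂ * ‖(tabLead μ.cells e θ 0 0).coeff k‖ := by
      refine mul_pos hη₂ (norm_pos_iff.2 (hne ħ θ hs4 0 0 k ?_))
      rw [boxCount_zero_zero]; exact (mem_range.1 hk).le
    rw [hsrc0] at h2 ⊢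
    exact h1.eventually_le_const h2
  set Bt : ℂ → ℝ := fun t => ∑ k ∈ range μ.card,
    ‖(tailPoly μ ħ M (c + t • v) 0).coeff k - (tailPoly μ ħ M c 0).coeff k‖ /
      ‖(tabLead μ.cells e θ 0 0).coeff k‖ with hBt
  have hkey : ∀ᶠ t in 𝓝[≠] (0 : ℂ), ∀ a k, ‖(tailPoly μ ħ M (c + t • v) a).coeff k -
      (tailPoly μ ħ M c a).coeff k‖ ≤ B * Bt t * ‖(tabLead μ.cells e θ a 0).coeff k‖ := by
    filter_upwards [hcol, hsrc] with t ht1 ht2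
    obtain ⟨Q, hQ, hdeg, hQc⟩ := exists_isQFamily_tailPoly hħ hM (c + t • v)
    obtain ⟨Q', hQ', hdeg', hQc'⟩ := exists_isQFamily_tailPoly hħ hM c
    intro a k
    rw [← hQc, ← hQc']
    refine hlip ħ θ hs1 Q Q' hQ hdeg hQ' hdeg' ?_ ?_ (Bt t) (fun k => ?_) a 0 k
    · refine hnear ħ θ hs2 Q hQ hdeg (fun k => ?_) e he fun a k => ?_
      · rw [hQc, ← hsrc0]
        by_cases hk : k < μ.card
        · exact ht2 k (mem_range.2 hk)
        · rw [coeff_tailPoly_eq_tabLead hħ hM _ e θ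
            (by rw [boxCount_zero_zero]; exact not_lt.1 hk), sub_self, norm_zero]
          positivity
      · rw [hQc]; exact ht1 a k
    · refine hnear ħ θ hs2 Q' hQ' hdeg' (fun k => ?_) e he fun a k => ?_
      · rw [hQc', hc.source, sub_self, norm_zero]; positivity
      · rw [hQc']; exact hc.near a k
    · rw [hQc, hQc']
      by_cases hk : k < μ.card
      · rw [← div_le_iff₀ (norm_pos_iff.2 (hne ħ θ hs4 0 0 k
          (by rw [boxCount_zero_zero]; exact hk.le)))]
        exact single_le_sum (f := fun k => ‖(tailPoly μ ħ M (c + t • v) 0).coeff k -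
          (tailPoly μ ħ M c 0).coeff k‖ / ‖(tabLead μ.cells e θ 0 0).coeff k‖)
          (fun _ _ => by positivity) (mem_range.2 hk)
      · have hk' : boxCount μ.cells 0 0 ≤ k := by
          rw [boxCount_zero_zero]; exact not_lt.1 hk
        rw [coeff_tailPoly_eq_tabLead hħ hM _ e θ hk', coeff_tailPoly_eq_tabLead hħ hM _ e θ hk',
          sub_self, norm_zero]
        exact mul_nonneg (sum_nonneg fun _ _ => by positivity) (norm_nonneg _)
  have hBt0 : Tendsto (fun t => Bt t / ‖t‖) (𝓝[≠] (0 : ℂ)) (𝓝 0) := by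
    simp only [hBt, sum_div]
    have hzero : (0 : ℝ) = ∑ k ∈ range μ.card, 0 := sum_const_zero.symm
    conv => rhs; rw [hzero]
    refine tendsto_finsetSum _ fun k hk => ?_
    have h1 := hasDerivAt_pi.1 hv ⟨k, mem_range.1 hk⟩
    rw [hasDerivAt_iff_tendsto_slope] at h1
    have h2 := (h1.norm.div_const ‖(tabLead μ.cells e θ 0 0).coeff k‖)
    simp only [Pi.zero_apply, norm_zero, zero_div] at h2
    refine h2.congr fun t => ?_
    rw [slope_def_field]
    simp only [tailCoeffs, zero_smul, add_zero, sub_zero, norm_div]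
    rw [div_right_comm]
  refine eq_zero_of_tailPoly_stationary (c := c) hħ fun a k => ?_
  have h1 : Tendsto (fun t => B * (Bt t / ‖t‖) * ‖(tabLead μ.cells e θ a 0).coeff k‖) (𝓝[≠] 0)
      (𝓝 (B * 0 * ‖(tabLead μ.cells e θ a 0).coeff k‖)) := (hBt0.const_mul B).mul_const _
  rw [mul_zero, zero_mul] at h1
  refine squeeze_zero_norm' ?_ h1
  filter_upwards [hkey, self_mem_nhdsWithin] with t ht ht0
  rw [norm_div, div_le_iff₀ (norm_pos_iff.2 ht0)]
  refine (ht a k).trans (le_of_eq ?_)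
  have : ‖t‖ ≠ 0 := norm_ne_zero_iff.2 ht0
  field_simp

theorem WellSeparated.scale_last {L : ℕ} {δ K : ℝ} {θ : ℕ → ℂ}
    (h : WellSeparated L δ K ħ θ) {t : ℝ} (ht : 1 ≤ t) :
    WellSeparated L δ K ħ (Function.update θ (L - 1) (t * θ (L - 1))) := by
  have hle : ∀ j, ‖θ j‖ ≤ ‖Function.update θ (L - 1) (t * θ (L - 1)) j‖ := by
    intro j
    by_cases hj : j = L - 1
    · subst hj
      rw [Function.update_self, norm_mul, Complex.norm_real, Real.norm_of_nonneg (by linarith)]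
      exact le_mul_of_one_le_left (norm_nonneg _) ht
    · rw [Function.update_of_ne hj]
  refine ⟨h.ħ_ne, fun j => norm_pos_iff.1 ((norm_pos_iff.2 (h.θ_ne j)).trans_le (hle j)),
    fun hL => (h.first hL).trans (hle 0), fun j hj => ?_⟩
  rw [Function.update_of_ne (by omega : j ≠ L - 1)]
  exact (h.ratio j hj).trans (hle _)

theorem IsLabelled.exists_continuation {δ : ℝ} (hδ : 0 < δ) (he : IsTab μ.cells e)
    (hM : (M, 0) ∉ μ) : ∃ K : ℝ, ∀ ħ θ, WellSeparated μ.card δ K ħ θ →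
      (∃ t : ℝ, 1 ≤ t ∧ ∃ c, IsLabelled μ M ħ
        (Function.update θ (μ.card - 1) (t * θ (μ.card - 1))) e (1 / 2) c) →
      ∃ c, IsLabelled μ M ħ θ e (1 / 2) c := by
  obtain ⟨K₂, hinj⟩ := IsLabelled.exists_injective hδ he hM
  obtain ⟨K₃, himp⟩ := IsLabelled.exists_improve hδ he hM (show (0 : ℝ) < 1 / 4 by norm_num)
  obtain ⟨K₄, hne⟩ := exists_coeff_ne_zero hδ he
  refine ⟨max K₂ (max K₃ K₄), fun ħ θ hs hex => ?_⟩
  set θt : Set.Ici (1 : ℝ) → ℕ → ℂ := fun t =>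
    Function.update θ (μ.card - 1) (((t : ℝ) : ℂ) * θ (μ.card - 1)) with hθt
  have hst : ∀ t, WellSeparated μ.card δ (max K₂ (max K₃ K₄)) ħ (θt t) := fun t =>
    hs.scale_last t.2
  have hs2 := fun t => (hst t).mono (le_max_left K₂ (max K₃ K₄))
  have hs3 := fun t => (hst t).mono ((le_max_left K₃ K₄).trans (le_max_right K₂ _))
  have hs4 := fun t => (hst t).mono ((le_max_right K₃ K₄).trans (le_max_right K₂ _))
  have hħ := hs.ħ_ne
  have hcont : ∀ t₀ j, Tendsto (fun t => θt t j) (𝓝 t₀) (𝓝 (θt t₀ j)) := by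
    intro t₀ j
    simp only [hθt]
    by_cases hj : j = μ.card - 1
    · subst hj
      simp only [Function.update_self]
      exact ((Complex.continuous_ofReal.comp continuous_subtype_val).mul continuous_const).tendsto _
    · simp only [Function.update_of_ne hj]
      exact tendsto_const_nhds
  have htab : ∀ t₀ a, CoeffTendsto (fun t => tabLead μ.cells e (θt t) a 0) (𝓝 t₀)
      (tabLead μ.cells e (θt t₀) a 0) := fun t₀ a => coeffTendsto_tabLead (hcont t₀) _ _ _ _
  set A : Set (Set.Ici (1 : ℝ)) := {t | ∃ c, IsLabelled μ M ħ (θt t) e (1 / 2) c} with hA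
  have hopen : IsOpen A := by
    rw [isOpen_iff_eventually]
    rintro t₀ ⟨c, hc⟩
    have hc4 := himp ħ _ (hs3 t₀) c hc
    obtain ⟨G, hG, hGF⟩ := exists_lift (F := tailCoeffs μ ħ M) (z₀ := c)
      (by rw [Fintype.card_coe, card_gaugeIndex_rowDeg hM, Fintype.card_fin])
      (contDiff_tailCoeffs μ ħ M).contDiffAt (hinj ħ _ (hs2 t₀) c hc)
    set y : Set.Ici (1 : ℝ) → Fin μ.card → ℂ := fun t k =>
      (tabLead μ.cells e (θt t) 0 0).coeff k with hy
    have hyt : Tendsto y (𝓝 t₀) (𝓝 (tailCoeffs μ ħ M c)) := by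
      refine tendsto_pi_nhds.2 fun k => ?_
      have h1 := htab t₀ 0 k
      rw [tailCoeffs, hc.source, ← tabLead_zero_zero he]
      exact h1
    have hnear := eventually_near (l := 𝓝 t₀) (e := e) (θ := θt) hħ hM
      (z := fun t => G (y t)) fun a k hk => eventually_norm_sub_le
        ((coeffSmooth_tailPoly μ ħ M a).tendsto (hG.comp hyt) k) (htab t₀ a k)
        (hne ħ _ (hs4 t₀) a 0 k hk.le) (hc4.near a k)
    filter_upwards [hnear, hyt.eventually hGF] with t h1 h2
    refine ⟨G (y t), ?_, h1⟩
    rw [← tabLead_zero_zero he]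
    ext k
    by_cases hk : k < μ.card
    · exact congrFun h2 ⟨k, hk⟩
    · exact coeff_tailPoly_eq_tabLead hħ hM _ e _ (by rw [boxCount_zero_zero]; exact not_lt.1 hk)
  have hclosed : IsClosed A := by
    refine isClosed_of_closure_subset fun t₀ ht₀ => ?_
    obtain ⟨l, hlA, hl⟩ := mem_closure_iff_ultrafilter.1 ht₀
    choose! c hc using fun t (ht : t ∈ A) => ht
    have hlim : ∀ a k, ∃ x, Tendsto (fun t => (tailPoly μ ħ M (c t) a).coeff k) l (𝓝 x) := by
      intro a k
      have h1 := (((htab t₀ a k).mono_left hl).norm).eventually_le_const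
        (lt_add_one ‖(tabLead μ.cells e (θt t₀) a 0).coeff k‖)
      refine exists_tendsto_of_eventually_norm_le l
        (B := 2 * (‖(tabLead μ.cells e (θt t₀) a 0).coeff k‖ + 1)) ?_
      filter_upwards [h1, hlA] with t h2 h3
      have h4 := (hc t h3).near a k
      have h5 := norm_sub_norm_le ((tailPoly μ ħ M (c t) a).coeff k)
        ((tabLead μ.cells e (θt t) a 0).coeff k)
      have h6 := norm_nonneg ((tabLead μ.cells e (θt t) a 0).coeff k)
      linarith
    choose x hx using hlim
    obtain ⟨c₀, hc₀⟩ := exists_tendsto_of_tailPoly hħ l (c := c)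
      (V := fun a => ∑ k ∈ range (boxCount μ.cells a 0 + 1), C (x a k) * X ^ k) (by
        intro a k
        have heq : x a k = (∑ k ∈ range (boxCount μ.cells a 0 + 1), C (x a k) * X ^ k).coeff k := by
          simp only [finsetSum_coeff, coeff_C_mul_X_pow]
          by_cases hk : k ≤ boxCount μ.cells a 0
          · rw [sum_eq_single k]
            · rw [if_pos rfl]
            · exact fun j _ hj => if_neg hj.symm
            · exact fun h => absurd (mem_range.2 (by omega)) h
          · rw [sum_eq_zero fun j hj => if_neg (by
              have := mem_range.1 hj; omega)]
            refine tendsto_nhds_unique (hx a k) (tendsto_const_nhds.congr fun t => ?_)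
            exact (coeff_eq_zero_of_natDegree_lt ((natDegree_tailPoly_le hM ħ _ a).trans_lt
              (not_le.1 hk))).symm
        rw [← heq]; exact hx a k)
    have hV := fun a => (coeffSmooth_tailPoly μ ħ M a).tendsto hc₀
    refine ⟨c₀, ?_, fun a k => ?_⟩
    · rw [← tabLead_zero_zero he]
      ext k
      refine tendsto_nhds_unique (hV 0 k) (((htab t₀ 0 k).mono_left hl).congr' ?_)
      filter_upwards [hlA] with t ht
      rw [(hc t ht).source, ← tabLead_zero_zero he]
    · refine le_of_tendsto_of_tendsto (((hV a k).sub ((htab t₀ a k).mono_left hl)).norm)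
        (((htab t₀ a k).mono_left hl).norm.const_mul (1 / 2)) ?_
      filter_upwards [hlA] with t ht using (hc t ht).near a k
  have hconn : PreconnectedSpace (Set.Ici (1 : ℝ)) :=
    isPreconnected_iff_preconnectedSpace.1 isPreconnected_Ici
  obtain ⟨t, ht, hct⟩ := hex
  have huniv : A = Set.univ := IsClopen.eq_univ ⟨hclosed, hopen⟩ ⟨⟨t, ht⟩, hct⟩
  have h1 : (⟨1, Set.mem_Ici.2 le_rfl⟩ : Set.Ici (1 : ℝ)) ∈ A := by rw [huniv]; trivial
  obtain ⟨c, hc⟩ := h1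
  refine ⟨c, ?_⟩
  have h2 : θt ⟨1, Set.mem_Ici.2 le_rfl⟩ = θ := by
    simp only [hθt]
    rw [Complex.ofReal_one, one_mul, Function.update_eq_self]
  rwa [h2] at hc

end

/-! ### Removing a corner of the diagram -/

/-- `ν` is obtained from `μ` by removing the corner box `c`. -/
structure IsCorner (μ ν : YoungDiagram) (c : ℕ × ℕ) : Prop where
  mem : c ∈ μ
  below : (c.1 + 1, c.2) ∉ μ
  right : (c.1, c.2 + 1) ∉ μ
  cells : ν.cells = μ.cells.erase c

theorem IsTab.exists_isCorner {e : ℕ × ℕ → ℕ} (he : IsTab μ.cells e)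
    (h0 : 0 < μ.card) : ∃ ν c, IsCorner μ ν c ∧ e c = μ.card - 1 ∧ IsTab ν.cells e := by
  obtain ⟨c, hc, hec⟩ := he.exists_box (show μ.card - 1 < μ.cells.card by
    have : μ.cells.card = μ.card := rfl
    omega)
  have hmax : ∀ d ∈ μ.cells, e d ≤ e c := fun d hd => by
    have := he.lt d hd
    have : μ.cells.card = μ.card := rfl
    omega
  have h1 : (c.1 + 1, c.2) ∉ μ := fun h => by
    have := he.mono c hc _ h (Nat.le_succ _) le_rfl (fun h => by simpa using congrArg Prod.fst h)
    exact absurd (hmax _ h) (not_le.2 this)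
  have h2 : (c.1, c.2 + 1) ∉ μ := fun h => by
    have := he.mono c hc _ h le_rfl (Nat.le_succ _) (fun h => by simpa using congrArg Prod.snd h)
    exact absurd (hmax _ h) (not_le.2 this)
  obtain ⟨ν, hν⟩ := exists_erase_corner h1 h2
  refine ⟨ν, c, ⟨hc, h1, h2, hν⟩, hec, ?_⟩
  rw [hν]
  refine ⟨fun d hd => ?_, fun d hd d' hd' => he.inj d (mem_of_mem_erase hd) d'
    (mem_of_mem_erase hd'), fun d hd d' hd' => he.mono d (mem_of_mem_erase hd) d'
    (mem_of_mem_erase hd')⟩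
  have h3 := hmax d (mem_of_mem_erase hd)
  have h4 : e d ≠ e c := fun h => ne_of_mem_erase hd (he.inj d (mem_of_mem_erase hd) c hc h)
  rw [card_erase_of_mem hc]
  have : μ.cells.card = μ.card := rfl
  omega

section

variable {μ ν : YoungDiagram} {c : ℕ × ℕ} {M : ℕ}

theorem IsCorner.mem_iff (h : IsCorner μ ν c) {d : ℕ × ℕ} : d ∈ ν ↔ d ≠ c ∧ d ∈ μ := by
  rw [← mem_cells, h.cells, mem_erase, mem_cells]

theorem IsCorner.lt (h : IsCorner μ ν c) (hM : (M, 0) ∉ μ) : c.1 < M := by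
  by_contra hlt
  exact hM (μ.up_left_mem (not_lt.1 hlt) (Nat.zero_le _) h.mem)

theorem IsCorner.not_mem (h : IsCorner μ ν c) (hM : (M, 0) ∉ μ) : (M, 0) ∉ ν :=
  fun h' => hM (h.mem_iff.1 h').2

theorem IsCorner.card (h : IsCorner μ ν c) : ν.card + 1 = μ.card := by
  rw [YoungDiagram.card, h.cells]
  exact card_erase_add_one h.mem

theorem IsCorner.boxCount_eq (h : IsCorner μ ν c) (a : ℕ) :
    boxCount μ.cells a 0 = boxCount ν.cells a 0 + if a ≤ c.1 then 1 else 0 := by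
  rw [boxCount_erase (show c ∈ μ.cells from h.mem), h.cells]
  simp

theorem IsCorner.rowLen_of_ne (h : IsCorner μ ν c) {a : ℕ} (ha : a ≠ c.1) :
    ν.rowLen a = μ.rowLen a := by
  have h1 : ∀ s, s < ν.rowLen a ↔ s < μ.rowLen a := fun s => by
    rw [← mem_iff_lt_rowLen, ← mem_iff_lt_rowLen, h.mem_iff]
    exact and_iff_right fun h => ha (congrArg Prod.fst h)
  have h2 := h1 (ν.rowLen a)
  have h3 := h1 (μ.rowLen a)
  omega

theorem IsCorner.rowLen_top (h : IsCorner μ ν c) : μ.rowLen c.1 = c.2 + 1 := by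
  have h1 := mem_iff_lt_rowLen.1 (show (c.1, c.2) ∈ μ from h.mem)
  have h2 := mt mem_iff_lt_rowLen.2 h.right
  omega

theorem IsCorner.rowLen_self (h : IsCorner μ ν c) : ν.rowLen c.1 = c.2 := by
  have h1 : (c.1, c.2) ∉ ν := fun h' => (h.mem_iff.1 h').1 rfl
  have h2 := mt mem_iff_lt_rowLen.2 h1
  by_contra hne
  have h3 : (c.1, ν.rowLen c.1) ∈ ν := by
    refine h.mem_iff.2 ⟨fun h' => hne (congrArg Prod.snd h'), ?_⟩
    exact μ.up_left_mem le_rfl (show ν.rowLen c.1 ≤ c.2 by omega) h.mem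
  exact absurd (mem_iff_lt_rowLen.1 h3) (lt_irrefl _)

theorem IsCorner.rowDeg_of_ne (h : IsCorner μ ν c) {a : ℕ} (ha : a ≠ c.1) :
    rowDeg ν M a = rowDeg μ M a := by rw [rowDeg, rowDeg, h.rowLen_of_ne ha]

theorem IsCorner.rowDeg_self (h : IsCorner μ ν c) : rowDeg μ M c.1 = rowDeg ν M c.1 + 1 := by
  rw [rowDeg, rowDeg, h.rowLen_self, h.rowLen_top]; omega

theorem IsCorner.hookC_eq (h : IsCorner μ ν c) (hM : (M, 0) ∉ μ) {i : ℕ} (hi : i < c.1) :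
    hookC μ.cells i c.2 = (rowDeg μ M i : ℂ) - rowDeg μ M c.1 + 1 := by
  have hcol : ∀ n ≤ c.1 + 1, boxCount μ.cells (c.1 + 1 - n) c.2 =
      boxCount μ.cells (c.1 + 1 - n) (c.2 + 1) + n := by
    intro n
    induction n with
    | zero =>
      intro _
      rw [Nat.sub_zero, boxCount_eq_zero h.below, boxCount_eq_zero]
      exact fun h' => h.below (μ.up_left_mem le_rfl (Nat.le_succ _) h')
    | succ n ih =>
      intro hn
      have h1 := ih (by omega)
      have h2 : c.1 + 1 - n = c.1 + 1 - (n + 1) + 1 := by omega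
      have h3 : c.2 < μ.rowLen (c.1 + 1 - (n + 1)) := mem_iff_lt_rowLen.1
        (μ.up_left_mem (by omega) le_rfl h.mem)
      rw [boxCount_succ_left, boxCount_succ_left _ (c.2 + 1), ← h2, h1]
      omega
  have h1 := hcol (c.1 - i) (by omega)
  rw [show c.1 + 1 - (c.1 - i) = i + 1 by omega] at h1
  have h3 : c.2 < μ.rowLen i := mem_iff_lt_rowLen.1 (μ.up_left_mem hi.le le_rfl h.mem)
  have hlt := h.lt hM
  have h4 := h.rowLen_top
  have h5 : boxCount μ.cells i c.2 + rowDeg μ M c.1 =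
      boxCount μ.cells (i + 1) (c.2 + 1) + rowDeg μ M i + 1 := by
    rw [boxCount_succ_left, h1, rowDeg, rowDeg]; omega
  have h6 : (boxCount μ.cells i c.2 : ℂ) + rowDeg μ M c.1 =
      boxCount μ.cells (i + 1) (c.2 + 1) + rowDeg μ M i + 1 := by exact_mod_cast h5
  rw [hookC]
  linear_combination h6

theorem casLead_succ (ħ : ℂ) {p : ℕ} (d : Fin (p + 1) → ℕ) :
    casLead ħ d = (-ħ) ^ p * (∏ j : Fin p, ((d j.succ : ℂ) - d 0)) *
      casLead ħ (fun j : Fin p => d j.succ) := by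
  have h1 : ∑ k : Fin (p + 1), (k : ℕ) = (∑ k : Fin p, (k : ℕ)) + p := by
    rw [Fin.sum_univ_eq_sum_range (fun k => k), Fin.sum_univ_eq_sum_range (fun k => k),
      sum_range_succ]
  rw [casLead, casLead, h1, Fin.prod_univ_succ, Fin.prod_Ioi_zero]
  simp only [Fin.prod_Ioi_succ]
  ring

theorem tailLead_eq (μ : YoungDiagram) (ħ : ℂ) {a : ℕ} (ha : a < M) :
    tailLead μ ħ M a = (-ħ) ^ (M - (a + 1)) *
      (∏ b ∈ Finset.Ico (a + 1) M, ((rowDeg μ M b : ℂ) - rowDeg μ M a)) *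
      tailLead μ ħ M (a + 1) := by
  have h : ∀ (p : ℕ) (hp : M - a = p + 1), tailLead μ ħ M a =
      casLead ħ fun i : Fin (p + 1) => rowDeg μ M (a + i) := by
    intro p hp
    rw [tailLead, hp]
  rw [h (M - (a + 1)) (by omega), casLead_succ, prod_Ico_eq_prod_range,
    ← Fin.prod_univ_eq_prod_range (fun j => ((rowDeg μ M (a + 1 + j) : ℂ) - rowDeg μ M a)), tailLead]
  simp only [Fin.val_succ, Fin.val_zero, add_zero, add_assoc, add_comm 1]

theorem IsCorner.tailLead_ratio (h : IsCorner μ ν c) (hM : (M, 0) ∉ μ) (hħ : ħ ≠ 0) {a : ℕ}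
    (ha : a ≤ c.1) : tailLead μ ħ M 0 * tailLead ν ħ M a =
      cornerRatio μ.cells c a 0 * (tailLead ν ħ M 0 * tailLead μ ħ M a) := by
  induction a with
  | zero => rw [cornerRatio_zero]; ring
  | succ a ih =>
    have hcM := h.lt hM
    have h0 := ih (by omega)
    have hmem : c.1 ∈ Finset.Ico (a + 1) M := mem_Ico.2 ⟨ha, hcM⟩
    have hprod : (∏ b ∈ (Finset.Ico (a + 1) M).erase c.1, ((rowDeg ν M b : ℂ) - rowDeg ν M a)) =
        ∏ b ∈ (Finset.Ico (a + 1) M).erase c.1, ((rowDeg μ M b : ℂ) - rowDeg μ M a) := by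
      refine prod_congr rfl fun b hb => ?_
      rw [h.rowDeg_of_ne (ne_of_mem_erase hb), h.rowDeg_of_ne (by omega : a ≠ c.1)]
    have hlt : rowDeg μ M c.1 < rowDeg μ M a := rowDeg_strictAnti (by omega) hcM
    have hlt' : ((rowDeg μ M c.1 : ℂ) - rowDeg μ M a) ≠ 0 := by
      rw [sub_ne_zero]; exact_mod_cast hlt.ne
    have hlt2 : ((rowDeg μ M a : ℂ) - rowDeg μ M c.1 + 1) ≠ 0 := by
      rw [← Nat.cast_sub hlt.le]; exact Nat.cast_add_one_ne_zero _
    have hνc : (rowDeg ν M c.1 : ℂ) = rowDeg μ M c.1 - 1 := by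
      rw [h.rowDeg_self]; push_cast; ring
    rw [tailLead_eq ν ħ (by omega : a < M), tailLead_eq μ ħ (by omega : a < M),
      ← mul_prod_erase _ _ hmem, ← mul_prod_erase _ _ hmem, hprod, hνc,
      h.rowDeg_of_ne (by omega : a ≠ c.1)] at h0
    set P := ∏ b ∈ (Finset.Ico (a + 1) M).erase c.1, ((rowDeg μ M b : ℂ) - rowDeg μ M a) with hP
    have hP0 : P ≠ 0 := by
      refine prod_ne_zero_iff.2 fun b hb => ?_
      have hb' := mem_Ico.1 (mem_of_mem_erase hb)
      rw [sub_ne_zero]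
      exact_mod_cast (rowDeg_strictAnti (μ := μ) (show a < b by omega) hb'.2).ne
    have hr : cornerRatio μ.cells c (a + 1) 0 = cornerRatio μ.cells c a 0 *
        (((rowDeg μ M a : ℂ) - rowDeg μ M c.1) / ((rowDeg μ M a : ℂ) - rowDeg μ M c.1 + 1)) := by
      rw [cornerRatio, cornerRatio, prod_range_succ, h.hookC_eq hM (by omega : a < c.1)]
      simp only [range_zero, prod_empty, mul_one, add_sub_cancel_right]
    rw [hr]
    have hpow : (-ħ) ^ (M - (a + 1)) * P ≠ 0 := mul_ne_zero (pow_ne_zero _ (neg_ne_zero.2 hħ)) hP0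
    refine mul_left_cancel₀ hpow ?_
    refine mul_left_cancel₀ hlt2 ?_
    have key := div_mul_cancel₀ ((rowDeg μ M a : ℂ) - rowDeg μ M c.1) hlt2
    linear_combination (-1) * h0 - (-ħ) ^ (M - (a + 1)) * P * cornerRatio μ.cells c a 0 *
      (tailLead ν ħ M 0 * tailLead μ ħ M (a + 1)) * key

/-! ### Multilinearity of the Wronskian -/

theorem casTail_update (ħ : ℂ) (P : ℕ → ℂ[X]) {a b : ℕ} (hab : a ≤ b) (hb : b < M) (v w : ℂ[X])
    (t : ℂ) : casTail ħ M (Function.update P b (v + C t * w)) a =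
      casTail ħ M (Function.update P b v) a + C t * casTail ħ M (Function.update P b w) a := by
  have h : ∀ x : ℂ[X], casTail ħ M (Function.update P b x) a =
      (updateRow (of fun i k : Fin (M - a) =>
        shift ħ (((M - a : ℕ) : ℤ) - 1 - 2 * (k : ℤ)) (P (a + i))) ⟨b - a, by omega⟩
        (fun k => shift ħ (((M - a : ℕ) : ℤ) - 1 - 2 * (k : ℤ)) x)).det := by
    intro x
    rw [casTail, cas]
    refine congrArg _ (ext fun i k => ?_)
    rw [updateRow_apply, of_apply]
    split_ifs with hi
    · rw [hi]
      simp only [show a + (b - a) = b by omega, Function.update_self]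
    · rw [of_apply, Function.update_of_ne]
      rintro rfl
      exact hi (Fin.ext (by simp))
  rw [h, h, h, ← det_updateRow_smul, ← det_updateRow_add]
  refine congrArg _ (congrArg _ (funext fun k => ?_))
  rw [Pi.add_apply, Pi.smul_apply, smul_eq_mul, shift_add, shift_mul, shift_C]

theorem casTail_update_of_lt (ħ : ℂ) (P : ℕ → ℂ[X]) {a b : ℕ} (hab : b < a) (v : ℂ[X]) :
    casTail ħ M (Function.update P b v) a = casTail ħ M P a := by
  unfold casTail
  congr 1
  funext i
  rw [Function.update_of_ne (by omega)]

end

/-! ### Adding a box with a very large inhomogeneity -/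

section

open Filter Topology

variable {μ ν : YoungDiagram} {c : ℕ × ℕ} {M : ℕ} {e : ℕ × ℕ → ℕ}

/-- A tuple for `μ` which degenerates to one for `ν` when the parameter `z (Sum.inr 0)` vanishes. -/
noncomputable def startTuple (μ ν : YoungDiagram) (M b : ℕ)
    (z : gaugeIndex M (rowDeg ν M) ⊕ Fin 2 → ℂ) : ℕ → ℂ[X] :=
  Function.update (gaugeTuple M (rowDeg ν M) (z ∘ Sum.inl)) b
    (gaugeTuple M (rowDeg ν M) (z ∘ Sum.inl) b + C (-z (Sum.inr 0)) * X ^ rowDeg μ M b)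

/-- The Wronskians of the tuple for `ν` with one polynomial replaced by a monomial. -/
noncomputable def startWronskian (μ ν : YoungDiagram) (ħ : ℂ) (M b : ℕ)
    (c : gaugeIndex M (rowDeg ν M) → ℂ) (a : ℕ) : ℂ[X] :=
  casTail ħ M (Function.update (gaugeTuple M (rowDeg ν M) c) b (X ^ rowDeg μ M b)) a

/-- The coefficients of the normalised Wronskian of a degenerating tuple. -/
noncomputable def startCoeffs (μ ν : YoungDiagram) (ħ : ℂ) (M b : ℕ)
    (z : gaugeIndex M (rowDeg ν M) ⊕ Fin 2 → ℂ) (k : Fin (μ.card + 1)) : ℂ :=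
  (C (z (Sum.inr 1)) * (C (tailLead ν ħ M 0)⁻¹ * casTail ħ M (startTuple μ ν M b z) 0)).coeff k

theorem tailLead_mul_tailPoly (hħ : ħ ≠ 0) (c : gaugeIndex M (rowDeg ν M) → ℂ) (a : ℕ) :
    casTail ħ M (gaugeTuple M (rowDeg ν M) c) a = C (tailLead ν ħ M a) * tailPoly ν ħ M c a := by
  rw [tailPoly, ← mul_assoc, ← C_mul, mul_inv_cancel₀ (tailLead_ne_zero hħ a), C_1, one_mul]

theorem casTail_startTuple (hħ : ħ ≠ 0) {b : ℕ} (hb : b < M)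
    (z : gaugeIndex M (rowDeg ν M) ⊕ Fin 2 → ℂ) {a : ℕ} (hab : a ≤ b) :
    casTail ħ M (startTuple μ ν M b z) a = C (tailLead ν ħ M a) * tailPoly ν ħ M (z ∘ Sum.inl) a -
        C (z (Sum.inr 0)) * startWronskian μ ν ħ M b (z ∘ Sum.inl) a := by
  rw [startTuple, casTail_update ħ _ hab hb, Function.update_eq_self, tailLead_mul_tailPoly hħ,
    startWronskian, C_neg, neg_mul, sub_eq_add_neg]

theorem casTail_startTuple_of_lt (hħ : ħ ≠ 0) {b : ℕ}
    (z : gaugeIndex M (rowDeg ν M) ⊕ Fin 2 → ℂ) {a : ℕ} (hab : b < a) :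
    casTail ħ M (startTuple μ ν M b z) a =
      C (tailLead ν ħ M a) * tailPoly ν ħ M (z ∘ Sum.inl) a := by
  rw [startTuple, casTail_update_of_lt ħ _ hab, tailLead_mul_tailPoly hħ]

theorem IsCorner.natDegree_update_le (h : IsCorner μ ν c)
    (x : gaugeIndex M (rowDeg ν M) → ℂ) {f : ℂ[X]} (hf : f.natDegree ≤ rowDeg μ M c.1) {a : ℕ}
    (ha : a < M) :
    (Function.update (gaugeTuple M (rowDeg ν M) x) c.1 f a).natDegree ≤ rowDeg μ M a := by
  by_cases hac : a = c.1
  · subst hac; rwa [Function.update_self]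
  · rw [Function.update_of_ne hac, (hasRowDegrees_gaugeTuple x a ha).2, h.rowDeg_of_ne hac]

theorem IsCorner.natDegree_start_le (h : IsCorner μ ν c) (hM : (M, 0) ∉ μ)
    (z : gaugeIndex M (rowDeg ν M) ⊕ Fin 2 → ℂ) {a : ℕ} (ha : a < M) :
    (startTuple μ ν M c.1 z a).natDegree ≤ rowDeg μ M a := by
  refine h.natDegree_update_le _ (natDegree_add_le_of_degree_le ?_
    (natDegree_C_mul_X_pow_le _ _)) ha
  rw [(hasRowDegrees_gaugeTuple _ _ (h.lt hM)).2, h.rowDeg_self]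
  omega

theorem IsCorner.coeff_startWronskian (h : IsCorner μ ν c) (hM : (M, 0) ∉ μ) (ħ : ℂ)
    (x : gaugeIndex M (rowDeg ν M) → ℂ) (a : ℕ) :
    (startWronskian μ ν ħ M c.1 x a).coeff (boxCount μ.cells a 0) = tailLead μ ħ M a := by
  rw [startWronskian, coeff_casTail hM ħ (fun b hb => h.natDegree_update_le x
    (natDegree_X_pow_le _) hb), prod_eq_one, one_mul]
  intro i _
  by_cases hac : a + i = c.1
  · rw [hac, Function.update_self, coeff_X_pow_self]
  · rw [Function.update_of_ne hac]
    have h1 := isGaugeFixed_gaugeTuple (d := rowDeg ν M) (fun _ _ h h' => rowDeg_strictAnti h h') x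
      (a + i) (by omega)
    have h2 := h1.1.coeff_natDegree
    rwa [h1.2.1, h.rowDeg_of_ne hac] at h2

theorem IsCorner.hasRowDegrees_start (h : IsCorner μ ν c) (hM : (M, 0) ∉ μ)
    {z : gaugeIndex M (rowDeg ν M) ⊕ Fin 2 → ℂ} (hz : z (Sum.inr 0) ≠ 0) :
    HasRowDegrees μ M (startTuple μ ν M c.1 z) := by
  intro a ha
  by_cases hac : a = c.1
  · subst hac
    have h1 : (startTuple μ ν M c.1 z c.1).coeff (rowDeg μ M c.1) ≠ 0 := by
      rw [startTuple, Function.update_self, coeff_add, coeff_C_mul, coeff_X_pow_self,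
        coeff_eq_zero_of_natDegree_lt, zero_add, mul_one]
      · exact neg_ne_zero.2 hz
      · rw [(hasRowDegrees_gaugeTuple _ _ ha).2, h.rowDeg_self]; omega
    exact ⟨fun h0 => h1 (by rw [h0, coeff_zero]),
      le_antisymm (h.natDegree_start_le hM z ha) (le_natDegree_of_ne_zero h1)⟩
  · rw [startTuple, Function.update_of_ne hac, ← h.rowDeg_of_ne hac]
    exact hasRowDegrees_gaugeTuple _ a ha

theorem coeffSmooth_startWronskian (h : IsCorner μ ν c) (ħ : ℂ) (a : ℕ) :
    CoeffSmooth fun x => startWronskian μ ν ħ M c.1 x a := by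
  refine CoeffSmooth.cas (D := rowDeg μ M 0) ħ (fun i => ?_) fun x i =>
    (h.natDegree_update_le x (natDegree_X_pow_le _) (by omega)).trans
      (rowDeg_le μ M (Nat.zero_le _) (by omega))
  by_cases hac : a + i = c.1
  · simp only [hac, Function.update_self]
    exact CoeffSmooth.const _
  · simp only [Function.update_of_ne hac]
    exact coeffSmooth_gaugeTuple M _ _

theorem coeffSmooth_comp {E E' : Type*} [NormedAddCommGroup E] [NormedSpace ℂ E]
    [NormedAddCommGroup E'] [NormedSpace ℂ E'] {f : E → ℂ[X]} (hf : CoeffSmooth f) {g : E' → E}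
    (hg : ContDiff ℂ 1 g) : CoeffSmooth fun x => f (g x) := fun k => (hf k).comp hg

theorem contDiff_startCoeffs (h : IsCorner μ ν c) (hM : (M, 0) ∉ μ) (hħ : ħ ≠ 0) :
    ContDiff ℂ 1 (startCoeffs μ ν ħ M c.1) := by
  have hl : ContDiff ℂ 1 fun z : gaugeIndex M (rowDeg ν M) ⊕ Fin 2 → ℂ => z ∘ Sum.inl :=
    contDiff_pi.2 fun p => contDiff_apply ℂ ℂ (Sum.inl p)
  refine contDiff_pi.2 fun k => ?_
  simp only [startCoeffs, casTail_startTuple hħ (h.lt hM) _ (Nat.zero_le _), sub_eq_add_neg,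
    ← neg_mul, ← C_neg]
  refine ((CoeffSmooth.C (contDiff_apply ℂ ℂ _)).mul ((CoeffSmooth.const _).mul
    (((CoeffSmooth.const _).mul (coeffSmooth_comp (coeffSmooth_tailPoly ν ħ M 0) hl)).add
      ((CoeffSmooth.C (contDiff_apply ℂ ℂ _).neg).mul
        (coeffSmooth_comp (coeffSmooth_startWronskian h ħ 0) hl))))) k

theorem startCoeffs_eq (h : IsCorner μ ν c) (hM : (M, 0) ∉ μ) (hħ : ħ ≠ 0)
    (z : gaugeIndex M (rowDeg ν M) ⊕ Fin 2 → ℂ) (k : Fin (μ.card + 1)) :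
    startCoeffs μ ν ħ M c.1 z k = z (Sum.inr 1) * ((tailPoly ν ħ M (z ∘ Sum.inl) 0).coeff k -
      (tailLead ν ħ M 0)⁻¹ * z (Sum.inr 0) *
        (startWronskian μ ν ħ M c.1 (z ∘ Sum.inl) 0).coeff k) := by
  rw [startCoeffs, casTail_startTuple hħ (h.lt hM) _ (Nat.zero_le _)]
  simp only [coeff_C_mul, coeff_sub]
  rw [mul_sub, ← mul_assoc (tailLead ν ħ M 0)⁻¹, inv_mul_cancel₀ (tailLead_ne_zero hħ 0), one_mul,
    mul_assoc (tailLead ν ħ M 0)⁻¹]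

/-- The point at which the tuple degenerates. -/
def startPoint (x : gaugeIndex M (rowDeg ν M) → ℂ) : gaugeIndex M (rowDeg ν M) ⊕ Fin 2 → ℂ :=
  Sum.elim x ![0, 1]

theorem startCoeffs_injective (h : IsCorner μ ν c) (hM : (M, 0) ∉ μ) (hħ : ħ ≠ 0)
    {x : gaugeIndex M (rowDeg ν M) → ℂ}
    (hinj : ∀ v, HasDerivAt (fun t : ℂ => tailCoeffs ν ħ M (x + t • v)) 0 0 → v = 0)
    (v : gaugeIndex M (rowDeg ν M) ⊕ Fin 2 → ℂ)
    (hv : HasDerivAt (fun t : ℂ => startCoeffs μ ν ħ M c.1 (startPoint x + t • v)) 0 0) : v = 0 := by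
  have hνM := h.not_mem hM
  have hcard := h.card
  have e1 : ∀ t : ℂ, (startPoint x + t • v) ∘ Sum.inl = x + t • (v ∘ Sum.inl) := fun t => rfl
  have e2 : ∀ t : ℂ, (startPoint x + t • v) (Sum.inr 0) = t * v (Sum.inr 0) := fun t => by
    simp [startPoint]
  have e3 : ∀ t : ℂ, (startPoint x + t • v) (Sum.inr 1) = 1 + t * v (Sum.inr 1) := fun t => by
    simp [startPoint]
  have hv' := hasDerivAt_pi.1 hv
  simp only [startCoeffs_eq h hM hħ, e1, e2, e3] at hv'
  have hμ0 : boxCount μ.cells 0 0 = μ.card := boxCount_zero_zero _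
  have hν0 : boxCount ν.cells 0 0 = ν.card := boxCount_zero_zero _
  have h2 : v (Sum.inr 0) = 0 := by
    have h3 := hv' ⟨μ.card, Nat.lt_succ_self _⟩
    have hw : ∀ y : gaugeIndex M (rowDeg ν M) → ℂ,
        (startWronskian μ ν ħ M c.1 y 0).coeff μ.card = tailLead μ ħ M 0 := fun y => by
      rw [← hμ0]; exact h.coeff_startWronskian hM ħ y 0
    have hz : ∀ y : gaugeIndex M (rowDeg ν M) → ℂ, (tailPoly ν ħ M y 0).coeff μ.card = 0 :=
      fun y => coeff_eq_zero_of_natDegree_lt ((natDegree_tailPoly_le hνM ħ y 0).trans_lt (by omega))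
    simp only [hw, hz, Pi.zero_apply, zero_sub] at h3
    have h4 : HasDerivAt (fun t : ℂ => (1 + t * v (Sum.inr 1)) *
        -((tailLead ν ħ M 0)⁻¹ * (t * v (Sum.inr 0)) * tailLead μ ħ M 0))
        (-((tailLead ν ħ M 0)⁻¹ * v (Sum.inr 0) * tailLead μ ħ M 0)) 0 := by
      have h5 := (((hasDerivAt_id (0 : ℂ)).mul_const (v (Sum.inr 1))).const_add 1).mul
        (((((hasDerivAt_id (0 : ℂ)).mul_const (v (Sum.inr 0))).const_mul
          (tailLead ν ħ M 0)⁻¹).mul_const (tailLead μ ħ M 0)).neg)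
      refine h5.congr_deriv ?_
      simp
    have h6 := h3.unique h4
    rw [eq_comm, neg_eq_zero, mul_eq_zero, mul_eq_zero] at h6
    exact (h6.resolve_right (tailLead_ne_zero hħ 0)).resolve_left
      (inv_ne_zero (tailLead_ne_zero hħ 0))
  simp only [h2, mul_zero, zero_mul, sub_zero] at hv'
  have h3 : v (Sum.inr 1) = 0 := by
    have h3 := hv' ⟨ν.card, by omega⟩
    have hz : ∀ y : gaugeIndex M (rowDeg ν M) → ℂ, (tailPoly ν ħ M y 0).coeff ν.card = 1 :=
      fun y => by rw [← hν0]; exact coeff_tailPoly hħ hνM y 0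
    simp only [hz, Pi.zero_apply, mul_one] at h3
    have h5 := ((hasDerivAt_id (0 : ℂ)).mul_const (v (Sum.inr 1))).const_add 1
    simpa using (h3.unique h5).symm
  simp only [h3, mul_zero, add_zero, one_mul] at hv'
  have h4 := hinj (v ∘ Sum.inl) (hasDerivAt_pi.2 fun k => hv' ⟨k, by omega⟩)
  funext p
  rcases p with p | p
  · exact congrFun h4 p
  · fin_cases p
    · exact h2
    · exact h3

theorem IsCorner.tabLead_of_lt (h : IsCorner μ ν c) (hec : ∀ d ∈ μ.cells, d ≠ c → e d < e c)
    {θ θ' : ℕ → ℂ} (hθ : ∀ j < e c, θ' j = θ j) {a : ℕ} (ha : c.1 < a) :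
    tabLead μ.cells e θ' a 0 = tabLead ν.cells e θ a 0 := by
  rw [tabLead, tabLead, h.cells, filter_erase, erase_eq_of_notMem
    (fun h' => absurd (mem_filter.1 h').2.1 (by omega))]
  refine prod_congr rfl fun d hd => ?_
  obtain ⟨hd1, hd2⟩ := mem_filter.1 hd
  have hne : d ≠ c := by rintro rfl; omega
  rw [tabRatio_erase hec hd1 hne, hθ _ (hec d hd1 hne)]

theorem IsCorner.tabLead_of_le (h : IsCorner μ ν c) (hec : ∀ d ∈ μ.cells, d ≠ c → e d < e c)
    {θ θ' : ℕ → ℂ} (hθ : ∀ j < e c, θ' j = θ j) {a : ℕ} (ha : a ≤ c.1) :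
    tabLead μ.cells e θ' a 0 = (X - C (θ' (e c) * cornerRatio μ.cells c a 0)) *
      tabLead ν.cells e θ a 0 := by
  have hmem : c ∈ μ.cells.filter fun d : ℕ × ℕ => a ≤ d.1 ∧ 0 ≤ d.2 :=
    mem_filter.2 ⟨h.mem, ha, Nat.zero_le _⟩
  rw [tabLead, tabLead, ← mul_prod_erase _ _ hmem, tabRatio_top hec, h.cells, filter_erase]
  congr 1
  refine prod_congr rfl fun d hd => ?_
  have hd1 := (mem_filter.1 (mem_of_mem_erase hd)).1
  have hne := ne_of_mem_erase hd
  rw [tabRatio_erase hec hd1 hne, hθ _ (hec d hd1 hne)]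

end

/-! ### Existence of solutions with given leading order -/

section

open Filter Topology

variable {μ ν : YoungDiagram} {c : ℕ × ℕ} {M : ℕ} {e : ℕ × ℕ → ℕ}

theorem tailPoly_monic (hħ : ħ ≠ 0) (hM : (M, 0) ∉ μ)
    (x : gaugeIndex M (rowDeg μ M) → ℂ) (a : ℕ) : (tailPoly μ ħ M x a).Monic :=
  monic_of_natDegree_le_of_coeff_eq_one _ (natDegree_tailPoly_le hM ħ x a)
    (coeff_tailPoly hħ hM x a)

theorem exists_tailPoly_of_startCoeffs (h : IsCorner μ ν c) (hM : (M, 0) ∉ μ) (hħ : ħ ≠ 0)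
    {z : gaugeIndex M (rowDeg ν M) ⊕ Fin 2 → ℂ} {ϑ : ℂ} (hϑ : ϑ ≠ 0) (hκ : z (Sum.inr 1) ≠ 0)
    {S : ℂ[X]} (hS : S.Monic) (hSd : S.natDegree = ν.card)
    (hF : ∀ k, startCoeffs μ ν ħ M c.1 z k = (S * (1 - C ϑ⁻¹ * X)).coeff k) :
    ∃ x, tailPoly μ ħ M x 0 = S * (X - C ϑ) ∧ (∀ a ≤ c.1, tailPoly μ ħ M x a =
        C (-(ϑ * z (Sum.inr 1) * cornerRatio μ.cells c a 0)) * tailPoly ν ħ M (z ∘ Sum.inl) a +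
          C (tailLead μ ħ M a)⁻¹ * startWronskian μ ν ħ M c.1 (z ∘ Sum.inl) a) ∧
      ∀ a, c.1 < a → tailPoly μ ħ M x a = tailPoly ν ħ M (z ∘ Sum.inl) a := by
  have hνM := h.not_mem hM
  have hcM := h.lt hM
  have hcard := h.card
  have hμ0 : boxCount μ.cells 0 0 = μ.card := boxCount_zero_zero _
  have hlead : ∀ a, tailLead μ ħ M a ≠ 0 := tailLead_ne_zero hħ
  have hlead' : ∀ a, tailLead ν ħ M a ≠ 0 := tailLead_ne_zero hħ
  have hfac : S * (1 - C ϑ⁻¹ * X) = C (-ϑ⁻¹) * (S * (X - C ϑ)) := by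
    have h1 : C ϑ⁻¹ * C ϑ = (1 : ℂ[X]) := by rw [← C_mul, inv_mul_cancel₀ hϑ, C_1]
    rw [C_neg]
    linear_combination (-S) * h1
  have hSX : (S * (X - C ϑ)).Monic := hS.mul (monic_X_sub_C ϑ)
  have hSXd : (S * (X - C ϑ)).natDegree = μ.card := by
    rw [hS.natDegree_mul (monic_X_sub_C ϑ), hSd, natDegree_X_sub_C, hcard]
  have hε1 : z (Sum.inr 1) * z (Sum.inr 0) * tailLead μ ħ M 0 * ϑ = tailLead ν ħ M 0 := by
    have h1 := hF ⟨μ.card, Nat.lt_succ_self _⟩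
    have h2 := hSX.coeff_natDegree
    have h3 := h.coeff_startWronskian hM ħ (z ∘ Sum.inl) 0
    rw [hSXd] at h2
    rw [hμ0] at h3
    rw [startCoeffs_eq h hM hħ, hfac, coeff_C_mul] at h1
    simp only [h2, h3] at h1
    rw [coeff_eq_zero_of_natDegree_lt ((natDegree_tailPoly_le hνM ħ _ 0).trans_lt (by
      rw [boxCount_zero_zero]; exact (Nat.lt_succ_self _).trans_eq hcard))] at h1
    have h4 := hlead' 0
    field_simp at h1
    linear_combination (-1) * h1
  have hε : z (Sum.inr 0) ≠ 0 := by
    intro h0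
    rw [h0] at hε1
    exact hlead' 0 (by rw [← hε1]; ring)
  obtain ⟨x, hx⟩ := exists_tailPoly_eq hħ (h.hasRowDegrees_start hM hε)
  refine ⟨x, ?_, fun a ha => ?_, fun a ha => ?_⟩
  · refine Propto.eq_of_monic ((hx 0).trans ?_) (tailPoly_monic hħ hM x 0) hSX
    have hp : C (z (Sum.inr 1)) * (C (tailLead ν ħ M 0)⁻¹ *
        casTail ħ M (startTuple μ ν M c.1 z) 0) = S * (1 - C ϑ⁻¹ * X) := by
      ext k
      by_cases hk : k < μ.card + 1
      · exact hF ⟨k, hk⟩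
      · rw [coeff_eq_zero_of_natDegree_lt, coeff_eq_zero_of_natDegree_lt]
        · rw [hfac]
          exact (natDegree_C_mul_le _ _).trans_lt (by omega)
        · refine ((natDegree_C_mul_le _ _).trans ((natDegree_C_mul_le _ _).trans
            (natDegree_casTail_le hM ħ (fun _ hb => h.natDegree_start_le hM z hb) 0))).trans_lt ?_
          rw [hμ0]; omega
    rw [hfac, ← mul_assoc, ← C_mul] at hp
    have h1 : Propto (C (z (Sum.inr 1) * (tailLead ν ħ M 0)⁻¹) *
        casTail ħ M (startTuple μ ν M c.1 z) 0) (casTail ħ M (startTuple μ ν M c.1 z) 0) :=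
      ⟨_, mul_ne_zero hκ (inv_ne_zero (hlead' 0)), rfl⟩
    rw [hp] at h1
    exact h1.symm.trans ⟨_, neg_ne_zero.2 (inv_ne_zero hϑ), rfl⟩
  · obtain ⟨y, hy, hxy⟩ := hx a
    rw [casTail_startTuple hħ hcM z ha] at hxy
    have h1 := coeff_tailPoly hħ hM x a
    have h5 := h.boxCount_eq a
    rw [if_pos ha] at h5
    rw [hxy, coeff_C_mul, coeff_sub, coeff_C_mul, coeff_C_mul, h.coeff_startWronskian hM,
      coeff_eq_zero_of_natDegree_lt ((natDegree_tailPoly_le hνM ħ _ a).trans_lt (by omega))] at h1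
    have hy' : y * z (Sum.inr 0) = -(tailLead μ ħ M a)⁻¹ := by
      have := hlead a
      field_simp
      linear_combination (-1) * h1
    have hr := h.tailLead_ratio hM hħ ha
    have hyν : y * tailLead ν ħ M a = -(ϑ * z (Sum.inr 1) * cornerRatio μ.cells c a 0) := by
      refine mul_right_cancel₀ hε (mul_right_cancel₀ (hlead a) (mul_right_cancel₀ (hlead' 0) ?_))
      linear_combination (-tailLead ν ħ M 0 * tailLead ν ħ M a) * h1 -
        ϑ * z (Sum.inr 1) * z (Sum.inr 0) * hr + tailLead ν ħ M a * hε1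
    rw [hxy, ← hyν, ← neg_neg (tailLead μ ħ M a)⁻¹, ← hy']
    simp only [C_mul, C_neg]
    ring
  · refine Propto.eq_of_monic ((hx a).trans ?_) (tailPoly_monic hħ hM x a)
      (tailPoly_monic hħ hνM _ a)
    rw [casTail_startTuple_of_lt hħ z ha]
    exact ⟨_, hlead' a, rfl⟩

theorem IsLabelled.exists_start (h : IsCorner μ ν c) (hM : (M, 0) ∉ μ) (hħ : ħ ≠ 0)
    {θ : ℕ → ℂ} (hθ : ∀ j, θ j ≠ 0) (he : IsTab μ.cells e) (hec : e c = μ.card - 1)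
    (hne : ∀ a k, k ≤ boxCount ν.cells a 0 → (tabLead ν.cells e θ a 0).coeff k ≠ 0)
    {x : gaugeIndex M (rowDeg ν M) → ℂ} (hx : IsLabelled ν M ħ θ e (1 / 4) x)
    (hinj : ∀ v, HasDerivAt (fun t : ℂ => tailCoeffs ν ħ M (x + t • v)) 0 0 → v = 0) :
    ∃ t : ℝ, 1 ≤ t ∧ ∃ y, IsLabelled μ M ħ
      (Function.update θ (μ.card - 1) (t * θ (μ.card - 1))) e (1 / 2) y := by
  have hνM := h.not_mem hM
  have hcard := h.card
  have hcμ : μ.cells.card = μ.card := rfl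
  set ϑ : ℝ → ℂ := fun t => (t : ℂ) * θ (μ.card - 1) with hϑ
  set θt : ℝ → ℕ → ℂ := fun t => Function.update θ (μ.card - 1) (ϑ t) with hθt
  set S : ℂ[X] := tailPoly ν ħ M x 0 with hS
  have hSd : S.natDegree = ν.card := by
    obtain ⟨Q, hQ, h1, h2⟩ := exists_isQFamily_tailPoly hħ hνM x
    rw [hS, ← h2, h1]
  have hlt : ∀ d ∈ μ.cells, d ≠ c → e d < e c := fun d hd hdc => by
    have h1 := he.lt d hd
    have h2 : e d ≠ e c := fun h' => hdc (he.inj d hd c h.mem h')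
    omega
  have hθeq : ∀ t, ∀ j < e c, θt t j = θ j := fun t j hj => Function.update_of_ne (by omega) _ _
  have hθtop : ∀ t, θt t (e c) = t * θ (μ.card - 1) := fun t => by
    simp only [hθt, hec, Function.update_self, hϑ]
  have hinv : Tendsto (fun t : ℝ => ((t : ℂ))⁻¹) atTop (𝓝 0) := by
    have h1 := (Complex.continuous_ofReal.tendsto 0).comp tendsto_inv_atTop_zero
    rw [Complex.ofReal_zero] at h1
    exact h1.congr fun t => by simp
  have hϑinv : Tendsto (fun t => (ϑ t)⁻¹) atTop (𝓝 0) := by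
    have h1 := hinv.mul_const (θ (μ.card - 1))⁻¹
    rw [zero_mul] at h1
    exact h1.congr fun t => by simp only [hϑ, mul_inv]
  obtain ⟨G, hG, hGF⟩ := exists_lift (F := startCoeffs μ ν ħ M c.1) (z₀ := startPoint x)
    (by rw [Fintype.card_sum, Fintype.card_coe, card_gaugeIndex_rowDeg hνM, Fintype.card_fin,
      Fintype.card_fin, ← hcard])
    (contDiff_startCoeffs h hM hħ).contDiffAt (startCoeffs_injective h hM hħ hinj)
  set T : ℝ → Fin (μ.card + 1) → ℂ := fun t k => (S * (1 - C (ϑ t)⁻¹ * X)).coeff k with hT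
  have hTt : Tendsto T atTop (𝓝 (startCoeffs μ ν ħ M c.1 (startPoint x))) := by
    refine tendsto_pi_nhds.2 fun k => ?_
    have h1 := ((CoeffTendsto.const S).mul ((CoeffTendsto.const 1).sub
      ((CoeffTendsto.C hϑinv).mul (CoeffTendsto.const X)))) k
    have h2 : startCoeffs μ ν ħ M c.1 (startPoint x) k = (S * (1 - C 0 * X)).coeff k := by
      rw [startCoeffs_eq h hM hħ]
      simp only [startPoint, Sum.elim_inr, Sum.elim_comp_inl, cons_val_zero,
        cons_val_one, mul_zero, zero_mul, sub_zero, one_mul, C_0, mul_one, hS]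
    rw [h2]
    exact h1
  set z := fun t => G (T t) with hz
  have hzt : Tendsto z atTop (𝓝 (startPoint x)) := hG.comp hTt
  have hκ : Tendsto (fun t => z t (Sum.inr 1)) atTop (𝓝 1) := by
    have h1 := (tendsto_pi_nhds.1 hzt) (Sum.inr 1)
    simpa [startPoint] using h1
  have hxt : Tendsto (fun t => z t ∘ Sum.inl) atTop (𝓝 x) :=
    tendsto_pi_nhds.2 fun p => (tendsto_pi_nhds.1 hzt) (Sum.inl p)
  have hϑ0 : ∀ t : ℝ, 1 ≤ t → ϑ t ≠ 0 := fun t ht =>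
    mul_ne_zero (Complex.ofReal_ne_zero.2 (by linarith)) (hθ _)
  have hgood : ∀ᶠ t in atTop, 1 ≤ t ∧ z t (Sum.inr 1) ≠ 0 ∧
      startCoeffs μ ν ħ M c.1 (z t) = T t := by
    filter_upwards [eventually_ge_atTop 1, hκ.eventually_ne one_ne_zero, hTt.eventually hGF]
      with t h1 h2 h3 using ⟨h1, h2, h3⟩
  choose! y hy1 hy2 hy3 using fun t (ht : 1 ≤ t ∧ z t (Sum.inr 1) ≠ 0 ∧
      startCoeffs μ ν ħ M c.1 (z t) = T t) =>
    exists_tailPoly_of_startCoeffs h hM hħ (hϑ0 t ht.1) ht.2.1 (tailPoly_monic hħ hνM x 0) hSd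
      (fun k => congrFun ht.2.2 k)
  have hnear := eventually_near (l := atTop) (e := e) (z := y) (θ := θt) hħ hM (by
    intro a k hk
    have hk' := h.boxCount_eq a
    have hV := (coeffSmooth_tailPoly ν ħ M a).tendsto hxt k
    rcases le_or_gt a c.1 with ha | ha
    · rw [if_pos ha] at hk'
      set R := cornerRatio μ.cells c a 0 with hR
      set L := θ (μ.card - 1) with hL
      have hLR : L * R ≠ 0 := by
        refine mul_ne_zero (hθ _) ?_
        rw [hR, ← tabRatio_top hlt]
        exact he.tabRatio_ne_zero h.mem ha (Nat.zero_le _)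
      have hu : Tendsto (fun t : ℝ => -(L * z t (Sum.inr 1) * R) *
          (tailPoly ν ħ M (z t ∘ Sum.inl) a).coeff k + (tailLead μ ħ M a)⁻¹ *
          (startWronskian μ ν ħ M c.1 (z t ∘ Sum.inl) a).coeff k * (t : ℂ)⁻¹) atTop
          (𝓝 (-(L * 1 * R) * (tailPoly ν ħ M x a).coeff k + (tailLead μ ħ M a)⁻¹ *
            (startWronskian μ ν ħ M c.1 x a).coeff k * 0)) :=
        (((hκ.const_mul L).mul_const R).neg.mul hV).add
          ((((coeffSmooth_startWronskian h ħ a).tendsto hxt k).const_mul _).mul hinv)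
      have hv : Tendsto (fun t : ℝ => (X * tabLead ν.cells e θ a 0).coeff k * (t : ℂ)⁻¹ -
          L * R * (tabLead ν.cells e θ a 0).coeff k) atTop
          (𝓝 ((X * tabLead ν.cells e θ a 0).coeff k * 0 -
            L * R * (tabLead ν.cells e θ a 0).coeff k)) := (hinv.const_mul _).sub_const _
      have hn0 := hne a k (by omega)
      have hev := eventually_norm_sub_le hu hv
        (by rw [mul_zero, zero_sub, neg_ne_zero]; exact mul_ne_zero hLR hn0) (by
          have h1 := hx.near a k
          have h2 : -(L * 1 * R) * (tailPoly ν ħ M x a).coeff k + (tailLead μ ħ M a)⁻¹ *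
              (startWronskian μ ν ħ M c.1 x a).coeff k * 0 -
              ((X * tabLead ν.cells e θ a 0).coeff k * 0 -
              L * R * (tabLead ν.cells e θ a 0).coeff k) =
              -(L * R) * ((tailPoly ν ħ M x a).coeff k - (tabLead ν.cells e θ a 0).coeff k) := by
            ring
          rw [h2, mul_zero, zero_sub, norm_neg, norm_mul, norm_mul, norm_neg, mul_left_comm]
          exact mul_le_mul_of_nonneg_left h1 (norm_nonneg _))
      filter_upwards [hev, hgood] with t h1 h2
      have ht0 : (t : ℂ) ≠ 0 := Complex.ofReal_ne_zero.2 (by linarith [h2.1])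
      have e1 : (tailPoly μ ħ M (y t) a).coeff k = (t : ℂ) * (-(L * z t (Sum.inr 1) * R) *
          (tailPoly ν ħ M (z t ∘ Sum.inl) a).coeff k + (tailLead μ ħ M a)⁻¹ *
          (startWronskian μ ν ħ M c.1 (z t ∘ Sum.inl) a).coeff k * (t : ℂ)⁻¹) := by
        rw [hy2 t h2 a ha, coeff_add, coeff_C_mul, coeff_C_mul]
        field_simp
        simp only [hϑ]
        ring
      have e2 : (tabLead μ.cells e (θt t) a 0).coeff k =
          (t : ℂ) * ((X * tabLead ν.cells e θ a 0).coeff k * (t : ℂ)⁻¹ -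
          L * R * (tabLead ν.cells e θ a 0).coeff k) := by
        rw [h.tabLead_of_le hlt (hθeq t) ha, hθtop, sub_mul, coeff_sub, coeff_C_mul, ← hR]
        field_simp
      rw [e1, e2, ← mul_sub, norm_mul, norm_mul, mul_left_comm]
      exact mul_le_mul_of_nonneg_left h1 (norm_nonneg _)
    · rw [if_neg (by omega)] at hk'
      filter_upwards [hgood, eventually_norm_sub_le hV tendsto_const_nhds (hne a k (by omega))
        (hx.near a k)] with t h1 h2
      rw [hy3 t h1 a ha, h.tabLead_of_lt hlt (hθeq t) ha]
      exact h2)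
  obtain ⟨t, ht, hnt⟩ := (hgood.and hnear).exists
  refine ⟨t, ht.1, y t, ?_, hnt⟩
  rw [hy1 t ht, hx.source, ← hcard, prod_range_succ, Nat.add_sub_cancel, Function.update_self]
  have hlast : μ.card - 1 = ν.card := by omega
  simp only [hϑ, hlast]
  congr 1
  refine prod_congr rfl fun j hj => ?_
  rw [Function.update_of_ne (mem_range.1 hj).ne]

theorem WellSeparated.of_le {L L' : ℕ} {δ K : ℝ} {θ : ℕ → ℂ}
    (h : WellSeparated L δ K ħ θ) (hL : L' ≤ L) : WellSeparated L' δ K ħ θ :=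
  ⟨h.ħ_ne, h.θ_ne, fun h' => h.first (by omega), fun j hj => h.ratio j (by omega)⟩

theorem exists_isLabelled {δ : ℝ} (hδ : 0 < δ) (hM : (M, 0) ∉ μ) (he : IsTab μ.cells e) :
    ∃ K : ℝ, ∀ ħ θ, WellSeparated μ.card δ K ħ θ → ∃ x, IsLabelled μ M ħ θ e (1 / 2) x := by
  induction hn : μ.card generalizing μ with
  | zero =>
    refine ⟨0, fun ħ θ hs => ⟨0, ?_, fun a k => ?_⟩⟩
    · rw [← tabLead_zero_zero he]
      ext k
      exact coeff_tailPoly_eq_tabLead hs.ħ_ne hM _ e θ (by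
        rw [boxCount_zero_zero]; exact hn.le.trans (Nat.zero_le _))
    · rw [coeff_tailPoly_eq_tabLead hs.ħ_ne hM _ e θ, sub_self, norm_zero]
      · positivity
      · exact (boxCount_mono _ (Nat.zero_le a) le_rfl).trans (by
          rw [boxCount_zero_zero]; exact hn.le.trans (Nat.zero_le _))
  | succ L ih =>
    obtain ⟨ν, c, h, hec, heν⟩ := he.exists_isCorner (by omega)
    have hcard := h.card
    have hνM := h.not_mem hM
    obtain ⟨K₁, h1⟩ := ih hνM heν (by omega)
    obtain ⟨K₂, h2⟩ := IsLabelled.exists_improve hδ heν hνM (show (0 : ℝ) < 1 / 4 by norm_num)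
    obtain ⟨K₃, h3⟩ := IsLabelled.exists_injective hδ heν hνM
    obtain ⟨K₄, h4⟩ := exists_coeff_ne_zero hδ heν
    obtain ⟨K₅, h5⟩ := IsLabelled.exists_continuation hδ he hM
    refine ⟨max (max K₁ K₂) (max (max K₃ K₄) K₅), fun ħ θ hs => ?_⟩
    have hsν : WellSeparated ν.card δ _ ħ θ := hs.of_le (by omega)
    obtain ⟨x, hx⟩ := h1 ħ θ ((hs.of_le (by omega)).mono ((le_max_left _ _).trans (le_max_left _ _)))
    have hx3 := h3 ħ θ (hsν.mono (((le_max_left _ _).trans (le_max_left _ _)).trans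
      (le_max_right _ _))) x hx
    have hx2 := h2 ħ θ (hsν.mono ((le_max_right _ _).trans (le_max_left _ _))) x hx
    have hx4 := h4 ħ θ (hsν.mono (((le_max_right _ _).trans (le_max_left _ _)).trans
      (le_max_right _ _)))
    exact h5 ħ θ (by rw [hn]; exact hs.mono ((le_max_right _ _).trans (le_max_right _ _)))
      (IsLabelled.exists_start h hM hs.ħ_ne hs.θ_ne he hec (fun a k hk => hx4 a 0 k hk) hx2 hx3)

end

/-! ### The supersymmetric Wronskian determinants -/

theorem superWronskian_swap (ħ : ℂ) {p q : ℕ} (Qb : Fin p → ℂ[X]) (Qf : Fin q → ℂ[X])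
    (Qm : Fin p → Fin q → ℂ[X]) :
    superWronskian ħ Qf Qb (fun j i => Qm i j) = superWronskian ħ Qb Qf Qm := by
  unfold superWronskian
  rcases lt_trichotomy p q with h | h | h
  · rw [if_pos h.le, if_neg (not_le.2 h)]
  · subst h
    rw [if_pos le_rfl, if_pos le_rfl, ← det_transpose]
    congr 1
    ext1 i j
    simp
  · rw [if_neg (not_le.2 h), if_pos h.le]

theorem superWronskian_of_le (ħ : ℂ) {p q : ℕ} (h : q ≤ p) (Qb : Fin p → ℂ[X])
    (Qf : Fin q → ℂ[X]) (Qm : Fin p → Fin q → ℂ[X]) :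
    superWronskian ħ Qb Qf Qm = det (of fun k a : Fin p =>
      if h : (k : ℕ) < q then shift ħ ((p : ℤ) - q) (Qm a ⟨k, h⟩)
      else shift ħ ((p : ℤ) - q - 1 - 2 * ((k : ℤ) - q)) (Qb a)) := by
  rw [superWronskian, if_pos h, ← det_transpose]
  rfl

theorem det_eq_add_of_row_zero {R : Type*} [CommRing R] {p : ℕ}
    {A : Matrix (Fin (p + 1)) (Fin (p + 1)) R} (B : Matrix (Fin (p + 1)) (Fin (p + 1)) R) (c : R)
    (h0 : A 0 = B 0 + Pi.single 0 c)
    (hs : ∀ k : Fin p, A k.succ = B k.succ) :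
    A.det = B.det + c * (B.submatrix Fin.succ Fin.succ).det := by
  have h : ∀ a, A.submatrix Fin.succ (Fin.succAbove a) = B.submatrix Fin.succ (Fin.succAbove a) :=
    fun a => by ext1 i j; exact congrFun (hs i) _
  have h' : A.submatrix Fin.succ Fin.succ = B.submatrix Fin.succ Fin.succ := h 0
  rw [det_succ_row_zero, det_succ_row_zero B, Fin.sum_univ_succ, Fin.sum_univ_succ]
  simp only [h, h', h0, Pi.add_apply, Pi.single_eq_same, Pi.single_eq_of_ne (Fin.succ_ne_zero _),
    add_zero, Fin.succAbove_zero, Fin.val_zero, pow_zero, one_mul]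
  ring

theorem superWronskian_add_aux (ħ : ℂ) {p q : ℕ} (h : q ≤ p) (Qb : Fin (p + 1) → ℂ[X])
    (Qf : Fin (q + 1) → ℂ[X]) {Qm Qm' : Fin (p + 1) → Fin (q + 1) → ℂ[X]} {c : ℂ}
    (h0 : Qm' 0 0 = Qm 0 0 + C c) (hne : ∀ i j, ¬(i = 0 ∧ j = 0) → Qm' i j = Qm i j) :
    superWronskian ħ Qb Qf Qm' = superWronskian ħ Qb Qf Qm +
      C c * superWronskian ħ (Fin.tail Qb) (Fin.tail Qf) (fun i j => Qm i.succ j.succ) := by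
  rw [superWronskian_of_le ħ (by omega), superWronskian_of_le ħ (by omega),
    superWronskian_of_le ħ h]
  refine (det_eq_add_of_row_zero (of fun k a : Fin (p + 1) =>
      if h : (k : ℕ) < q + 1 then shift ħ (((p + 1 : ℕ) : ℤ) - (q + 1 : ℕ)) (Qm a ⟨k, h⟩)
      else shift ħ (((p + 1 : ℕ) : ℤ) - (q + 1 : ℕ) - 1 - 2 * ((k : ℤ) - (q + 1 : ℕ))) (Qb a))
      (C c) ?_ fun k => ?_).trans ?_
  · ext1 a
    have h1 : ((0 : Fin (p + 1)) : ℕ) < q + 1 := Nat.succ_pos q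
    rw [Pi.add_apply, of_apply, of_apply, dif_pos h1, dif_pos h1]
    refine Fin.cases ?_ (fun i => ?_) a
    · rw [Pi.single_eq_same]
      exact (congrArg _ h0).trans (by rw [shift_add, shift_C]; rfl)
    · rw [Pi.single_eq_of_ne (Fin.succ_ne_zero i), add_zero,
        hne _ _ fun h => Fin.succ_ne_zero i h.1]
  · ext1 a
    simp only [of_apply]
    split_ifs with h1
    · rw [hne _ _ fun h => by simpa using congrArg Fin.val h.2]
    · rfl
  · congr 3
    ext1 k a
    simp only [submatrix_apply, of_apply, Fin.val_succ, add_lt_add_iff_right]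
    split_ifs with h1
    · exact shift_congr (by push_cast; ring) _
    · exact shift_congr (by push_cast; ring) _

/-- The Wronskian determinant is an affine function of the constant term of the first mixed
entry. -/
theorem superWronskian_add (ħ : ℂ) {p q : ℕ} (Qb : Fin (p + 1) → ℂ[X])
    (Qf : Fin (q + 1) → ℂ[X]) {Qm Qm' : Fin (p + 1) → Fin (q + 1) → ℂ[X]} {c : ℂ}
    (h0 : Qm' 0 0 = Qm 0 0 + C c) (hne : ∀ i j, ¬(i = 0 ∧ j = 0) → Qm' i j = Qm i j) :
    superWronskian ħ Qb Qf Qm' = superWronskian ħ Qb Qf Qm +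
      C c * superWronskian ħ (Fin.tail Qb) (Fin.tail Qf) (fun i j => Qm i.succ j.succ) := by
  rcases le_total q p with h | h
  · exact superWronskian_add_aux ħ h Qb Qf h0 hne
  · rw [← superWronskian_swap, ← superWronskian_swap ħ Qb Qf Qm,
      ← superWronskian_swap ħ (Fin.tail Qb)]
    exact superWronskian_add_aux ħ h Qf Qb h0 fun i j hij => hne j i fun h => hij ⟨h.2, h.1⟩

theorem det_insertNth {R : Type*} [CommRing R] {n : ℕ} (p : Fin (n + 1)) (w : Fin (n + 1) → R)
    (Y : Fin n → Fin (n + 1) → R) :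
    det (of (Fin.insertNth p w Y : Fin (n + 1) → Fin (n + 1) → R)) =
      (-1) ^ (p : ℕ) * det (of (Fin.cons w Y : Fin (n + 1) → Fin (n + 1) → R)) := by
  have h := det_permute (Fin.cycleRange p) (of (Fin.cons w Y))
  have h2 : (of (Fin.cons w Y : Fin (n + 1) → Fin (n + 1) → R)).submatrix
      (Fin.cycleRange p) id = of (Fin.insertNth p w Y : Fin (n + 1) → _) :=
    Fin.cons_comp_cycleRange w Y p
  rw [← h2, h, Fin.sign_cycleRange]
  push_cast
  rfl

section

variable {q k : ℕ} {Qb : Fin (q + k + 2) → ℂ[X]} {Qf : Fin (q + 1) → ℂ[X]}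
  {Qm : Fin (q + k + 2) → Fin (q + 1) → ℂ[X]}

/-- The columns common to the determinants around a box. -/
noncomputable def commonCols (ħ : ℂ) (Qb : Fin (q + k + 2) → ℂ[X])
    (Qm : Fin (q + k + 2) → Fin (q + 1) → ℂ[X]) (j : Fin (q + k)) (a : Fin (q + k + 2)) : ℂ[X] :=
  if h : (j : ℕ) < q then shift ħ k (Qm a ⟨j + 1, by omega⟩)
  else shift ħ ((k : ℤ) - 1 - 2 * ((j : ℤ) - q)) (Qb a)

theorem shift_add_two (h : ∀ a i, shift ħ 1 (Qm a i) - shift ħ (-1) (Qm a i) = Qb a * Qf i)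
    (a : Fin (q + k + 2)) (i : Fin (q + 1)) (l : ℤ) : shift ħ (l + 2) (Qm a i) =
      shift ħ l (Qm a i) + shift ħ (l + 1) (Qf i) * shift ħ (l + 1) (Qb a) := by
  have := congrArg (shift ħ (l + 1)) (h a i)
  simp only [shift_sub, shift_mul, shift_shift] at this
  rw [show l + 1 + 1 = l + 2 by ring, show l + 1 + -1 = l by ring] at this
  linear_combination this

theorem shift_one_superWronskian
    (h : ∀ a i, shift ħ 1 (Qm a i) - shift ħ (-1) (Qm a i) = Qb a * Qf i) :
    shift ħ 1 (superWronskian ħ Qb Qf Qm) = (-1) ^ (q + 1) *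
      detTwo (commonCols ħ Qb Qm) (fun a => shift ħ (k + 1) (Qb a))
        (fun a => shift ħ k (Qm a 0)) := by
  rw [superWronskian_of_le ħ (by omega), shift_det, detTwo]
  refine Eq.trans ?_ (det_insertNth (⟨q + 1, by omega⟩ : Fin (q + k + 2)) _ _)
  refine det_eq_of_forall_row_eq_smul_add_const
    (fun j => if h : (j : ℕ) < q + 1 then shift ħ (k + 1) (Qf ⟨j, h⟩) else 0) ⟨q + 1, by omega⟩
    (dif_neg (by simp)) fun j a => ?_
  simp only [of_apply, Fin.insertNth_apply_same]
  refine Fin.succAboveCases (⟨q + 1, by omega⟩ : Fin (q + k + 2)) ?_ (fun j => ?_) j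
  · simp only [lt_irrefl, dif_neg, not_false_eq_true, Fin.insertNth_apply_same, zero_mul, add_zero,
      shift_shift]
    exact shift_congr (by push_cast; ring) _
  · rw [Fin.insertNth_apply_succAbove]
    refine Fin.cases ?_ (fun j => ?_) j
    · have h0 : ((Fin.succAbove (⟨q + 1, by omega⟩ : Fin (q + k + 2)) 0 : Fin (q + k + 2)) : ℕ) = 0 := by
        simp
      simp only [h0, Nat.succ_pos, dif_pos, Fin.cons_zero, shift_shift]
      have := shift_add_two h a 0 k
      rw [shift_congr (show (1 : ℤ) + (((q + k + 2 : ℕ) : ℤ) - (q + 1 : ℕ)) = k + 2 by push_cast; ring)]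
      exact this
    · rw [Fin.cons_succ, commonCols]
      by_cases hj : (j : ℕ) < q
      · have h0 : ((Fin.succAbove (⟨q + 1, by omega⟩ : Fin (q + k + 2)) j.succ : Fin (q + k + 2)) : ℕ)
            = j + 1 := by
          rw [Fin.succAbove_of_castSucc_lt _ _ (by simp [Fin.lt_def]; omega)]; simp
        simp only [h0, hj, add_lt_add_iff_right, dif_pos, shift_shift]
        rw [shift_congr (show (1 : ℤ) + (((q + k + 2 : ℕ) : ℤ) - (q + 1 : ℕ)) = k + 2 by push_cast; ring)]
        exact shift_add_two h a _ k
      · have h0 : ((Fin.succAbove (⟨q + 1, by omega⟩ : Fin (q + k + 2)) j.succ : Fin (q + k + 2)) : ℕ)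
            = j + 2 := by
          rw [Fin.succAbove_of_le_castSucc _ _ (by simp [Fin.le_def]; omega)]; simp
        have hj' : ¬ (j : ℕ) + 2 < q + 1 := by omega
        simp only [h0, hj, hj', dif_neg, not_false_eq_true, shift_shift, zero_mul, add_zero]
        exact shift_congr (by push_cast; ring) _

theorem shift_neg_one_superWronskian :
    shift ħ (-1) (superWronskian ħ Qb Qf Qm) = (-1) ^ (q + k + 1) *
      detTwo (commonCols ħ Qb Qm) (fun a => shift ħ (-(k + 1)) (Qb a))
        (fun a => shift ħ k (Qm a 0)) := by
  rw [superWronskian_of_le ħ (by omega), shift_det, detTwo, det_cons_eq_snoc, ← mul_assoc,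
    ← mul_pow, neg_one_mul, neg_neg, one_pow, one_mul]
  congr 1
  ext1 j a
  simp only [of_apply]
  refine Fin.lastCases ?_ (fun j => ?_) j
  · rw [Fin.snoc_last, dif_neg (by simp), shift_shift]
    exact shift_congr (by push_cast; ring) _
  · rw [Fin.snoc_castSucc]
    refine Fin.cases ?_ (fun j => ?_) j
    · rw [dif_pos (by simp), shift_shift]
      exact shift_congr (by push_cast; ring) _
    · rw [Fin.cons_succ, commonCols]
      by_cases hj : (j : ℕ) < q
      · rw [dif_pos (by simpa using hj), dif_pos hj, shift_shift]
        exact shift_congr (by push_cast; ring) _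
      · rw [dif_neg (by simpa using hj), dif_neg hj, shift_shift]
        exact shift_congr (by simp; ring) _

/-- The superWronskian of the tail, as that of a family whose first mixed column is a unit
vector. -/
theorem superWronskian_tail :
    superWronskian ħ (Fin.tail Qb) (Fin.tail Qf) (fun i j => Qm i.succ j.succ) =
      superWronskian ħ (p := q + k + 2) Qb (Fin.cons 0 (Fin.tail Qf) : Fin (q + 1) → ℂ[X])
        (fun a => Fin.cons (Pi.single (M := fun _ => ℂ[X]) 0 1 a) (Fin.tail (Qm a))) := by
  have h0 : superWronskian ħ (p := q + k + 2) Qb (Fin.cons 0 (Fin.tail Qf) : Fin (q + 1) → ℂ[X])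
      (fun a => (Fin.cons 0 (Fin.tail (Qm a)) : Fin (q + 1) → ℂ[X])) = 0 := by
    rw [superWronskian_of_le ħ (by omega)]
    refine det_eq_zero_of_row_eq_zero 0 fun a => ?_
    rw [of_apply, dif_pos (by simp)]
    exact shift_zero_right _ _
  rw [superWronskian_add ħ (p := q + k + 1)
    (Qm := fun a => (Fin.cons 0 (Fin.tail (Qm a)) : Fin (q + 1) → ℂ[X])) (c := 1) Qb
    (Fin.cons 0 (Fin.tail Qf)) (by simp) (by
      intro i j hij
      refine Fin.cases (fun h => ?_) (fun j _ => rfl) j hij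
      have h : i ≠ 0 := by simpa using h
      simp [h]), h0, zero_add, C_1, one_mul]
  rfl

theorem superWronskian_tail_right
    (h : ∀ a i, shift ħ 1 (Qm a i) - shift ħ (-1) (Qm a i) = Qb a * Qf i) :
    superWronskian ħ Qb (Fin.tail Qf) (fun i j => Qm i j.succ) = (-1) ^ (q + (q + k + 1)) *
      detTwo (commonCols ħ Qb Qm) (fun a => shift ħ (-(k + 1)) (Qb a))
        (fun a => shift ħ (k + 1) (Qb a)) := by
  rw [superWronskian_of_le ħ (by omega), detTwo, det_cons_eq_snoc, pow_add, mul_assoc,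
    ← mul_assoc ((-1) ^ (q + k + 1)), ← mul_pow, neg_one_mul, neg_neg, one_pow, one_mul,
    ← Fin.cons_snoc_eq_snoc_cons]
  refine Eq.trans ?_ (det_insertNth (⟨q, by omega⟩ : Fin (q + k + 2)) _ _)
  refine det_eq_of_forall_row_eq_smul_add_const
    (fun j => if h : (j : ℕ) < q then shift ħ (k + 1) (Qf ⟨j + 1, by omega⟩) else 0)
    ⟨q, by omega⟩ (dif_neg (by simp)) fun j a => ?_
  simp only [of_apply, Fin.insertNth_apply_same]
  refine Fin.succAboveCases (⟨q, by omega⟩ : Fin (q + k + 2)) ?_ (fun j => ?_) j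
  · simp only [lt_irrefl, dif_neg, not_false_eq_true, Fin.insertNth_apply_same, zero_mul, add_zero]
    exact shift_congr (by push_cast; ring) _
  · rw [Fin.insertNth_apply_succAbove]
    by_cases hj : (j : ℕ) < q
    · obtain ⟨j, rfl⟩ : ∃ i : Fin (q + k), j = Fin.castSucc i := ⟨⟨j, by omega⟩, rfl⟩
      have h0 : ((Fin.succAbove (⟨q, by omega⟩ : Fin (q + k + 2)) j.castSucc : Fin (q + k + 2)) : ℕ)
            = j := by
        rw [Fin.succAbove_of_castSucc_lt _ _ (by simpa [Fin.lt_def] using hj)]; simp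
      rw [Fin.val_castSucc] at hj
      simp only [h0, hj, dif_pos]
      rw [Fin.snoc_castSucc, commonCols, dif_pos hj,
        shift_congr (show ((q + k + 2 : ℕ) : ℤ) - (q : ℕ) = k + 2 by push_cast; ring)]
      exact shift_add_two h a _ k
    · have h0 : ((Fin.succAbove (⟨q, by omega⟩ : Fin (q + k + 2)) j : Fin (q + k + 2)) : ℕ)
            = j + 1 := by
        rw [Fin.succAbove_of_le_castSucc _ _ (by simpa [Fin.le_def] using hj)]; simp
      have hj' : ¬ (j : ℕ) + 1 < q := by omega
      simp only [h0, hj', dif_neg, not_false_eq_true, zero_mul, add_zero]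
      revert hj
      refine Fin.lastCases (fun _ => ?_) (fun j hj => ?_) j
      · rw [Fin.snoc_last]
        exact shift_congr (by push_cast; simp; ring) _
      · rw [Fin.snoc_castSucc, commonCols, dif_neg (by simpa using hj)]
        exact shift_congr (by simp; ring) _

theorem superWronskian_tail_left :
    superWronskian ħ (p := q + k + 1) (Fin.tail Qb) Qf (fun i => Qm i.succ) =
      detTwo (commonCols ħ Qb Qm) (Pi.single 0 1) (fun a => shift ħ k (Qm a 0)) := by
  rw [superWronskian_of_le ħ (by omega), detTwo_single_zero]
  congr 1
  ext1 j a
  simp only [of_apply]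
  refine Fin.cases ?_ (fun j => ?_) j
  · rw [dif_pos (by simp)]
    exact shift_congr (by push_cast; ring) _
  · rw [Fin.cons_succ, Function.comp_apply, commonCols]
    by_cases hj : (j : ℕ) < q
    · rw [dif_pos (by simpa using hj), dif_pos hj]
      exact shift_congr (by push_cast; ring) _
    · rw [dif_neg (by simpa using hj), dif_neg hj]
      exact shift_congr (by simp) _

theorem superWronskian_qq_of_lt
    (h : ∀ a i, shift ħ 1 (Qm a i) - shift ħ (-1) (Qm a i) = Qb a * Qf i) :
    Propto (superWronskian ħ (p := q + k + 1) (Fin.tail Qb) Qf (fun i => Qm i.succ) *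
        superWronskian ħ Qb (Fin.tail Qf) (fun i j => Qm i j.succ))
      (wronskian ħ (superWronskian ħ Qb Qf Qm)
        (superWronskian ħ (p := q + k + 1) (Fin.tail Qb) (Fin.tail Qf)
          (fun i j => Qm i.succ j.succ))) := by
  have h' : ∀ a i, shift ħ 1 ((Fin.cons (Pi.single (M := fun _ => ℂ[X]) 0 1 a) (Fin.tail (Qm a)) :
      Fin (q + 1) → ℂ[X]) i) - shift ħ (-1) ((Fin.cons (Pi.single (M := fun _ => ℂ[X]) 0 1 a)
      (Fin.tail (Qm a)) : Fin (q + 1) → ℂ[X]) i) =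
      Qb a * (Fin.cons 0 (Fin.tail Qf) : Fin (q + 1) → ℂ[X]) i := by
    intro a i
    refine Fin.cases ?_ (fun i => h a i.succ) i
    rw [Fin.cons_zero, Fin.cons_zero, mul_zero]
    refine Fin.cases ?_ (fun a => ?_) a
    · rw [Pi.single_eq_same, shift_one, shift_one, sub_self]
    · rw [Pi.single_eq_of_ne (Fin.succ_ne_zero a), shift_zero_right, shift_zero_right, sub_self]
  have hc : commonCols ħ Qb (fun a => (Fin.cons (Pi.single (M := fun _ => ℂ[X]) 0 1 a)
      (Fin.tail (Qm a)) : Fin (q + 1) → ℂ[X])) = commonCols ħ Qb Qm := by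
    funext j a
    rfl
  have hs : (fun a : Fin (q + k + 2) => shift ħ k ((Fin.cons (Pi.single (M := fun _ => ℂ[X]) 0 1 a)
      (Fin.tail (Qm a)) : Fin (q + 1) → ℂ[X]) 0)) = Pi.single 0 1 := by
    funext a
    rw [Fin.cons_zero]
    refine Fin.cases ?_ (fun a => ?_) a
    · exact shift_one _ _
    · simp
  rw [superWronskian_tail, wronskian, shift_one_superWronskian h, shift_one_superWronskian h',
    shift_neg_one_superWronskian, shift_neg_one_superWronskian, superWronskian_tail_left,
    superWronskian_tail_right h, hc, hs]
  have hp := detTwo_pluecker (commonCols ħ Qb Qm) (fun a => shift ħ (k + 1) (Qb a))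
    (fun a => shift ħ k (Qm a 0)) (fun a => shift ħ (-(k + 1)) (Qb a)) (Pi.single 0 1)
  rw [detTwo_swap _ (fun a => shift ħ k (Qm a 0)) (fun a => shift ħ (-(k + 1)) (Qb a)),
    detTwo_swap _ (fun a => shift ħ k (Qm a 0)) (Pi.single 0 1),
    detTwo_swap _ (fun a => shift ħ (k + 1) (Qb a)) (fun a => shift ħ (-(k + 1)) (Qb a))] at hp
  refine ⟨-1, by simp, ?_⟩
  rw [C_neg, C_1]
  linear_combination -(-1) ^ (q + (q + k + 1)) * hp

end

theorem det_bordered {R : Type*} [CommRing R] {r : ℕ} (b f : Fin r → R) (x : Fin r → Fin r → R) :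
    det (of (Fin.cons (Fin.cons 1 b) (fun j => Fin.cons (-f j) (x j)) :
      Fin (r + 1) → Fin (r + 1) → R)) = det (of fun j a => x j a + f j * b a) := by
  rw [← det_eq_of_forall_row_eq_smul_add_const
    (A := of (Fin.cons (Fin.cons 1 b) (fun j => Fin.cons 0 (fun a => x j a + f j * b a)) :
      Fin (r + 1) → Fin (r + 1) → R)) (Fin.cons 0 f) 0 rfl, det_succ_column_zero,
    Fin.sum_univ_succ, sum_eq_zero]
  · simp only [of_apply, Fin.cons_zero, Fin.val_zero, pow_zero, one_mul, add_zero]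
    rfl
  · intro i _
    simp
  · intro i j
    refine Fin.cases ?_ (fun i => ?_) i
    · simp
    · refine Fin.cases ?_ (fun j => ?_) j <;> simp

theorem superWronskian_self (ħ : ℂ) {p : ℕ} (Qb : Fin p → ℂ[X])
    (Qf : Fin p → ℂ[X]) (Qm : Fin p → Fin p → ℂ[X]) :
    superWronskian ħ Qb Qf Qm = det (of fun k a : Fin p => Qm a k) := by
  rw [superWronskian_of_le ħ le_rfl]
  congr 1
  ext1 k a
  rw [of_apply, dif_pos k.2, sub_self, shift_zero]
  rfl

theorem superWronskian_succ_self {r : ℕ} {Qb : Fin (r + 1) → ℂ[X]}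
    {Qf : Fin r → ℂ[X]} {Qm : Fin (r + 1) → Fin r → ℂ[X]}
    (h : ∀ a i, shift ħ 1 (Qm a i) - shift ħ (-1) (Qm a i) = Qb a * Qf i) :
    superWronskian ħ Qb Qf Qm = (-1) ^ r * det (of
      (Fin.cons Qb (fun j a => shift ħ (-1) (Qm a j)) : Fin (r + 1) → Fin (r + 1) → ℂ[X])) := by
  rw [superWronskian_of_le ħ (by omega), det_cons_eq_snoc, ← mul_assoc, ← mul_pow, neg_one_mul,
    neg_neg, one_pow, one_mul]
  refine det_eq_of_forall_row_eq_smul_add_const (Fin.snoc Qf 0) (Fin.last r)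
    (Fin.snoc_last _ _) fun j a => ?_
  simp only [of_apply]
  refine Fin.lastCases ?_ (fun j => ?_) j
  · simp
  · rw [dif_pos (by simp), Fin.snoc_castSucc, Fin.snoc_castSucc, Fin.snoc_last]
    have := h a j
    rw [shift_congr (show ((r + 1 : ℕ) : ℤ) - (r : ℕ) = 1 by push_cast; ring)]
    exact sub_eq_iff_eq_add'.1 (this.trans (mul_comm _ _))

theorem superWronskian_qq_of_eq {r : ℕ} {Qb Qf : Fin (r + 1) → ℂ[X]}
    {Qm : Fin (r + 1) → Fin (r + 1) → ℂ[X]}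
    (h : ∀ a i, shift ħ 1 (Qm a i) - shift ħ (-1) (Qm a i) = Qb a * Qf i) :
    Propto (superWronskian ħ (Fin.tail Qb) Qf (fun i => Qm i.succ) *
        superWronskian ħ Qb (Fin.tail Qf) (fun i j => Qm i j.succ))
      (wronskian ħ (superWronskian ħ Qb Qf Qm)
        (superWronskian ħ (Fin.tail Qb) (Fin.tail Qf) (fun i j => Qm i.succ j.succ))) := by
  set c : Fin (r + 1) → Fin (r + 2) → ℂ[X] :=
    fun j => Fin.cons (-Qf j) (fun a => shift ħ (-1) (Qm a j)) with hc
  set E : Fin (r + 2) → ℂ[X] := Fin.cons 1 Qb with hE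
  set Y : Fin r → Fin (r + 2) → ℂ[X] := fun j => c j.succ with hY
  have hx : ∀ a j, shift ħ (-1) (Qm a j) + Qf j * Qb a = shift ħ 1 (Qm a j) := fun a j => by
    linear_combination -h a j
  have hcY : (Fin.cons (c 0) Y : Fin (r + 1) → Fin (r + 2) → ℂ[X]) = c := by
    funext j
    exact Fin.cases rfl (fun _ => rfl) j
  have hsA : ∀ (z : ℂ[X]) (v : Fin (r + 1) → ℂ[X]),
      (Fin.cons z v : Fin (r + 2) → ℂ[X]) ∘ Fin.succAbove 1 = Fin.cons z (Fin.tail v) := by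
    intro z v
    funext a
    refine Fin.cases ?_ (fun a => ?_) a
    · simp
    · rw [Function.comp_apply, show Fin.succAbove (1 : Fin (r + 2)) a.succ = a.succ.succ from
        Fin.succ_succAbove_succ 0 a]
      rfl
  have a1 : detTwo Y E (c 0) = shift ħ 1 (superWronskian ħ Qb Qf Qm) := by
    rw [superWronskian_self, shift_det, detTwo, hcY, det_bordered]
    simp only [hx, of_apply]
  have a2 : detTwo Y (Pi.single 0 1) (Pi.single 1 1) = shift ħ (-1)
      (superWronskian ħ (Fin.tail Qb) (Fin.tail Qf) (fun i j => Qm i.succ j.succ)) := by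
    rw [superWronskian_self, shift_det, detTwo_single_zero, det_succ_row_zero,
      Fin.sum_univ_succ, sum_eq_zero]
    · have : (Pi.single 1 1 : Fin (r + 2) → ℂ[X]) (Fin.succ 0) = 1 := Pi.single_eq_same _ _
      simp only [of_apply, Fin.cons_zero, Function.comp_apply, this, Fin.val_zero, pow_zero,
        one_mul, add_zero]
      rfl
    · intro i _
      have : (Pi.single 1 1 : Fin (r + 2) → ℂ[X]) (Fin.succ i.succ) = 0 :=
        Pi.single_eq_of_ne (fun h => by simpa using congrArg Fin.val h) _
      simp only [of_apply, Fin.cons_zero, Function.comp_apply, this, mul_zero, zero_mul]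
  have a3 : detTwo Y (Pi.single 0 1) (c 0) = shift ħ (-1) (superWronskian ħ Qb Qf Qm) := by
    rw [superWronskian_self, shift_det, detTwo_single_zero]
    congr 1
    ext1 j a
    exact Fin.cases rfl (fun _ => rfl) j
  have a4 : detTwo Y (Pi.single 1 1) E = - shift ħ 1
      (superWronskian ħ (Fin.tail Qb) (Fin.tail Qf) (fun i j => Qm i.succ j.succ)) := by
    rw [superWronskian_self, shift_det, detTwo_single_one]
    simp only [hY, hE, hc, hsA]
    refine congrArg _ ((det_bordered (Fin.tail Qb) (Fin.tail Qf) _).trans ?_)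
    congr 1
    ext1 j a
    exact hx _ _
  have a5 : superWronskian ħ Qb (Fin.tail Qf) (fun i j => Qm i j.succ) =
      (-1) ^ r * detTwo Y (Pi.single 0 1) E := by
    rw [superWronskian_succ_self (Qf := Fin.tail Qf) (fun a i => h a i.succ), detTwo_single_zero]
    rfl
  have a6 : superWronskian ħ (Fin.tail Qb) Qf (fun i => Qm i.succ) =
      (-1) ^ r * detTwo Y (Pi.single 1 1) (c 0) := by
    rw [← superWronskian_swap, superWronskian_succ_self (Qf := Fin.tail Qb)
      (fun i a => (h a.succ i).trans (mul_comm _ _)), detTwo_single_one]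
    have : (Fin.cons (c 0 ∘ Fin.succAbove 1) (fun j => Y j ∘ Fin.succAbove 1) :
        Fin (r + 1) → Fin (r + 1) → ℂ[X]) = fun j => c j ∘ Fin.succAbove 1 := by
      funext j
      exact Fin.cases rfl (fun _ => rfl) j
    have hv := det_mul_column (Fin.cons (-1) (fun _ => 1) : Fin (r + 1) → ℂ[X]) (of
      (Fin.cons Qf (fun a j => shift ħ (-1) (Qm a.succ j)) : Fin (r + 1) → Fin (r + 1) → ℂ[X]))
    rw [Fin.prod_univ_succ, Fin.cons_zero, prod_eq_one fun i _ => Fin.cons_succ _ _ _,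
      mul_one, neg_one_mul] at hv
    rw [this]
    refine congrArg _ (neg_eq_iff_eq_neg.1 (hv.symm.trans ?_))
    rw [← det_transpose]
    congr 1
    ext1 j a
    simp only [hc, hsA]
    refine Fin.cases ?_ (fun a => ?_) a
    · simp
    · simp [Fin.tail]
  have hp := detTwo_pluecker Y E (c 0) (Pi.single 0 1) (Pi.single 1 1)
  rw [detTwo_swap Y E (Pi.single 0 1), detTwo_swap Y E (Pi.single 1 1),
    detTwo_swap Y (c 0) (Pi.single 0 1), detTwo_swap Y (c 0) (Pi.single 1 1), a1, a2, a3, a4] at hp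
  refine ⟨(-1) ^ r * (-1) ^ r, by simp, ?_⟩
  rw [a5, a6, wronskian]
  simp only [C_mul, C_pow, C_neg, C_1]
  linear_combination -(-1) ^ r * (-1) ^ r * hp

/-- The QQ-relations between the Wronskian determinants. -/
theorem superWronskian_qq {p q : ℕ} {Qb : Fin (p + 1) → ℂ[X]} {Qf : Fin (q + 1) → ℂ[X]}
    {Qm : Fin (p + 1) → Fin (q + 1) → ℂ[X]}
    (h : ∀ a i, shift ħ 1 (Qm a i) - shift ħ (-1) (Qm a i) = Qb a * Qf i) :
    Propto (superWronskian ħ (Fin.tail Qb) Qf (fun i => Qm i.succ) *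
        superWronskian ħ Qb (Fin.tail Qf) (fun i j => Qm i j.succ))
      (wronskian ħ (superWronskian ħ Qb Qf Qm)
        (superWronskian ħ (Fin.tail Qb) (Fin.tail Qf) (fun i j => Qm i.succ j.succ))) := by
  rcases lt_trichotomy p q with hpq | rfl | hpq
  · obtain ⟨k, rfl⟩ := Nat.exists_eq_add_of_lt hpq
    have h1 := superWronskian_qq_of_lt (q := p) (k := k) (Qb := Qf) (Qf := Qb)
      (Qm := fun j i => Qm i j) fun a i => (h i a).trans (mul_comm _ _)
    have e1 := superWronskian_swap ħ Qb Qf Qm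
    have e2 := superWronskian_swap ħ (Fin.tail Qb) (Fin.tail Qf) (fun i j => Qm i.succ j.succ)
    have e3 := superWronskian_swap ħ (Fin.tail Qb) Qf (fun i => Qm i.succ)
    have e4 := superWronskian_swap ħ Qb (Fin.tail Qf) (fun i j => Qm i j.succ)
    rw [mul_comm, ← e1, ← e2, ← e3, ← e4]
    exact h1
  · exact superWronskian_qq_of_eq h
  · obtain ⟨k, rfl⟩ := Nat.exists_eq_add_of_lt hpq
    exact superWronskian_qq_of_lt h

namespace QFunctions

variable {m n : ℕ} {ħ : ℂ}

theorem upper_eq (D : QFunctions m n) (ħ : ℂ) {a s p q : ℕ} (hp : m - a = p) (hq : n - s = q) :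
    D.upper ħ a s = superWronskian ħ (fun i : Fin p => D.bos ⟨a + i, by omega⟩)
      (fun j : Fin q => D.fer ⟨s + j, by omega⟩)
      (fun (i : Fin p) (j : Fin q) => D.mix ⟨a + i, by omega⟩ ⟨s + j, by omega⟩) := by
  subst hp hq
  rfl

/-- The defining relation of the mixed Q-functions. -/
def IsMixed (D : QFunctions m n) (ħ : ℂ) : Prop :=
  ∀ a i, shift ħ 1 (D.mix a i) - shift ħ (-1) (D.mix a i) = D.bos a * D.fer i

/-- Exchange of the two kinds of indices. -/
def swap (D : QFunctions m n) : QFunctions n m := ⟨D.fer, D.bos, fun i a => D.mix a i⟩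

theorem upper_swap (D : QFunctions m n) (ħ : ℂ) (a s : ℕ) :
    D.swap.upper ħ s a = D.upper ħ a s := superWronskian_swap ħ _ _ _

theorem IsMixed.qq {D : QFunctions m n} (h : D.IsMixed ħ) {a s : ℕ} (ha : a < m) (hs : s < n) :
    Propto (D.upper ħ (a + 1) s * D.upper ħ a (s + 1))
      (wronskian ħ (D.upper ħ a s) (D.upper ħ (a + 1) (s + 1))) := by
  obtain ⟨p, hp⟩ : ∃ p, m - a = p + 1 := ⟨m - a - 1, by omega⟩
  obtain ⟨q, hq⟩ : ∃ q, n - s = q + 1 := ⟨n - s - 1, by omega⟩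
  have h1 := superWronskian_qq (Qb := fun i : Fin (p + 1) => D.bos ⟨a + i, by omega⟩)
    (Qf := fun j : Fin (q + 1) => D.fer ⟨s + j, by omega⟩)
    (Qm := fun i j => D.mix ⟨a + i, by omega⟩ ⟨s + j, by omega⟩) (fun i j => h _ _)
  rw [D.upper_eq ħ hp hq, D.upper_eq ħ (a := a + 1) (p := p) (by omega) hq,
    D.upper_eq ħ (s := s + 1) (q := q) hp (by omega),
    D.upper_eq ħ (a := a + 1) (s := s + 1) (p := p) (q := q) (by omega) (by omega)]
  simp only [Fin.val_succ] at h1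
  simp only [add_assoc, add_comm 1]
  exact h1

theorem upper_add {D D' : QFunctions m n} (hb : D'.bos = D.bos) (hf : D'.fer = D.fer) {c : ℂ}
    {a s : ℕ} (ha : a < m) (hs : s < n) (h0 : D'.mix ⟨a, ha⟩ ⟨s, hs⟩ = D.mix ⟨a, ha⟩ ⟨s, hs⟩ + C c)
    (hne : ∀ b t, a ≤ b.1 → s ≤ t.1 → ¬(b.1 = a ∧ t.1 = s) → D'.mix b t = D.mix b t) :
    D'.upper ħ a s = D.upper ħ a s + C c * D.upper ħ (a + 1) (s + 1) := by
  obtain ⟨p, hp⟩ : ∃ p, m - a = p + 1 := ⟨m - a - 1, by omega⟩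
  obtain ⟨q, hq⟩ : ∃ q, n - s = q + 1 := ⟨n - s - 1, by omega⟩
  have h1 := superWronskian_add ħ (fun i : Fin (p + 1) => D.bos ⟨a + i, by omega⟩)
    (fun j : Fin (q + 1) => D.fer ⟨s + j, by omega⟩)
    (Qm := fun i j => D.mix ⟨a + i, by omega⟩ ⟨s + j, by omega⟩)
    (Qm' := fun i j => D'.mix ⟨a + i, by omega⟩ ⟨s + j, by omega⟩) (c := c)
    (by simpa using h0) (fun i j hij => hne _ _ (by simp) (by simp) fun h => hij
      ⟨Fin.ext (by simpa using h.1), Fin.ext (by simpa using h.2)⟩)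
  have h2 : D.upper ħ (a + 1) (s + 1) = superWronskian ħ
      (Fin.tail fun i : Fin (p + 1) => D.bos ⟨a + i, by omega⟩)
      (Fin.tail fun j : Fin (q + 1) => D.fer ⟨s + j, by omega⟩)
      (fun (i : Fin p) (j : Fin q) => D.mix ⟨a + i.succ, by simp; omega⟩
        ⟨s + j.succ, by simp; omega⟩) := by
    rw [D.upper_eq ħ (a := a + 1) (s := s + 1) (p := p) (q := q) (by omega) (by omega)]
    simp only [Fin.val_succ, add_assoc, add_comm 1]
    rfl
  rw [h2, D.upper_eq ħ hp hq, D'.upper_eq ħ hp hq, hb, hf]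
  exact h1

theorem upper_congr {D D' : QFunctions m n} (hb : D'.bos = D.bos) (hf : D'.fer = D.fer) {a s : ℕ}
    (h : ∀ b t, a ≤ b.1 → s ≤ t.1 → D'.mix b t = D.mix b t) :
    D'.upper ħ a s = D.upper ħ a s := by
  simp only [upper, hb, hf]
  congr 1
  funext i j
  exact h _ _ (by simp) (by simp)

/-- The polynomials `Q_{a|∅}` as a sequence. -/
noncomputable def bosSeq (D : QFunctions m n) (a : ℕ) : ℂ[X] :=
  if h : a < m then D.bos ⟨a, h⟩ else 0

theorem upper_right (D : QFunctions m n) (ħ : ℂ) {a s : ℕ} (hs : n ≤ s) :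
    D.upper ħ a s = casTail ħ m D.bosSeq a := by
  rw [D.upper_eq ħ rfl (Nat.sub_eq_zero_of_le hs), superWronskian_of_le ħ (Nat.zero_le _), casTail,
    cas, ← det_transpose]
  congr 1
  ext1 i k
  rw [transpose_apply, of_apply, dif_neg (Nat.not_lt_zero _), of_apply,
    bosSeq, dif_pos (show a + (i : ℕ) < m by omega)]
  exact shift_congr (by push_cast; ring) _

theorem upper_bottom (D : QFunctions m n) (ħ : ℂ) {a s : ℕ} (ha : m ≤ a) :
    D.upper ħ a s = casTail ħ n D.swap.bosSeq s := by
  rw [← upper_swap, upper_right _ _ ha]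

end QFunctions

/-! ### From solutions of the Wronskian Bethe equations to the Q-system -/

theorem exists_shifted_diagram (μ : YoungDiagram) (n : ℕ) :
    ∃ ν : YoungDiagram, ∀ a s, (a, s) ∈ ν ↔ (a, s + n) ∈ μ := by
  have hinj : Function.Injective fun c : ℕ × ℕ => (c.1, c.2 + n) := by
    rintro ⟨a, s⟩ ⟨b, t⟩ h
    simpa using h
  refine ⟨⟨μ.cells.preimage (fun c : ℕ × ℕ => (c.1, c.2 + n)) hinj.injOn, ?_⟩, fun a s => ?_⟩
  · intro c d hcd h
    rw [mem_coe, mem_preimage] at h ⊢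
    exact μ.up_left_mem hcd.1 (Nat.add_le_add_right hcd.2 n) h
  · rw [← mem_cells, mem_preimage, mem_cells]

theorem exists_isQFamily_right (hħ : ħ ≠ 0) {m n : ℕ} (hmn : (m, n) ∉ μ) {f : ℕ → ℂ[X]}
    (hf : ∀ a < m, f a ≠ 0 ∧ (f a).natDegree = bosWeight μ m n a) :
    ∃ Q : ℕ → ℕ → ℂ[X], (∀ a s, (Q a s).Monic) ∧ (∀ a s, (a, s + n) ∉ μ → Q a s = 1) ∧
      (∀ a s, (a, s + n) ∈ μ →
        Propto (Q (a + 1) s * Q a (s + 1)) (wronskian ħ (Q a s) (Q (a + 1) (s + 1)))) ∧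
      ∀ a ≤ m, Propto (Q a 0) (casTail ħ m f a) := by
  obtain ⟨ν, hν⟩ := exists_shifted_diagram μ n
  have hlen : ∀ a, ν.rowLen a = μ.rowLen a - n := fun a => by
    refine Nat.le_antisymm (Nat.le_of_not_lt fun h => ?_) (Nat.le_of_not_lt fun h => ?_)
    · have h1 := mem_iff_lt_rowLen.1 ((hν a _).1 (mem_iff_lt_rowLen.2 h))
      omega
    · exact lt_irrefl _ (mem_iff_lt_rowLen.1
        ((hν a (ν.rowLen a)).2 (mem_iff_lt_rowLen.2 (by omega))))
  obtain ⟨Q, hQ, h⟩ := exists_isQFamily (μ := ν) hħ (M := m) (P := f) (by simpa [hν] using hmn)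
    fun a ha => ⟨(hf a ha).1, by rw [(hf a ha).2, bosWeight, rowDeg, hlen]⟩
  refine ⟨Q, hQ.monic, fun a s h => hQ.eq_one a s (mt (hν a s).1 h),
    fun a s h => hQ.qq a s ((hν a s).2 h), fun a ha => ?_⟩
  rw [← cas_nodeTuple_zero ν]
  exact h a ha 0 (Or.inl rfl)

theorem IsBoundaryNode.transpose {m n : ℕ} (h : IsBoundaryNode μ m n) :
    IsBoundaryNode μ.transpose n m :=
  ⟨fun h' => h.1 (mem_transpose.1 h'), by
    rcases h.2 with h | h | h
    exacts [Or.inr (Or.inl h), Or.inl h, Or.inr (Or.inr (mem_transpose.2 h))]⟩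

theorem bosWeight_transpose (μ : YoungDiagram) (m n i : ℕ) :
    bosWeight μ.transpose n m i = ferWeight μ m n i := by
  rw [bosWeight, ferWeight, rowLen_transpose]

variable {μ : YoungDiagram} {m n : ℕ}

theorem IsBoundaryNode.mem (h : IsBoundaryNode μ m n) {a s : ℕ} (ha : a < m) (hs : s < n) :
    (a, s) ∈ μ := by
  rcases h.2 with rfl | rfl | h
  · omega
  · omega
  · exact μ.up_left_mem (by omega) (by omega) h

theorem bosWeight_strictAnti (μ : YoungDiagram) (m n : ℕ) (a b : ℕ) (h : a < b) (hb : b < m) :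
    bosWeight μ m n b < bosWeight μ m n a := by
  have := μ.rowLen_anti a b h.le
  unfold bosWeight; omega

theorem QFunctions.bosSeq_ne_zero {D : QFunctions m n} (h1 : ∀ a, (D.bos a).Monic)
    (h2 : ∀ a, (D.bos a).natDegree = bosWeight μ m n a) (a : ℕ) (ha : a < m) :
    D.bosSeq a ≠ 0 ∧ (D.bosSeq a).natDegree = bosWeight μ m n a := by
  rw [QFunctions.bosSeq, dif_pos ha]
  exact ⟨(h1 _).ne_zero, h2 _⟩

theorem IsWBESolution.exists_isQSystem (hħ : ħ ≠ 0) {θ : Fin μ.card → ℂ} {D : QFunctions m n}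
    (hmn : IsBoundaryNode μ m n) (hD : IsWBESolution μ ħ θ m n D) :
    ∃ Q, IsQSystem μ ħ θ Q ∧ ∀ a ≤ m, ∀ s ≤ n, Propto (D.upper ħ a s) (Q a s) := by
  obtain ⟨Q₁, h1m, h1o, h1q, h1u⟩ := exists_isQFamily_right hħ hmn.1
    (QFunctions.bosSeq_ne_zero hD.bos_monic hD.bos_degree)
  obtain ⟨Q₂, h2m, h2o, h2q, h2u⟩ := exists_isQFamily_right hħ hmn.transpose.1
    (QFunctions.bosSeq_ne_zero (D := D.swap) hD.fer_monic fun i =>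
      (hD.fer_degree i).trans (bosWeight_transpose μ m n i).symm)
  simp only [mem_transpose, Prod.swap_prod_mk] at h2o h2q
  simp only [← QFunctions.upper_right D ħ le_rfl] at h1u
  simp only [← QFunctions.upper_bottom D ħ le_rfl] at h2u
  have hmix : D.IsMixed ħ := hD.mix_eq
  have hne : ∀ N, ∀ a ≤ m, ∀ s ≤ n, m - a + (n - s) ≤ N → D.upper ħ a s ≠ 0 := by
    intro N
    induction N with
    | zero =>
      intro a ha s hs h
      obtain rfl : a = m := by omega
      exact (h2u s hs).ne_zero (h2m _ _).ne_zero
    | succ N ih =>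
      intro a ha s hs h
      rcases ha.eq_or_lt with rfl | ha
      · exact (h2u s hs).ne_zero (h2m _ _).ne_zero
      rcases hs.eq_or_lt with rfl | hs
      · exact (h1u a ha.le).ne_zero (h1m _ _).ne_zero
      intro h0
      refine (hmix.qq ha hs).ne_zero (mul_ne_zero (ih _ ha _ hs.le (by omega))
        (ih _ ha.le _ hs (by omega))) ?_
      rw [h0, wronskian, shift_zero_right, shift_zero_right, zero_mul, zero_mul, sub_zero]
  set Q : ℕ → ℕ → ℂ[X] := fun a s => if n ≤ s then Q₁ a (s - n) else if m ≤ a then Q₂ s (a - m)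
    else monicize (D.upper ħ a s) with hQ
  have hR : ∀ a s, Q a (s + n) = Q₁ a s := fun a s => by simp [hQ]
  have hB : ∀ a s, Q (a + m) s = Q₂ s a := by
    intro a s
    rcases le_or_gt n s with h | h
    · have hnot : (a + m, s) ∉ μ := fun h' => hmn.1 (μ.up_left_mem (by omega) h h')
      rw [h2o s a hnot, ← Nat.sub_add_cancel h, hR]
      exact h1o _ _ (by rwa [Nat.sub_add_cancel h])
    · simp [hQ, not_le.2 h]
  have hU : ∀ a ≤ m, ∀ s ≤ n, Propto (Q a s) (D.upper ħ a s) := by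
    intro a ha s hs
    rcases hs.eq_or_lt with rfl | hs
    · have := hR a 0
      rw [zero_add] at this
      exact this ▸ h1u a ha
    rcases ha.eq_or_lt with rfl | ha
    · have := hB 0 s
      rw [zero_add] at this
      exact this ▸ h2u s hs.le
    simp only [hQ, not_le.2 hs, not_le.2 ha, if_false]
    exact propto_monicize (hne _ a ha.le s hs.le le_rfl)
  have hm : ∀ a s, (Q a s).Monic := by
    intro a s
    simp only [hQ]
    split_ifs with h1 h2
    exacts [h1m _ _, h2m _ _, monicize_monic (hne _ a (by omega) s (by omega) le_rfl)]
  refine ⟨Q, ⟨hm, ?_, ?_, ?_⟩, fun a ha s hs => (hU a ha s hs).symm⟩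
  · intro a s h
    rcases le_or_gt n s with h1 | h1
    · rw [← Nat.sub_add_cancel h1, hR]
      exact h1o _ _ (by rwa [Nat.sub_add_cancel h1])
    rcases le_or_gt m a with h2 | h2
    · rw [← Nat.sub_add_cancel h2, hB]
      exact h2o _ _ (by rwa [Nat.sub_add_cancel h2])
    · exact absurd (hmn.mem h2 h1) h
  · exact ((hU 0 (Nat.zero_le _) 0 (Nat.zero_le _)).trans hD.wronskian_eq).eq_of_monic (hm 0 0)
      (monic_prod_of_monic _ _ fun _ _ => monic_X_sub_C _)
  · intro a s h
    rcases le_or_gt n s with h1 | h1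
    · obtain ⟨t, rfl⟩ := Nat.exists_eq_add_of_le' h1
      rw [show t + n + 1 = t + 1 + n by ring, hR, hR, hR, hR]
      exact h1q a t h
    rcases le_or_gt m a with h2 | h2
    · obtain ⟨b, rfl⟩ := Nat.exists_eq_add_of_le' h2
      rw [show b + m + 1 = b + 1 + m by ring, hB, hB, hB, hB, mul_comm]
      exact h2q s b h
    · exact ((hU _ h2 _ h1.le).mul (hU _ h2.le _ h1)).trans ((hmix.qq h2 h1).trans
        ((hU _ h2.le _ h1.le).symm.wronskian (hU _ h2 _ h1).symm))

/-! ### From the Q-system to the Wronskian Bethe equations -/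

theorem wronskian_one (ħ : ℂ) (f : ℂ[X]) : wronskian ħ f 1 = shift ħ 1 f - shift ħ (-1) f := by
  simp [wronskian]

theorem exists_eq_of_wronskian_eq_zero (hħ : ħ ≠ 0) {f g : ℂ[X]} (hg : g ≠ 0)
    (h : wronskian ħ f g = 0) : ∃ c, f = C c * g := by
  refine ⟨f.coeff g.natDegree / g.leadingCoeff, sub_eq_zero.1 ?_⟩
  have hl := leadingCoeff_ne_zero.2 hg
  set v := f - C (f.coeff g.natDegree / g.leadingCoeff) * g with hv
  have hv0 : v.coeff g.natDegree = 0 := by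
    rw [hv, coeff_sub, coeff_C_mul, coeff_natDegree, div_mul_cancel₀ _ hl, sub_self]
  have hw : wronskian ħ v g = 0 := by
    simp only [wronskian, hv, shift_sub, shift_mul, shift_C] at h ⊢
    linear_combination h
  by_contra hne
  have hdeg : v.natDegree ≠ g.natDegree := fun h' => hne (leadingCoeff_eq_zero.1 (by
    rw [leadingCoeff, h', hv0]))
  have := (coeff_wronskian (ħ := ħ) (le_refl v.natDegree) (le_refl g.natDegree)).2
    (v.natDegree + g.natDegree - 1) (by omega)
  rw [hw, coeff_zero] at this
  refine mul_ne_zero (mul_ne_zero hħ (sub_ne_zero.2 (by exact_mod_cast hdeg)))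
    (mul_ne_zero (leadingCoeff_ne_zero.2 hne) hl) this.symm

theorem IsGaugeFixed.eq_of_casTail_propto (hħ : ħ ≠ 0) {M : ℕ} {d : ℕ → ℕ}
    (hd : ∀ a b, a < b → b < M → d b < d a) {g g' : ℕ → ℂ[X]} (hg : IsGaugeFixed M d g)
    (hg' : IsGaugeFixed M d g') (h : ∀ a < M, Propto (casTail ħ M g a) (casTail ħ M g' a)) :
    ∀ N, ∀ a < M, M - a ≤ N → g a = g' a := by
  intro N
  induction N with
  | zero => intro a ha h; omega
  | succ N ih =>
    intro a ha hN
    have hS : (fun i : Fin (M - (a + 1)) => g' (a + 1 + i)) = fun i : Fin _ => g (a + 1 + i) :=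
      funext fun i => (ih _ (by omega) (by omega)).symm
    obtain ⟨c, hc, h1⟩ := h a ha
    rw [casTail_eq_cons ħ g ha, casTail_eq_cons ħ g' ha, hS] at h1
    refine Propto.eq_of_monic ⟨c, hc, ?_⟩ (hg a ha).1 (hg' a ha).1
    have hdeg : ∀ i : Fin (M - (a + 1)), (g (a + 1 + i)).natDegree = d (a + 1 + i) := fun i =>
      (hg _ (by omega)).2.1
    refine sub_eq_zero.1 (eq_zero_of_cas_cons_eq_zero hħ
      (f := fun i : Fin (M - (a + 1)) => g (a + 1 + i)) (fun i => (hg _ (by omega)).1.ne_zero)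
      (fun i j hij => ?_) (fun i => ?_) ?_)
    · simp only [hdeg] at hij
      rcases lt_trichotomy i j with hlt | heq | hlt
      · exact absurd hij (hd _ _ (Nat.add_lt_add_left hlt _) (by omega)).ne'
      · exact heq
      · exact absurd hij (hd _ _ (Nat.add_lt_add_left hlt _) (by omega)).ne
    · rw [hdeg, coeff_sub, coeff_C_mul, (hg a ha).2.2 _ (by omega) (by omega),
        (hg' a ha).2.2 _ (by omega) (by omega), mul_zero, sub_zero]
    · rw [sub_eq_add_neg, ← neg_mul, ← C_neg, cas_cons_add, cas_cons_C_mul, h1, C_neg]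
      ring

variable {μ : YoungDiagram} {m n : ℕ}

theorem IsQSystem.isQFamily {θ : Fin μ.card → ℂ} (h : IsQSystem μ ħ θ Q) :
    IsQFamily μ ħ Q ∧ (Q 0 0).natDegree = μ.card :=
  ⟨⟨h.monic, h.eq_one, h.qq⟩, by
    rw [h.source, sourcePoly, natDegree_prod_of_monic _ _ fun _ _ => monic_X_sub_C _]; simp⟩

theorem isGaugeFixed_bosSeq {D : QFunctions m n} {d : ℕ → ℕ} (h1 : ∀ a, (D.bos a).Monic)
    (h2 : ∀ a, (D.bos a).natDegree = d a)
    (h3 : ∀ a b : Fin m, a < b → (D.bos a).coeff (d b) = 0) : IsGaugeFixed m d D.bosSeq := by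
  intro a ha
  rw [QFunctions.bosSeq, dif_pos ha]
  exact ⟨h1 _, h2 _, fun b hab hb => h3 ⟨a, ha⟩ ⟨b, hb⟩ hab⟩

theorem bos_eq_of_casTail_propto (hħ : ħ ≠ 0) {D D' : QFunctions m n}
    (hg : IsGaugeFixed m (bosWeight μ m n) D.bosSeq)
    (hg' : IsGaugeFixed m (bosWeight μ m n) D'.bosSeq)
    (h : ∀ a < m, Propto (casTail ħ m D.bosSeq a) (casTail ħ m D'.bosSeq a)) :
    D.bos = D'.bos := by
  funext a
  have := hg.eq_of_casTail_propto hħ (bosWeight_strictAnti μ m n) hg' h _ a a.2 le_rfl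
  simpa [QFunctions.bosSeq] using this

/-- Solutions of the Wronskian Bethe equations are determined by the Q-system. -/
theorem IsWBESolution.eq_of_propto (hħ : ħ ≠ 0) (hmn : IsBoundaryNode μ m n)
    {θ : Fin μ.card → ℂ} {D D' : QFunctions m n} (hD : IsWBESolution μ ħ θ m n D)
    (hD' : IsWBESolution μ ħ θ m n D') {Q : ℕ → ℕ → ℂ[X]} (hQ : IsQSystem μ ħ θ Q)
    (h : ∀ a ≤ m, ∀ s ≤ n, Propto (D.upper ħ a s) (Q a s))
    (h' : ∀ a ≤ m, ∀ s ≤ n, Propto (D'.upper ħ a s) (Q a s)) : D' = D := by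
  have hb : D'.bos = D.bos := by
    refine bos_eq_of_casTail_propto hħ
      (isGaugeFixed_bosSeq hD'.bos_monic hD'.bos_degree hD'.bos_gauge)
      (isGaugeFixed_bosSeq hD.bos_monic hD.bos_degree hD.bos_gauge) fun a ha => ?_
    rw [← D'.upper_right ħ le_rfl, ← D.upper_right ħ le_rfl]
    exact (h' a ha.le n le_rfl).trans (h a ha.le n le_rfl).symm
  have hf : D'.fer = D.fer := by
    refine bos_eq_of_casTail_propto (μ := μ.transpose) (D := D'.swap) (D' := D.swap) hħ
      (isGaugeFixed_bosSeq hD'.fer_monic ?_ ?_) (isGaugeFixed_bosSeq hD.fer_monic ?_ ?_)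
      fun s hs => ?_
    rotate_right
    · rw [← D'.upper_bottom ħ le_rfl, ← D.upper_bottom ħ le_rfl]
      exact (h' m le_rfl s hs.le).trans (h m le_rfl s hs.le).symm
    all_goals simp only [bosWeight_transpose]
    exacts [hD'.fer_degree, hD'.fer_gauge, hD.fer_degree, hD.fer_gauge]
  have hmix : ∀ N, ∀ (a : Fin m) (s : Fin n), m - a + (n - s) ≤ N → D'.mix a s = D.mix a s := by
    intro N
    induction N with
    | zero => intro a s h; omega
    | succ N ih =>
      intro a s hN
      obtain ⟨c, hc⟩ := exists_eq_of_wronskian_eq_zero (f := D'.mix a s - D.mix a s) hħ one_ne_zero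
        (by
          rw [wronskian_one]
          simp only [shift_sub]
          linear_combination hD'.mix_eq a s - hD.mix_eq a s + congrFun hb a * D'.fer s +
            D.bos a * congrFun hf s)
      rw [mul_one, sub_eq_iff_eq_add'] at hc
      have hadd := QFunctions.upper_add (ħ := ħ) hb hf a.2 s.2 hc fun b t hb ht hne =>
        ih b t (by omega)
      obtain ⟨x, -, hx⟩ := h a a.2.le s s.2.le
      obtain ⟨y, -, hy⟩ := h' a a.2.le s s.2.le
      obtain ⟨z, hz0, hz⟩ := h (a + 1) a.2 (s + 1) s.2
      rw [hx, hy, hz] at hadd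
      obtain ⟨hQf, h0⟩ := hQ.isQFamily
      have hlt : (Q (a + 1) (s + 1)).natDegree < (Q a s).natDegree := by
        rw [hQf.natDegree_eq h0, hQf.natDegree_eq h0]
        exact boxCount_hook_pos (hmn.mem a.2 s.2)
      have h1 := congrArg (fun p => p.coeff (Q a s).natDegree) hadd
      simp only [coeff_add, coeff_C_mul, coeff_natDegree, (hQ.monic a s).leadingCoeff,
        coeff_eq_zero_of_natDegree_lt hlt, mul_zero, add_zero, mul_one] at h1
      rw [h1, left_eq_add, ← mul_assoc, ← C_mul] at hadd
      have hc0 : c = 0 := by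
        simpa [hz0, (hQ.monic (a + 1) (s + 1)).ne_zero] using hadd
      rw [hc, hc0, C_0, add_zero]
  exact QFunctions.ext hb hf (funext fun a => funext fun s => hmix _ a s le_rfl)

theorem exists_shift_sub_shift_eq (hħ : ħ ≠ 0) (N : ℕ) :
    ∀ f : ℂ[X], (∀ k, N ≤ k → f.coeff k = 0) → ∃ x, shift ħ 1 x - shift ħ (-1) x = f := by
  induction N with
  | zero => exact fun f hf => ⟨0, by rw [ext fun k => (hf k k.zero_le).trans (coeff_zero k).symm]; simp⟩
  | succ N ih =>
    intro f hf
    obtain ⟨h1, h2⟩ := coeff_wronskian (ħ := ħ) (f := X ^ (N + 1)) (g := 1) (d := N + 1) (e := 0)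
      (natDegree_X_pow_le _) (by simp)
    have h2 := h2 N rfl
    have hc : ħ * ((N : ℂ) + 1) ≠ 0 := mul_ne_zero hħ (Nat.cast_add_one_ne_zero N)
    simp only [coeff_X_pow_self, coeff_one_zero, mul_one, Nat.cast_zero, sub_zero, Nat.cast_add,
      Nat.cast_one] at h2
    obtain ⟨x, hx⟩ := ih (f - C (f.coeff N / (ħ * (N + 1))) * wronskian ħ (X ^ (N + 1)) 1) (by
      intro k hk
      rw [coeff_sub, coeff_C_mul]
      rcases hk.eq_or_lt with rfl | hk
      · rw [h2, div_mul_cancel₀ _ hc, sub_self]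
      · rw [h1 k (by omega), hf k hk, mul_zero, sub_zero])
    refine ⟨x + C (f.coeff N / (ħ * (N + 1))) * X ^ (N + 1), ?_⟩
    rw [wronskian_one] at hx
    simp only [shift_add, shift_mul, shift_C]
    linear_combination hx

theorem exists_add_propto (hħ : ħ ≠ 0) {U V Q Q₁ : ℂ[X]} (hV : Propto V Q₁) (h1 : Q₁ ≠ 0)
    (hW : Propto (wronskian ħ Q Q₁) (wronskian ħ U V)) : ∃ d, Propto (U + C d * V) Q := by
  obtain ⟨k, hk, h⟩ := hW.trans ((Propto.refl U).wronskian hV)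
  obtain ⟨c, hc⟩ := exists_eq_of_wronskian_eq_zero (f := Q - C k * U) hħ h1 (by
    simp only [wronskian, shift_sub, shift_mul, shift_C] at h ⊢
    linear_combination h)
  obtain ⟨v, hv, hV⟩ := hV
  refine ⟨c / (k * v), k⁻¹, inv_ne_zero hk, ?_⟩
  have e1 : C k⁻¹ * C k = (1 : ℂ[X]) := by rw [← C_mul, inv_mul_cancel₀ hk, C_1]
  have e2 : C (c / (k * v)) * C v = C k⁻¹ * C c := by
    rw [← C_mul, ← C_mul]
    congr 1
    field_simp
  rw [hV]
  linear_combination Q₁ * e2 - C k⁻¹ * hc - U * e1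

theorem exists_qFunctions (hħ : ħ ≠ 0) (hmn : IsBoundaryNode μ m n) (hQ : IsQFamily μ ħ Q)
    {g g' : ℕ → ℂ[X]}
    (hg : ∀ a ≤ m, Propto (casTail ħ m g a) (Q a n))
    (hg' : ∀ s ≤ n, Propto (casTail ħ n g' s) (Q m s)) (N : ℕ) :
    ∃ D : QFunctions m n, (D.bos = fun a : Fin m => g a) ∧ (D.fer = fun s : Fin n => g' s) ∧ D.IsMixed ħ ∧
      ∀ a ≤ m, ∀ s ≤ n, m - a + (n - s) ≤ N → Propto (D.upper ħ a s) (Q a s) := by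
  have hbd : ∀ D : QFunctions m n, (D.bos = fun a : Fin m => g a) → (D.fer = fun s : Fin n => g' s) →
      ∀ a ≤ m, ∀ s ≤ n, (a = m ∨ s = n) → Propto (D.upper ħ a s) (Q a s) := by
    rintro D hb hf a ha s hs (rfl | rfl)
    · rw [D.upper_bottom ħ le_rfl, casTail_congr ħ (P' := g')
        fun t ht => by rw [QFunctions.bosSeq, dif_pos ht]; exact congrFun hf _]
      exact hg' s hs
    · rw [D.upper_right ħ le_rfl, casTail_congr ħ (P' := g)
        fun t ht => by rw [QFunctions.bosSeq, dif_pos ht]; exact congrFun hb _]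
      exact hg a ha
  induction N with
  | zero =>
    choose x hx using fun f : ℂ[X] => exists_shift_sub_shift_eq hħ (f.natDegree + 1) f
      fun k hk => coeff_eq_zero_of_natDegree_lt hk
    exact ⟨⟨fun a => g a, fun s => g' s, fun a s => x (g a * g' s)⟩, rfl, rfl, fun _ _ => hx _,
      fun a ha s hs h => hbd _ rfl rfl a ha s hs (Or.inl (by omega))⟩
  | succ N ih =>
    obtain ⟨D, hb, hf, hD, h⟩ := ih
    have hd : ∀ a s, ∃ d, a < m → s < n → m - a + (n - s) = N + 1 →
        Propto (D.upper ħ a s + C d * D.upper ħ (a + 1) (s + 1)) (Q a s) := by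
      intro a s
      by_cases hc : a < m ∧ s < n ∧ m - a + (n - s) = N + 1
      · obtain ⟨ha, hs, hN⟩ := hc
        obtain ⟨d, hd⟩ := exists_add_propto hħ (U := D.upper ħ a s) (Q := Q a s)
          (h (a + 1) ha (s + 1) hs (by omega)) (hQ.monic _ _).ne_zero
          ((hQ.qq a s (hmn.mem ha hs)).symm.trans (Propto.trans
            ((h (a + 1) ha s hs.le (by omega)).mul (h a ha.le (s + 1) hs (by omega))).symm
            (hD.qq ha hs)))
        exact ⟨d, fun _ _ _ => hd⟩
      · exact ⟨0, fun h1 h2 h3 => absurd ⟨h1, h2, h3⟩ hc⟩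
    choose d hd using hd
    set D' : QFunctions m n := ⟨D.bos, D.fer, fun a s => D.mix a s +
      C (if m - a + (n - s) = N + 1 then d a s else 0)⟩ with hD'
    have hlow : ∀ (b : Fin m) (t : Fin n), m - b + (n - t) ≤ N → D'.mix b t = D.mix b t := by
      intro b t h
      simp only [hD']
      rw [if_neg (by omega), C_0, add_zero]
    refine ⟨D', hb, hf, fun a s => ?_, fun a ha s hs hN => ?_⟩
    · simp only [hD', shift_add, shift_C]
      linear_combination hD a s
    · rcases ha.eq_or_lt with h1 | ha'
      · exact hbd D' hb hf a ha s hs (Or.inl h1)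
      rcases hs.eq_or_lt with h1 | hs'
      · exact hbd D' hb hf a ha s hs (Or.inr h1)
      rcases hN.eq_or_lt with hN | hN
      · rw [QFunctions.upper_add (D := D) (D' := D') (c := d a s) rfl rfl ha' hs'
          (by simp only [hD', if_pos hN]) fun b t hb ht hne => hlow b t (by omega)]
        exact hd a s ha' hs' hN
      · rw [QFunctions.upper_congr (D := D) (D' := D') rfl rfl fun b t hb ht => hlow b t (by omega)]
        exact h a ha s hs (by omega)

section

variable {μ : YoungDiagram} {m n : ℕ}

/-- A solution of the Q-system is determined to the right of a column. -/
theorem IsQFamily.eq_of_column {Q Q' : ℕ → ℕ → ℂ[X]} (hQ : IsQFamily μ ħ Q)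
    (hQ' : IsQFamily μ ħ Q') {s₀ : ℕ} (h : ∀ a, Q a s₀ = Q' a s₀) :
    ∀ s, s₀ ≤ s → ∀ a, Q a s = Q' a s := by
  intro s hs
  induction s, hs using Nat.le_induction with
  | base => exact h
  | succ s hs ih =>
    have h1 : ∀ N a, μ.colLen s ≤ a + N → Q a (s + 1) = Q' a (s + 1) := by
      intro N
      have hout : ∀ a, (a, s) ∉ μ → Q a (s + 1) = Q' a (s + 1) := by
        intro a ha
        have : (a, s + 1) ∉ μ := fun h => ha (μ.up_left_mem le_rfl s.le_succ h)
        rw [hQ.eq_one _ _ this, hQ'.eq_one _ _ this]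
      induction N with
      | zero =>
        exact fun a ha => hout a fun h => absurd (mem_iff_lt_colLen.1 h) (not_lt.2 ha)
      | succ N ihN =>
        intro a ha
        by_cases hmem : (a, s) ∈ μ
        · have e := hQ'.qq a s hmem
          rw [← ih, ← ih, ← ihN (a + 1) (by omega)] at e
          exact mul_left_cancel₀ (hQ.monic (a + 1) s).ne_zero
            (((hQ.qq a s hmem).trans e.symm).eq_of_monic ((hQ.monic _ _).mul (hQ.monic _ _))
              ((hQ.monic _ _).mul (hQ'.monic _ _)))
        · exact hout a hmem
    exact fun a => h1 (μ.colLen s) a (by omega)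

theorem IsQFamily.transpose (hQ : IsQFamily μ ħ Q) : IsQFamily μ.transpose ħ (fun a s => Q s a) :=
  ⟨fun a s => hQ.monic s a, fun a s h => hQ.eq_one s a fun h' => h (mem_transpose.2 h'),
    fun a s h => by
      rw [mul_comm]
      exact hQ.qq s a (mem_transpose.1 h)⟩

/-- A solution of the Q-system is determined by the rectangle of a boundary node. -/
theorem IsQFamily.eq_of_rectangle {Q Q' : ℕ → ℕ → ℂ[X]} (hQ : IsQFamily μ ħ Q)
    (hQ' : IsQFamily μ ħ Q') (hmn : (m, n) ∉ μ) (h : ∀ a ≤ m, ∀ s ≤ n, Q a s = Q' a s) :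
    Q = Q' := by
  have h1 : ∀ a, Q a n = Q' a n := fun a => by
    rcases le_total a m with ha | ha
    · exact h a ha n le_rfl
    · have : (a, n) ∉ μ := fun h => hmn (μ.up_left_mem ha le_rfl h)
      rw [hQ.eq_one _ _ this, hQ'.eq_one _ _ this]
  have h2 : ∀ s, Q m s = Q' m s := fun s => by
    rcases le_total s n with hs | hs
    · exact h m le_rfl s hs
    · have : (m, s) ∉ μ := fun h => hmn (μ.up_left_mem le_rfl hs h)
      rw [hQ.eq_one _ _ this, hQ'.eq_one _ _ this]
  funext a s
  rcases le_total n s with hs | hs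
  · exact hQ.eq_of_column hQ' h1 s hs a
  rcases le_total m a with ha | ha
  · exact hQ.transpose.eq_of_column hQ'.transpose h2 a ha s
  · exact h a ha s hs

theorem exists_hasRowDegrees_succ (hħ : ħ ≠ 0) {M : ℕ} (hM : (M, 0) ∉ μ)
    (hP : HasRowDegrees μ M P) : ∃ P', HasRowDegrees μ (M + 1) P' ∧
      ∀ a, Propto (casTail ħ (M + 1) P' a) (casTail ħ M P a) := by
  choose x hx using fun f : ℂ[X] => exists_shift_sub_shift_eq hħ (f.natDegree + 1) f
    fun k hk => coeff_eq_zero_of_natDegree_lt hk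
  refine ⟨fun b => if b < M then x (P b) else 1, fun b hb => ?_, fun a => ?_⟩
  · by_cases h : b < M
    · obtain ⟨h1, h2⟩ := hP b h
      obtain ⟨d, hd⟩ : ∃ d, (x (P b)).natDegree = d + 1 := Nat.exists_eq_succ_of_ne_zero fun h0 =>
        h1 (by rw [← hx (P b), eq_C_of_natDegree_eq_zero h0, shift_C, shift_C, sub_self])
      have h3 := (natDegree_fdiff hħ hd).2
      rw [fdiff, hx, h2] at h3
      have h4 : x (P b) ≠ 0 := by rintro h; simp [h] at hd
      simp only [if_pos h]
      refine ⟨h4, ?_⟩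
      rw [hd, ← h3, rowDeg, rowDeg]
      omega
    · simp only [if_neg h]
      refine ⟨one_ne_zero, ?_⟩
      rw [natDegree_one, rowDeg, rowLen_eq_zero_of_le hM (not_lt.1 h)]
      omega
  · rcases lt_or_ge M a with ha | ha
    · rw [casTail_of_le ħ _ (Nat.succ_le_of_lt ha), casTail_of_le ħ _ ha.le]
      exact Propto.refl 1
    · have h := cas_append_propto hħ 1 (fun i : Fin (M - a) => x (P (a + i))) (fun _ => 1)
        fun j => ⟨one_ne_zero, by rw [natDegree_one]; omega⟩
      simp only [Function.iterate_one, fdiff, hx] at h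
      rw [casTail, casTail, ← cas_cast ħ (show M - a + 1 = M + 1 - a by omega)]
      convert h using 2
      funext i
      refine Fin.addCases (fun i => ?_) (fun i => ?_) i
      · rw [Fin.append_left, if_pos (by simp; omega)]
        rfl
      · rw [Fin.append_right, if_neg (by simp; omega)]

theorem exists_hasRowDegrees_of_le (hħ : ħ ≠ 0) {M : ℕ} (hM : (M, 0) ∉ μ)
    (hP : HasRowDegrees μ M P) (t : ℕ) : ∃ P', HasRowDegrees μ (M + t) P' ∧
      ∀ a, Propto (casTail ħ (M + t) P' a) (casTail ħ M P a) := by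
  induction t with
  | zero => exact ⟨P, hP, fun a => Propto.refl _⟩
  | succ t ih =>
    obtain ⟨P', hP', h⟩ := ih
    obtain ⟨P'', hP'', h'⟩ := exists_hasRowDegrees_succ hħ
      (fun h => hM (μ.up_left_mem (Nat.le_add_right M t) le_rfl h)) hP'
    exact ⟨P'', hP'', fun a => (h' a).trans (h a)⟩

theorem IsQFamily.exists_gaugeFixed (hħ : ħ ≠ 0) {M : ℕ} (hM : (M, 0) ∉ μ)
    (hP : HasRowDegrees μ M P) {Q : ℕ → ℕ → ℂ[X]} (hQ : IsQFamily μ ħ Q)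
    (h : ∀ a, Propto (Q a 0) (casTail ħ M P a)) (hmn : IsBoundaryNode μ m n) :
    ∃ g, IsGaugeFixed m (bosWeight μ m n) g ∧ ∀ a ≤ m, Propto (casTail ħ m g a) (Q a n) := by
  obtain ⟨P', hP', hP1⟩ := exists_hasRowDegrees_of_le hħ hM hP m
  have hM' : (M + m, 0) ∉ μ := fun h => hM (μ.up_left_mem (Nat.le_add_right M m) le_rfl h)
  obtain ⟨Q', hQ', h0, hcol⟩ := exists_isQFamily_column hħ hM' hP'
  obtain ⟨Q'', hQ'', h''⟩ := exists_isQFamily hħ hM' hP'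
  have hQQ : ∀ a, Q a n = Q'' a n := hQ.eq_of_column hQ'' (s₀ := 0) (fun a => by
    rcases le_or_gt a (M + m) with ha | ha
    · have := h'' a ha 0 (Or.inl rfl)
      rw [cas_nodeTuple_zero] at this
      exact ((h a).trans ((hP1 a).symm.trans this.symm)).eq_of_monic (hQ.monic _ _) (hQ''.monic _ _)
    · have : (a, 0) ∉ μ := fun h => hM' (μ.up_left_mem ha.le le_rfl h)
      rw [hQ.eq_one _ _ this, hQ''.eq_one _ _ this]) n (Nat.zero_le n)
  have hrow : ∀ b < m, n ≤ μ.rowLen b := fun b hb => Nat.le_of_not_lt fun h => by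
    have := mem_iff_lt_rowLen.1 (hmn.mem hb (s := n - 1) (by omega))
    omega
  set f : ℕ → ℂ[X] := fun b => (fdiff ħ)^[M + m - m + n] (P' b) with hf
  have hfd : ∀ b < m, f b ≠ 0 ∧ (f b).natDegree = bosWeight μ m n b := fun b hb =>
    natDegree_fdiff_iterate hħ _ (hP' b (by omega)).1 (by
      have := hrow b hb
      rw [(hP' b (by omega)).2, rowDeg, bosWeight]
      omega)
  obtain ⟨g, hg, hs⟩ := exists_isGaugeFixed (bosWeight_strictAnti μ m n) hfd
  refine ⟨g, hg, fun a ha => ?_⟩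
  have h1 := casTail_propto_of_mem_span hħ (bosWeight_strictAnti μ m n)
    (fun a ha => ⟨(hg a ha).1.ne_zero, (hg a ha).2.1⟩) hs a
  refine h1.trans ((cas_nodeTuple_propto_fdiff hħ hM' hP' hmn (by omega) ha).symm.trans ?_)
  rw [hQQ]
  refine (h'' a (by omega) n ?_).symm
  rcases Nat.eq_zero_or_pos n with h | h
  · exact Or.inl h
  rcases Nat.eq_zero_or_pos m with h' | h'
  · exact Or.inr (by omega)
  · have := mem_iff_lt_colLen.1 (hmn.mem (a := m - 1) (s := n - 1) (by omega) (by omega))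
    exact Or.inr (by omega)

theorem IsQSystem.exists_isWBESolution (hħ : ħ ≠ 0) {M M' : ℕ} (hM : (M, 0) ∉ μ)
    (hM' : (M', 0) ∉ μ.transpose) {P P' : ℕ → ℂ[X]} (hP : HasRowDegrees μ M P)
    (hP' : HasRowDegrees μ.transpose M' P') {θ : Fin μ.card → ℂ} {Q : ℕ → ℕ → ℂ[X]}
    (hQ : IsQSystem μ ħ θ Q) (h : ∀ a, Propto (Q a 0) (casTail ħ M P a))
    (h' : ∀ s, Propto (Q 0 s) (casTail ħ M' P' s)) (hmn : IsBoundaryNode μ m n) :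
    ∃ D, IsWBESolution μ ħ θ m n D ∧ ∀ a ≤ m, ∀ s ≤ n, Propto (D.upper ħ a s) (Q a s) := by
  have hF := hQ.isQFamily.1
  obtain ⟨g, hg, hgQ⟩ := hF.exists_gaugeFixed hħ hM hP h hmn
  obtain ⟨g', hg', hgQ'⟩ := hF.transpose.exists_gaugeFixed hħ hM' hP' h' hmn.transpose
  obtain ⟨D, hb, hf, hD, hu⟩ := exists_qFunctions hħ hmn hF hgQ hgQ' (m + n)
  have hu' : ∀ a ≤ m, ∀ s ≤ n, Propto (D.upper ħ a s) (Q a s) := fun a ha s hs =>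
    hu a ha s hs (by omega)
  refine ⟨D, ⟨?_, ?_, ?_, ?_, ?_, ?_, hD, hQ.source ▸ hu' 0 (Nat.zero_le _) 0 (Nat.zero_le _)⟩, hu'⟩
  all_goals first | rw [hb] | rw [hf]
  · exact fun a => (hg a a.2).1
  · exact fun a => (hg a a.2).2.1
  · exact fun a b hab => (hg a a.2).2.2 b hab b.2
  · exact fun a => (hg' a a.2).1
  · exact fun a => (hg' a a.2).2.1.trans (bosWeight_transpose _ _ _ _)
  · exact fun a b hab => bosWeight_transpose μ m n b ▸ (hg' a a.2).2.2 b hab b.2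

end

/-! ### Classification of the solutions of the Q-system -/

section

variable {μ : YoungDiagram} {δ : ℝ}

theorem exists_bound_tabs {R : (ℕ × ℕ → ℕ) → ℂ → (ℕ → ℂ) → Prop}
    (hR : ∀ e, IsTab μ.cells e → ∃ K, ∀ ħ θ, WellSeparated μ.card δ K ħ θ → R e ħ θ)
    (hc : ∀ e e' ħ θ, (∀ c ∈ μ.cells, e c = e' c) → R e' ħ θ → R e ħ θ) :
    ∃ K, ∀ ħ θ, WellSeparated μ.card δ K ħ θ → ∀ e, IsTab μ.cells e → R e ħ θ := by
  obtain ⟨S, hS, hS'⟩ := exists_finset_tabs μ.cells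
  obtain ⟨K, hK⟩ := exists_bound_of_finite S
    (P := fun e K => ∀ ħ θ, WellSeparated μ.card δ K ħ θ → R e ħ θ) fun e he => by
      obtain ⟨K, hK⟩ := hR e (hS e he)
      exact ⟨K, fun K' h ħ θ hs => hK ħ θ (hs.mono h)⟩
  refine ⟨K, fun ħ θ hs e he => ?_⟩
  obtain ⟨e', he', h⟩ := hS' e he
  exact hc e e' ħ θ h (hK e' he' K le_rfl ħ θ hs)

/-- Solutions of the Q-system whose source has the given roots. -/
def IsSourced (μ : YoungDiagram) (ħ : ℂ) (θ : ℕ → ℂ) (Q : ℕ → ℕ → ℂ[X]) : Prop :=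
  IsQFamily μ ħ Q ∧ Q 0 0 = ∏ j ∈ range μ.card, (X - C (θ j))

theorem IsSourced.natDegree {θ : ℕ → ℂ} (h : IsSourced μ ħ θ Q) : (Q 0 0).natDegree = μ.card := by
  rw [h.2, natDegree_prod_of_monic _ _ fun _ _ => monic_X_sub_C _]
  simp

theorem IsSourced.source_near {θ : ℕ → ℂ} (h : IsSourced μ ħ θ Q) {η : ℝ} (hη : 0 < η) (k : ℕ) :
    ‖(Q 0 0).coeff k - (∏ j ∈ range μ.card, (X - C (θ j))).coeff k‖ ≤
      η * ‖(∏ j ∈ range μ.card, (X - C (θ j))).coeff k‖ := by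
  rw [h.2, sub_self, norm_zero]
  positivity

theorem exists_classification (hδ : 0 < δ) {M : ℕ} (hM : (M, 0) ∉ μ) :
    ∃ K, ∀ ħ θ, WellSeparated μ.card δ K ħ θ →
      (∀ Q, IsSourced μ ħ θ Q → ∃ e, IsTab μ.cells e ∧ IsNear μ.cells e θ (1 / 2) Q) ∧
      (∀ e, IsTab μ.cells e → (∃ c Q, IsSourced μ ħ θ Q ∧ IsNear μ.cells e θ (1 / 2) Q ∧
          ∀ a, Q a 0 = tailPoly μ ħ M c a) ∧
        ∀ Q Q', IsSourced μ ħ θ Q → IsSourced μ ħ θ Q' → IsNear μ.cells e θ (1 / 2) Q →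
          IsNear μ.cells e θ (1 / 2) Q' → Q = Q') ∧
      ∀ e e', IsTab μ.cells e → IsTab μ.cells e' → ∀ Q, IsNear μ.cells e θ (1 / 2) Q →
        IsNear μ.cells e' θ (1 / 2) Q → ∀ c ∈ μ.cells, e c = e' c := by
  obtain ⟨K₁, η₁, hη₁, h₁⟩ := exists_isNear μ hδ one_half_pos
  obtain ⟨K₂, h₂⟩ := exists_eq_of_isNear μ hδ
  obtain ⟨K₃, h₃⟩ := exists_bound_tabs (μ := μ) (δ := δ) (R := fun e ħ θ =>
      (∃ c Q, IsSourced μ ħ θ Q ∧ IsNear μ.cells e θ (1 / 2) Q ∧ ∀ a, Q a 0 = tailPoly μ ħ M c a) ∧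
        ∀ Q Q', IsSourced μ ħ θ Q → IsSourced μ ħ θ Q' → IsNear μ.cells e θ (1 / 2) Q →
          IsNear μ.cells e θ (1 / 2) Q' → Q = Q')
    (fun e he => by
      obtain ⟨K₁, h₁⟩ := exists_isLabelled hδ hM he
      obtain ⟨K₂, η, hη, h₂⟩ := exists_isNear_of_column μ hδ one_half_pos
      obtain ⟨K₃, η₃, C₃, hη₃, h₃⟩ := exists_lipschitz hδ he
      obtain ⟨K₄, η₄, hη₄, h₄⟩ := exists_isNear_of_column μ hδ hη₃
      refine ⟨max (max K₁ K₂) (max K₃ K₄), fun ħ θ hs => ⟨?_, fun Q Q' hQ hQ' hn hn' => ?_⟩⟩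
      · obtain ⟨x, hx⟩ := h₁ ħ θ (hs.mono (by simp))
        obtain ⟨Q, hQ, hdeg, hcol⟩ := exists_isQFamily_tailPoly hs.ħ_ne hM x
        have hsrc : IsSourced μ ħ θ Q := ⟨hQ, (hcol 0).trans hx.source⟩
        exact ⟨x, Q, hsrc, h₂ ħ θ (hs.mono (by simp)) Q hQ hdeg (hsrc.source_near hη) e he
          fun a k => by rw [hcol]; exact hx.near a k, hcol⟩
      · have hnear : ∀ Q, IsSourced μ ħ θ Q → IsNear μ.cells e θ (1 / 2) Q →
            IsNear μ.cells e θ η₃ Q := fun Q hQ hn =>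
          h₄ ħ θ (hs.mono (by simp)) Q hQ.1 hQ.natDegree (hQ.source_near hη₄) e he
            fun a k => hn a 0 k
        funext a s
        ext k
        have := h₃ ħ θ (hs.mono (by simp)) Q Q' hQ.1 hQ.natDegree hQ'.1 hQ'.natDegree
          (hnear Q hQ hn) (hnear Q' hQ' hn') 0 (fun k => by rw [hQ.2, hQ'.2]; simp) a s k
        rwa [mul_zero, zero_mul, norm_le_zero_iff, sub_eq_zero] at this)
    fun e e' ħ θ h => by
      simp only [IsNear, tabLead_congr h]
      exact id
  refine ⟨max K₁ (max K₂ K₃), fun ħ θ hs => ⟨fun Q hQ => ?_, h₃ ħ θ (hs.mono (by simp)),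
    fun e e' he he' Q h h' => ?_⟩⟩
  · exact h₁ ħ θ (hs.mono (by simp)) Q hQ.1 hQ.natDegree (hQ.source_near hη₁)
  · exact h₂ ħ θ (hs.mono (by simp)) e e' he he' (fun a => Q a 0) (fun a => h a 0) fun a => h' a 0

theorem exists_hasRowDegrees_column (μ : YoungDiagram) (hδ : 0 < δ) :
    ∃ M K, (M, 0) ∉ μ ∧ ∀ ħ θ, WellSeparated μ.card δ K ħ θ → ∀ Q, IsSourced μ ħ θ Q →
      ∃ P, HasRowDegrees μ M P ∧ ∀ a, Propto (Q a 0) (casTail ħ M P a) := by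
  have hM : (μ.colLen 0, 0) ∉ μ := fun h => lt_irrefl _ (mem_iff_lt_colLen.1 h)
  obtain ⟨K, hK⟩ := exists_classification hδ hM
  refine ⟨_, K, hM, fun ħ θ hs Q hQ => ?_⟩
  obtain ⟨h1, h2, -⟩ := hK ħ θ hs
  obtain ⟨e, he, hn⟩ := h1 Q hQ
  obtain ⟨⟨c, Q', hQ', hn', hcol⟩, huniq⟩ := h2 e he
  obtain rfl := huniq Q Q' hQ hQ' hn hn'
  exact ⟨_, hasRowDegrees_gaugeTuple c, fun a => by
    rw [hcol]
    exact ⟨_, inv_ne_zero (tailLead_ne_zero hs.ħ_ne a), rfl⟩⟩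

end

/-! ### Standard Young tableaux as entry functions -/

namespace StandardYoungTableau

variable {μ : YoungDiagram}

/-- The entries of a tableau as a function of the box. -/
def entryFun (T : StandardYoungTableau μ) (c : ℕ × ℕ) : ℕ :=
  if h : c ∈ μ.cells then T.entry ⟨c, h⟩ else 0

theorem entryFun_coe (T : StandardYoungTableau μ) (c : {c : ℕ × ℕ // c ∈ μ.cells}) :
    T.entryFun c = T.entry c := dif_pos c.2

theorem isTab_entryFun (T : StandardYoungTableau μ) : IsTab μ.cells T.entryFun where
  lt c hc := by rw [T.entryFun_coe ⟨c, hc⟩]; exact Fin.is_lt _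
  inj c hc d hd h := by
    rw [T.entryFun_coe ⟨c, hc⟩, T.entryFun_coe ⟨d, hd⟩] at h
    exact congrArg Subtype.val (T.entry.injective (Fin.ext h))
  mono c hc d hd h1 h2 hne := by
    have hx : (c.1, d.2) ∈ μ.cells := μ.isLowerSet (Prod.mk_le_mk.2 ⟨h1, le_rfl⟩ : (c.1, d.2) ≤ d) hd
    rw [T.entryFun_coe ⟨c, hc⟩, T.entryFun_coe ⟨d, hd⟩]
    rcases h1.eq_or_lt with e1 | l1 <;> rcases h2.eq_or_lt with e2 | l2
    · exact absurd (Prod.ext e1 e2) hne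
    · exact T.row_lt _ _ e1 l2
    · exact T.col_lt _ _ e2 l1
    · exact (T.row_lt ⟨c, hc⟩ ⟨_, hx⟩ rfl l2).trans (T.col_lt ⟨_, hx⟩ ⟨d, hd⟩ rfl l1)

theorem eq_of_entryFun {T T' : StandardYoungTableau μ}
    (h : ∀ c ∈ μ.cells, T.entryFun c = T'.entryFun c) : T = T' := by
  have : T.entry = T'.entry := Equiv.ext fun c => Fin.ext (by
    rw [← T.entryFun_coe, ← T'.entryFun_coe, h c c.2])
  cases T
  cases T'
  cases this
  rfl

theorem exists_entryFun_eq {e : ℕ × ℕ → ℕ} (he : IsTab μ.cells e) :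
    ∃ T : StandardYoungTableau μ, ∀ c ∈ μ.cells, e c = T.entryFun c := by
  have hinj : Function.Injective fun c : {c : ℕ × ℕ // c ∈ μ.cells} =>
      (⟨e c, he.lt c c.2⟩ : Fin μ.card) := fun c d h =>
    Subtype.ext (he.inj c c.2 d d.2 (congrArg Fin.val h))
  refine ⟨⟨Equiv.ofBijective _ ((Fintype.bijective_iff_injective_and_card _).2 ⟨hinj, by simp⟩),
    fun c d h1 h2 => he.mono c c.2 d d.2 h1.le h2.le fun h => ?_,
    fun c d h1 h2 => he.mono c c.2 d d.2 h2.le h1.le fun h => ?_⟩, fun c hc => ?_⟩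
  · rw [h] at h2; exact lt_irrefl _ h2
  · rw [h] at h2; exact lt_irrefl _ h2
  · rw [entryFun, dif_pos hc]
    rfl

end StandardYoungTableau

/-- The cells of a finite set in the hook at `(a, s)`. -/
theorem hookC_eq_card (ν : Finset (ℕ × ℕ)) (a s : ℕ) : hookC ν a s =
    (ν.filter fun c => (c.1 = a ∧ s ≤ c.2) ∨ (c.2 = s ∧ a < c.1)).card := by
  rw [hookC, sub_eq_iff_eq_add, boxCount, boxCount, ← Nat.cast_add,
    ← card_union_of_disjoint, ← filter_or]
  · congr 3
    ext c
    omega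
  · refine disjoint_filter.2 fun c _ h h' => ?_
    omega

variable {μ : YoungDiagram}

theorem StandardYoungTableau.hook_eq (T : StandardYoungTableau μ)
    (c : {c : ℕ × ℕ // c ∈ μ.cells}) (a s : ℕ) :
    (T.hook (T.entry c) a s : ℂ) =
      hookC (μ.cells.filter fun d => T.entryFun d ≤ T.entryFun c) a s := by
  rw [hookC_eq_card, filter_filter, StandardYoungTableau.hook,
    ← card_map (Function.Embedding.subtype _)]
  congr 2
  ext d
  simp only [mem_map, mem_filter, mem_univ, true_and]
  constructor
  · rintro ⟨d, ⟨h1, h2⟩, rfl⟩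
    exact ⟨d.2, by rw [T.entryFun_coe c, Function.Embedding.subtype_apply, T.entryFun_coe d]; exact h1, h2⟩
  · rintro ⟨h, h1, h2⟩
    exact ⟨⟨d, h⟩, ⟨by rwa [T.entryFun_coe c, T.entryFun_coe ⟨d, h⟩] at h1, h2⟩, rfl⟩

/-- Inhomogeneities as a sequence. -/
noncomputable def extendSeq {L : ℕ} (θ : Fin L → ℂ) (j : ℕ) : ℂ := if h : j < L then θ ⟨j, h⟩ else 1

theorem extendSeq_coe {L : ℕ} (θ : Fin L → ℂ) (j : Fin L) : extendSeq θ j = θ j := dif_pos j.2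

theorem StandardYoungTableau.lead_eq (T : StandardYoungTableau μ) (θ : Fin μ.card → ℂ)
    (a s : ℕ) : T.lead θ a s = tabLead μ.cells T.entryFun (extendSeq θ) a s := by
  rw [StandardYoungTableau.lead, tabLead]
  refine prod_bij (fun c _ => c.1) (fun c hc => ?_) (fun _ _ _ _ h => Subtype.ext h)
    (fun c hc => ?_) fun c _ => ?_
  · exact mem_filter.2 ⟨c.2, (mem_filter.1 hc).2⟩
  · rw [mem_filter] at hc
    exact ⟨⟨c, hc.1⟩, mem_filter.2 ⟨mem_univ _, hc.2⟩, rfl⟩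
  · rw [StandardYoungTableau.ratio, tabRatio, cornerRatio, T.entryFun_coe, extendSeq_coe,
      ← T.entryFun_coe]
    simp only [T.hook_eq]

theorem sourcePoly_eq {L : ℕ} (θ : Fin L → ℂ) :
    sourcePoly θ = ∏ j ∈ range L, (X - C (extendSeq θ j)) := by
  rw [← Fin.prod_univ_eq_prod_range (fun j => X - C (extendSeq θ j)), sourcePoly]
  simp only [extendSeq_coe]

theorem Separated.wellSeparated {L : ℕ} {δ K : ℝ} {θ : Fin L → ℂ} (hδ : 0 < δ)
    (h : Separated δ (max K 1) ħ θ) : WellSeparated L δ K ħ (extendSeq θ) := by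
  obtain ⟨h0, h1, h2⟩ := h
  have hne : ∀ j, ∀ hj : j < L, θ ⟨j, hj⟩ ≠ 0 := by
    intro j hj h
    cases j with
    | zero =>
      have := h1 ⟨0, hj⟩ rfl
      rw [h, norm_zero] at this
      exact absurd this (not_le.2 (mul_pos hδ (norm_pos_iff.2 h0)))
    | succ j =>
      have := h2 ⟨j, by omega⟩ ⟨j + 1, hj⟩ rfl
      rw [h, zero_div, norm_zero] at this
      exact absurd ((le_max_right K 1).trans this) (by norm_num)
  refine ⟨h0, fun j => ?_, fun hL => ?_, fun j hj => ?_⟩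
  · rw [extendSeq]
    split_ifs with hj
    exacts [hne j hj, one_ne_zero]
  · exact (h1 ⟨0, hL⟩ rfl).trans_eq (by rw [← extendSeq_coe θ ⟨0, hL⟩])
  · have := h2 ⟨j, by omega⟩ ⟨j + 1, hj⟩ rfl
    have hp : 0 < ‖θ ⟨j, by omega⟩‖ := norm_pos_iff.2 (hne j (by omega))
    rw [norm_div, le_div_iff₀ hp] at this
    rw [extendSeq, extendSeq, dif_pos hj, dif_pos (show j < L by omega)]
    exact (mul_le_mul_of_nonneg_right (le_max_left K 1) hp.le).trans this

theorem isQSystem_iff {θ : Fin μ.card → ℂ} : IsQSystem μ ħ θ Q ↔ IsSourced μ ħ (extendSeq θ) Q :=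
  ⟨fun h => ⟨h.isQFamily.1, h.source.trans (sourcePoly_eq θ)⟩,
    fun h => ⟨h.1.monic, h.1.eq_one, h.2.trans (sourcePoly_eq θ).symm, h.1.qq⟩⟩

theorem card_transpose (μ : YoungDiagram) : μ.transpose.card = μ.card :=
  (card_equiv (Equiv.prodComm ℕ ℕ) fun c => by
    simp only [mem_cells, mem_transpose]; rfl)

open Classical in
/-- The solution of the Q-system labelled by a tableau, where it exists. -/
noncomputable def labelledSolution (μ : YoungDiagram) (ħ : ℂ) (θ : Fin μ.card → ℂ)
    (T : StandardYoungTableau μ) : ℕ → ℕ → ℂ[X] :=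
  if h : ∃ Q, IsQSystem μ ħ θ Q ∧ IsNear μ.cells T.entryFun (extendSeq θ) (1 / 2) Q then h.choose
  else fun _ _ => 1

theorem labelledSolution_spec {θ : Fin μ.card → ℂ} {T : StandardYoungTableau μ}
    (h : ∃ Q, IsQSystem μ ħ θ Q ∧ IsNear μ.cells T.entryFun (extendSeq θ) (1 / 2) Q) :
    IsQSystem μ ħ θ (labelledSolution μ ħ θ T) ∧
      IsNear μ.cells T.entryFun (extendSeq θ) (1 / 2) (labelledSolution μ ħ θ T) := by
  rw [labelledSolution, dif_pos h]
  exact h.choose_spec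

end TwistlessQSystem

open TwistlessQSystem

theorem mainTheorem8 (μ : YoungDiagram) :
    ∃ Φ : ℂ → (Fin μ.card → ℂ) → TwistlessQSystem.StandardYoungTableau μ →
        (ℕ → ℕ → Polynomial ℂ),
      ∀ δ : ℝ, 0 < δ →
        -- for large enough but finite ratios, `Φ ħ θ` labels the solutions bijectively
        (∃ K : ℝ, ∀ (ħ : ℂ) (θ : Fin μ.card → ℂ), TwistlessQSystem.Separated δ K ħ θ →
          -- solutions of the Q-system on the Young diagram
          Set.BijOn (Φ ħ θ) Set.univ {Q | TwistlessQSystem.IsQSystem μ ħ θ Q} ∧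
          -- solutions of the Wronskian Bethe equations at every boundary node
          ∀ m n : ℕ, TwistlessQSystem.IsBoundaryNode μ m n →
            ∃ Ψ : TwistlessQSystem.StandardYoungTableau μ → TwistlessQSystem.QFunctions m n,
              Set.BijOn Ψ Set.univ {D | TwistlessQSystem.IsWBESolution μ ħ θ m n D} ∧
              ∀ T, ∀ a ≤ m, ∀ s ≤ n,
                TwistlessQSystem.Propto ((Ψ T).upper ħ a s) (Φ ħ θ T a s)) ∧
        -- when the ratios tend to infinity, the solution labelled by `T` approaches
        -- the product of linear factors, at leading order in every coefficient
        (∀ ε : ℝ, 0 < ε → ∃ K : ℝ, ∀ (ħ : ℂ) (θ : Fin μ.card → ℂ),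
          TwistlessQSystem.Separated δ K ħ θ →
          ∀ (T : TwistlessQSystem.StandardYoungTableau μ) (a s k : ℕ),
            ‖(Φ ħ θ T a s).coeff k - (T.lead θ a s).coeff k‖ ≤
              ε * ‖(T.lead θ a s).coeff k‖) := by
  refine ⟨labelledSolution μ, fun δ hδ => ?_⟩
  have hM : (μ.colLen 0, 0) ∉ μ := fun h => lt_irrefl _ (YoungDiagram.mem_iff_lt_colLen.1 h)
  obtain ⟨K₁, h₁⟩ := exists_classification hδ hM
  have hspec : ∀ {K : ℝ} (ħ : ℂ) (θ : Fin μ.card → ℂ), K₁ ≤ K →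
      WellSeparated μ.card δ K ħ (extendSeq θ) → ∀ T, IsQSystem μ ħ θ (labelledSolution μ ħ θ T) ∧
        IsNear μ.cells T.entryFun (extendSeq θ) (1 / 2) (labelledSolution μ ħ θ T) :=
    fun ħ θ hK hs T => by
      obtain ⟨-, Q, hQ, hn, -⟩ := ((h₁ ħ _ (hs.mono hK)).2.1 _ T.isTab_entryFun).1
      exact labelledSolution_spec ⟨Q, isQSystem_iff.2 hQ, hn⟩
  refine ⟨?_, fun ε hε => ?_⟩
  · obtain ⟨M, K₂, hM₂, h₂⟩ := exists_hasRowDegrees_column μ hδ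
    obtain ⟨M', K₃, hM₃, h₃⟩ := exists_hasRowDegrees_column μ.transpose hδ
    rw [card_transpose] at h₃
    refine ⟨max (max K₁ (max K₂ K₃)) 1, fun ħ θ hsep => ?_⟩
    have hs := hsep.wellSeparated hδ
    have hsp := hspec ħ θ (le_max_left _ _) hs
    obtain ⟨hex, huniq, hdist⟩ := h₁ ħ _ (hs.mono (le_max_left _ _))
    have hbij : Set.BijOn (labelledSolution μ ħ θ) Set.univ {Q | IsQSystem μ ħ θ Q} := by
      refine ⟨fun T _ => (hsp T).1, fun T _ T' _ h => ?_, fun Q hQ => ?_⟩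
      · exact StandardYoungTableau.eq_of_entryFun (hdist _ _ T.isTab_entryFun T'.isTab_entryFun _
          (hsp T).2 (h ▸ (hsp T').2))
      · obtain ⟨e, he, hn⟩ := hex Q (isQSystem_iff.1 hQ)
        obtain ⟨T, hT⟩ := StandardYoungTableau.exists_entryFun_eq he
        simp only [IsNear, tabLead_congr hT] at hn
        exact ⟨T, Set.mem_univ T, (huniq _ T.isTab_entryFun).2 _ _ (isQSystem_iff.1 (hsp T).1)
          (isQSystem_iff.1 hQ) (hsp T).2 hn⟩
    refine ⟨hbij, fun m n hmn => ?_⟩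
    have hD : ∀ T, ∃ D : QFunctions m n, IsWBESolution μ ħ θ m n D ∧ ∀ a ≤ m, ∀ s ≤ n,
        Propto (D.upper ħ a s) (labelledSolution μ ħ θ T a s) := by
      intro T
      have hQ := isQSystem_iff.1 (hsp T).1
      obtain ⟨P, hP, hc⟩ := h₂ ħ _ (hs.mono (by simp)) _ hQ
      obtain ⟨P', hP', hc'⟩ := h₃ ħ _ (hs.mono (by simp)) _
        ⟨hQ.1.transpose, by rw [card_transpose]; exact hQ.2⟩
      exact (hsp T).1.exists_isWBESolution hs.ħ_ne hM₂ hM₃ hP hP' hc hc' hmn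
    choose Ψ hΨ hu using hD
    refine ⟨Ψ, ⟨fun T _ => hΨ T, fun T _ T' _ h => ?_, fun D hD => ?_⟩, hu⟩
    · refine hbij.injOn (Set.mem_univ T) (Set.mem_univ T')
        ((hsp T).1.isQFamily.1.eq_of_rectangle (hsp T').1.isQFamily.1 hmn.1 fun a ha s hs => ?_)
      exact ((hu T a ha s hs).symm.trans (h ▸ hu T' a ha s hs)).eq_of_monic
        ((hsp T).1.monic a s) ((hsp T').1.monic a s)
    · obtain ⟨Q, hQ, hDQ⟩ := hD.exists_isQSystem hs.ħ_ne hmn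
      obtain ⟨T, -, rfl⟩ := hbij.surjOn hQ
      exact ⟨T, Set.mem_univ T, hD.eq_of_propto hs.ħ_ne hmn (hΨ T) hQ hDQ (hu T)⟩
  · obtain ⟨K₂, η, hη, h₂⟩ := exists_isNear_of_column μ hδ hε
    refine ⟨max (max K₁ K₂) 1, fun ħ θ hsep T a s k => ?_⟩
    have hs := hsep.wellSeparated hδ
    obtain ⟨hQ, hn⟩ := hspec ħ θ (le_max_left _ _) hs T
    have hQ' := isQSystem_iff.1 hQ
    rw [T.lead_eq]
    exact h₂ ħ _ (hs.mono (le_max_right _ _)) _ hQ'.1 hQ'.natDegree (hQ'.source_near hη) _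
      T.isTab_entryFun (fun a k => hn a 0 k) a s k
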